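/- Let $d\ge 4$ and $\omega_0\in\mathbb R^d$. For a smooth $H$ on $\mathbb T^d\times\mathbb R^d$ ($\mathbb T=\mathbb R/\mathbb Z$), let $\Phi_H^t$ be the flow of $\dot\varphi=\partial_rH$, $\dot r=-\partial_\varphi H$. A function is $\mathcal O^\infty(r_4)$ if all its derivatives vanish on $\{r_4=0\}$. For $\sigma>1$, $L>0$ put $\|F\|_{\sigma,L}=\sup_{k,x}L^k\|D^kF(x)\|/(k!)^\sigma$ (a Gevrey-$\sigma$ norm). A vector $(\alpha,\beta)\in\mathbb R^2$ is *Liouville* if $\alpha,\beta$ are rationally independent and for every $N\in\mathbb N$ there is $k\in\mathbb Z^2$ with $|k|_\infty\ge 2$ and $|k_1\alpha+k_2\beta|<|k|_\infty^{-N}$. A *Liouville twist* is a triple $f=(f_1,f_2,f_3)$ of functions in $C^\infty(\mathbb R,[0,1))$ with $f_i(0)=0$ such that there are intervals $I_n=(a_n,b_n)\subset(0,\infty)$, $n\in\mathbb Z$, with $a_n\to0$ as $n\to-\infty$, $a_n\to\infty$ as $n\to\infty$, $a_n<b_{n-1}<a_{n+1}<b_n$, for which, for every $n$: $f_1,f_2$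 are constant on $I_{3n}$; $f_1,f_3$ are constant on $I_{3n+1}$; $f_2,f_3$ are constant on $I_{3n-1}$; and in each case the constant vector $(f_i+\omega_{0,i},f_j+\omega_{0,j})$ is Liouville; and such that the functions $x\mapsto f_i(-x)$ have the same property (with possibly different intervals). Put $H_0^f(\varphi,r)=\langle\omega_0,r\rangle+\sum_{i=1}^3f_i(r_4)r_i$. Let $\mathcal U_0$ be the set of exact symplectic diffeomorphisms $U$ of $\mathbb T^d\times\mathbb R^d$ that preserve $r_4$ and satisfy $U-\mathrm{Id}=\mathcal O^\infty(r_4)$, and let $\overline{\mathcal H}_0^f$ be the closure of $\{H_0^f\circ U:U\in\mathcal U_0\}$ in $C^\infty(\mathbb T^d\times\mathbb R^d)$ with the $C^\infty$ topology (uniform convergence on compact sets of all derivatives). **(a)** For all $\sigma>1$, $L>0$, $\epsilon>0$, $s\in\mathbb N$ there are a Liouville twist $f$ and $g\in C^\infty(\mathbb T^d\times\mathbb R^d)$ with $\|f_i\|_{C^s(\mathbb R)}$, $\|f_i\|_{\sigma,L}$, $\|g\|_{C^s(\mathbb T^d\times\mathbb R^d)}$ and $\|g\|_{\sigma,L}$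 all $<\epsilon$, such that $h=f_1(r_4)r_1+f_2(r_4)r_2+f_3(r_4)r_3+g$ satisfies $$\|D^kh(\varphi,r)\|\le\epsilon(1+\|r\|)\quad\text{for all }k\le s\text{ and all }(\varphi,r),\qquad h=\mathcal O^\infty(r_4),$$ and $H=\langle\omega_0,r\rangle+h$ belongs to $\overline{\mathcal H}_0^f$, has a complete flow, and $$\limsup_{t\to+\infty}\|\Phi_H^t(\varphi,r)\|=\limsup_{t\to-\infty}\|\Phi_H^t(\varphi,r)\|=\infty\quad\text{whenever }r_4\neq0.$$ The union of all $\Phi_H^t$-invariant embedded $d$-dimensional tori in $\mathbb T^d\times\mathbb R^d$ has Lebesgue measure zero; in particular $\mathbb T^d\times\{0\}$ is not accumulated by a positive measure of invariant tori. **(b)** For every Liouville twist $f$, each of the following is a dense $G_\delta$ subset of $\overline{\mathcal H}_0^f$: the set of $H\in\overline{\mathcal H}_0^f$ that have a complete flow with $\limsup_{t\to\pm\infty}\|\Phi_H^t(p)\|=\infty$ for all $p=(\varphi,r)$ with $r_4\ne0$; and the set of $H\in\overline{\mathcal H}_0^f$ that have a complete flow and such that for every such $p$ there are distinct $i_1,i_2\in\{1,2,3\}$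 such that, for $i=i_1$ and $i=i_2$, the coordinate $r_i$ of $\Phi_H^t(p)$ has $\limsup=+\infty$ and $\liminf=-\infty$, both as $t\to+\infty$ and as $t\to-\infty$. -/

import Mathlib

open scoped ContDiff
open Filter MeasureTheory

noncomputable section

/-- The action space `ℝ^d` with its Euclidean norm. -/
abbrev Act (d : ℕ) : Type := EuclideanSpace ℝ (Fin d)

/-- The universal cover `ℝ^d × ℝ^d` of `𝕋^d × ℝ^d`; a point is `(φ, r)`. Functions on
`𝕋^d × ℝ^d` are functions on the cover that are `ℤ^d`-periodic in `φ`. -/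
abbrev Cover (d : ℕ) : Type := Act d × Act d

/-- The phase space `𝕋^d × ℝ^d`, `𝕋 = ℝ / ℤ`. -/
abbrev Phase (d : ℕ) : Type := (Fin d → UnitAddCircle) × Act d

/-- The covering map `ℝ^d × ℝ^d → 𝕋^d × ℝ^d`. -/
def toPhase {d : ℕ} (x : Cover d) : Phase d := (fun i => (x.1 i : UnitAddCircle), x.2)

/-- An integer vector, as an element of `ℝ^d`. -/
def intVec {d : ℕ} (m : Fin d → ℤ) : Act d := WithLp.toLp 2 fun i => (m i : ℝ)

/-- `F` is `ℤ^d`-periodic in `φ`. -/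
def AnglePeriodic {d : ℕ} (F : Cover d → ℝ) : Prop :=
  ∀ (m : Fin d → ℤ) (x : Cover d), F (x.1 + intVec m, x.2) = F x

/-- The index (counted from `0`) of the `i`-th of the first four coordinates of `ℝ^d`. -/
def idx {d : ℕ} (hd : 4 ≤ d) (i : Fin 4) : Fin d := Fin.castLE hd i

/-- The action variable `r_4`. -/
def r4 {d : ℕ} (hd : 4 ≤ d) (x : Cover d) : ℝ := x.2 (idx hd 3)

/-- `F = 𝒪^∞(r_4)`: all derivatives of all orders vanish on `{r_4 = 0}`. -/
def FlatAlong {d : ℕ} (hd : 4 ≤ d) {E : Type*} [NormedAddCommGroup E] [NormedSpace ℝ E]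
    (F : Cover d → E) : Prop :=
  ∀ (k : ℕ) (x : Cover d), r4 hd x = 0 → iteratedFDeriv ℝ k F x = 0

/-- `‖F‖_{C^s} < ε`, the supremum being over the whole space. -/
def CsNormLT {E : Type*} [NormedAddCommGroup E] [NormedSpace ℝ E] (s : ℕ) (ε : ℝ) (F : E → ℝ) :
    Prop :=
  ∃ δ < ε, ∀ k ≤ s, ∀ x, ‖iteratedFDeriv ℝ k F x‖ ≤ δ

/-- `‖F‖_{σ,L} < ε`, with the Gevrey norm `sup_{k,x} L^k ‖D^k F(x)‖ / (k!)^σ`. -/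
def GevreyNormLT {E : Type*} [NormedAddCommGroup E] [NormedSpace ℝ E] (σ L ε : ℝ) (F : E → ℝ) :
    Prop :=
  ∃ δ < ε, ∀ (k : ℕ) (x : E), L ^ k * ‖iteratedFDeriv ℝ k F x‖ ≤ δ * (k.factorial : ℝ) ^ σ

/-- `C^∞(𝕋^d × ℝ^d)`. -/
def SmoothHam (d : ℕ) : Type := {H : Cover d → ℝ // ContDiff ℝ ∞ H ∧ AnglePeriodic H}

/-- The `k`-th derivative of a smooth Hamiltonian, as a continuous map. -/
def SmoothHam.deriv {d : ℕ} (k : ℕ) (H : SmoothHam d) :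
    C(Cover d, ContinuousMultilinearMap ℝ (fun _ : Fin k => Cover d) ℝ) :=
  ⟨iteratedFDeriv ℝ k H.1, H.2.1.continuous_iteratedFDeriv (mod_cast le_top)⟩

/-- The `C^∞` topology: uniform convergence on compact sets of all derivatives. -/
instance (d : ℕ) : TopologicalSpace (SmoothHam d) :=
  ⨅ k : ℕ, TopologicalSpace.induced (SmoothHam.deriv k) inferInstance

/-- The Hamiltonian vector field `(∂_r H, -∂_φ H)`. -/
def hamVec {d : ℕ} (H : Cover d → ℝ) (x : Cover d) : Cover d :=
  (gradient (fun r => H (x.1, r)) x.2, -gradient (fun φ => H (φ, x.2)) x.1)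

/-- `Φ` is the (complete) Hamiltonian flow of `H`, lifted to the cover. -/
def IsHamFlow {d : ℕ} (H : Cover d → ℝ) (Φ : ℝ → Cover d → Cover d) : Prop :=
  ∀ p, Φ 0 p = p ∧ ∀ t, HasDerivAt (fun τ => Φ τ p) (hamVec H (Φ t p)) t

/-- `limsup ‖Φ^t(p)‖ = ∞` as `t → +∞` and as `t → -∞`. The norm is taken on `𝕋^d × ℝ^d`, whose
first factor is compact, so it is the norm of the action variable. -/
def Escapes {d : ℕ} (Φ : ℝ → Cover d → Cover d) (p : Cover d) : Prop :=
  limsup (fun t => ((‖(Φ t p).2‖ : ℝ) : EReal)) atTop = ⊤ ∧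
  limsup (fun t => ((‖(Φ t p).2‖ : ℝ) : EReal)) atBot = ⊤

/-- The `j`-th action oscillates between `-∞` and `+∞`, as `t → +∞` and as `t → -∞`. -/
def ActionOscillates {d : ℕ} (Φ : ℝ → Cover d → Cover d) (p : Cover d) (j : Fin d) : Prop :=
  limsup (fun t => (((Φ t p).2 j : ℝ) : EReal)) atTop = ⊤ ∧
  liminf (fun t => (((Φ t p).2 j : ℝ) : EReal)) atTop = ⊥ ∧
  limsup (fun t => (((Φ t p).2 j : ℝ) : EReal)) atBot = ⊤ ∧
  liminf (fun t => (((Φ t p).2 j : ℝ) : EReal)) atBot = ⊥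

/-- At least two of the actions `r_1, r_2, r_3` oscillate between `-∞` and `+∞` along both
semi-orbits of `p`. -/
def TwoActionsOscillate {d : ℕ} (hd : 4 ≤ d) (Φ : ℝ → Cover d → Cover d) (p : Cover d) : Prop :=
  ∃ i₁ i₂ : Fin 3, i₁ ≠ i₂ ∧ ActionOscillates Φ p (idx hd i₁.castSucc) ∧
    ActionOscillates Φ p (idx hd i₂.castSucc)

/-- `T ⊆ 𝕋^d × ℝ^d` is an embedded (merely continuous) `d`-torus invariant under the flow. -/
def IsInvariantTorus {d : ℕ} (Φ : ℝ → Cover d → Cover d) (T : Set (Phase d)) : Prop :=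
  (∃ ι : (Fin d → UnitAddCircle) → Phase d,
    Continuous ι ∧ Function.Injective ι ∧ Set.range ι = T) ∧
  ∀ (t : ℝ) (x : Cover d), toPhase x ∈ T → toPhase (Φ t x) ∈ T

/-- `(α, β)` is a Liouville vector: rationally independent, and for every `N` some integer vector
`(k, l)` with `max |k| |l| ≥ 2` has `|k α + l β| < (max |k| |l|)^{-N}`. -/
def IsLiouvillePair (α β : ℝ) : Prop :=
  (∀ k l : ℤ, k * α + l * β = 0 → k = 0 ∧ l = 0) ∧
  ∀ N : ℕ, ∃ k l : ℤ, 2 ≤ max |k| |l| ∧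
    |k * α + l * β| < 1 / ((max |k| |l| : ℤ) : ℝ) ^ N

/-- The intervals `(a_n, b_n)`, `n ∈ ℤ`, are an increasing cover of `(0, ∞)`. -/
def IsIncreasingCover (a b : ℤ → ℝ) : Prop :=
  (∀ n, 0 < a n) ∧ Tendsto a atBot (nhds 0) ∧ Tendsto a atTop atTop ∧
  ∀ n, a n < b (n - 1) ∧ b (n - 1) < a (n + 1) ∧ a (n + 1) < b n

/-- On `I`, the functions `f_i` and `f_j` are constant, and the constant vector
`(f_i + w_i, f_j + w_j)` is Liouville. -/
def LiouvilleOn (w : Fin 3 → ℝ) (f : Fin 3 → ℝ → ℝ) (i j : Fin 3) (I : Set ℝ) : Prop :=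
  ∃ u v : ℝ, (∀ x ∈ I, f i x = u) ∧ (∀ x ∈ I, f j x = v) ∧ IsLiouvillePair (u + w i) (v + w j)

/-- There is an increasing cover `(I_n)` of `(0, ∞)` such that on `I_{3n}`, `I_{3n+1}`, `I_{3n-1}`
the pairs of functions with (one-based) indices `(1,2)`, `(1,3)`, `(2,3)`, respectively, are
constant and yield Liouville frequencies. -/
def HalfLineTwist (w : Fin 3 → ℝ) (f : Fin 3 → ℝ → ℝ) : Prop :=
  ∃ a b : ℤ → ℝ, IsIncreasingCover a b ∧ ∀ n : ℤ,
    LiouvilleOn w f 0 1 (Set.Ioo (a (3 * n)) (b (3 * n))) ∧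
    LiouvilleOn w f 0 2 (Set.Ioo (a (3 * n + 1)) (b (3 * n + 1))) ∧
    LiouvilleOn w f 1 2 (Set.Ioo (a (3 * n - 1)) (b (3 * n - 1)))

/-- The frequency functions `f_1, f_2, f_3` of an infinitely degenerate Liouville twist: smooth,
with values in `[0, 1)`, zero at `0`, and with the above property on either side of `0`. -/
def IsLiouvilleTwist (w : Fin 3 → ℝ) (f : Fin 3 → ℝ → ℝ) : Prop :=
  (∀ i, ContDiff ℝ ∞ (f i)) ∧ (∀ i x, f i x ∈ Set.Ico (0 : ℝ) 1) ∧ (∀ i, f i 0 = 0) ∧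
  HalfLineTwist w f ∧ HalfLineTwist w (fun i x => f i (-x))

/-- `f_1(r_4) r_1 + f_2(r_4) r_2 + f_3(r_4) r_3`. -/
def twistPart {d : ℕ} (hd : 4 ≤ d) (f : Fin 3 → ℝ → ℝ) (x : Cover d) : ℝ :=
  ∑ i : Fin 3, f i (r4 hd x) * x.2 (idx hd i.castSucc)

/-- `H_0(φ, r) = ⟨ω_0, r⟩ + f_1(r_4) r_1 + f_2(r_4) r_2 + f_3(r_4) r_3`. -/
def H0 {d : ℕ} (hd : 4 ≤ d) (ω₀ : Act d) (f : Fin 3 → ℝ → ℝ) (x : Cover d) : ℝ :=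
  inner ℝ ω₀ x.2 + twistPart hd f x

/-- The first three coordinates of `ω_0`. -/
def freq3 {d : ℕ} (hd : 4 ≤ d) (ω₀ : Act d) : Fin 3 → ℝ := fun i => ω₀ (idx hd i.castSucc)

/-- `U(φ, r) = (ψ, s)` is (the lift, equal to the identity on `{r_4 = 0}`, of) an exact symplectic
diffeomorphism of `𝕋^d × ℝ^d` with `s_4 = r_4` and `U - Id = 𝒪^∞(r_4)`. Exactness: the one-form
`s dψ - r dφ` is the differential of a function `S` on `𝕋^d × ℝ^d`. -/
def IsFlatExactDiffeo {d : ℕ} (hd : 4 ≤ d) (U : Cover d → Cover d) : Prop :=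
  ContDiff ℝ ∞ U ∧
  (∃ W : Cover d → Cover d, ContDiff ℝ ∞ W ∧ Function.LeftInverse W U ∧
    Function.RightInverse W U) ∧
  (∀ (m : Fin d → ℤ) (x : Cover d),
    U (x.1 + intVec m, x.2) = ((U x).1 + intVec m, (U x).2)) ∧
  (∃ S : Cover d → ℝ, ContDiff ℝ ∞ S ∧ AnglePeriodic S ∧ ∀ x v : Cover d,
    inner ℝ (U x).2 (fderiv ℝ U x v).1 - inner ℝ x.2 v.1 = fderiv ℝ S x v) ∧
  (∀ x, r4 hd (U x) = r4 hd x) ∧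
  FlatAlong hd (fun x => U x - x)

/-- The set of all Hamiltonians `H_0 ∘ U`, with `U` as above. -/
def conjClass {d : ℕ} (hd : 4 ≤ d) (ω₀ : Act d) (f : Fin 3 → ℝ → ℝ) : Set (SmoothHam d) :=
  {H | ∃ U, IsFlatExactDiffeo hd U ∧ ∀ x, H.1 x = H0 hd ω₀ f (U x)}

/-- The Hamiltonians `H` in the closure of the set of all `H_0 ∘ U` that have a complete flow, all
of whose orbits with `r_4 ≠ 0` satisfy `limsup ‖Φ^t‖ = ∞` as `t → ±∞`. -/
def escapingSet {d : ℕ} (hd : 4 ≤ d) (ω₀ : Act d) (f : Fin 3 → ℝ → ℝ) :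
    Set (closure (conjClass hd ω₀ f)) :=
  {H | ∃ Φ, IsHamFlow H.1.1 Φ ∧ ∀ p, r4 hd p ≠ 0 → Escapes Φ p}

/-- The same, with the stronger property that two of `r_1, r_2, r_3` oscillate between `-∞` and
`+∞` along both semi-orbits of every point with `r_4 ≠ 0`. -/
def oscillatingSet {d : ℕ} (hd : 4 ≤ d) (ω₀ : Act d) (f : Fin 3 → ℝ → ℝ) :
    Set (closure (conjClass hd ω₀ f)) :=
  {H | ∃ Φ, IsHamFlow H.1.1 Φ ∧ ∀ p, r4 hd p ≠ 0 → TwoActionsOscillate hd Φ p}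

end

/-!
Let `m ∈ ℤ³` and let `χ` be a function of `r_4` supported in a window where the frequency of the angle
`⟨m, φ⟩` is a constant `δ ≠ 0`. The shear generated by `|δ|^{-1/2} χ(r_4) cos (2π ⟨m, φ⟩)` changes `H_0`
by a resonant term (`baseTerm`) of size `|δ|^{1/2}`, which is tiny when `m` is chosen by the Liouville
property of the window, while the shear itself moves the actions by about `|δ|^{-1/2}`. A sum `G` of
resonant terms whose divisors decrease fast enough (`IsLacunary`) converges in `C^∞`, and `H_0 + κ G`
is a limit of conjugates of `H_0` by shears (`IsLacunary.mem_closure`). Since `G` depends on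
`φ_1, φ_2, φ_3, r_4` only, the flow of `H_0 + κ G` is given by quadratures: up to the time `1 / |δ|` at
which a term becomes visible, the earlier terms have contributed much less and the later ones have not
yet started to act. Every `r_4 ≠ 0` lies in a window that is used infinitely often, so
`y = r_1 + r_2 + r_3` is unbounded along all orbits with `r_4 ≠ 0`; moreover `y²` dominates
`r_1, r_2, r_3` at suitable times (`IsLacunary.exists_flow`).

For small Gevrey perturbations one takes a twist whose constant frequencies are, alternately, rational
multiples of `1` and of a number `ξ` such that `(1, ξ)` has exponentially small divisors; such `ξ` exist
by the Baire category theorem (`exists_isExpLiouvillePair`), and the twist is a sum of dilates of a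
bump built from `exp (-x⁻ᵖ)` (`exists_gevrey_twist`). Exponentially small divisors beat the Gevrey norms
of the resonant terms (`exists_gevrey_isLacunary`). Invariant tori are compact, hence contained in the
null set `{r_4 = 0}` (`volume_invariantTori`).

For genericity, finite orbit segments persist under small perturbations, so the two sets of
Hamiltonians are countable intersections of open sets (`isGδ_setOf_flow`). For density, an element
`H_0 ∘ U` of the conjugacy class is approximated in two ways. First, on large sets `U` agrees with a
diffeomorphism `U'` of the group that moves the actions by a bounded amount (`exists_tame_eq`): a
diffeomorphism close to the identity is given by a generating function, which can be cut off, and the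
scaling of the actions connects `U` to the identity within the group. Second, `H_0` is replaced by
`(H_0 + ε G) ∘ (Id + ε Z)`, where `Z` is the vector field of
`y² ∑_c C_c(r_4) cos (2π ⟨e_i - e_j, φ⟩)`, the sum being over the three pairs `c = {i, j}` and `C_c` being
positive exactly on the windows of type `c`. This shear preserves `y` and kicks the actions by multiples
of `y²`. One or two of the coefficients `C_c` are positive for any given `r_4 ≠ 0`, so two of the three
actions feel exactly one rotating phase each (`exists_two_indices`), and the growth of `y` becomes an
oscillation of these two actions (`exists_two_oscillating`). Composition with `U'` changes the actions
by a bounded amount only, and `ε → 0` gives `dense_oscillatingSet`. The escaping Hamiltonians contain the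
oscillating ones.
-/

open scoped Topology

/-! ### The `C^∞` topology -/

section Topology

variable {d : ℕ}

/-- Convergence in the `C^∞` topology is uniform convergence on compact sets of each derivative. -/
theorem SmoothHam.tendsto_nhds_of {ι : Type*} {l : Filter ι} {F : ι → SmoothHam d}
    {H : SmoothHam d}
    (h : ∀ (k : ℕ) (K : Set (Cover d)), IsCompact K → ∀ ε > 0, ∀ᶠ i in l, ∀ x ∈ K,
      ‖iteratedFDeriv ℝ k (F i).1 x - iteratedFDeriv ℝ k H.1 x‖ < ε) :
    Tendsto F l (𝓝 H) := by
  rw [nhds_iInf, tendsto_iInf]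
  intro k
  rw [nhds_induced, tendsto_comap_iff,
    ContinuousMap.tendsto_iff_forall_isCompact_tendstoUniformlyOn]
  intro K hK
  rw [Metric.tendstoUniformlyOn_iff]
  intro ε hε
  filter_upwards [h k K hK ε hε] with i hi x hx
  rw [dist_comm, dist_eq_norm]
  exact hi x hx

theorem SmoothHam.continuous_deriv (k : ℕ) : Continuous (SmoothHam.deriv (d := d) k) :=
  continuous_iff_le_induced.2 (iInf_le _ k)

theorem SmoothHam.eventually_deriv_close (k : ℕ) (H : SmoothHam d) {K : Set (Cover d)}
    (hK : IsCompact K) {ε : ℝ} (hε : 0 < ε) :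
    ∀ᶠ H' in 𝓝 H, ∀ x ∈ K, ‖iteratedFDeriv ℝ k H'.1 x - iteratedFDeriv ℝ k H.1 x‖ < ε := by
  have h := (SmoothHam.continuous_deriv (d := d) k).tendsto H
  rw [ContinuousMap.tendsto_iff_forall_isCompact_tendstoUniformlyOn] at h
  filter_upwards [Metric.tendstoUniformlyOn_iff.1 (h K hK) ε hε] with H' hH' x hx
  have := hH' x hx
  rw [dist_comm, dist_eq_norm] at this
  exact this

variable {E F : Type*} [NormedAddCommGroup E] [NormedSpace ℝ E]
  [NormedAddCommGroup F] [NormedSpace ℝ F]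

theorem iteratedFDeriv_slice {Φ : ℝ × E → F} (h : ContDiff ℝ ∞ Φ) (k : ℕ) (e : ℝ) (x : E) :
    iteratedFDeriv ℝ k (fun y => Φ (e, y)) x =
      (iteratedFDeriv ℝ k Φ (e, x)).compContinuousLinearMap
        fun _ => ContinuousLinearMap.inr ℝ ℝ E := by
  have h1 : (fun y => Φ (e, y)) =
      (fun z => Φ (z + (e, 0))) ∘ (ContinuousLinearMap.inr ℝ ℝ E) := by
    funext y; simp
  have h2 : ContDiff ℝ ∞ (fun z => Φ (z + (e, 0))) := h.comp (contDiff_id.add contDiff_const)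
  rw [h1, (ContinuousLinearMap.inr ℝ ℝ E).iteratedFDeriv_comp_right h2 x (mod_cast le_top),
    iteratedFDeriv_comp_add_right]
  simp

theorem continuous_iteratedFDeriv_slice {Φ : ℝ × E → F} (h : ContDiff ℝ ∞ Φ) (k : ℕ) :
    Continuous fun q : ℝ × E => iteratedFDeriv ℝ k (fun y => Φ (q.1, y)) q.2 := by
  have : (fun q : ℝ × E => iteratedFDeriv ℝ k (fun y => Φ (q.1, y)) q.2) = fun q =>
      ContinuousMultilinearMap.compContinuousLinearMapL
        (fun _ : Fin k => ContinuousLinearMap.inr ℝ ℝ E) (iteratedFDeriv ℝ k Φ q) := by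
    funext q
    rw [iteratedFDeriv_slice h]; rfl
  rw [this]
  exact (ContinuousLinearMap.continuous _).comp
    (h.continuous_iteratedFDeriv (mod_cast le_top))

/-- A family of Hamiltonians that depends jointly smoothly on a parameter and on the point depends
continuously on the parameter in the `C^∞` topology. -/
theorem SmoothHam.continuous_of_contDiff {F : ℝ → SmoothHam d}
    (h : ContDiff ℝ ∞ (fun q : ℝ × Cover d => (F q.1).1 q.2)) : Continuous F := by
  refine continuous_iInf_rng.2 fun k => continuous_induced_rng.2 ?_
  refine ContinuousMap.continuous_of_continuous_uncurry _ ?_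
  exact continuous_iteratedFDeriv_slice h k

end Topology

/-! ### Functions all of whose derivatives vanish at a point -/

section Flat

variable {E F G V : Type*} [NormedAddCommGroup E] [NormedSpace ℝ E]
  [NormedAddCommGroup F] [NormedSpace ℝ F] [NormedAddCommGroup G] [NormedSpace ℝ G]
  [NormedAddCommGroup V] [NormedSpace ℝ V]

/-- All derivatives of `f` (of order zero, too) vanish at `x`. -/
def FlatAt (f : E → F) (x : E) : Prop := ∀ k : ℕ, iteratedFDeriv ℝ k f x = 0

theorem flatAt_zero (x : E) : FlatAt (fun _ : E => (0 : F)) x := fun k => by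
  have := iteratedFDeriv_fun_zero (𝕜 := ℝ) (E := E) (F := F) (n := k)
  exact congrFun this x

theorem FlatAt.apply_eq_zero {f : E → F} {x : E} (h : FlatAt f x) : f x = 0 := by
  have := congrArg norm (h 0)
  rwa [norm_iteratedFDeriv_zero, norm_zero, norm_eq_zero] at this

theorem FlatAt.congr {f g : E → F} {x : E} (h : FlatAt f x) (hfg : g =ᶠ[𝓝 x] f) :
    FlatAt g x := fun k => by rw [(hfg.iteratedFDeriv ℝ k).self_of_nhds]; exact h k

theorem FlatAt.add {f g : E → F} {x : E} (hf : FlatAt f x) (hg : FlatAt g x)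
    (hfs : ContDiff ℝ ∞ f) (hgs : ContDiff ℝ ∞ g) : FlatAt (fun y => f y + g y) x := fun k => by
  have := iteratedFDeriv_add_apply (i := k) (x := x)
    (hfs.of_le (mod_cast le_top)).contDiffAt (hgs.of_le (mod_cast le_top)).contDiffAt
  exact this.trans (by rw [hf k, hg k, add_zero])

theorem FlatAt.neg {f : E → F} {x : E} (hf : FlatAt f x) : FlatAt (fun y => -f y) x := fun k => by
  have := iteratedFDeriv_neg_apply (𝕜 := ℝ) (i := k) (f := f) (x := x)
  exact this.trans (by rw [hf k, neg_zero])

theorem FlatAt.sub {f g : E → F} {x : E} (hf : FlatAt f x) (hg : FlatAt g x)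
    (hfs : ContDiff ℝ ∞ f) (hgs : ContDiff ℝ ∞ g) : FlatAt (fun y => f y - g y) x := by
  simpa only [sub_eq_add_neg] using hf.add hg.neg hfs hgs.neg

theorem FlatAt.sum {ι : Type*} (s : Finset ι) {f : ι → E → F} {x : E}
    (hf : ∀ i ∈ s, FlatAt (f i) x) (hfs : ∀ i ∈ s, ContDiff ℝ ∞ (f i)) :
    FlatAt (fun y => ∑ i ∈ s, f i y) x := by
  classical
  induction s using Finset.induction_on with
  | empty => simpa using flatAt_zero x
  | insert a s ha ih =>
    simp only [Finset.sum_insert ha]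
    simp only [Finset.mem_insert, forall_eq_or_imp] at hf hfs
    exact hf.1.add (ih hf.2 hfs.2) hfs.1 (ContDiff.sum hfs.2)

theorem FlatAt.bilin_left (B : F →L[ℝ] G →L[ℝ] V) {f : E → F} {g : E → G} {x : E}
    (hf : FlatAt f x) (hfs : ContDiff ℝ ∞ f) (hgs : ContDiff ℝ ∞ g) :
    FlatAt (fun y => B (f y) (g y)) x := fun k => by
  have := B.norm_iteratedFDeriv_le_of_bilinear hfs hgs x (n := k) (mod_cast le_top)
  simpa [hf _] using this

theorem FlatAt.bilin_right (B : F →L[ℝ] G →L[ℝ] V) {f : E → F} {g : E → G} {x : E}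
    (hg : FlatAt g x) (hfs : ContDiff ℝ ∞ f) (hgs : ContDiff ℝ ∞ g) :
    FlatAt (fun y => B (f y) (g y)) x := fun k => by
  have := B.norm_iteratedFDeriv_le_of_bilinear hfs hgs x (n := k) (mod_cast le_top)
  simpa [hg _] using this

theorem FlatAt.smul_left {f : E → ℝ} {g : E → G} {x : E}
    (hf : FlatAt f x) (hfs : ContDiff ℝ ∞ f) (hgs : ContDiff ℝ ∞ g) :
    FlatAt (fun y => f y • g y) x :=
  hf.bilin_left (ContinuousLinearMap.lsmul ℝ ℝ) hfs hgs

theorem FlatAt.smul_right {f : E → ℝ} {g : E → G} {x : E}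
    (hg : FlatAt g x) (hfs : ContDiff ℝ ∞ f) (hgs : ContDiff ℝ ∞ g) :
    FlatAt (fun y => f y • g y) x :=
  hg.bilin_right (ContinuousLinearMap.lsmul ℝ ℝ) hfs hgs

theorem FlatAt.clm_apply {f : E → F} {x : E} (hf : FlatAt f x) (L : F →L[ℝ] G)
    (hfs : ContDiff ℝ ∞ f) : FlatAt (fun y => L (f y)) x :=
  hf.bilin_right (ContinuousLinearMap.id ℝ (F →L[ℝ] G)) (f := fun _ => L) contDiff_const hfs

theorem FlatAt.comp {g : F → G} {f : E → F} {x : E} (hg : FlatAt g (f x))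
    (hgs : ContDiff ℝ ∞ g) (hfs : ContDiff ℝ ∞ f) : FlatAt (fun y => g (f y)) x := fun k => by
  obtain ⟨D, hD⟩ : ∃ D : ℝ, 1 ≤ D ∧ ∀ i ≤ k, ‖iteratedFDeriv ℝ i f x‖ ≤ D := by
    refine ⟨1 + ∑ i ∈ Finset.range (k + 1), ‖iteratedFDeriv ℝ i f x‖, ?_, fun i hi => ?_⟩
    · linarith [Finset.sum_nonneg (s := Finset.range (k + 1))
        (fun i _ => norm_nonneg (iteratedFDeriv ℝ i f x))]
    · have := Finset.single_le_sum (s := Finset.range (k + 1))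
        (f := fun i => ‖iteratedFDeriv ℝ i f x‖) (fun i _ => norm_nonneg _)
        (Finset.mem_range.2 (Nat.lt_succ_of_le hi))
      linarith
  have := norm_iteratedFDeriv_comp_le (n := k) (N := ∞) hgs hfs (mod_cast le_top) x
    (C := 0) (D := D) (fun i _ => by rw [hg i, norm_zero])
    (fun i h1 hi => (hD.2 i hi).trans (le_self_pow₀ hD.1 (by omega)))
  simpa [Function.comp_def] using this

theorem FlatAt.flatAt_fderiv {f : E → F} {x : E} (hf : FlatAt f x) : FlatAt (fderiv ℝ f) x := fun k => by
  have := norm_iteratedFDeriv_fderiv (𝕜 := ℝ) (f := f) (x := x) (n := k)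
  rw [hf, norm_zero] at this
  exact norm_eq_zero.1 this

theorem FlatAt.of_fderiv {f : E → F} {x : E} (hf : FlatAt (fderiv ℝ f) x) (h0 : f x = 0) :
    FlatAt f x := fun k => by
  cases k with
  | zero => apply norm_eq_zero.1; rw [norm_iteratedFDeriv_zero, h0, norm_zero]
  | succ k =>
    have := norm_iteratedFDeriv_fderiv (𝕜 := ℝ) (f := f) (x := x) (n := k)
    rw [hf, norm_zero] at this
    exact norm_eq_zero.1 this.symm

/-- A smooth function whose zeros have interior points accumulating at `x` is flat at `x`. -/
theorem FlatAt.of_mem_closure {f : E → F} {x : E} (hfs : ContDiff ℝ ∞ f)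
    (hx : x ∈ closure (interior {y | f y = 0})) : FlatAt f x := fun k => by
  have hc : IsClosed {y | iteratedFDeriv ℝ k f y = 0} :=
    isClosed_eq (hfs.continuous_iteratedFDeriv (mod_cast le_top)) continuous_const
  refine (hc.closure_subset_iff.2 fun y hy => ?_) hx
  have : f =ᶠ[𝓝 y] fun _ => 0 := by
    filter_upwards [mem_interior_iff_mem_nhds.1 hy] with z hz using hz
  exact (flatAt_zero y).congr this k

end Flat

/-! ### The Hamiltonian vector field -/

section HamVec

variable {d : ℕ}

/-- The linear map that takes the differential of a Hamiltonian to its Hamiltonian vector. -/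
noncomputable def hamJ : (Cover d →L[ℝ] ℝ) →L[ℝ] Cover d :=
  LinearMap.toContinuousLinearMap
    { toFun := fun l => (WithLp.toLp 2 fun i => l (0, EuclideanSpace.single i 1),
        -WithLp.toLp 2 fun i => l (EuclideanSpace.single i 1, 0))
      map_add' := fun a b => by
        ext i <;> simp [add_comm]
      map_smul' := fun c a => by
        ext i <;> simp }

theorem hamJ_fst (l : Cover d →L[ℝ] ℝ) (i : Fin d) :
    (hamJ l).1 i = l (0, EuclideanSpace.single i 1) := rfl

theorem hamJ_snd (l : Cover d →L[ℝ] ℝ) (i : Fin d) :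
    (hamJ l).2 i = -l (EuclideanSpace.single i 1, 0) := rfl

theorem hamVec_eq {H : Cover d → ℝ} {x : Cover d} (h : DifferentiableAt ℝ H x) :
    hamVec H x = hamJ (fderiv ℝ H x) := by
  have e1 : (fun r => H (x.1, r)) = H ∘ fun r => (x.1, r) := rfl
  have e2 : (fun r => H (r, x.2)) = H ∘ fun r => (r, x.2) := rfl
  have d1 : HasFDerivAt (fun r => H (x.1, r))
      ((fderiv ℝ H x).comp (ContinuousLinearMap.inr ℝ (Act d) (Act d))) x.2 :=
    HasFDerivAt.comp x.2 (f := fun r => (x.1, r)) h.hasFDerivAt (hasFDerivAt_prodMk_right x.1 x.2)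
  have d2 : HasFDerivAt (fun r => H (r, x.2))
      ((fderiv ℝ H x).comp (ContinuousLinearMap.inl ℝ (Act d) (Act d))) x.1 :=
    HasFDerivAt.comp x.1 (f := fun r => (r, x.2)) h.hasFDerivAt (hasFDerivAt_prodMk_left x.1 x.2)
  have key : ∀ (f : Act d → ℝ) (y : Act d) (i : Fin d),
      gradient f y i = fderiv ℝ f y (EuclideanSpace.single i 1) := fun f y i => by
    have := InnerProductSpace.toDual_symm_apply (𝕜 := ℝ) (x := EuclideanSpace.single i (1 : ℝ))
      (y := fderiv ℝ f y)
    rw [← this, EuclideanSpace.inner_single_right]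
    simp [gradient]
  unfold hamVec
  ext i
  · rw [hamJ_fst]; simp only [key, d1.fderiv]; simp
  · rw [hamJ_snd]; simp only [PiLp.neg_apply, key, d2.fderiv]; simp

theorem apply_eq_sum (l : Act d →L[ℝ] ℝ) (v : Act d) :
    l v = ∑ i, l (EuclideanSpace.single i 1) * v i := by
  conv_lhs => rw [← (EuclideanSpace.basisFun (Fin d) ℝ).sum_repr v]
  simp [map_sum, mul_comm]

/-- The Hamiltonian vector is dual to the differential with respect to the symplectic form. -/
theorem apply_eq_hamJ (l : Cover d →L[ℝ] ℝ) (v : Cover d) :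
    l v = inner ℝ (hamJ l).1 v.2 - inner ℝ (hamJ l).2 v.1 := by
  have h : l v = (l.comp (ContinuousLinearMap.inl ℝ _ _)) v.1 +
      (l.comp (ContinuousLinearMap.inr ℝ _ _)) v.2 := by
    simp [← map_add]
  rw [h, apply_eq_sum, apply_eq_sum (l.comp (ContinuousLinearMap.inr ℝ _ _))]
  simp only [PiLp.inner_apply, hamJ_fst, hamJ_snd]
  simp [mul_comm, add_comm]

theorem contDiff_hamJ_fderiv {H : Cover d → ℝ} (h : ContDiff ℝ ∞ H) :
    ContDiff ℝ ∞ fun x => hamJ (fderiv ℝ H x) :=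
  hamJ.contDiff.comp (h.fderiv_right (m := ∞) (mod_cast le_top))

end HamVec

/-! ### The group of flat exact symplectic diffeomorphisms -/

section Group

variable {d : ℕ} {hd : 4 ≤ d}

theorem flatAlong_iff {E : Type*} [NormedAddCommGroup E] [NormedSpace ℝ E] {F : Cover d → E} :
    FlatAlong hd F ↔ ∀ x, r4 hd x = 0 → FlatAt F x :=
  ⟨fun h x hx k => h k x hx, fun h k x hx => h x hx k⟩

theorem fderiv_comp_apply' {E F G : Type*} [NormedAddCommGroup E] [NormedSpace ℝ E]
    [NormedAddCommGroup F] [NormedSpace ℝ F] [NormedAddCommGroup G] [NormedSpace ℝ G]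
    {g : F → G} {f : E → F} (hg : ContDiff ℝ ∞ g) (hf : ContDiff ℝ ∞ f) (x v : E) :
    fderiv ℝ (fun y => g (f y)) x v = fderiv ℝ g (f x) (fderiv ℝ f x v) := by
  have := fderiv_comp (𝕜 := ℝ) x ((hg.differentiable (by simp)).differentiableAt (x := f x))
    ((hf.differentiable (by simp)).differentiableAt (x := x))
  simp only [Function.comp_def] at this
  rw [this]; rfl

theorem fderiv_leftInverse {E : Type*} [NormedAddCommGroup E] [NormedSpace ℝ E]
    {U W : E → E} (hU : ContDiff ℝ ∞ U) (hW : ContDiff ℝ ∞ W) (h : Function.LeftInverse W U)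
    (x v : E) : fderiv ℝ W (U x) (fderiv ℝ U x v) = v := by
  rw [← fderiv_comp_apply' hW hU]
  have : (fun y => W (U y)) = id := funext h
  rw [this, fderiv_id]; rfl

/-- The primitives add up: if `U`, `V` have primitives `S`, `T`, then `T ∘ U + S` is one for `V ∘ U`. -/
theorem IsFlatExactDiffeo.comp {U V : Cover d → Cover d} (hV : IsFlatExactDiffeo hd V)
    (hU : IsFlatExactDiffeo hd U) : IsFlatExactDiffeo hd (fun x => V (U x)) := by
  obtain ⟨cU, ⟨WU, cWU, lU, rU⟩, pU, ⟨S, cS, pS, eS⟩, r4U, fU⟩ := hU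
  obtain ⟨cV, ⟨WV, cWV, lV, rV⟩, pV, ⟨T, cT, pT, eT⟩, r4V, fV⟩ := hV
  refine ⟨cV.comp cU, ⟨fun x => WU (WV x), cWU.comp cWV, fun x => ?_, fun x => ?_⟩, fun m x => ?_,
    ⟨fun x => T (U x) + S x, (cT.comp cU).add cS, fun m x => ?_, fun x v => ?_⟩, fun x => ?_, ?_⟩
  · simp only [lV (U x), lU x]
  · simp only [rU (WV x), rV x]
  · simp only [pU, pV]
  · simp only [pU, pS m x]
    rw [pT m (U x)]
  · have h1 : fderiv ℝ (fun x => T (U x) + S x) x v =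
        fderiv ℝ T (U x) (fderiv ℝ U x v) + fderiv ℝ S x v := by
      rw [← fderiv_comp_apply' cT cU]
      have := fderiv_fun_add (𝕜 := ℝ) (x := x) (f := fun x => T (U x)) (g := S)
        (((cT.comp cU).differentiable (by simp)) x) ((cS.differentiable (by simp)) x)
      rw [this]; rfl
    rw [h1, fderiv_comp_apply' cV cU, ← eT, ← eS]
    ring
  · rw [r4V, r4U]
  · rw [flatAlong_iff] at *
    intro x hx
    have h1 := (FlatAt.comp (f := U) (fV (U x) (by rw [r4U, hx])) (cV.sub contDiff_id) cU).add
      (fU x hx) ((cV.sub contDiff_id).comp cU) (cU.sub contDiff_id)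
    refine h1.congr (Eventually.of_forall fun y => ?_)
    simp

theorem IsFlatExactDiffeo.inverse {U W : Cover d → Cover d} (hU : IsFlatExactDiffeo hd U)
    (cW : ContDiff ℝ ∞ W) (l : Function.LeftInverse W U) (r : Function.RightInverse W U) :
    IsFlatExactDiffeo hd W := by
  obtain ⟨cU, -, pU, ⟨S, cS, pS, eS⟩, r4U, fU⟩ := hU
  have pW : ∀ (m : Fin d → ℤ) (x : Cover d),
      W (x.1 + intVec m, x.2) = ((W x).1 + intVec m, (W x).2) := fun m x => by
    rw [← l ((W x).1 + intVec m, (W x).2), pU, r x]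
  have r4W : ∀ x, r4 hd (W x) = r4 hd x := fun x => by rw [← r4U, r x]
  refine ⟨cW, ⟨U, cU, r, l⟩, pW, ⟨fun x => -S (W x), (cS.comp cW).neg, fun m x => ?_,
    fun x v => ?_⟩, r4W, ?_⟩
  · simp only [pW]; rw [pS m (W x)]
  · have h1 : fderiv ℝ (fun x => -S (W x)) x v = -fderiv ℝ S (W x) (fderiv ℝ W x v) := by
      rw [← fderiv_comp_apply' cS cW, fderiv_fun_neg]; rfl
    have h2 : fderiv ℝ U (W x) (fderiv ℝ W x v) = v := fderiv_leftInverse cW cU r x v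
    rw [h1, ← eS, h2, r x]; ring
  · rw [flatAlong_iff] at *
    intro x hx
    have h1 := (FlatAt.comp (f := W) (fU (W x) (by rw [r4W, hx])) (cU.sub contDiff_id) cW).neg
    refine h1.congr (Eventually.of_forall fun y => ?_)
    simp [r y]

/-- The derivative of an exact symplectic diffeomorphism preserves the symplectic form. -/
theorem IsFlatExactDiffeo.symplectic {U : Cover d → Cover d} (hU : IsFlatExactDiffeo hd U)
    (x u v : Cover d) :
    inner ℝ (fderiv ℝ U x u).2 (fderiv ℝ U x v).1 - inner ℝ (fderiv ℝ U x v).2 (fderiv ℝ U x u).1 =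
      inner ℝ u.2 v.1 - inner ℝ v.2 u.1 := by
  obtain ⟨cU, -, -, ⟨S, cS, -, eS⟩, -, -⟩ := hU
  have cU' : ContDiff ℝ ∞ (fderiv ℝ U) := cU.fderiv_right (mod_cast le_top)
  have cS' : ContDiff ℝ ∞ (fderiv ℝ S) := cS.fderiv_right (mod_cast le_top)
  -- differentiate the exactness identity, evaluated on `b`, in the direction `a`
  have key : ∀ a b : Cover d,
      fderiv ℝ (fderiv ℝ S) x a b = inner ℝ (fderiv ℝ U x a).2 (fderiv ℝ U x b).1 +
        inner ℝ (U x).2 (fderiv ℝ (fderiv ℝ U) x a b).1 - inner ℝ a.2 b.1 := fun a b => by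
    have dU : HasFDerivAt U (fderiv ℝ U x) x := (cU.differentiable (by simp) x).hasFDerivAt
    have dU' : HasFDerivAt (fun y => fderiv ℝ U y b) ((fderiv ℝ (fderiv ℝ U) x).flip b) x :=
      (cU'.differentiable (by simp) x).hasFDerivAt.clm_apply (hasFDerivAt_const b x) |>.congr_fderiv
        (by ext <;> simp)
    have dS' : HasFDerivAt (fun y => fderiv ℝ S y b) ((fderiv ℝ (fderiv ℝ S) x).flip b) x :=
      (cS'.differentiable (by simp) x).hasFDerivAt.clm_apply (hasFDerivAt_const b x) |>.congr_fderiv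
        (by ext <;> simp)
    have d1 : HasFDerivAt (fun y : Cover d => inner ℝ (U y).2 (fderiv ℝ U y b).1 - inner ℝ y.2 b.1)
        _ x := ((dU.snd).inner ℝ (dU'.fst)).sub
          ((hasFDerivAt_snd (p := x)).inner ℝ (hasFDerivAt_const b.1 x))
    have e : (fun y : Cover d => inner ℝ (U y).2 (fderiv ℝ U y b).1 - inner ℝ y.2 b.1) =
        fun y => fderiv ℝ S y b := funext fun y => eS y b
    rw [e] at d1
    have := congrArg (fun L : Cover d →L[ℝ] ℝ => L a) (dS'.unique d1)
    simp [fderivInnerCLM_apply] at this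
    rw [this]; ring
  have sU : fderiv ℝ (fderiv ℝ U) x u v = fderiv ℝ (fderiv ℝ U) x v u :=
    (cU.contDiffAt.isSymmSndFDerivAt (by simpa using WithTop.coe_le_coe.2 (le_top : (2 : ℕ∞) ≤ ⊤))) u v
  have sS : fderiv ℝ (fderiv ℝ S) x u v = fderiv ℝ (fderiv ℝ S) x v u :=
    (cS.contDiffAt.isSymmSndFDerivAt (by simpa using WithTop.coe_le_coe.2 (le_top : (2 : ℕ∞) ≤ ⊤))) u v
  rw [key u v, key v u, sU] at sS
  linarith

/-- `hamJ l` is the vector that represents `l` with respect to the symplectic form. -/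
theorem hamJ_eq_of {l : Cover d →L[ℝ] ℝ} {z : Cover d}
    (h : ∀ v : Cover d, l v = inner ℝ z.1 v.2 - inner ℝ z.2 v.1) : hamJ l = z := by
  ext i
  · rw [hamJ_fst, h]; simp [EuclideanSpace.inner_single_right]
  · rw [hamJ_snd, h]; simp [EuclideanSpace.inner_single_right]

/-- A symplectic diffeomorphism conjugates the flow of `K ∘ U` to the flow of `K`. -/
theorem IsHamFlow.conj {K : Cover d → ℝ} (hK : ContDiff ℝ ∞ K) {Φ : ℝ → Cover d → Cover d}
    (hΦ : IsHamFlow K Φ) {U W : Cover d → Cover d} (hU : IsFlatExactDiffeo hd U)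
    (cW : ContDiff ℝ ∞ W) (l : Function.LeftInverse W U) (r : Function.RightInverse W U) :
    IsHamFlow (fun x => K (U x)) (fun t x => W (Φ t (U x))) := by
  intro p
  refine ⟨by simp only [(hΦ (U p)).1, l p], fun t => ?_⟩
  set q := Φ t (U p) with hq
  have h1 := (hΦ (U p)).2 t
  have h2 : HasDerivAt (fun τ => W (Φ τ (U p))) (fderiv ℝ W q (hamVec K q)) t :=
    HasFDerivAt.comp_hasDerivAt t (cW.differentiable (by simp) q).hasFDerivAt h1
  convert h2 using 1
  have cU := hU.1
  have cKU : ContDiff ℝ ∞ fun x => K (U x) := hK.comp cU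
  rw [hamVec_eq (cKU.differentiable (by simp) _),
    hamVec_eq (hK.differentiable (by simp) _)]
  change hamJ (fderiv ℝ (fun x => K (U x)) (W q)) = _
  refine hamJ_eq_of fun v => ?_
  have h3 : fderiv ℝ U (W q) (fderiv ℝ W q (hamJ (fderiv ℝ K q))) = hamJ (fderiv ℝ K q) := by
    exact fderiv_leftInverse cW cU r q _
  have h4 := hU.symplectic (W q) v (fderiv ℝ W q (hamJ (fderiv ℝ K q)))
  rw [h3] at h4
  rw [fderiv_comp_apply' hK cU, r q, apply_eq_hamJ (fderiv ℝ K q)]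
  rw [real_inner_comm, h4, real_inner_comm]

/-- Precomposition of a Hamiltonian with a smooth map that commutes with the deck translations. -/
def SmoothHam.precomp (X : Cover d → Cover d) (hX : ContDiff ℝ ∞ X)
    (pX : ∀ (m : Fin d → ℤ) (x : Cover d),
      X (x.1 + intVec m, x.2) = ((X x).1 + intVec m, (X x).2)) (H : SmoothHam d) : SmoothHam d :=
  ⟨fun x => H.1 (X x), H.2.1.comp hX, fun m x => by
    simp only [pX]; exact H.2.2 m (X x)⟩

/-- On a compact set `K`, the `k`-th derivative of `H ∘ X` is controlled by the derivatives of order at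
most `k` of `H` on the image of `K`, which is compact. -/
theorem SmoothHam.continuous_precomp (X : Cover d → Cover d) (hX : ContDiff ℝ ∞ X)
    (pX : ∀ (m : Fin d → ℤ) (x : Cover d),
      X (x.1 + intVec m, x.2) = ((X x).1 + intVec m, (X x).2)) :
    Continuous (SmoothHam.precomp X hX pX) := by
  refine continuous_iff_continuousAt.2 fun H => SmoothHam.tendsto_nhds_of fun k K hK ε hε => ?_
  obtain ⟨D, hD1, hD⟩ : ∃ D : ℝ, 1 ≤ D ∧ ∀ i ≤ k, ∀ x ∈ K, ‖iteratedFDeriv ℝ i X x‖ ≤ D := by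
    have : ∀ i : ℕ, ∃ C, ∀ x ∈ K, ‖iteratedFDeriv ℝ i X x‖ ≤ C := fun i =>
      hK.exists_bound_of_continuousOn (hX.continuous_iteratedFDeriv (mod_cast le_top)).continuousOn
    choose C hC using this
    refine ⟨1 + ∑ i ∈ Finset.range (k + 1), |C i|, ?_, fun i hi x hx => ?_⟩
    · linarith [Finset.sum_nonneg (s := Finset.range (k + 1)) (fun i _ => abs_nonneg (C i))]
    · have := Finset.single_le_sum (s := Finset.range (k + 1)) (f := fun i => |C i|)
        (fun i _ => abs_nonneg _) (Finset.mem_range.2 (Nat.lt_succ_of_le hi))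
      linarith [hC i x hx, le_abs_self (C i)]
  set M : ℝ := k.factorial * D ^ k with hM
  have hMpos : 0 < M := by positivity
  have hev : ∀ᶠ H' in 𝓝 H, ∀ i ∈ Finset.range (k + 1), ∀ x ∈ X '' K,
      ‖iteratedFDeriv ℝ i H'.1 x - iteratedFDeriv ℝ i H.1 x‖ < ε / (2 * M) :=
    (Finset.eventually_all _).2 fun i _ => SmoothHam.eventually_deriv_close i H
      (hK.image hX.continuous) (by positivity)
  filter_upwards [hev] with H' hH' x hx
  have sub_eq : ∀ (i : ℕ) (F G : Cover d → ℝ), ContDiff ℝ ∞ F → ContDiff ℝ ∞ G → ∀ y,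
      iteratedFDeriv ℝ i (fun z => F z - G z) y =
        iteratedFDeriv ℝ i F y - iteratedFDeriv ℝ i G y := fun i F G hF hG y =>
    iteratedFDeriv_sub_apply (hF.of_le (mod_cast le_top)).contDiffAt
      (hG.of_le (mod_cast le_top)).contDiffAt
  rw [← sub_eq k _ _ (precomp X hX pX H').2.1 (precomp X hX pX H).2.1]
  have := norm_iteratedFDeriv_comp_le (n := k) (N := ∞) (H'.2.1.sub H.2.1) hX (mod_cast le_top) x
    (C := ε / (2 * M)) (D := D) (fun i hi => by
      have := hH' i (Finset.mem_range.2 (Nat.lt_succ_of_le hi)) (X x) ⟨x, hx, rfl⟩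
      have h2 := sub_eq i _ _ H'.2.1 H.2.1 (X x)
      exact (congrArg norm h2).trans_le this.le)
    (fun i h1 hi => (hD i hi x hx).trans (le_self_pow₀ hD1 (by omega)))
  refine lt_of_le_of_lt this ?_
  have : (k.factorial : ℝ) * (ε / (2 * M)) * D ^ k = ε / 2 := by
    rw [hM]; field_simp
  rw [this]; linarith

/-- The closure of the conjugacy class is invariant under the group. -/
theorem mem_closure_conjClass_precomp {ω₀ : Act d} {f : Fin 3 → ℝ → ℝ} {H H' : SmoothHam d}
    (hH : H ∈ closure (conjClass hd ω₀ f)) {U : Cover d → Cover d} (hU : IsFlatExactDiffeo hd U)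
    (h : ∀ x, H'.1 x = H.1 (U x)) : H' ∈ closure (conjClass hd ω₀ f) := by
  have e : H' = SmoothHam.precomp U hU.1 hU.2.2.1 H := Subtype.ext (funext h)
  rw [e]
  refine map_mem_closure (SmoothHam.continuous_precomp U hU.1 hU.2.2.1) hH ?_
  rintro K ⟨V, hV, hKV⟩
  exact ⟨fun x => V (U x), hV.comp hU, fun x => hKV (U x)⟩

end Group

/-! ### Shears generated by commuting functions -/

section Shear

variable {d : ℕ} (hd : 4 ≤ d)

/-- The index in `ℝ^d` of the `i`-th of the first three coordinates. -/
abbrev e3 (i : Fin 3) : Fin d := idx hd i.castSucc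

theorem e3_ne (i : Fin 3) : e3 hd i ≠ idx hd 3 := by
  intro h
  have := congrArg Fin.val h
  simp [idx] at this
  omega

theorem e3_injective : Function.Injective (e3 hd) := fun i j h => by
  have := congrArg Fin.val h
  simp [idx] at this
  exact Fin.ext this

/-- The vector of `ℝ^d` with the given first three coordinates, the others being zero. -/
noncomputable def vec3 (a : Fin 3 → ℝ) : Act d := ∑ i, a i • EuclideanSpace.single (e3 hd i) 1

theorem vec3_apply (a : Fin 3 → ℝ) (j : Fin d) :
    vec3 hd a j = ∑ i, if j = e3 hd i then a i else 0 := by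
  simp [vec3, Pi.single_apply]

theorem vec3_e3 (a : Fin 3 → ℝ) (i : Fin 3) : vec3 hd a (e3 hd i) = a i := by
  rw [vec3_apply, Finset.sum_eq_single i] <;> simp [(e3_injective hd).eq_iff]
  intro b hb h; exact absurd h.symm hb

theorem vec3_idx (a : Fin 3 → ℝ) : vec3 hd a (idx hd 3) = 0 := by
  rw [vec3_apply]
  exact Finset.sum_eq_zero fun i _ => if_neg (e3_ne hd i).symm

theorem inner_vec3 (a : Fin 3 → ℝ) (v : Act d) :
    inner ℝ (vec3 hd a) v = ∑ i, a i * v (e3 hd i) := by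
  simp [vec3, sum_inner, inner_smul_left, EuclideanSpace.inner_single_left]

theorem vec3_smul (c : ℝ) (a : Fin 3 → ℝ) : vec3 hd (c • a) = c • vec3 hd a := by
  simp [vec3, Finset.smul_sum, smul_smul]

/-- The action `r_4`, as a linear form. -/
noncomputable def r4L : Cover d →L[ℝ] ℝ := (EuclideanSpace.proj (idx hd 3)).comp (ContinuousLinearMap.snd ℝ _ _)

/-- The sum `r_1 + r_2 + r_3`, as a linear form. -/
noncomputable def yL : Cover d →L[ℝ] ℝ :=
  ∑ i, (EuclideanSpace.proj (e3 hd i)).comp (ContinuousLinearMap.snd ℝ _ _)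

/-- The linear form `m_1 φ_1 + m_2 φ_2 + m_3 φ_3`. -/
noncomputable def phaseL (m : Fin 3 → ℤ) : Cover d →L[ℝ] ℝ :=
  ∑ i, (m i : ℝ) • (EuclideanSpace.proj (e3 hd i)).comp (ContinuousLinearMap.fst ℝ _ _)

theorem r4L_apply (x : Cover d) : r4L hd x = x.2 (idx hd 3) := rfl

theorem r4_eq (x : Cover d) : r4 hd x = r4L hd x := rfl

theorem yL_apply (x : Cover d) : yL hd x = ∑ i, x.2 (e3 hd i) := by
  simp [yL]

theorem phaseL_apply (m : Fin 3 → ℤ) (x : Cover d) :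
    phaseL hd m x = ∑ i, (m i : ℝ) * x.1 (e3 hd i) := by
  simp [phaseL]

theorem hamJ_r4L : hamJ (r4L hd) = (EuclideanSpace.single (idx hd 3) 1, 0) :=
  hamJ_eq_of fun v => by simp [r4L_apply, EuclideanSpace.inner_single_left]

theorem hamJ_yL : hamJ (yL hd) = (vec3 hd fun _ => 1, 0) :=
  hamJ_eq_of fun v => by simp [yL_apply, inner_vec3]

theorem hamJ_phaseL (m : Fin 3 → ℤ) : hamJ (phaseL hd m) = (0, -vec3 hd fun i => m i) :=
  hamJ_eq_of fun v => by simp [phaseL_apply, inner_vec3]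

theorem phaseL_intVec (m : Fin 3 → ℤ) (n : Fin d → ℤ) (x : Cover d) :
    phaseL hd m (x.1 + intVec n, x.2) = phaseL hd m x + ((∑ i, m i * n (e3 hd i) : ℤ) : ℝ) := by
  simp [phaseL_apply, mul_add, Finset.sum_add_distrib, intVec]

variable {hd}

/-- If the Hamiltonian vector field `Z` of `F` is constant along its own direction lines, the
time-one map of the flow is `x ↦ x + Z x`. -/
theorem isFlatExactDiffeo_add {F : Cover d → ℝ} (hF : ContDiff ℝ ∞ F) (pF : AnglePeriodic F)
    (fF : FlatAlong hd F) {Z : Cover d → Cover d} (hZ : ∀ x, hamJ (fderiv ℝ F x) = Z x)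
    (h1 : ∀ (c : ℝ) (x : Cover d), Z (x + c • Z x) = Z x)
    (h2 : ∀ x v : Cover d, inner ℝ (Z x).2 (fderiv ℝ Z x v).1 = 0)
    (h4 : ∀ x, (Z x).2 (idx hd 3) = 0) :
    IsFlatExactDiffeo hd (fun x => x + Z x) := by
  have hZ' : (fun x => hamJ (fderiv ℝ F x)) = Z := funext hZ
  have cZ : ContDiff ℝ ∞ Z := hZ' ▸ contDiff_hamJ_fderiv hF
  -- `Z` is periodic since `F` is
  have pZ : ∀ (m : Fin d → ℤ) (x : Cover d), Z (x.1 + intVec m, x.2) = Z x := fun m x => by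
    have e : (fun y : Cover d => F (y + ((intVec m, 0) : Cover d))) = F := funext fun y => by
      have := pF m y
      convert this using 2
      ext <;> simp
    have e2 : ((x.1 + intVec m, x.2) : Cover d) = x + ((intVec m, 0) : Cover d) := by
      ext <;> simp
    rw [← hZ, ← hZ, e2]
    conv_rhs => rw [← e]
    rw [fderiv_comp_add_right]
  have dA : ∀ x : Cover d, HasFDerivAt Z (fderiv ℝ Z x) x := fun x =>
    (cZ.differentiable (by simp) x).hasFDerivAt
  -- the inverse is `x ↦ x - Z x`; the primitive is the action `⟨r, Z⟩ - F` of the time-one orbit,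
  -- and `h2` cancels the term that is quadratic in `Z`
  refine ⟨contDiff_id.add cZ, ⟨fun x => x - Z x, contDiff_id.sub cZ, fun x => ?_, fun x => ?_⟩,
    fun m x => ?_, ⟨fun x => inner ℝ x.2 (Z x).1 - F x, ?_, fun m x => ?_, fun x v => ?_⟩,
    fun x => ?_, ?_⟩
  · have := h1 1 x
    rw [one_smul] at this
    simp only [this, add_sub_cancel_right]
  · have := h1 (-1) x
    rw [neg_one_smul, ← sub_eq_add_neg] at this
    simp only [this, sub_add_cancel]
  · simp only [pZ]
    ext <;> simp [add_right_comm]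
  · exact (contDiff_snd.inner ℝ cZ.fst).sub hF
  · simp only [pZ, pF m x]
  · have d1 : HasFDerivAt (fun y : Cover d => inner ℝ y.2 (Z y).1 - F y) _ x :=
      ((hasFDerivAt_snd (p := x)).inner ℝ (dA x).fst).sub
        (hF.differentiable (by simp) x).hasFDerivAt
    have d2 : HasFDerivAt (fun y : Cover d => y + Z y) _ x := (hasFDerivAt_id x).add (dA x)
    rw [d1.fderiv, d2.fderiv]
    have h3 := apply_eq_hamJ (fderiv ℝ F x) v
    rw [hZ] at h3
    simp [fderivInnerCLM_apply, h3, inner_add_left, inner_add_right, h2,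
      real_inner_comm v.2 (Z x).1]
    ring
  · simp [r4, h4]
  · rw [flatAlong_iff] at *
    intro x hx
    have := (fF x hx).flatAt_fderiv.clm_apply hamJ (hF.fderiv_right (m := ∞) (mod_cast le_top))
    refine this.congr (Eventually.of_forall fun y => ?_)
    simp [hZ]

variable (hd) {ι : Type*}

/-- The Hamiltonian `(r_1 + r_2 + r_3)^n ∑_j c_j(r_4) cos (2π ⟨m_j, φ⟩)`. -/
noncomputable def shearHam (s : Finset ι) (c : ι → ℝ → ℝ) (n : ℕ) (m : ι → Fin 3 → ℤ) (x : Cover d) : ℝ :=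
  ∑ j ∈ s, c j (r4L hd x) * yL hd x ^ n * Real.cos (2 * Real.pi * phaseL hd (m j) x)

/-- The first three components of the `r`-part of the vector field of `shearHam`. -/
noncomputable def shearKick (s : Finset ι) (c : ι → ℝ → ℝ) (n : ℕ) (m : ι → Fin 3 → ℤ) (x : Cover d) :
    Fin 3 → ℝ :=
  ∑ j ∈ s, (2 * Real.pi * (c j (r4L hd x) * yL hd x ^ n *
    Real.sin (2 * Real.pi * phaseL hd (m j) x))) • fun i => (m j i : ℝ)

/-- The Hamiltonian vector field of `shearHam`. -/
noncomputable def shearVec (s : Finset ι) (c : ι → ℝ → ℝ) (n : ℕ) (m : ι → Fin 3 → ℤ) (x : Cover d) : Cover d :=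
  ((∑ j ∈ s, deriv (c j) (r4L hd x) * yL hd x ^ n *
      Real.cos (2 * Real.pi * phaseL hd (m j) x)) • EuclideanSpace.single (idx hd 3) 1 +
    (∑ j ∈ s, c j (r4L hd x) * (n * yL hd x ^ (n - 1)) *
      Real.cos (2 * Real.pi * phaseL hd (m j) x)) • vec3 hd fun _ => 1,
    vec3 hd (shearKick hd s c n m x))

variable {hd} {s : Finset ι} {c : ι → ℝ → ℝ} {n : ℕ} {m : ι → Fin 3 → ℤ}

theorem contDiff_shearHam (hc : ∀ j ∈ s, ContDiff ℝ ∞ (c j)) :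
    ContDiff ℝ ∞ (shearHam hd s c n m) := by
  refine ContDiff.sum fun j hj => ((((hc j hj).comp (r4L hd).contDiff).mul
    ((yL hd).contDiff.pow n)).mul (Real.contDiff_cos.comp (contDiff_const.mul
      (phaseL hd (m j)).contDiff)))

theorem hamJ_fderiv_shearHam (hc : ∀ j ∈ s, ContDiff ℝ ∞ (c j)) (x : Cover d) :
    hamJ (fderiv ℝ (shearHam hd s c n m) x) = shearVec hd s c n m x := by
  have h : ∀ j ∈ s, HasFDerivAt (fun x => c j (r4L hd x) * yL hd x ^ n *
      Real.cos (2 * Real.pi * phaseL hd (m j) x))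
      ((deriv (c j) (r4L hd x) * yL hd x ^ n * Real.cos (2 * Real.pi * phaseL hd (m j) x)) • r4L hd +
       (c j (r4L hd x) * (n * yL hd x ^ (n - 1)) *
          Real.cos (2 * Real.pi * phaseL hd (m j) x)) • yL hd -
       (2 * Real.pi * (c j (r4L hd x) * yL hd x ^ n *
          Real.sin (2 * Real.pi * phaseL hd (m j) x))) • phaseL hd (m j)) x := fun j hj => by
    have h1 : HasFDerivAt (fun x => c j (r4L hd x)) (deriv (c j) (r4L hd x) • r4L hd) x :=
      HasDerivAt.comp_hasFDerivAt x ((hc j hj).differentiable (by simp) _).hasDerivAt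
        (r4L hd).hasFDerivAt
    have h2 : HasFDerivAt (fun x => yL hd x ^ n) ((n * yL hd x ^ (n - 1)) • yL hd) x :=
      HasDerivAt.comp_hasFDerivAt x (hasDerivAt_pow n _) (yL hd).hasFDerivAt
    have h3 : HasFDerivAt (fun x => Real.cos (2 * Real.pi * phaseL hd (m j) x))
        (-Real.sin (2 * Real.pi * phaseL hd (m j) x) • ((2 * Real.pi) • phaseL hd (m j))) x :=
      HasDerivAt.comp_hasFDerivAt x (Real.hasDerivAt_cos _)
        ((phaseL hd (m j)).hasFDerivAt.const_mul (2 * Real.pi))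
    refine ((h1.mul h2).mul h3).congr_fderiv ?_
    ext v <;> simp <;> ring
  have h' : HasFDerivAt (shearHam hd s c n m) _ x := HasFDerivAt.fun_sum h
  rw [h'.fderiv, map_sum]
  simp only [map_sub, map_add, map_smul, hamJ_r4L, hamJ_yL, hamJ_phaseL]
  rw [Finset.sum_sub_distrib, Finset.sum_add_distrib, shearVec]
  ext k
  · simp [Finset.sum_mul, Prod.fst_sum, Pi.single_apply]
  · simp only [Prod.snd_add, Prod.snd_sub, Prod.snd_sum, Prod.smul_snd, smul_zero,
      Finset.sum_const_zero, zero_add, zero_sub, smul_neg, Finset.sum_neg_distrib, neg_neg,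
      shearKick, ← vec3_smul]
    simp [vec3_apply, Finset.sum_apply]
    rw [Finset.sum_comm]
    refine Finset.sum_congr rfl fun i _ => ?_
    split_ifs <;> simp

theorem r4L_add_shearVec (a : ℝ) (x : Cover d) :
    r4L hd (x + a • shearVec hd s c n m x) = r4L hd x := by
  simp [r4L_apply, shearVec, vec3_idx]

theorem sum_shearKick (h : ∀ j ∈ s, ∑ i, m j i = 0) (x : Cover d) :
    ∑ i, shearKick hd s c n m x i = 0 := by
  simp only [shearKick, Finset.sum_apply, Pi.smul_apply, smul_eq_mul]
  rw [Finset.sum_comm]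
  refine Finset.sum_eq_zero fun j hj => ?_
  rw [← Finset.mul_sum, ← Int.cast_sum, h j hj]; simp

theorem phaseL_add_shearVec (h : n = 0 ∨ ∀ j ∈ s, ∑ i, m j i = 0) {j : ι} (hj : j ∈ s) (a : ℝ)
    (x : Cover d) :
    phaseL hd (m j) (x + a • shearVec hd s c n m x) = phaseL hd (m j) x := by
  rw [map_add, map_smul]
  have : phaseL hd (m j) (shearVec hd s c n m x) = 0 := by
    rw [phaseL_apply]
    simp only [shearVec, PiLp.add_apply, PiLp.smul_apply, vec3_e3]
    have : ∀ i, (EuclideanSpace.single (idx hd 3) (1 : ℝ)) (e3 hd i) = 0 := fun i => by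
      simp [e3_ne hd i]
    simp only [this, smul_eq_mul, mul_one]
    rw [← Finset.sum_mul, ← Int.cast_sum]
    rcases h with h | h
    · simp [h]
    · simp [h j hj]
  rw [this, smul_zero, add_zero]

theorem yL_add_shearVec (h : ∀ j ∈ s, ∑ i, m j i = 0) (a : ℝ) (x : Cover d) :
    yL hd (x + a • shearVec hd s c n m x) = yL hd x := by
  rw [map_add, map_smul]
  have : yL hd (shearVec hd s c n m x) = 0 := by
    rw [yL_apply]
    simp only [shearVec, vec3_e3]
    exact sum_shearKick h x
  rw [this, smul_zero, add_zero]

/-- The vector field of `shearHam` is constant along its own direction lines when `n = 0` or every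
`m_j` sums to zero: then its direction preserves `r_4`, the phases `⟨m_j, φ⟩` and, if it matters,
`r_1 + r_2 + r_3`. -/
theorem shearVec_add_shearVec (h : n = 0 ∨ ∀ j ∈ s, ∑ i, m j i = 0) (a : ℝ) (x : Cover d) :
    shearVec hd s c n m (x + a • shearVec hd s c n m x) = shearVec hd s c n m x := by
  set z := x + a • shearVec hd s c n m x with hz
  have h1 : r4L hd z = r4L hd x := r4L_add_shearVec a x
  have h2 : ∀ j ∈ s, phaseL hd (m j) z = phaseL hd (m j) x := fun j hj =>
    phaseL_add_shearVec h hj a x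
  have h3 : yL hd z ^ n = yL hd x ^ n ∧
      (n : ℝ) * yL hd z ^ (n - 1) = n * yL hd x ^ (n - 1) := by
    rcases h with h | h
    · simp [h]
    · rw [hz, yL_add_shearVec h a x]; exact ⟨rfl, rfl⟩
  unfold shearVec shearKick
  rw [h1, h3.1, h3.2]
  refine Prod.ext ?_ ?_
  · dsimp only
    congr 2
    · exact Finset.sum_congr rfl fun j hj => by rw [h2 j hj]
    · exact Finset.sum_congr rfl fun j hj => by rw [h2 j hj]
  · dsimp only
    congr 1
    exact Finset.sum_congr rfl fun j hj => by rw [h2 j hj]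

theorem anglePeriodic_shearHam : AnglePeriodic (shearHam hd s c n m) := fun k x => by
  refine Finset.sum_congr rfl fun j _ => ?_
  rw [phaseL_intVec, mul_add]
  have : r4L hd (x.1 + intVec k, x.2) = r4L hd x := rfl
  rw [this]
  have : yL hd (x.1 + intVec k, x.2) = yL hd x := by simp [yL_apply]
  rw [this, show 2 * Real.pi * ((∑ i, m j i * k (e3 hd i) : ℤ) : ℝ) =
    ((∑ i, m j i * k (e3 hd i) : ℤ) : ℝ) * (2 * Real.pi) by ring, Real.cos_add_int_mul_two_pi]

theorem flatAlong_shearHam (hc : ∀ j ∈ s, ContDiff ℝ ∞ (c j)) (hf : ∀ j ∈ s, FlatAt (c j) 0) :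
    FlatAlong hd (shearHam hd s c n m) := by
  rw [flatAlong_iff]
  intro x hx
  have hy : ContDiff ℝ ∞ (yL hd) := (yL hd).contDiff
  have hp : ∀ j, ContDiff ℝ ∞ fun x => Real.cos (2 * Real.pi * phaseL hd (m j) x) := fun j =>
    Real.contDiff_cos.comp (contDiff_const.mul (phaseL hd (m j)).contDiff)
  have h1 : ∀ j ∈ s, ContDiff ℝ ∞ fun x => c j (r4L hd x) := fun j hj =>
    (hc j hj).comp (r4L hd).contDiff
  refine FlatAt.sum s (fun j hj => ?_) (fun j hj => ((h1 j hj).mul (hy.pow n)).mul (hp j))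
  have h2 : FlatAt (fun x => c j (r4L hd x)) x :=
    FlatAt.comp (by rw [← r4_eq, hx]; exact hf j hj) (hc j hj) (r4L hd).contDiff
  exact (h2.smul_left (h1 j hj) (hy.pow n)).smul_left ((h1 j hj).mul (hy.pow n)) (hp j)

/-- The time-one map of the flow of `shearHam`, with coefficients flat at `0`, is in the group. -/
theorem isFlatExactDiffeo_shear (hc : ∀ j ∈ s, ContDiff ℝ ∞ (c j)) (hf : ∀ j ∈ s, FlatAt (c j) 0)
    (h : n = 0 ∨ ∀ j ∈ s, ∑ i, m j i = 0) :
    IsFlatExactDiffeo hd (fun x => x + shearVec hd s c n m x) := by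
  have cZ : ContDiff ℝ ∞ (shearVec hd s c n m) := by
    have := contDiff_hamJ_fderiv (contDiff_shearHam (hd := hd) (n := n) (m := m) hc)
    exact (funext (hamJ_fderiv_shearHam (hd := hd) (n := n) (m := m) hc)) ▸ this
  refine isFlatExactDiffeo_add (contDiff_shearHam hc) anglePeriodic_shearHam
    (flatAlong_shearHam hc hf) (hamJ_fderiv_shearHam hc) (fun a x => shearVec_add_shearVec h a x)
    (fun x v => ?_) (fun x => vec3_idx hd _)
  -- the linear form `⟨kick, ·⟩` kills the directions in which the angles move
  set k := (shearVec hd s c n m x).2 with hk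
  have key : ∀ y, inner ℝ k (shearVec hd s c n m y).1 = 0 := fun y => by
    have h0 : inner ℝ k (EuclideanSpace.single (idx hd 3) (1 : ℝ)) = 0 := by
      simp [EuclideanSpace.inner_single_right, hk, shearVec, vec3_idx]
    simp only [shearVec, inner_add_right, inner_smul_right, h0, mul_zero, zero_add]
    rcases h with h | h
    · simp [h]
    · rw [hk]; simp only [shearVec, inner_vec3, vec3_e3, mul_one, sum_shearKick h x, mul_zero]
  have d1 : HasFDerivAt (fun y => inner ℝ k (shearVec hd s c n m y).1) _ x :=
    (hasFDerivAt_const k x).inner ℝ ((cZ.differentiable (by simp) x).hasFDerivAt.fst)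
  have e : (fun y => inner ℝ k (shearVec hd s c n m y).1) = fun _ => 0 := funext key
  rw [e] at d1
  have := congrArg (fun L : Cover d →L[ℝ] ℝ => L v) (d1.unique (hasFDerivAt_const 0 x))
  simpa [fderivInnerCLM_apply] using this

/-- The effect of a kick of the first three actions on `H_0`. -/
theorem H0_add_kick (ω₀ : Act d) (f : Fin 3 → ℝ → ℝ) (x z : Cover d) (g : Fin 3 → ℝ)
    (hz : z.2 = x.2 + vec3 hd g) :
    H0 hd ω₀ f z = H0 hd ω₀ f x + ∑ i, (freq3 hd ω₀ i + f i (r4L hd x)) * g i := by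
  have h4 : r4 hd z = r4L hd x := by simp [r4, r4L_apply, hz, vec3_idx]
  unfold H0 twistPart
  rw [h4, hz, inner_add_right, real_inner_comm (vec3 hd g) ω₀, inner_vec3, r4_eq]
  simp only [PiLp.add_apply, vec3_e3, mul_add, add_mul, Finset.sum_add_distrib, freq3]
  simp only [mul_comm (g _)]
  ring

end Shear

/-! ### Cutting off a flat exact symplectic diffeomorphism close to the identity -/

section NearIdentity

variable {E : Type*} [NormedAddCommGroup E] [NormedSpace ℝ E] [CompleteSpace E]

/-- A perturbation of the identity by a map with derivative of norm at most `1 / 2` is a diffeomorphism. -/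
theorem exists_inverse_id_add {f : E → E} (hf : ContDiff ℝ ∞ f)
    (h : ∀ x, ‖fderiv ℝ f x‖ ≤ 1 / 2) :
    ∃ Z : E → E, ContDiff ℝ ∞ Z ∧ Function.LeftInverse Z (fun x => x + f x) ∧
      Function.RightInverse Z (fun x => x + f x) ∧ ∀ y, ‖fderiv ℝ Z y‖ ≤ 2 := by
  have hdf : ∀ x, HasFDerivAt f (fderiv ℝ f x) x := fun x =>
    (hf.differentiable (by simp) x).hasFDerivAt
  have hs : ContDiff ℝ ∞ fun x => x + f x := contDiff_id.add hf
  have lip : LipschitzWith (1 / 2) f :=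
    lipschitzWith_of_nnnorm_fderiv_le (hf.differentiable (by simp)) fun x => by
      rw [← NNReal.coe_le_coe]; simpa using h x
  have happ : ApproximatesLinearOn (fun x => x + f x)
      ((ContinuousLinearEquiv.refl ℝ E : E ≃L[ℝ] E) : E →L[ℝ] E) Set.univ (1 / 2) := by
    rw [ApproximatesLinearOn.approximatesLinearOn_iff_lipschitzOnWith]
    have : ((fun x => x + f x) - ⇑((ContinuousLinearEquiv.refl ℝ E : E ≃L[ℝ] E) : E →L[ℝ] E)) =
        f := by
      ext x; simp
    rw [this]; exact lip.lipschitzOnWith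
  have hc : Subsingleton E ∨ (1 / 2 : NNReal) <
      ‖((ContinuousLinearEquiv.refl ℝ E).symm : E →L[ℝ] E)‖₊⁻¹ := by
    rcases subsingleton_or_nontrivial E with h1 | h1
    · exact Or.inl h1
    · right
      have : ‖((ContinuousLinearEquiv.refl ℝ E).symm : E →L[ℝ] E)‖₊ = 1 := by
        have := ContinuousLinearMap.norm_id (𝕜 := ℝ) (E := E)
        ext; exact this
      rw [this, ← NNReal.coe_lt_coe]; norm_num
  let e : E ≃ₜ E := happ.toHomeomorph _ hc
  have he : ∀ x, e x = x + f x := fun x => rfl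
  have hlt : ∀ x, ‖-fderiv ℝ f x‖ < 1 := fun x => by
    rw [norm_neg]; linarith [h x]
  let D : E → E ≃L[ℝ] E := fun x =>
    ContinuousLinearEquiv.unitsEquiv ℝ E (Units.oneSub (-fderiv ℝ f x) (hlt x))
  have hD : ∀ x, HasFDerivAt e (D x : E →L[ℝ] E) x := fun x => by
    have := (hasFDerivAt_id x).add (hdf x)
    refine HasFDerivAt.congr_fderiv (f := e) this ?_
    ext v
    simp [D]
  have hZ : ContDiff ℝ ∞ e.symm := e.contDiff_symm hD hs
  have hr : Function.RightInverse e.symm (fun x => x + f x) := fun y => e.apply_symm_apply y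
  refine ⟨e.symm, hZ, fun x => e.symm_apply_apply x, hr, fun y => ?_⟩
  refine ContinuousLinearMap.opNorm_le_bound _ zero_le_two fun v => ?_
  set w := fderiv ℝ e.symm y v with hw
  have h1 : fderiv ℝ (fun x => x + f x) (e.symm y) w = v := fderiv_leftInverse hZ hs hr y v
  have h2 : fderiv ℝ (fun x => x + f x) (e.symm y) w = w + fderiv ℝ f (e.symm y) w := by
    have := ((hasFDerivAt_id (𝕜 := ℝ) (e.symm y)).add (hdf (e.symm y))).fderiv
    exact congrArg (fun L : E →L[ℝ] E => L w) this
  have h3 : ‖fderiv ℝ f (e.symm y) w‖ ≤ 1 / 2 * ‖w‖ :=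
    ContinuousLinearMap.le_of_opNorm_le _ (h _) _
  have h4 : ‖w‖ ≤ ‖v‖ + ‖fderiv ℝ f (e.symm y) w‖ := by
    have : w = v - fderiv ℝ f (e.symm y) w := by rw [← h1, h2]; simp
    calc ‖w‖ = ‖v - fderiv ℝ f (e.symm y) w‖ := by rw [← this]
      _ ≤ _ := norm_sub_le _ _
  linarith

end NearIdentity

section CutOff

variable {d : ℕ} {hd : 4 ≤ d}

/-- The actions are moved by a bounded amount. -/
def Tame (U : Cover d → Cover d) : Prop := ∃ C, ∀ x, ‖(U x).2 - x.2‖ ≤ C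

theorem exists_bound_fderiv_comp_snd {F : Type*} [NormedAddCommGroup F] [NormedSpace ℝ F]
    {g : Act d → F} (hg : ContDiff ℝ ∞ g) (h : HasCompactSupport g) :
    ∃ C, ∀ x : Cover d, ‖g x.2‖ ≤ C ∧ ‖fderiv ℝ (fun y : Cover d => g y.2) x‖ ≤ C := by
  obtain ⟨C1, hC1⟩ := h.exists_bound_of_continuous hg.continuous
  obtain ⟨C2, hC2⟩ := (h.fderiv ℝ).exists_bound_of_continuous
    (hg.fderiv_right (m := ∞) (mod_cast le_top)).continuous
  refine ⟨max C1 C2, fun x => ⟨(hC1 _).trans (le_max_left _ _), ?_⟩⟩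
  have : HasFDerivAt (fun y : Cover d => g y.2)
      ((fderiv ℝ g x.2).comp (ContinuousLinearMap.snd ℝ _ _)) x :=
    HasFDerivAt.comp x (hg.differentiable (by simp) _).hasFDerivAt hasFDerivAt_snd
  rw [this.fderiv]
  calc _ ≤ ‖fderiv ℝ g x.2‖ * ‖ContinuousLinearMap.snd ℝ (Act d) (Act d)‖ :=
        ContinuousLinearMap.opNorm_comp_le _ _
    _ ≤ ‖fderiv ℝ g x.2‖ * 1 := by gcongr; exact ContinuousLinearMap.norm_snd_le _ _ _
    _ ≤ _ := by rw [mul_one]; exact (hC2 _).trans (le_max_right _ _)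

/-- The data obtained from two bump functions of the actions: `P₁ = 1` on `{‖r‖ ≤ R + 2}`, `P = 1`
on `{‖r‖ ≤ R}`, `P = 0` off `{‖r‖ < R + 1}`, with all relevant derivatives bounded. -/
theorem exists_cutoffs (R : ℝ) (hR : 0 < R) : ∃ (P₁ P : Act d → ℝ) (M : ℝ), 0 ≤ M ∧
    ContDiff ℝ ∞ P₁ ∧ ContDiff ℝ ∞ P ∧
    (∀ r, ‖r‖ ≤ R + 2 → P₁ r = 1) ∧ (∀ r, R + 3 ≤ ‖r‖ → P₁ r = 0) ∧ (∀ r, |P₁ r| ≤ 1) ∧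
    (∀ r, ‖r‖ ≤ R → P r = 1) ∧ (∀ r, R + 1 ≤ ‖r‖ → P r = 0) ∧ (∀ r, |P r| ≤ 1) ∧
    (∀ x : Cover d, ‖fderiv ℝ (fun y : Cover d => P₁ y.2) x‖ ≤ M) ∧
    (∀ x : Cover d, ‖fderiv ℝ (fun y : Cover d => P y.2) x‖ ≤ M) ∧
    (∀ x : Cover d, ‖hamJ (fderiv ℝ (fun y : Cover d => P y.2) x)‖ ≤ M) ∧
    (∀ x : Cover d,
      ‖fderiv ℝ (fun z => hamJ (fderiv ℝ (fun y : Cover d => P y.2) z)) x‖ ≤ M) := by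
  let B1 : ContDiffBump (0 : Act d) := ⟨R + 2, R + 3, by linarith, by linarith⟩
  let B : ContDiffBump (0 : Act d) := ⟨R, R + 1, hR, by linarith⟩
  obtain ⟨C1, hC1⟩ := exists_bound_fderiv_comp_snd B1.contDiff B1.hasCompactSupport
  obtain ⟨C2, hC2⟩ := exists_bound_fderiv_comp_snd B.contDiff B.hasCompactSupport
  let L : (Act d →L[ℝ] ℝ) →L[ℝ] Cover d := hamJ.comp
    ((ContinuousLinearMap.compL ℝ (Cover d) (Act d) ℝ).flip (ContinuousLinearMap.snd ℝ _ _))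
  have hB' : ContDiff ℝ ∞ (fderiv ℝ B) := B.contDiff.fderiv_right (m := ∞) (mod_cast le_top)
  have hL : (fun x : Cover d => hamJ (fderiv ℝ (fun y : Cover d => B y.2) x)) =
      fun x => L (fderiv ℝ B x.2) := by
    funext x
    have : HasFDerivAt (fun y : Cover d => B y.2)
        ((fderiv ℝ B x.2).comp (ContinuousLinearMap.snd ℝ _ _)) x :=
      HasFDerivAt.comp x (f := Prod.snd)
        (B.contDiff.differentiable (n := ∞) (by simp) _).hasFDerivAt hasFDerivAt_snd
    rw [this.fderiv]; rfl
  obtain ⟨C3, hC3⟩ := exists_bound_fderiv_comp_snd (g := fun r => L (fderiv ℝ B r))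
    (L.contDiff.comp hB') ((B.hasCompactSupport.fderiv ℝ).comp_left (map_zero L))
  have hC10 : 0 ≤ C1 := (norm_nonneg _).trans (hC1 0).1
  have habs : ∀ (B : ContDiffBump (0 : Act d)) r, |B r| ≤ 1 := fun B r => by
    rw [abs_of_nonneg B.nonneg]; exact B.le_one
  refine ⟨B1, B, max C1 (max C2 C3), hC10.trans (le_max_left _ _), B1.contDiff, B.contDiff,
    fun r hr => B1.one_of_mem_closedBall (by simpa using hr),
    fun r hr => B1.zero_of_le_dist (by simpa using hr), habs B1,
    fun r hr => B.one_of_mem_closedBall (by simpa using hr),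
    fun r hr => B.zero_of_le_dist (by simpa using hr), habs B,
    fun x => (hC1 x).2.trans (le_max_left _ _),
    fun x => (hC2 x).2.trans ((le_max_left _ _).trans (le_max_right _ _)), fun x => ?_, fun x => ?_⟩
  · rw [congrFun hL x]
    exact (hC3 x).1.trans ((le_max_right _ _).trans (le_max_right _ _))
  · rw [hL]
    exact (hC3 x).2.trans ((le_max_right _ _).trans (le_max_right _ _))

theorem hasFDerivAt_shift {X : Cover d → Cover d} (hX : ContDiff ℝ ∞ X) (x : Cover d) :
    HasFDerivAt (fun y => X y - y) (fderiv ℝ (fun y => X y - y) x) x :=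
  ((hX.sub contDiff_id).differentiable (by simp) x).hasFDerivAt

/-- Every flat exact symplectic diffeomorphism `X = Id + (u, w)` has a mixed generating function
`σ`: in terms of `X = (Φ, R)`, `dσ = ⟨w, dΦ⟩ - ⟨u, dr⟩`. -/
theorem exists_generating {X : Cover d → Cover d} (hX : IsFlatExactDiffeo hd X) :
    ∃ σ : Cover d → ℝ, ContDiff ℝ ∞ σ ∧ AnglePeriodic σ ∧ FlatAlong hd σ ∧
      ∀ x v, fderiv ℝ σ x v =
        inner ℝ (X x - x).2 (v.1 + (fderiv ℝ (fun y => X y - y) x v).1) -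
          inner ℝ (X x - x).1 v.2 := by
  obtain ⟨cX, -, pX, ⟨S, cS, pS, eS⟩, r4X, fX⟩ := hX
  have cD : ContDiff ℝ ∞ fun y => X y - y := cX.sub contDiff_id
  have cD' : ContDiff ℝ ∞ (fderiv ℝ fun y => X y - y) := cD.fderiv_right (mod_cast le_top)
  -- subtracting `S 0` makes `σ` vanish at a point of `{r_4 = 0}`, hence on this hyperplane
  let σ : Cover d → ℝ := fun x => S x - inner ℝ x.2 (X x - x).1 - S 0
  have cσ : ContDiff ℝ ∞ σ := (cS.sub (contDiff_snd.inner ℝ cD.fst)).sub contDiff_const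
  have key : ∀ x v, fderiv ℝ σ x v =
        inner ℝ (X x - x).2 (v.1 + (fderiv ℝ (fun y => X y - y) x v).1) -
          inner ℝ (X x - x).1 v.2 := fun x v => by
    have d0 := hasFDerivAt_shift cX x
    have d1 : HasFDerivAt σ _ x := ((cS.differentiable (by simp) x).hasFDerivAt.sub
      ((hasFDerivAt_snd (p := x)).inner ℝ d0.fst)).sub_const (S 0)
    have d2 : HasFDerivAt X (fderiv ℝ (fun y => X y - y) x + ContinuousLinearMap.id ℝ _) x := by
      have := d0.add (hasFDerivAt_id x)
      refine this.congr_of_eventuallyEq (Eventually.of_forall fun y => ?_)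
      simp
    have h := eS x v
    rw [d2.fderiv] at h
    rw [d1.fderiv]
    simp [fderivInnerCLM_apply, ← h, inner_add_right, inner_sub_left, inner_sub_right,
      real_inner_comm v.2]
    ring
  rw [flatAlong_iff] at fX
  refine ⟨σ, cσ, fun m x => ?_, flatAlong_iff.2 fun x hx => ?_, key⟩
  · have h1 : S (x.1 + intVec m, x.2) = S x := pS m x
    simp only [σ, pX, h1, Prod.fst_sub]
    congr 2
    abel_nf
  · have hz : ∀ y, r4 hd y = 0 → fderiv ℝ σ y = 0 := fun y hy => by
      refine ContinuousLinearMap.ext fun v => ?_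
      have h0 : X y - y = 0 := (fX y hy).apply_eq_zero
      rw [key, h0]; simp
    -- `dσ` is flat, being bilinear in the displacement and a smooth map; and `σ` vanishes, being
    -- constant along the segment from `0` to `x`
    refine FlatAt.of_fderiv ?_ ?_
    · have e : fderiv ℝ σ = fun y =>
          (∑ i, ((X y - y).2 i) • ((EuclideanSpace.proj i : Act d →L[ℝ] ℝ).comp
            ((ContinuousLinearMap.fst ℝ _ _).comp
              (ContinuousLinearMap.id ℝ _ + fderiv ℝ (fun y => X y - y) y)))) -
          ∑ i, ((X y - y).1 i) • ((EuclideanSpace.proj i : Act d →L[ℝ] ℝ).comp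
            (ContinuousLinearMap.snd ℝ (Act d) (Act d))) := by
        funext y
        refine ContinuousLinearMap.ext fun v => ?_
        rw [key]
        simp [PiLp.inner_apply, mul_comm]
        exact Finset.sum_congr rfl fun i _ => by ring
      have hp : ∀ i, ContDiff ℝ ∞ fun y => (X y - y).2 i := fun i =>
        ((EuclideanSpace.proj i : Act d →L[ℝ] ℝ).comp
          (ContinuousLinearMap.snd ℝ (Act d) (Act d))).contDiff.comp cD
      have hq : ∀ i, ContDiff ℝ ∞ fun y => (X y - y).1 i := fun i =>
        ((EuclideanSpace.proj i : Act d →L[ℝ] ℝ).comp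
          (ContinuousLinearMap.fst ℝ (Act d) (Act d))).contDiff.comp cD
      have hpf : ∀ i, FlatAt (fun y => (X y - y).2 i) x := fun i =>
        (fX x hx).clm_apply ((EuclideanSpace.proj i : Act d →L[ℝ] ℝ).comp
          (ContinuousLinearMap.snd ℝ (Act d) (Act d))) cD
      have hqf : ∀ i, FlatAt (fun y => (X y - y).1 i) x := fun i =>
        (fX x hx).clm_apply ((EuclideanSpace.proj i : Act d →L[ℝ] ℝ).comp
          (ContinuousLinearMap.fst ℝ (Act d) (Act d))) cD
      have hA : ∀ i : Fin d, ContDiff ℝ ∞ fun y => (EuclideanSpace.proj i : Act d →L[ℝ] ℝ).comp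
            ((ContinuousLinearMap.fst ℝ _ _).comp
              (ContinuousLinearMap.id ℝ _ + fderiv ℝ (fun y => X y - y) y)) := fun i =>
        contDiff_const.clm_comp (contDiff_const.clm_comp (contDiff_const.add cD'))
      rw [e]
      refine FlatAt.sub (FlatAt.sum _ (fun i _ => (hpf i).smul_left (hp i) (hA i))
        fun i _ => (hp i).smul (hA i)) (FlatAt.sum _ (fun i _ => (hqf i).smul_left (hq i)
        contDiff_const) fun i _ => (hq i).smul contDiff_const)
        (ContDiff.sum fun i _ => (hp i).smul (hA i))
        (ContDiff.sum fun i _ => (hq i).smul contDiff_const)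
    · have h0 : σ 0 = 0 := by simp [σ]
      have hd : ∀ t : ℝ, HasDerivAt (fun t : ℝ => σ (t • x)) 0 t := fun t => by
        have h1 : HasDerivAt (fun t : ℝ => t • x) x t := by
          simpa using (hasDerivAt_id t).smul_const x
        have h2 := (cσ.differentiable (by simp) (t • x)).hasFDerivAt.comp_hasDerivAt t h1
        rw [hz (t • x) (by rw [r4_eq, map_smul, ← r4_eq, hx, smul_zero])] at h2
        exact h2
      have := is_const_of_deriv_eq_zero (fun t => (hd t).differentiableAt)
        (fun t => (hd t).deriv) 1 0
      simpa [h0] using this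

end CutOff

section CutOffMain

variable {d : ℕ} {hd : 4 ≤ d}

theorem fderiv_comp_clm_add {E F : Type*} [NormedAddCommGroup E] [NormedSpace ℝ E]
    [NormedAddCommGroup F] [NormedSpace ℝ F] {N : E → F} (hN : ContDiff ℝ ∞ N) (L : F →L[ℝ] E)
    (x v : E) : fderiv ℝ (fun y => y + L (N y)) x v = v + L (fderiv ℝ N x v) := by
  have h1 : HasFDerivAt N (fderiv ℝ N x) x := (hN.differentiable (by simp) x).hasFDerivAt
  have h2 := ((hasFDerivAt_id (𝕜 := ℝ) x).add (L.hasFDerivAt.comp x h1)).fderiv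
  exact congrArg (fun L : E →L[ℝ] E => L v) h2

theorem norm_fderiv_clm_comp_le {E F : Type*} [NormedAddCommGroup E] [NormedSpace ℝ E]
    [NormedAddCommGroup F] [NormedSpace ℝ F] {N : E → F} (hN : ContDiff ℝ ∞ N) {L : F →L[ℝ] E}
    (hL : ‖L‖ ≤ 1) {c : ℝ} {x : E} (h : ‖fderiv ℝ N x‖ ≤ c) :
    ‖fderiv ℝ (fun y => L (N y)) x‖ ≤ c := by
  have h1 : HasFDerivAt N (fderiv ℝ N x) x := (hN.differentiable (by simp) x).hasFDerivAt
  have h2 : HasFDerivAt (fun y => L (N y)) (L.comp (fderiv ℝ N x)) x := L.hasFDerivAt.comp x h1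
  rw [h2.fderiv]
  calc _ ≤ ‖L‖ * ‖fderiv ℝ N x‖ := ContinuousLinearMap.opNorm_comp_le _ _
    _ ≤ 1 * c := by gcongr
    _ = c := one_mul c

variable (d) in
/-- The projection `(a, b) ↦ (a, 0)`. -/
noncomputable def projAngle : Cover d →L[ℝ] Cover d :=
  (ContinuousLinearMap.inl ℝ _ _).comp (ContinuousLinearMap.fst ℝ _ _)

variable (d) in
/-- The map `(a, b) ↦ (0, -b)`. -/
noncomputable def negAction : Cover d →L[ℝ] Cover d :=
  -((ContinuousLinearMap.inr ℝ _ _).comp (ContinuousLinearMap.snd ℝ _ _))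

theorem projAngle_apply (x : Cover d) : projAngle d x = (x.1, 0) := rfl

theorem negAction_apply (x : Cover d) : negAction d x = (0, -x.2) := by
  simp [negAction]

theorem norm_projAngle_le : ‖projAngle d‖ ≤ 1 :=
  ContinuousLinearMap.opNorm_le_bound _ zero_le_one fun x => by
    rw [projAngle_apply, Prod.norm_def]; simpa using norm_fst_le x

theorem norm_negAction_le : ‖negAction d‖ ≤ 1 :=
  ContinuousLinearMap.opNorm_le_bound _ zero_le_one fun x => by
    rw [negAction_apply, Prod.norm_def]; simpa using norm_snd_le x

/-- A flat periodic function `τ` with Hamiltonian vector field `N` that is small in `C^1` is the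
mixed generating function of a flat exact symplectic diffeomorphism. -/
theorem exists_diffeo_of_generating {τ : Cover d → ℝ} {N : Cover d → Cover d}
    (cτ : ContDiff ℝ ∞ τ) (pτ : AnglePeriodic τ)
    (cN : ContDiff ℝ ∞ N) (pN : ∀ (m : Fin d → ℤ) (x : Cover d), N (x.1 + intVec m, x.2) = N x)
    (eN : ∀ x v, fderiv ℝ τ x v = inner ℝ (N x).1 v.2 - inner ℝ (N x).2 v.1)
    (sN : ∀ x, ‖fderiv ℝ N x‖ ≤ 1 / 2) (fN : FlatAlong hd N) (r4N : ∀ x, r4 hd (N x) = 0) :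
    ∃ X, IsFlatExactDiffeo hd X ∧
      ∀ x : Cover d, X (x.1 + (N x).1, x.2) = (x.1, x.2 - (N x).2) := by
  have sY : ∀ x, ‖fderiv ℝ (fun y => projAngle d (N y)) x‖ ≤ 1 / 2 := fun x =>
    norm_fderiv_clm_comp_le cN norm_projAngle_le (sN x)
  have sZ : ∀ x, ‖fderiv ℝ (fun y => negAction d (N y)) x‖ ≤ 1 / 2 := fun x =>
    norm_fderiv_clm_comp_le cN norm_negAction_le (sN x)
  have cY : ContDiff ℝ ∞ fun y => projAngle d (N y) := (projAngle d).contDiff.comp cN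
  have cZ : ContDiff ℝ ∞ fun y => negAction d (N y) := (negAction d).contDiff.comp cN
  obtain ⟨V, cV, lV, rV, -⟩ := exists_inverse_id_add cY sY
  obtain ⟨V₂, cV₂, lV₂, rV₂, -⟩ := exists_inverse_id_add cZ sZ
  have hV : ∀ x, x = V x + projAngle d (N (V x)) := fun x => (rV x).symm
  have hV2 : ∀ x, (V x).2 = x.2 := fun x => by
    conv_rhs => rw [hV x]
    simp [projAngle_apply]
  have r4V : ∀ x, r4 hd (V x) = r4 hd x := fun x => by simp only [r4, hV2]
  have pV : ∀ (m : Fin d → ℤ) (x : Cover d),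
      V (x.1 + intVec m, x.2) = ((V x).1 + intVec m, (V x).2) := fun m x => by
    rw [← lV ((V x).1 + intVec m, (V x).2)]
    congr 1
    simp only [pN]
    conv_lhs => rw [hV x]
    simp [projAngle_apply, add_right_comm]
  have cX : ContDiff ℝ ∞ fun x => V x + negAction d (N (V x)) :=
    (contDiff_id.add cZ).comp cV
  -- `V` inverts `(a, r) ↦ (a + N₁, r)`, so that `X` is `V` followed by `(a, r) ↦ (a, r - N₂)`; the
  -- roles of the two factors are interchanged in the inverse
  refine ⟨fun x => V x + negAction d (N (V x)), ⟨cX,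
    ⟨fun x => V₂ x + projAngle d (N (V₂ x)), (contDiff_id.add cY).comp cV₂, fun x => ?_,
      fun x => ?_⟩, fun m x => ?_, ⟨fun x => τ (V x) - inner ℝ (V x).2 (N (V x)).1, ?_,
      fun m x => ?_, fun x v => ?_⟩, fun x => ?_, ?_⟩, fun x => ?_⟩
  · have h := lV₂ (V x)
    dsimp only at h ⊢
    rw [h]; exact (hV x).symm
  · have h := lV (V₂ x)
    dsimp only at h ⊢
    rw [h]; exact rV₂ x
  · simp only [pV, pN]
    ext <;> simp [negAction_apply]
  · exact (cτ.comp cV).sub (cV.snd.inner ℝ ((cN.comp cV).fst))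
  · simp only [pV, pN]
    rw [pτ m (V x)]
  · set q := V x with hq
    set ξ := fderiv ℝ V x v with hξ
    have h1 : ξ + projAngle d (fderiv ℝ N q ξ) = v := by
      rw [← fderiv_comp_clm_add cN]
      exact fderiv_leftInverse cV (contDiff_id.add cY) rV x v
    have h2 : fderiv ℝ (fun x => V x + negAction d (N (V x))) x v =
        ξ + negAction d (fderiv ℝ N q ξ) := by
      rw [← fderiv_comp_clm_add cN]
      exact fderiv_comp_apply' (g := fun y => y + negAction d (N y)) (contDiff_id.add cZ) cV x v
    have h3 : fderiv ℝ (fun x => τ (V x) - inner ℝ (V x).2 (N (V x)).1) x v =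
        fderiv ℝ (fun x => τ x - inner ℝ x.2 (N x).1) q ξ :=
      fderiv_comp_apply' (cτ.sub (contDiff_snd.inner ℝ cN.fst)) cV x v
    have h4 : HasFDerivAt (fun x => τ x - inner ℝ x.2 (N x).1) _ q :=
      (cτ.differentiable (by simp) q).hasFDerivAt.sub ((hasFDerivAt_snd (p := q)).inner ℝ
        (cN.differentiable (by simp) q).hasFDerivAt.fst)
    rw [h2, h3, h4.fderiv]
    have h5 : x.2 = q.2 := (hV2 x).symm
    have h6 : v.1 = ξ.1 + (fderiv ℝ N q ξ).1 := by rw [← h1]; simp [projAngle_apply]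
    simp [fderivInnerCLM_apply, negAction_apply, h5, h6, inner_add_right, inner_sub_left, eN,
      real_inner_comm ξ.2, ← sub_eq_add_neg]
    ring
  · have h := r4N (V x)
    simp only [r4] at h
    simp [r4, negAction_apply, hV2, h]
  · rw [flatAlong_iff] at *
    intro x hx
    have := (FlatAt.comp (f := V) (fN (V x) (by rw [r4V, hx])) cN cV).neg
    refine this.congr (Eventually.of_forall fun y => ?_)
    dsimp only
    conv_lhs => rw [sub_eq_add_neg]; enter [2]; rw [hV y]
    ext <;> simp [projAngle_apply, negAction_apply]
  · have h := lV x
    have e : x + projAngle d (N x) = (x.1 + (N x).1, x.2) := by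
      ext <;> simp [projAngle_apply]
    dsimp only at h ⊢
    rw [e] at h
    rw [h]
    ext <;> simp [negAction_apply, sub_eq_add_neg]

theorem abs_symplectic_le (z v : Cover d) :
    |inner ℝ z.1 v.2 - inner ℝ z.2 v.1| ≤ 2 * ‖z‖ * ‖v‖ := by
  have h1 := (abs_real_inner_le_norm z.1 v.2).trans
    (mul_le_mul (norm_fst_le z) (norm_snd_le v) (norm_nonneg _) (norm_nonneg _))
  have h2 := (abs_real_inner_le_norm z.2 v.1).trans
    (mul_le_mul (norm_snd_le z) (norm_fst_le v) (norm_nonneg _) (norm_nonneg _))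
  have := abs_sub (inner ℝ z.1 v.2 : ℝ) (inner ℝ z.2 v.1)
  linarith

/-- A flat exact symplectic diffeomorphism that is `C^1`-close to the identity on a large set
agrees on a smaller one with one that moves the actions by a bounded amount: cut off its mixed
generating function. -/
theorem exists_tame_of_close (R : ℝ) (hR : 0 < R) : ∃ η > 0, ∀ X : Cover d → Cover d,
    IsFlatExactDiffeo hd X →
    (∀ x, ‖x.2‖ ≤ R + 3 → ‖X x - x‖ ≤ η ∧ ‖fderiv ℝ (fun y => X y - y) x‖ ≤ η) →
    ∃ X', IsFlatExactDiffeo hd X' ∧ Tame X' ∧ ∀ x, ‖x.2‖ < R → X' x = X x := by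
  obtain ⟨P₁, P, M, hM, cP₁, cP, P₁one, P₁zero, P₁le, Pone, Pzero, Ple, hM₁, hM₂, hM₃, hM₄⟩ :=
    exists_cutoffs (d := d) R hR
  -- `η K` bounds the derivative of the vector field `N` below
  let K : ℝ := 2 * M + 2 * (R + 2) * M + M + 2
  have hK : 0 < K := by positivity
  refine ⟨1 / (2 * K), by positivity, fun X hX hclose => ?_⟩
  set η : ℝ := 1 / (2 * K) with hη
  have hη0 : 0 < η := by positivity
  have hηK : η * K = 1 / 2 := by rw [hη]; field_simp
  obtain ⟨σ, cσ, pσ, fσ, eσ⟩ := exists_generating hX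
  obtain ⟨cX, -, pX, -, r4X, fX⟩ := hX
  set D : Cover d → Cover d := fun y => X y - y with hD
  have cD : ContDiff ℝ ∞ D := cX.sub contDiff_id
  have pD : ∀ (m : Fin d → ℤ) (x : Cover d), D (x.1 + intVec m, x.2) = D x := fun m x => by
    ext <;> simp [hD, pX]
  have cP₁' : ContDiff ℝ ∞ fun x : Cover d => P₁ x.2 := cP₁.comp contDiff_snd
  have cP' : ContDiff ℝ ∞ fun x : Cover d => P x.2 := cP.comp contDiff_snd
  -- the map `(φ, r) ↦ (Φ, r)`, cut off far away so as to be invertible everywhere; `Z` is its inverse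
  have cQ : ContDiff ℝ ∞ fun x : Cover d => P₁ x.2 • D x := cP₁'.smul cD
  have sQ : ∀ x, ‖fderiv ℝ (fun x : Cover d => P₁ x.2 • D x) x‖ ≤ 1 / 2 := fun x => by
    by_cases hx : ‖x.2‖ ≤ R + 3
    · have h := ((cP₁'.differentiable (by simp) x).hasFDerivAt.smul
        (cD.differentiable (by simp) x).hasFDerivAt).fderiv
      have h' : fderiv ℝ (fun x : Cover d => P₁ x.2 • D x) x = _ := h
      rw [h']
      refine ContinuousLinearMap.opNorm_le_bound _ (by norm_num) fun v => ?_
      have e1 : ‖fderiv ℝ D x v‖ ≤ η * ‖v‖ := ContinuousLinearMap.le_of_opNorm_le _ (hclose x hx).2 v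
      have e2 : ‖fderiv ℝ (fun y : Cover d => P₁ y.2) x v‖ ≤ M * ‖v‖ :=
        ContinuousLinearMap.le_of_opNorm_le _ (hM₁ x) v
      have e3 : ‖D x‖ ≤ η := (hclose x hx).1
      calc _ ≤ ‖P₁ x.2 • fderiv ℝ D x v‖ + ‖fderiv ℝ (fun y : Cover d => P₁ y.2) x v • D x‖ := by
            simpa using norm_add_le _ _
        _ ≤ 1 * (η * ‖v‖) + (M * ‖v‖) * η := by
            rw [norm_smul, norm_smul]
            gcongr
            exact P₁le _
        _ = η * (1 + M) * ‖v‖ := by ring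
        _ ≤ η * K * ‖v‖ := by
            gcongr
            have : 0 ≤ 2 * (R + 2) * M := by positivity
            linarith
        _ = _ := by rw [hηK]
    · have : (fun x : Cover d => P₁ x.2 • D x) =ᶠ[𝓝 x] fun _ => 0 := by
        have : ∀ᶠ y : Cover d in 𝓝 x, R + 3 < ‖y.2‖ :=
          (isOpen_lt continuous_const continuous_snd.norm).mem_nhds (not_le.1 hx)
        filter_upwards [this] with y hy
        rw [P₁zero _ hy.le, zero_smul]
      rw [this.fderiv_eq]; simp
  have cY : ContDiff ℝ ∞ fun y : Cover d => projAngle d (P₁ y.2 • D y) :=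
    (projAngle d).contDiff.comp cQ
  obtain ⟨Z, cZ, lZ, rZ, sZ⟩ := exists_inverse_id_add cY
    fun x => norm_fderiv_clm_comp_le cQ norm_projAngle_le (sQ x)
  have hZ : ∀ x, x = Z x + projAngle d (P₁ (Z x).2 • D (Z x)) := fun x => (rZ x).symm
  have hZ2 : ∀ x, (Z x).2 = x.2 := fun x => by
    conv_rhs => rw [hZ x]
    simp [projAngle_apply]
  have r4Z : ∀ x, r4 hd (Z x) = r4 hd x := fun x => by simp only [r4, hZ2]
  have pZ : ∀ (m : Fin d → ℤ) (x : Cover d),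
      Z (x.1 + intVec m, x.2) = ((Z x).1 + intVec m, (Z x).2) := fun m x => by
    rw [← lZ ((Z x).1 + intVec m, (Z x).2)]
    congr 1
    simp only [pD]
    conv_lhs => rw [hZ x]
    simp [projAngle_apply, add_right_comm]
  -- the generating function as a function of `(Φ, r)`
  set σ' : Cover d → ℝ := fun x => σ (Z x) with hσ'
  have cσ' : ContDiff ℝ ∞ σ' := cσ.comp cZ
  have eσ' : ∀ x : Cover d, ‖x.2‖ < R + 2 → ∀ v,
      fderiv ℝ σ' x v = inner ℝ (-D (Z x)).1 v.2 - inner ℝ (-D (Z x)).2 v.1 := fun x hx v => by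
    set ξ := fderiv ℝ Z x v
    have hev : (fun y : Cover d => y + projAngle d (P₁ y.2 • D y)) =ᶠ[𝓝 (Z x)]
        fun y => y + projAngle d (D y) := by
      have : ∀ᶠ y : Cover d in 𝓝 (Z x), ‖y.2‖ < R + 2 :=
        (isOpen_lt continuous_snd.norm continuous_const).mem_nhds (by simpa [hZ2] using hx)
      filter_upwards [this] with y hy
      rw [P₁one _ hy.le, one_smul]
    have h1 : ξ + projAngle d (fderiv ℝ D (Z x) ξ) = v := by
      rw [← fderiv_comp_clm_add cD, ← hev.fderiv_eq]
      exact fderiv_leftInverse cZ (contDiff_id.add cY) rZ x v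
    have h2 : fderiv ℝ σ' x v = fderiv ℝ σ (Z x) ξ := fderiv_comp_apply' cσ cZ x v
    rw [h2, eσ, ← h1]
    change inner ℝ (D (Z x)).2 (ξ.1 + (fderiv ℝ D (Z x) ξ).1) - inner ℝ (D (Z x)).1 ξ.2 = _
    simp only [projAngle_apply, Prod.fst_add, Prod.snd_add, Prod.fst_neg, Prod.snd_neg,
      inner_neg_left, add_zero]
    ring
  have zσ' : ∀ x, r4 hd x = 0 → FlatAt σ' x := fun x hx =>
    FlatAt.comp (f := Z) (flatAlong_iff.1 fσ _ (by rw [r4Z, hx])) cσ cZ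
  have bD : ∀ x : Cover d, ‖x.2‖ ≤ R + 3 → ‖D (Z x)‖ ≤ η := fun x hx =>
    (hclose (Z x) (by rwa [hZ2])).1
  have dσ' : ∀ x : Cover d, ‖x.2‖ < R + 2 → ‖fderiv ℝ σ' x‖ ≤ 2 * η := fun x hx => by
    refine ContinuousLinearMap.opNorm_le_bound _ (by positivity) fun v => ?_
    rw [eσ' x hx, Real.norm_eq_abs]
    refine (abs_symplectic_le _ v).trans ?_
    rw [norm_neg]
    gcongr
    exact bD x (by linarith)
  -- integrate the bound for the derivative from `r = 0`, where `σ'` vanishes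
  have bσ' : ∀ x : Cover d, ‖x.2‖ < R + 2 → |σ' x| ≤ 2 * η * (R + 2) := fun x hx => by
    have hconv : Convex ℝ {y : Cover d | ‖y.2‖ < R + 2} := by
      have : {y : Cover d | ‖y.2‖ < R + 2} =
          (ContinuousLinearMap.snd ℝ (Act d) (Act d)) ⁻¹' Metric.ball 0 (R + 2) := by
        ext y; simp
      rw [this]
      exact (convex_ball _ _).is_linear_preimage (ContinuousLinearMap.isBoundedLinearMap _).toIsLinearMap
    have h0 : σ' (x.1, 0) = 0 := (zσ' (x.1, 0) (by simp [r4])).apply_eq_zero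
    have := hconv.norm_image_sub_le_of_norm_fderiv_le (𝕜 := ℝ) (f := σ')
      (fun y _ => cσ'.differentiable (by simp) y) (fun y hy => dσ' y hy)
      (x := ((x.1, 0) : Cover d)) (y := x) (by
        change ‖(0 : Act d)‖ < R + 2
        rw [norm_zero]; linarith) hx
    rw [h0, sub_zero, Real.norm_eq_abs] at this
    refine this.trans ?_
    gcongr
    have : ‖x - (x.1, 0)‖ = ‖x.2‖ := by simp [Prod.norm_def]
    rw [this]; exact hx.le
  set J : Cover d → Cover d := fun z => hamJ (fderiv ℝ (fun y : Cover d => P y.2) z) with hJ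
  have cJ : ContDiff ℝ ∞ J := contDiff_hamJ_fderiv cP'
  have J2 : ∀ x, (J x).2 = 0 := fun x => by
    have : HasFDerivAt (fun y : Cover d => P y.2)
        ((fderiv ℝ P x.2).comp (ContinuousLinearMap.snd ℝ _ _)) x :=
      HasFDerivAt.comp x (cP.differentiable (by simp) _).hasFDerivAt hasFDerivAt_snd
    ext i
    rw [hJ, hamJ_snd, this.fderiv]; simp
  have cDZ : ContDiff ℝ ∞ fun x => D (Z x) := cD.comp cZ
  -- the Hamiltonian vector field of the cut-off generating function `P σ'`
  set N : Cover d → Cover d := fun x => σ' x • J x - P x.2 • D (Z x) with hN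
  have cN : ContDiff ℝ ∞ N := (cσ'.smul cJ).sub (cP'.smul cDZ)
  have pJ : ∀ (m : Fin d → ℤ) (x : Cover d), J (x.1 + intVec m, x.2) = J x := fun m x => by
    have h : ∀ y : Cover d, fderiv ℝ (fun y : Cover d => P y.2) y =
        (fderiv ℝ P y.2).comp (ContinuousLinearMap.snd ℝ _ _) := fun y =>
      (HasFDerivAt.comp y (f := Prod.snd) (cP.differentiable (by simp) _).hasFDerivAt
        hasFDerivAt_snd).fderiv
    simp only [hJ, h]
  have Jzero : ∀ x : Cover d, R + 1 < ‖x.2‖ → J x = 0 := fun x hx => by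
    have : (fun y : Cover d => P y.2) =ᶠ[𝓝 x] fun _ => 0 := by
      have : ∀ᶠ y : Cover d in 𝓝 x, R + 1 < ‖y.2‖ :=
        (isOpen_lt continuous_const continuous_snd.norm).mem_nhds hx
      filter_upwards [this] with y hy using Pzero _ hy.le
    simp only [hJ, this.fderiv_eq]; simp
  have sN : ∀ x, ‖fderiv ℝ N x‖ ≤ 1 / 2 := fun x => by
    by_cases hx : ‖x.2‖ ≤ R + 1
    · have h : fderiv ℝ N x = _ := (((cσ'.differentiable (by simp) x).hasFDerivAt.smul
        (cJ.differentiable (by simp) x).hasFDerivAt).sub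
        ((cP'.differentiable (by simp) x).hasFDerivAt.smul
          (cDZ.differentiable (by simp) x).hasFDerivAt)).fderiv
      rw [h]
      refine ContinuousLinearMap.opNorm_le_bound _ (by norm_num) fun v => ?_
      have e1 : ‖fderiv ℝ (fun x => D (Z x)) x v‖ ≤ η * (2 * ‖v‖) := by
        rw [fderiv_comp_apply' cD cZ]
        refine (ContinuousLinearMap.le_of_opNorm_le _
          (hclose (Z x) (by rw [hZ2]; linarith)).2 _).trans ?_
        gcongr
        exact ContinuousLinearMap.le_of_opNorm_le _ (sZ x) v
      have e2 : ‖fderiv ℝ (fun y : Cover d => P y.2) x v‖ ≤ M * ‖v‖ :=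
        ContinuousLinearMap.le_of_opNorm_le _ (hM₂ x) v
      have e3 : ‖D (Z x)‖ ≤ η := bD x (by linarith)
      have e4 : ‖fderiv ℝ J x v‖ ≤ M * ‖v‖ := ContinuousLinearMap.le_of_opNorm_le _ (hM₄ x) v
      have e5 : ‖J x‖ ≤ M := hM₃ x
      have e6 : ‖σ' x‖ ≤ 2 * η * (R + 2) := bσ' x (by linarith)
      have e7 : ‖fderiv ℝ σ' x v‖ ≤ 2 * η * ‖v‖ :=
        ContinuousLinearMap.le_of_opNorm_le _ (dσ' x (by linarith)) v
      have e8 : ‖P x.2‖ ≤ 1 := Ple _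
      calc _ ≤ (‖σ' x • fderiv ℝ J x v‖ + ‖fderiv ℝ σ' x v • J x‖) +
              (‖P x.2 • fderiv ℝ (fun x => D (Z x)) x v‖ +
                ‖fderiv ℝ (fun y : Cover d => P y.2) x v • D (Z x)‖) := by
            have := (norm_sub_le (σ' x • fderiv ℝ J x v + fderiv ℝ σ' x v • J x)
              (P x.2 • fderiv ℝ (fun x => D (Z x)) x v +
                fderiv ℝ (fun y : Cover d => P y.2) x v • D (Z x))).trans
              (add_le_add (norm_add_le _ _) (norm_add_le _ _))
            simpa using this
        _ ≤ ((2 * η * (R + 2)) * (M * ‖v‖) + (2 * η * ‖v‖) * M) +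
              (1 * (η * (2 * ‖v‖)) + (M * ‖v‖) * η) := by
            simp only [norm_smul]
            gcongr
        _ = η * K * ‖v‖ := by simp only [K]; ring
        _ = _ := by rw [hηK]
    · have : N =ᶠ[𝓝 x] fun _ => 0 := by
        have : ∀ᶠ y : Cover d in 𝓝 x, R + 1 < ‖y.2‖ :=
          (isOpen_lt continuous_const continuous_snd.norm).mem_nhds (not_le.1 hx)
        filter_upwards [this] with y hy
        simp only [hN]
        rw [Pzero _ hy.le, zero_smul, Jzero y hy, smul_zero, sub_zero]
      rw [this.fderiv_eq]; simp
  have cτ : ContDiff ℝ ∞ fun x => P x.2 * σ' x := cP'.mul cσ'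
  have r4D : ∀ x, r4 hd (D x) = 0 := fun x => by
    have := r4X x
    simp only [r4] at this
    simp [r4, hD, this]
  obtain ⟨X', hX', eX'⟩ := exists_diffeo_of_generating (hd := hd) (τ := fun x => P x.2 * σ' x)
    (N := N) cτ (fun m x => by simp only [hσ', pZ]; rw [pσ m (Z x)]) cN
    (fun m x => by simp only [hN, hσ', pZ, pJ, pD]; rw [pσ m (Z x)]) (fun x v => by
      have h : fderiv ℝ (fun x => P x.2 * σ' x) x = _ :=
        ((cP'.differentiable (by simp) x).hasFDerivAt.mul
          (cσ'.differentiable (by simp) x).hasFDerivAt).fderiv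
      rw [h]
      have h1 := apply_eq_hamJ (fderiv ℝ (fun y : Cover d => P y.2) x) v
      have h2 : P x.2 * fderiv ℝ σ' x v =
          P x.2 * (inner ℝ (-D (Z x)).1 v.2 - inner ℝ (-D (Z x)).2 v.1) := by
        by_cases hx : ‖x.2‖ < R + 2
        · rw [eσ' x hx]
        · rw [Pzero _ (by linarith)]; simp
      have h3 : (J x).1 = (hamJ (fderiv ℝ (fun y : Cover d => P y.2) x)).1 := rfl
      have h4 : (J x).2 = (hamJ (fderiv ℝ (fun y : Cover d => P y.2) x)).2 := rfl
      simp only [_root_.add_apply, _root_.smul_apply, smul_eq_mul, h2, h1,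
        hN, Prod.fst_sub, Prod.snd_sub, Prod.smul_fst, Prod.smul_snd, inner_sub_left,
        real_inner_smul_left, Prod.fst_neg, Prod.snd_neg, inner_neg_left, h3, h4]
      ring) sN (by
      rw [flatAlong_iff] at *
      intro x hx
      exact ((zσ' x hx).smul_left cσ' cJ).sub ((FlatAt.comp (f := Z) (fX _ (by rw [r4Z, hx]))
        cD cZ).smul_right cP' cDZ) (cσ'.smul cJ) (cP'.smul cDZ)) (fun x => by
      have h1 := r4D (Z x)
      simp only [r4] at h1
      simp [hN, r4, J2, h1])
  refine ⟨X', hX', ⟨η, fun x => ?_⟩, fun x hx => ?_⟩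
  · obtain ⟨V, -, -, rV, -⟩ := exists_inverse_id_add ((projAngle d).contDiff.comp cN)
      fun x => norm_fderiv_clm_comp_le cN norm_projAngle_le (sN x)
    have h := rV x
    have e : x = ((V x).1 + (N (V x)).1, (V x).2) := by
      conv_lhs => rw [← h]
      ext <;> simp [projAngle_apply]
    rw [e, eX']
    simp only [hN, Prod.snd_sub, Prod.smul_snd, J2, smul_zero, zero_sub, sub_neg_eq_add,
      add_sub_cancel_left, norm_smul]
    by_cases hx : ‖(V x).2‖ ≤ R + 3
    · calc _ ≤ 1 * η := by
            gcongr
            · exact Ple _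
            · exact (norm_snd_le _).trans (bD _ hx)
        _ = η := one_mul η
    · rw [Pzero _ (by linarith)]; simpa using hη0.le
  -- where `P = P₁ = 1`, the cut-off generating function agrees with that of `X`
  · set q : Cover d := x + projAngle d (P₁ x.2 • D x) with hq
    have hZq : Z q = x := lZ x
    have hq2 : q.2 = x.2 := by simp [hq, projAngle_apply]
    have hNq : N q = -D x := by
      have hJq : J q = 0 := by
        have : (fun y : Cover d => P y.2) =ᶠ[𝓝 q] fun _ => 1 := by
          have : ∀ᶠ y : Cover d in 𝓝 q, ‖y.2‖ < R :=
            (isOpen_lt continuous_snd.norm continuous_const).mem_nhds (by simpa [hq2] using hx)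
          filter_upwards [this] with y hy using Pone _ hy.le
        simp only [hJ, this.fderiv_eq]; simp
      simp only [hN]
      rw [hJq, hZq, hq2, Pone _ hx.le]; simp
    have h := eX' q
    have e : ((q.1 + (N q).1, q.2) : Cover d) = x := by
      rw [hNq]
      ext <;> simp [hq, projAngle_apply, P₁one _ (by linarith : ‖x.2‖ ≤ R + 2)]
    rw [e, hNq] at h
    rw [h]
    ext <;> simp [hq, projAngle_apply, P₁one _ (by linarith : ‖x.2‖ ≤ R + 2), hD]

end CutOffMain

/-! ### The Alexander isotopy -/

section Alexander

variable {d : ℕ} {hd : 4 ≤ d}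

variable (d) in
/-- The fundamental domain `{φ ∈ [0,1]^d, ‖r‖ ≤ ρ}` of a neighborhood of the zero section. -/
def box (ρ : ℝ) : Set (Cover d) := {x | (∀ i, x.1 i ∈ Set.Icc (0 : ℝ) 1) ∧ ‖x.2‖ ≤ ρ}

theorem isCompact_box (ρ : ℝ) : IsCompact (box d ρ) := by
  refine Metric.isCompact_of_isClosed_isBounded ?_ ?_
  · have : box d ρ = (⋂ i, {x : Cover d | x.1 i ∈ Set.Icc (0 : ℝ) 1}) ∩ {x | ‖x.2‖ ≤ ρ} := by
      ext x; simp [box]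
    rw [this]
    refine IsClosed.inter (isClosed_iInter fun i => ?_)
      (isClosed_le continuous_snd.norm continuous_const)
    exact isClosed_Icc.preimage
      ((EuclideanSpace.proj i : Act d →L[ℝ] ℝ).continuous.comp continuous_fst)
  · refine (Metric.isBounded_closedBall (x := (0 : Cover d)) (r := max (√d) ρ)).subset fun x hx => ?_
    rw [mem_closedBall_zero_iff, Prod.norm_def]
    refine max_le_max ?_ hx.2
    rw [EuclideanSpace.norm_eq]
    refine Real.sqrt_le_sqrt ?_
    calc ∑ i, ‖x.1 i‖ ^ 2 ≤ ∑ _i : Fin d, (1 : ℝ) := Finset.sum_le_sum fun i _ => by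
          have := hx.1 i
          rw [Real.norm_eq_abs, sq_abs]
          nlinarith [this.1, this.2]
      _ = d := by simp

theorem exists_mem_box {ρ : ℝ} (x : Cover d) (hx : ‖x.2‖ ≤ ρ) :
    ∃ (m : Fin d → ℤ) (y : Cover d), y ∈ box d ρ ∧ x = (y.1 + intVec m, y.2) := by
  refine ⟨fun i => ⌊x.1 i⌋, (x.1 - intVec fun i => ⌊x.1 i⌋, x.2), ⟨fun i => ?_, hx⟩, by simp⟩
  have h1 := Int.floor_le (x.1 i)
  have h2 := Int.lt_floor_add_one (x.1 i)
  simp only [intVec, PiLp.sub_apply, Set.mem_Icc]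
  constructor <;> linarith

/-- Scaling of the actions. -/
noncomputable def scaleL (a : ℝ) : Cover d →L[ℝ] Cover d :=
  (ContinuousLinearMap.fst ℝ _ _).prod (a • ContinuousLinearMap.snd ℝ _ _)

theorem scaleL_apply (a : ℝ) (x : Cover d) : scaleL a x = (x.1, a • x.2) := rfl

theorem norm_scaleL_apply_le {a : ℝ} (h0 : 0 ≤ a) (h : a ≤ 1) (x : Cover d) :
    ‖scaleL a x‖ ≤ ‖x‖ := by
  rw [scaleL_apply, Prod.norm_def, Prod.norm_def]
  refine max_le_max le_rfl ?_
  dsimp only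
  rw [norm_smul, Real.norm_of_nonneg h0]
  exact mul_le_of_le_one_left (norm_nonneg _) h

theorem norm_scaleL_apply_le' {a : ℝ} (h : 1 ≤ a) (x : Cover d) : ‖scaleL a x‖ ≤ a * ‖x‖ := by
  rw [scaleL_apply, Prod.norm_def, Prod.norm_def, mul_max_of_nonneg _ _ (by linarith)]
  refine max_le_max (le_mul_of_one_le_left (norm_nonneg _) h) ?_
  dsimp only
  rw [norm_smul, Real.norm_of_nonneg (by linarith)]

/-- The conjugate of `U` by the scaling `r ↦ e^s r` of the actions: as `s → -∞` it tends to the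
identity, since `U` is tangent to the identity along `r = 0`. -/
noncomputable def alexander (U : Cover d → Cover d) (s : ℝ) (x : Cover d) : Cover d :=
  scaleL (Real.exp (-s)) (U (scaleL (Real.exp s) x))

theorem scaleL_exp_neg (s : ℝ) (x : Cover d) :
    scaleL (Real.exp (-s)) (scaleL (Real.exp s) x) = x := by
  simp [scaleL_apply, smul_smul, ← Real.exp_add]

theorem scaleL_exp_neg' (s : ℝ) (x : Cover d) :
    scaleL (Real.exp s) (scaleL (Real.exp (-s)) x) = x := by
  simp [scaleL_apply, smul_smul, ← Real.exp_add]

theorem alexander_zero (U : Cover d → Cover d) : alexander U 0 = U := by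
  funext x; simp [alexander, scaleL_apply]

theorem contDiff_alexander_joint {U : Cover d → Cover d} (hU : ContDiff ℝ ∞ U) :
    ContDiff ℝ ∞ fun q : ℝ × Cover d => alexander U q.1 q.2 := by
  have h1 : ContDiff ℝ ∞ fun q : ℝ × Cover d => U (scaleL (Real.exp q.1) q.2) :=
    hU.comp ((contDiff_fst.comp contDiff_snd).prodMk
      ((Real.contDiff_exp.comp contDiff_fst).smul (contDiff_snd.comp contDiff_snd)))
  exact h1.fst.prodMk ((Real.contDiff_exp.comp contDiff_fst.neg).smul h1.snd)

theorem contDiff_alexander {U : Cover d → Cover d} (hU : ContDiff ℝ ∞ U) (s : ℝ) :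
    ContDiff ℝ ∞ (alexander U s) :=
  (contDiff_alexander_joint hU).comp (contDiff_const.prodMk contDiff_id)

theorem alexander_leftInverse {U W : Cover d → Cover d} (h : Function.LeftInverse W U) (s : ℝ) :
    Function.LeftInverse (alexander W s) (alexander U s) := fun x => by
  simp only [alexander]
  rw [scaleL_exp_neg', h, scaleL_exp_neg]

theorem isFlatExactDiffeo_alexander {U : Cover d → Cover d} (hU : IsFlatExactDiffeo hd U) (s : ℝ) :
    IsFlatExactDiffeo hd (alexander U s) := by
  obtain ⟨cU, ⟨W, cW, lW, rW⟩, pU, ⟨S, cS, pS, eS⟩, r4U, fU⟩ := hU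
  refine ⟨contDiff_alexander cU s, ⟨alexander W s, contDiff_alexander cW s,
    alexander_leftInverse lW s, alexander_leftInverse rW s⟩, fun m x => ?_,
    ⟨fun x => Real.exp (-s) * S (scaleL (Real.exp s) x),
      contDiff_const.mul (cS.comp (scaleL _).contDiff), fun m x => ?_, fun x v => ?_⟩,
    fun x => ?_, ?_⟩
  · have := pU m (scaleL (Real.exp s) x)
    simp only [alexander, scaleL_apply] at *
    rw [this]
  · have := pS m (scaleL (Real.exp s) x)
    simp only [scaleL_apply] at *
    rw [this]
  · have h1 : fderiv ℝ (alexander U s) x v =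
        scaleL (Real.exp (-s)) (fderiv ℝ U (scaleL (Real.exp s) x) (scaleL (Real.exp s) v)) := by
      have e : alexander U s = fun x => (scaleL (Real.exp (-s)) : Cover d →L[ℝ] Cover d)
        (U ((scaleL (Real.exp s) : Cover d →L[ℝ] Cover d) x)) := rfl
      have c1 : ContDiff ℝ ∞ fun x => U ((scaleL (Real.exp s) : Cover d →L[ℝ] Cover d) x) :=
        cU.comp (scaleL _).contDiff
      rw [e, fderiv_comp_apply' (scaleL (Real.exp (-s))).contDiff c1,
        fderiv_comp_apply' cU (scaleL _).contDiff]
      simp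
    have h2 : fderiv ℝ (fun x => Real.exp (-s) * S (scaleL (Real.exp s) x)) x v =
        Real.exp (-s) * fderiv ℝ S (scaleL (Real.exp s) x) (scaleL (Real.exp s) v) := by
      have h3 := ((cS.comp (scaleL (Real.exp s)).contDiff).differentiable (by simp)
        x).hasFDerivAt.const_mul (Real.exp (-s))
      have h4 := fderiv_comp_apply' cS (scaleL (Real.exp s)).contDiff x v
      have h5 : fderiv ℝ (fun x => Real.exp (-s) * S (scaleL (Real.exp s) x)) x = _ := h3.fderiv
      rw [h5]
      have h6 : fderiv ℝ (S ∘ scaleL (Real.exp s)) x v = _ := h4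
      simp [h6]
    rw [h1, h2, ← eS]
    have e1 : Real.exp (-s) * Real.exp s = 1 := by rw [← Real.exp_add]; simp
    simp only [alexander, scaleL_apply, real_inner_smul_left]
    linear_combination (inner ℝ x.2 v.1 : ℝ) * e1
  · have h : ∀ (a : ℝ) (y : Cover d), r4 hd (scaleL a y) = a * r4 hd y := fun a y => by
      simp [scaleL_apply, r4]
    simp only [alexander, h, r4U]
    rw [← mul_assoc, ← Real.exp_add]; simp
  · rw [flatAlong_iff] at *
    intro x hx
    have h1 := (FlatAt.comp (f := scaleL (Real.exp s)) (x := x)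
      (fU (scaleL (Real.exp s) x) (by simp [scaleL_apply, r4] at *; exact hx))
      (cU.sub contDiff_id) (scaleL _).contDiff).clm_apply (scaleL (Real.exp (-s)))
      ((cU.sub contDiff_id).comp (scaleL _).contDiff)
    refine h1.congr (Eventually.of_forall fun y => ?_)
    simp only [map_sub, scaleL_exp_neg]
    rfl

theorem fderiv_periodic {F : Type*} [NormedAddCommGroup F] [NormedSpace ℝ F] {G : Cover d → F}
    (pG : ∀ (m : Fin d → ℤ) (x : Cover d), G (x.1 + intVec m, x.2) = G x)
    (m : Fin d → ℤ) (x : Cover d) : fderiv ℝ G (x.1 + intVec m, x.2) = fderiv ℝ G x := by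
  have e : (fun y : Cover d => G (y + ((intVec m, 0) : Cover d))) = G := funext fun y => by
    rw [← pG m y]; congr 1; ext <;> simp
  have e2 : ((x.1 + intVec m, x.2) : Cover d) = x + ((intVec m, 0) : Cover d) := by
    ext <;> simp
  conv_rhs => rw [← e]
  rw [e2, fderiv_comp_add_right]

/-- A smooth flat periodic map is `o(‖r‖)` on `{‖r‖ ≤ ρ}`, uniformly. -/
theorem exists_norm_le_of_flat {F : Type*} [NormedAddCommGroup F] [NormedSpace ℝ F]
    {G : Cover d → F} (cG : ContDiff ℝ ∞ G)
    (pG : ∀ (m : Fin d → ℤ) (x : Cover d), G (x.1 + intVec m, x.2) = G x) (fG : FlatAlong hd G)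
    {κ : ℝ} (hκ : 0 < κ) : ∃ δ > 0, ∀ x : Cover d, ‖x.2‖ ≤ δ → ‖G x‖ ≤ κ * ‖x.2‖ := by
  have cG' : ContDiff ℝ ∞ (fderiv ℝ G) := cG.fderiv_right (mod_cast le_top)
  have pG' := fderiv_periodic pG
  have hz : ∀ y : Cover d, y.2 = 0 → FlatAt G y := fun y hy =>
    flatAlong_iff.1 fG y (by simp [r4, hy])
  obtain ⟨δ, hδ, h⟩ : ∃ δ > 0, ∀ x : Cover d, ‖x.2‖ ≤ δ → ‖fderiv ℝ G x‖ ≤ κ := by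
    by_contra! hcon
    -- points of the fundamental domain where the derivative is large, converging to `r = 0`
    have : ∀ n : ℕ, ∃ y ∈ box d 1, ‖y.2‖ ≤ 1 / ((n : ℝ) + 1) ∧ κ < ‖fderiv ℝ G y‖ := fun n => by
      obtain ⟨x, hx, hx2⟩ := hcon (1 / ((n : ℝ) + 1)) (by positivity)
      obtain ⟨m, y, hy, rfl⟩ := exists_mem_box (ρ := 1) x (hx.trans (by
        rw [div_le_one (by positivity)]; linarith [(Nat.cast_nonneg n : (0 : ℝ) ≤ n)]))
      exact ⟨y, hy, hx, by rwa [pG' m y] at hx2⟩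
    choose y hy hy1 hy2 using this
    obtain ⟨a, -, φ, hφ, hlim⟩ := (isCompact_box (d := d) 1).tendsto_subseq hy
    have ha : a.2 = 0 := by
      have h1 : Tendsto (fun n => ‖(y (φ n)).2‖) atTop (𝓝 ‖a.2‖) :=
        ((continuous_snd.tendsto a).comp hlim).norm
      have h2 : Tendsto (fun n => ‖(y (φ n)).2‖) atTop (𝓝 0) :=
        squeeze_zero (fun _ => norm_nonneg _) (fun n => hy1 (φ n))
          (tendsto_one_div_add_atTop_nhds_zero_nat.comp hφ.tendsto_atTop)
      exact norm_eq_zero.1 (tendsto_nhds_unique h1 h2)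
    have h1 : Tendsto (fun n => ‖fderiv ℝ G (y (φ n))‖) atTop (𝓝 ‖fderiv ℝ G a‖) :=
      ((cG'.continuous.tendsto a).comp hlim).norm
    rw [(hz a ha).flatAt_fderiv.apply_eq_zero, norm_zero] at h1
    exact absurd (ge_of_tendsto' h1 fun n => (hy2 (φ n)).le) (not_le.2 hκ)
  refine ⟨δ, hδ, fun x hx => ?_⟩
  have hconv : Convex ℝ {y : Cover d | ‖y.2‖ ≤ δ} := by
    have : {y : Cover d | ‖y.2‖ ≤ δ} =
        (ContinuousLinearMap.snd ℝ (Act d) (Act d)) ⁻¹' Metric.closedBall 0 δ := by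
      ext y; simp
    rw [this]
    exact (convex_closedBall _ _).is_linear_preimage
      (ContinuousLinearMap.isBoundedLinearMap _).toIsLinearMap
  have := hconv.norm_image_sub_le_of_norm_fderiv_le (𝕜 := ℝ) (f := G)
    (fun y _ => cG.differentiable (by simp) y) (fun y hy => h y hy)
    (x := ((x.1, 0) : Cover d)) (y := x) (by
      change ‖(0 : Act d)‖ ≤ δ
      rw [norm_zero]; exact hδ.le) hx
  rw [(hz (x.1, 0) rfl).apply_eq_zero, sub_zero] at this
  have e : ‖x - (x.1, 0)‖ = ‖x.2‖ := by simp [Prod.norm_def]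
  rwa [e] at this

theorem shift_periodic {U : Cover d → Cover d} (hU : IsFlatExactDiffeo hd U) (m : Fin d → ℤ)
    (x : Cover d) : U (x.1 + intVec m, x.2) - (x.1 + intVec m, x.2) = U x - x := by
  rw [hU.2.2.1]
  ext <;> simp

theorem fderiv_alexander_sub {U : Cover d → Cover d} (cU : ContDiff ℝ ∞ U) (s : ℝ) (x v : Cover d) :
    fderiv ℝ (fun y => alexander U s y - y) x v = scaleL (Real.exp (-s))
      (fderiv ℝ (fun y => U y - y) (scaleL (Real.exp s) x) (scaleL (Real.exp s) v)) := by
  have e : (fun y => alexander U s y - y) = fun y =>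
      (scaleL (Real.exp (-s)) : Cover d →L[ℝ] Cover d)
        ((fun z => U z - z) ((scaleL (Real.exp s) : Cover d →L[ℝ] Cover d) y)) := by
    funext y
    simp only [map_sub, scaleL_exp_neg]
    rfl
  have cD : ContDiff ℝ ∞ fun z => U z - z := cU.sub contDiff_id
  have c1 : ContDiff ℝ ∞ fun y => (fun z => U z - z)
      ((scaleL (Real.exp s) : Cover d →L[ℝ] Cover d) y) := cD.comp (scaleL _).contDiff
  rw [e, fderiv_comp_apply' (scaleL (Real.exp (-s))).contDiff c1,
    fderiv_comp_apply' cD (scaleL _).contDiff]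
  simp

/-- For `s → -∞` the Alexander isotopy is `C^1`-close to the identity on `{‖r‖ ≤ ρ}`. -/
theorem exists_alexander_close {U : Cover d → Cover d} (hU : IsFlatExactDiffeo hd U) (ρ : ℝ)
    {η : ℝ} (hη : 0 < η) : ∃ s₀ < 0, ∀ x : Cover d, ‖x.2‖ ≤ ρ →
      ‖alexander U s₀ x - x‖ ≤ η ∧ ‖fderiv ℝ (fun y => alexander U s₀ y - y) x‖ ≤ η := by
  have cU := hU.1
  have fU := hU.2.2.2.2.2
  have cD : ContDiff ℝ ∞ fun z => U z - z := cU.sub contDiff_id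
  have pD := shift_periodic hU
  have fD' : FlatAlong hd (fderiv ℝ fun z => U z - z) :=
    flatAlong_iff.2 fun x hx => (flatAlong_iff.1 fU x hx).flatAt_fderiv
  set κ := η / (|ρ| + 1) with hκdef
  have hκ : 0 < κ := by positivity
  obtain ⟨δ₁, hδ₁, h₁⟩ := exists_norm_le_of_flat cD pD fU hκ
  obtain ⟨δ₂, hδ₂, h₂⟩ := exists_norm_le_of_flat (cD.fderiv_right (m := ∞) (mod_cast le_top))
    (fderiv_periodic pD) fD' hκ
  obtain ⟨s₀, hs₀, hs₁⟩ : ∃ s₀ < 0, Real.exp s₀ * (|ρ| + 1) ≤ min δ₁ δ₂ := by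
    have h : Tendsto (fun s => Real.exp s * (|ρ| + 1)) atBot (𝓝 (0 * (|ρ| + 1))) :=
      Real.tendsto_exp_atBot.mul_const _
    rw [zero_mul] at h
    obtain ⟨s, h1, h2⟩ := ((h.eventually (gt_mem_nhds (lt_min hδ₁ hδ₂))).and
      (eventually_lt_atBot 0)).exists
    exact ⟨s, h2, h1.le⟩
  refine ⟨s₀, hs₀, fun x hx => ?_⟩
  set z := scaleL (Real.exp s₀) x with hz
  have hz2 : ‖z.2‖ = Real.exp s₀ * ‖x.2‖ := by
    rw [hz, scaleL_apply, norm_smul, Real.norm_of_nonneg (Real.exp_pos _).le]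
  have hx' : ‖x.2‖ ≤ |ρ| + 1 := by linarith [le_abs_self ρ]
  have hle : ‖z.2‖ ≤ min δ₁ δ₂ := by
    rw [hz2]; refine le_trans ?_ hs₁; gcongr
  have hexp : 1 ≤ Real.exp (-s₀) := Real.one_le_exp (by linarith)
  have hexp' : Real.exp s₀ ≤ 1 := Real.exp_le_one_iff.2 hs₀.le
  have key : Real.exp (-s₀) * (κ * ‖z.2‖) ≤ η := by
    have e1 : Real.exp (-s₀) * Real.exp s₀ = 1 := by rw [← Real.exp_add]; simp
    calc Real.exp (-s₀) * (κ * ‖z.2‖) = (Real.exp (-s₀) * Real.exp s₀) * (κ * ‖x.2‖) := by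
          rw [hz2]; ring
      _ = κ * ‖x.2‖ := by rw [e1, one_mul]
      _ ≤ κ * (|ρ| + 1) := by gcongr
      _ = η := by rw [hκdef]; field_simp
  constructor
  · have e : alexander U s₀ x - x = scaleL (Real.exp (-s₀)) (U z - z) := by
      rw [map_sub, hz, scaleL_exp_neg]; rfl
    rw [e]
    refine (norm_scaleL_apply_le' hexp _).trans (le_trans ?_ key)
    gcongr
    exact h₁ z (hle.trans (min_le_left _ _))
  · refine ContinuousLinearMap.opNorm_le_bound _ hη.le fun v => ?_
    rw [fderiv_alexander_sub cU]
    refine (norm_scaleL_apply_le' hexp _).trans ?_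
    calc _ ≤ Real.exp (-s₀) * ((κ * ‖z.2‖) * ‖v‖) := by
          gcongr
          refine (ContinuousLinearMap.le_of_opNorm_le _
            (h₂ z (hle.trans (min_le_right _ _))) _).trans ?_
          gcongr
          exact norm_scaleL_apply_le (Real.exp_pos _).le hexp' v
      _ = Real.exp (-s₀) * (κ * ‖z.2‖) * ‖v‖ := by ring
      _ ≤ η * ‖v‖ := by gcongr

/-- The isotopy stays in a bounded region. -/
theorem exists_bound_alexander {U : Cover d → Cover d} (hU : IsFlatExactDiffeo hd U) (R : ℝ)
    (hR : 0 < R) : ∃ R' > R, ∀ s ≤ 0, ∀ x : Cover d, ‖x.2‖ ≤ R → ‖(alexander U s x).2‖ < R' := by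
  have cU := hU.1
  have fU := hU.2.2.2.2.2
  have cD : ContDiff ℝ ∞ fun z => U z - z := cU.sub contDiff_id
  have pD := shift_periodic hU
  obtain ⟨δ, hδ, h⟩ := exists_norm_le_of_flat cD pD fU one_pos
  obtain ⟨C, hC⟩ := (isCompact_box (d := d) R).exists_bound_of_continuousOn cD.continuous.continuousOn
  have hC' : ∀ x : Cover d, ‖x.2‖ ≤ R → ‖U x - x‖ ≤ |C| := fun x hx => by
    obtain ⟨m, y, hy, rfl⟩ := exists_mem_box x hx
    rw [pD]; exact (hC y hy).trans (le_abs_self C)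
  have hlin : ∀ x : Cover d, ‖x.2‖ ≤ R → ‖U x - x‖ ≤ (1 + |C| / δ) * ‖x.2‖ := fun x hx => by
    by_cases h' : ‖x.2‖ ≤ δ
    · refine (h x h').trans ?_
      gcongr
      linarith [div_nonneg (abs_nonneg C) hδ.le]
    · push Not at h'
      calc ‖U x - x‖ ≤ |C| := hC' x hx
        _ = |C| / δ * δ := by field_simp
        _ ≤ (1 + |C| / δ) * ‖x.2‖ := by gcongr; linarith
  refine ⟨R + (1 + |C| / δ) * R + 1, by have : 0 ≤ (1 + |C| / δ) * R := by positivity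
                                        linarith, fun s hs x hx => ?_⟩
  set z := scaleL (Real.exp s) x with hz
  have hz2 : ‖z.2‖ = Real.exp s * ‖x.2‖ := by
    rw [hz, scaleL_apply, norm_smul, Real.norm_of_nonneg (Real.exp_pos _).le]
  have hexp' : Real.exp s ≤ 1 := Real.exp_le_one_iff.2 hs
  have hzR : ‖z.2‖ ≤ R := by
    rw [hz2]; exact (mul_le_of_le_one_left (norm_nonneg _) hexp').trans hx
  have e : (alexander U s x).2 = x.2 + Real.exp (-s) • (U z - z).2 := by
    have : alexander U s x = x + scaleL (Real.exp (-s)) (U z - z) := by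
      rw [map_sub, hz, scaleL_exp_neg]; simp [alexander]
    rw [this]; simp [scaleL_apply]
  rw [e]
  have e1 : Real.exp (-s) * Real.exp s = 1 := by rw [← Real.exp_add]; simp
  calc _ ≤ ‖x.2‖ + ‖Real.exp (-s) • (U z - z).2‖ := norm_add_le _ _
    _ ≤ R + Real.exp (-s) * ((1 + |C| / δ) * (Real.exp s * ‖x.2‖)) := by
        rw [norm_smul, Real.norm_of_nonneg (Real.exp_pos _).le, ← hz2]
        gcongr
        exact (norm_snd_le _).trans (hlin z hzR)
    _ = R + (Real.exp (-s) * Real.exp s) * ((1 + |C| / δ) * ‖x.2‖) := by ring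
    _ ≤ R + (1 + |C| / δ) * R := by rw [e1, one_mul]; gcongr
    _ < _ := by linarith

/-- A jointly smooth family of maps that equals the identity at a parameter value is `C^1`-close
to the identity on a compact set near that value. -/
theorem eventually_close {Ψ : ℝ × Cover d → Cover d} (hΨ : ContDiff ℝ ∞ Ψ) {s₀ : ℝ}
    (h0 : ∀ x, Ψ (s₀, x) = x) {K : Set (Cover d)} (hK : IsCompact K) {η : ℝ} (hη : 0 < η) :
    ∀ᶠ s in 𝓝 s₀, ∀ x ∈ K, ‖Ψ (s, x) - x‖ ≤ η ∧ ‖fderiv ℝ (fun y => Ψ (s, y) - y) x‖ ≤ η := by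
  have cΔ : ContDiff ℝ ∞ fun q : ℝ × Cover d => Ψ q - q.2 := hΨ.sub contDiff_snd
  have c0 := cΔ.continuous
  have c1 : Continuous fun q : ℝ × Cover d => ‖fderiv ℝ (fun y => Ψ (q.1, y) - y) q.2‖ := by
    have := (continuous_iteratedFDeriv_slice cΔ 1).norm
    simpa only [norm_iteratedFDeriv_one] using this
  have z1 : ∀ x, fderiv ℝ (fun y => Ψ (s₀, y) - y) x = 0 := fun x => by
    simp [h0]
  refine hK.eventually_forall_of_forall_eventually fun x _ => ?_
  have e0 : ∀ᶠ q in 𝓝 ((s₀, x) : ℝ × Cover d), ‖Ψ q - q.2‖ < η :=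
    c0.norm.continuousAt.eventually_lt continuousAt_const (by simpa [h0] using hη)
  have e1 : ∀ᶠ q in 𝓝 ((s₀, x) : ℝ × Cover d), ‖fderiv ℝ (fun y => Ψ (q.1, y) - y) q.2‖ < η :=
    c1.continuousAt.eventually_lt continuousAt_const (by simpa [z1] using hη)
  filter_upwards [e0, e1] with q h h' using ⟨h.le, h'.le⟩

theorem Tame.comp {U V : Cover d → Cover d} (hV : Tame V) (hU : Tame U) :
    Tame fun x => V (U x) := by
  obtain ⟨C, hC⟩ := hU
  obtain ⟨C', hC'⟩ := hV
  refine ⟨C' + C, fun x => ?_⟩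
  have : (V (U x)).2 - x.2 = ((V (U x)).2 - (U x).2) + ((U x).2 - x.2) := by abel
  rw [this]
  exact (norm_add_le _ _).trans (add_le_add (hC' _) (hC _))

/-- Every flat exact symplectic diffeomorphism agrees, on any set `{‖r‖ < R}`, with one that moves
the actions by a bounded amount: the set of parameters of the Alexander isotopy for which this
holds is open, closed and not empty. -/
theorem exists_tame_eq {U : Cover d → Cover d} (hU : IsFlatExactDiffeo hd U) (R : ℝ) (hR : 0 < R) :
    ∃ U', IsFlatExactDiffeo hd U' ∧ Tame U' ∧ ∀ x, ‖x.2‖ < R → U' x = U x := by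
  obtain ⟨R', hR', hbd⟩ := exists_bound_alexander hU R hR
  obtain ⟨η, hη, hcut⟩ := exists_tame_of_close (hd := hd) R' (hR.trans hR')
  let P : ℝ → Prop := fun s => ∃ U', IsFlatExactDiffeo hd U' ∧ Tame U' ∧
    ∀ x, ‖x.2‖ < R → U' x = alexander U s x
  obtain ⟨s₀, hs₀, hclose⟩ := exists_alexander_close hU (R' + 3) hη
  have base : P s₀ := by
    obtain ⟨X', h1, h2, h3⟩ := hcut _ (isFlatExactDiffeo_alexander hU s₀) hclose
    exact ⟨X', h1, h2, fun x hx => h3 x (hx.trans hR')⟩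
  obtain ⟨W, cW, lW, rW⟩ := hU.2.1
  have hW := hU.inverse cW lW rW
  -- the transition from parameter `a` to parameter `b`: the correction `U_b ∘ U_a⁻¹` is close to the
  -- identity on the fundamental domain, hence everywhere by periodicity, and can be cut off
  have step : ∀ a b : ℝ, a ≤ 0 → (∀ x ∈ box d (R' + 3),
      ‖alexander U b (alexander W a x) - x‖ ≤ η ∧
        ‖fderiv ℝ (fun y => alexander U b (alexander W a y) - y) x‖ ≤ η) → P a → P b := by
    rintro a b ha hab ⟨U', h1, h2, h3⟩
    have hX := (isFlatExactDiffeo_alexander hU b).comp (isFlatExactDiffeo_alexander hW a)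
    obtain ⟨X', g1, g2, g3⟩ := hcut _ hX fun x hx => by
      obtain ⟨m, y, hy, rfl⟩ := exists_mem_box x hx
      rw [shift_periodic hX, fderiv_periodic (shift_periodic hX)]
      exact hab y hy
    refine ⟨fun x => X' (U' x), g1.comp h1, g2.comp h2, fun x hx => ?_⟩
    change X' (U' x) = _
    rw [h3 x hx, g3 _ (hbd a ha x hx.le), alexander_leftInverse lW a]
  have cU := hU.1
  have main : P 0 := by
    refine (isPreconnected_Iic (a := (0 : ℝ))).induction₂' (fun a b => P a → P b)
      (fun a ha => ?_) (fun a b c _ _ _ h h' hP => h' (h hP)) (Set.mem_Iic.2 hs₀.le) (Set.mem_Iic.2 le_rfl) base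
    have j1 : ContDiff ℝ ∞ fun q : ℝ × Cover d => alexander U q.1 (alexander W a q.2) :=
      (contDiff_alexander_joint cU).comp
        (contDiff_fst.prodMk ((contDiff_alexander cW a).comp contDiff_snd))
    have j2 : ContDiff ℝ ∞ fun q : ℝ × Cover d => alexander U a (alexander W q.1 q.2) :=
      (contDiff_alexander cU a).comp (contDiff_alexander_joint cW)
    have e1 := eventually_close j1 (s₀ := a) (fun x => alexander_leftInverse rW a x)
      (isCompact_box (d := d) (R' + 3)) hη
    have e2 := eventually_close j2 (s₀ := a) (fun x => alexander_leftInverse rW a x)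
      (isCompact_box (d := d) (R' + 3)) hη
    filter_upwards [nhdsWithin_le_nhds e1, nhdsWithin_le_nhds e2, self_mem_nhdsWithin]
      with b h1 h2 hb
    exact ⟨step a b ha h1, step b a hb h2⟩
  obtain ⟨U', h1, h2, h3⟩ := main
  exact ⟨U', h1, h2, fun x hx => by rw [h3 x hx, alexander_zero]⟩

end Alexander

/-! ### Robustness of finite orbit segments -/

section Robust

/-- Grönwall's estimate, forward and backward in time. -/
theorem dist_le_gronwallBound_abs {E : Type*} [NormedAddCommGroup E] [NormedSpace ℝ E]
    {v : E → E} {K : NNReal} (hv : LipschitzWith K v) {γ γ' w : ℝ → E} {T δ η : ℝ}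
    (hγ : ∀ t ∈ Set.Icc (-T) T, HasDerivAt γ (v (γ t)) t)
    (hγ' : ∀ t ∈ Set.Icc (-T) T, HasDerivAt γ' (w t) t)
    (hw : ∀ t ∈ Set.Icc (-T) T, dist (w t) (v (γ' t)) ≤ η) (h0 : dist (γ' 0) (γ 0) ≤ δ) {t : ℝ}
    (ht : t ∈ Set.Icc (-T) T) : dist (γ' t) (γ t) ≤ gronwallBound δ K η |t| := by
  -- the forward estimate; the backward one follows by reversing time
  have fwd : ∀ (v : E → E) (_ : LipschitzWith K v) (γ γ' w : ℝ → E) (t : ℝ)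
      (_ : ∀ s ∈ Set.Icc 0 t, HasDerivAt γ (v (γ s)) s)
      (_ : ∀ s ∈ Set.Icc 0 t, HasDerivAt γ' (w s) s)
      (_ : ∀ s ∈ Set.Icc 0 t, dist (w s) (v (γ' s)) ≤ η) (_ : dist (γ' 0) (γ 0) ≤ δ)
      (_ : 0 ≤ t), dist (γ' t) (γ t) ≤ gronwallBound δ K η t := by
    intro v hv γ γ' w t h1 h2 h3 h4 h5
    have := dist_le_of_approx_trajectories_ODE (v := fun _ => v) (K := K) (f := γ') (g := γ)
      (f' := w) (g' := fun s => v (γ s)) (a := 0) (b := t) (εf := η) (εg := 0) (δ := δ)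
      (fun _ => hv) (fun s hs => (h2 s hs).continuousAt.continuousWithinAt)
      (fun s hs => (h2 s (Set.Ico_subset_Icc_self hs)).hasDerivWithinAt)
      (fun s hs => h3 s (Set.Ico_subset_Icc_self hs))
      (fun s hs => (h1 s hs).continuousAt.continuousWithinAt)
      (fun s hs => (h1 s (Set.Ico_subset_Icc_self hs)).hasDerivWithinAt)
      (fun s hs => by simp) h4 t ⟨h5, le_rfl⟩
    simpa using this
  rcases le_total 0 t with h | h
  · rw [abs_of_nonneg h]
    have hs : ∀ s ∈ Set.Icc 0 t, s ∈ Set.Icc (-T) T := fun s hs =>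
      ⟨by linarith [hs.1, hs.2, ht.2], hs.2.trans ht.2⟩
    exact fwd v hv γ γ' w t (fun s h => hγ s (hs s h)) (fun s h => hγ' s (hs s h))
      (fun s h => hw s (hs s h)) h0 h
  · rw [abs_of_nonpos h]
    have hs : ∀ s ∈ Set.Icc 0 (-t), -s ∈ Set.Icc (-T) T := fun s hs =>
      ⟨by linarith [hs.1, hs.2, ht.1], by linarith [hs.1, hs.2, ht.1]⟩
    have := fwd (fun x => -v x) hv.neg (fun s => γ (-s)) (fun s => γ' (-s)) (fun s => -w (-s)) (-t)
      (fun s h => by simpa [Function.comp_def] using (hγ _ (hs s h)).scomp s (hasDerivAt_neg s))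
      (fun s h => by simpa [Function.comp_def] using (hγ' _ (hs s h)).scomp s (hasDerivAt_neg s))
      (fun s h => by rw [dist_neg_neg]; exact hw _ (hs s h)) (by simpa using h0) (by linarith)
    simpa using this

/-- A bounded Lipschitz vector field has solutions on all compact time intervals. -/
theorem exists_solution_of_lipschitz {E : Type*} [NormedAddCommGroup E] [NormedSpace ℝ E]
    [CompleteSpace E] {v : E → E} {K : NNReal} (hv : LipschitzWith K v) {M : ℝ}
    (hM : ∀ x, ‖v x‖ ≤ M) (T : ℝ) (p : E) :
    ∃ γ : ℝ → E, γ 0 = p ∧ ∀ t ∈ Set.Icc (-T) T, HasDerivAt γ (v (γ t)) t := by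
  have hM0 : 0 ≤ M := (norm_nonneg _).trans (hM p)
  set S := |T| + 1 with hS
  have hS0 : 0 < S := by positivity
  have hpl : IsPicardLindelof (fun _ => v) (tmin := -S) (tmax := S)
      ⟨0, by constructor <;> linarith⟩ p (Real.toNNReal (M * S)) 0 (Real.toNNReal M) K := by
    refine IsPicardLindelof.of_time_independent (fun x _ => ?_) hv.lipschitzOnWith ?_
    · rw [Real.coe_toNNReal _ hM0]; exact hM x
    · rw [Real.coe_toNNReal _ hM0, Real.coe_toNNReal _ (by positivity)]
      simp
  obtain ⟨γ, h0, h⟩ := hpl.exists_eq_forall_mem_Icc_hasDerivWithinAt₀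
  refine ⟨γ, h0, fun t ht => ?_⟩
  have h1 : t ∈ Set.Ioo (-S) S := by
    have := le_abs_self T
    constructor <;> linarith [ht.1, ht.2]
  exact (h t (Set.Ioo_subset_Icc_self h1)).hasDerivAt (Icc_mem_nhds h1.1 h1.2)

theorem gronwallBound_eq_mul (c K x : ℝ) : gronwallBound c K c x = c * gronwallBound 1 K 1 x := by
  unfold gronwallBound
  split_ifs <;> ring

variable {d : ℕ}

/-- `γ` solves Hamilton's equations of `H` on `[-T, T]`. -/
def IsSolOn (H : Cover d → ℝ) (T : ℝ) (γ : ℝ → Cover d) : Prop :=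
  ∀ t ∈ Set.Icc (-T) T, HasDerivAt γ (hamVec H (γ t)) t

theorem IsSolOn.mono {H : Cover d → ℝ} {T T' : ℝ} {γ : ℝ → Cover d} (h : IsSolOn H T γ)
    (hT : T' ≤ T) : IsSolOn H T' γ := fun t ht =>
  h t ⟨by linarith [ht.1], ht.2.trans hT⟩

theorem SmoothHam.hamVec_eq (H : SmoothHam d) (x : Cover d) :
    hamVec H.1 x = hamJ (fderiv ℝ H.1 x) :=
  _root_.hamVec_eq (H.2.1.differentiable (by simp) x)

/-- The Hamiltonian vector field cut off outside a ball. -/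
noncomputable def cutVec (χ : ContDiffBump (0 : Cover d)) (H : Cover d → ℝ) (x : Cover d) : Cover d :=
  χ x • hamJ (fderiv ℝ H x)

theorem cutVec_eq (χ : ContDiffBump (0 : Cover d)) (H : SmoothHam d) {x : Cover d}
    (hx : ‖x‖ ≤ χ.rIn) : cutVec χ H.1 x = hamVec H.1 x := by
  rw [cutVec, χ.one_of_mem_closedBall (by simpa using hx), one_smul, H.hamVec_eq]

theorem exists_lipschitz_cutVec (χ : ContDiffBump (0 : Cover d)) (H : SmoothHam d) :
    ∃ (K : NNReal) (M : ℝ), LipschitzWith K (cutVec χ H.1) ∧ ∀ x, ‖cutVec χ H.1 x‖ ≤ M := by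
  have c : ContDiff ℝ ∞ (cutVec χ H.1) := χ.contDiff.smul (contDiff_hamJ_fderiv H.2.1)
  have s : HasCompactSupport (cutVec χ H.1) := χ.hasCompactSupport.smul_right
  obtain ⟨K, hK⟩ := c.lipschitzWith_of_hasCompactSupport s (by simp)
  obtain ⟨M, hM⟩ := s.exists_bound_of_continuous c.continuous
  exact ⟨K, M, hK, hM⟩

theorem eventually_hamVec_close (H : SmoothHam d) {K : Set (Cover d)} (hK : IsCompact K) {ε : ℝ}
    (hε : 0 < ε) : ∀ᶠ H' in 𝓝 H, ∀ x ∈ K,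
      ‖hamJ (fderiv ℝ H'.1 x) - hamJ (fderiv ℝ H.1 x)‖ ≤ ε := by
  have hC : 0 < ‖(hamJ : (Cover d →L[ℝ] ℝ) →L[ℝ] Cover d)‖ + 1 := by positivity
  filter_upwards [H.eventually_deriv_close 1 hK (div_pos hε hC)] with H' h x hx
  have e : ‖fderiv ℝ H'.1 x - fderiv ℝ H.1 x‖ =
      ‖iteratedFDeriv ℝ 1 H'.1 x - iteratedFDeriv ℝ 1 H.1 x‖ := by
    have h1 := fderiv_fun_sub (H'.2.1.differentiable (by simp) x) (H.2.1.differentiable (by simp) x)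
    have h2 := iteratedFDeriv_sub_apply (i := 1) (x := x)
      (H'.2.1.of_le (mod_cast le_top)).contDiffAt (H.2.1.of_le (mod_cast le_top)).contDiffAt
    rw [← h1, ← h2, norm_iteratedFDeriv_one]
    rfl
  rw [← map_sub]
  refine (ContinuousLinearMap.le_opNorm _ _).trans ?_
  rw [e]
  have := (h x hx).le
  calc _ ≤ (‖(hamJ : (Cover d →L[ℝ] ℝ) →L[ℝ] Cover d)‖ + 1) *
        (ε / (‖(hamJ : (Cover d →L[ℝ] ℝ) →L[ℝ] Cover d)‖ + 1)) := by gcongr; linarith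
    _ = ε := by field_simp

/-- Finite orbit segments persist, with small changes, under small changes of the Hamiltonian and
of the initial point. -/
theorem eventually_exists_solOn_close (H : SmoothHam d) {T : ℝ} {γ : ℝ → Cover d} (hT : 0 ≤ T)
    (hγ : IsSolOn H.1 T γ) {ε : ℝ} (hε : 0 < ε) :
    ∀ᶠ q in 𝓝 (H, γ 0), ∃ γ', γ' 0 = q.2 ∧ IsSolOn q.1.1 T γ' ∧
      ∀ t ∈ Set.Icc (-T) T, dist (γ' t) (γ t) < ε := by
  have hcont : ContinuousOn γ (Set.Icc (-T) T) := fun t ht =>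
    (hγ t ht).continuousAt.continuousWithinAt
  obtain ⟨R, hR⟩ := isCompact_Icc.exists_bound_of_continuousOn hcont
  have hR0 : 0 ≤ R := (norm_nonneg _).trans (hR 0 ⟨by linarith, hT⟩)
  let χ : ContDiffBump (0 : Cover d) := ⟨R + ε, R + ε + 1, by linarith, by linarith⟩
  have hχ : χ.rIn = R + ε := rfl
  obtain ⟨K, M, hK, -⟩ := exists_lipschitz_cutVec χ H
  have hgB : 0 ≤ gronwallBound 1 K 1 T := by
    have := gronwallBound_mono (δ := 1) (ε := 1) zero_le_one zero_le_one K.coe_nonneg hT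
    rw [gronwallBound_x0] at this; exact zero_le_one.trans this
  obtain ⟨c, hc0, hc⟩ : ∃ c > 0, gronwallBound c K c T < ε := by
    refine ⟨ε / (gronwallBound 1 K 1 T + 1), by positivity, ?_⟩
    rw [gronwallBound_eq_mul, div_mul_eq_mul_div, div_lt_iff₀ (by positivity)]
    nlinarith
  have e1 : ∀ᶠ q : SmoothHam d × Cover d in 𝓝 (H, γ 0), ∀ x ∈ Metric.closedBall (0 : Cover d) χ.rOut,
      ‖hamJ (fderiv ℝ q.1.1 x) - hamJ (fderiv ℝ H.1 x)‖ ≤ c :=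
    (continuous_fst.tendsto (H, γ 0)).eventually
      (eventually_hamVec_close H (isCompact_closedBall _ _) hc0)
  have e2 : ∀ᶠ q : SmoothHam d × Cover d in 𝓝 (H, γ 0), dist q.2 (γ 0) < c :=
    (continuous_snd.tendsto (H, γ 0)).eventually (Metric.ball_mem_nhds _ hc0)
  filter_upwards [e1, e2] with q h1 h2
  obtain ⟨K', M', hK', hM'⟩ := exists_lipschitz_cutVec χ q.1
  obtain ⟨γ', h0, h'⟩ := exists_solution_of_lipschitz hK' hM' T q.2
  have hclose : ∀ t ∈ Set.Icc (-T) T, dist (γ' t) (γ t) < ε := fun t ht => by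
    have hg : ∀ t ∈ Set.Icc (-T) T, HasDerivAt γ (cutVec χ H.1 (γ t)) t := fun t ht => by
      rw [cutVec_eq χ H (by rw [hχ]; linarith [hR t ht])]; exact hγ t ht
    have := dist_le_gronwallBound_abs hK hg h' (η := c) (δ := c) (fun s _ => ?_)
      (by rw [h0]; exact h2.le) ht
    · refine lt_of_le_of_lt (this.trans ?_) hc
      exact gronwallBound_mono hc0.le hc0.le K.2 (abs_le.2 ht)
    · rw [dist_eq_norm, cutVec, cutVec, ← smul_sub, norm_smul, Real.norm_of_nonneg χ.nonneg]
      by_cases hs : γ' s ∈ Metric.closedBall (0 : Cover d) χ.rOut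
      · exact (mul_le_of_le_one_left (norm_nonneg _) χ.le_one).trans (h1 _ hs)
      · rw [χ.zero_of_le_dist (by simpa using (not_le.1 (by simpa using hs)).le), zero_mul]
        exact hc0.le
  refine ⟨γ', h0, fun t ht => ?_, hclose⟩
  have hn : ‖γ' t‖ ≤ χ.rIn := by
    rw [hχ]
    have h3 := hclose t ht
    rw [dist_eq_norm] at h3
    have := norm_le_norm_add_norm_sub' (γ' t) (γ t)
    linarith [hR t ht]
  rw [← cutVec_eq χ q.1 hn]
  exact h' t ht

theorem IsSolOn.eqOn {H : SmoothHam d} {T : ℝ} {γ γ' : ℝ → Cover d} (hT : 0 ≤ T)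
    (h : IsSolOn H.1 T γ)
    (h' : IsSolOn H.1 T γ') (h0 : γ' 0 = γ 0) {t : ℝ} (ht : t ∈ Set.Icc (-T) T) : γ' t = γ t := by
  have hcont : ContinuousOn γ (Set.Icc (-T) T) := fun t ht =>
    (h t ht).continuousAt.continuousWithinAt
  have hcont' : ContinuousOn γ' (Set.Icc (-T) T) := fun t ht =>
    (h' t ht).continuousAt.continuousWithinAt
  obtain ⟨R, hR⟩ := isCompact_Icc.exists_bound_of_continuousOn hcont
  obtain ⟨R', hR'⟩ := isCompact_Icc.exists_bound_of_continuousOn hcont'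
  have hR0 : 0 ≤ R := (norm_nonneg _).trans (hR 0 ⟨by linarith, hT⟩)
  have hR0' : 0 ≤ R' := (norm_nonneg _).trans (hR' 0 ⟨by linarith, hT⟩)
  let χ : ContDiffBump (0 : Cover d) := ⟨R + R' + 1, R + R' + 2, by linarith, by linarith⟩
  have hχ : χ.rIn = R + R' + 1 := rfl
  obtain ⟨K, M, hK, -⟩ := exists_lipschitz_cutVec χ H
  have := dist_le_gronwallBound_abs hK (γ := γ) (γ' := γ') (w := fun t => cutVec χ H.1 (γ' t))
    (T := T) (δ := 0) (η := 0) (fun t ht => ?_) (fun t ht => ?_) (fun t _ => by simp)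
    (by simp [h0]) ht
  · rw [gronwallBound_ε0_δ0] at this
    exact dist_le_zero.1 this
  · rw [cutVec_eq χ H (by rw [hχ]; linarith [hR t ht])]; exact h t ht
  · rw [cutVec_eq χ H (by rw [hχ]; linarith [hR' t ht])]; exact h' t ht

/-- Solutions on all compact time intervals, for all initial points, make up a complete flow. -/
theorem exists_isHamFlow (H : SmoothHam d) (h : ∀ (p : Cover d) (T : ℝ), ∃ γ, γ 0 = p ∧ IsSolOn H.1 T γ) :
    ∃ Φ, IsHamFlow H.1 Φ := by
  choose γ h0 hγ using h
  -- the solution on `[-|t|, |t|]` is used at time `t`; uniqueness glues the different solutions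
  refine ⟨fun t p => γ p |t| t, fun p => ⟨h0 _ _, fun t => ?_⟩⟩
  have key : ∀ s T : ℝ, |s| ≤ T → γ p |s| s = γ p T s := fun s T hs =>
    ((hγ p |s|).eqOn (abs_nonneg s) ((hγ p T).mono hs) (by rw [h0, h0]) (abs_le.1 le_rfl)).symm
  have hd := hγ p (|t| + 1) t (abs_le.1 (by linarith))
  rw [← key t (|t| + 1) (by linarith)] at hd
  refine hd.congr_of_eventuallyEq ?_
  have : ∀ᶠ s in 𝓝 t, |s| < |t| + 1 := continuous_abs.continuousAt.eventually_lt
    continuousAt_const (by linarith)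
  filter_upwards [this] with s hs using key s _ hs.le

theorem IsHamFlow.isSolOn {H : Cover d → ℝ} {Φ : ℝ → Cover d → Cover d} (h : IsHamFlow H Φ)
    (p : Cover d) (T : ℝ) : IsSolOn H T (fun t => Φ t p) := fun t _ => (h p).2 t

/-- The solution through `p` exists on some `[-T, T]` with `T ≥ T₀` and, for some `j`, visits all the
sets `O j i`. -/
def Reaches {ι J : Type*} (T₀ : ℝ) (O : J → ι → Set (ℝ × Cover d)) (H : SmoothHam d) (p : Cover d) :
    Prop :=
  ∃ T ≥ T₀, ∃ γ, γ 0 = p ∧ IsSolOn H.1 T γ ∧ ∃ j, ∀ i, ∃ t ∈ Set.Icc (-T) T, (t, γ t) ∈ O j i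

theorem isOpen_reaches {ι J : Type*} [Finite ι] {T₀ : ℝ} (hT₀ : 0 ≤ T₀)
    {O : J → ι → Set (ℝ × Cover d)} (hO : ∀ j i t, IsOpen {x | (t, x) ∈ O j i})
    {K : Set (Cover d)} (hK : IsCompact K) : IsOpen {H : SmoothHam d | ∀ p ∈ K, Reaches T₀ O H p} := by
  rw [isOpen_iff_mem_nhds]
  intro H hH
  refine hK.eventually_forall_of_forall_eventually fun p hp => ?_
  obtain ⟨T, hT, γ, rfl, hγ, j, hj⟩ := hH p hp
  choose t ht hto using hj
  obtain ⟨ε, hε, hball⟩ : ∃ ε > 0, ∀ i, Metric.ball (γ (t i)) ε ⊆ {x | (t i, x) ∈ O j i} := by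
    have : ∀ i, ∃ ε > 0, Metric.ball (γ (t i)) ε ⊆ {x | (t i, x) ∈ O j i} := fun i =>
      Metric.isOpen_iff.1 (hO j i (t i)) _ (hto i)
    choose ε hε hb using this
    have h1 : ∀ᶠ δ in 𝓝[>] (0 : ℝ), ∀ i, δ < ε i := eventually_all.2 fun i =>
      nhdsWithin_le_nhds (gt_mem_nhds (hε i))
    obtain ⟨δ, h, hδ⟩ := (h1.and self_mem_nhdsWithin).exists
    exact ⟨δ, hδ, fun i => (Metric.ball_subset_ball (h i).le).trans (hb i)⟩
  filter_upwards [eventually_exists_solOn_close H (hT₀.trans hT) hγ hε] with q hq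
  obtain ⟨γ', h0, hs, hc⟩ := hq
  exact ⟨T, hT, γ', h0, hs, j, fun i => ⟨t i, ht i, hball i (hc _ (ht i))⟩⟩

end Robust

/-! ### Unbounded orbits and `Gδ` sets -/

section GDelta

/-- `s u(t)` takes arbitrarily large values as `σ t → +∞`; here `σ, s = ±1`. -/
def UnboundedAlong (σ s : ℝ) (u : ℝ → ℝ) : Prop := ∀ N : ℕ, ∃ t, (N : ℝ) < σ * t ∧ (N : ℝ) < s * u t

theorem limsup_atTop_eq_top_iff {u : ℝ → ℝ} :
    limsup (fun t => ((u t : ℝ) : EReal)) atTop = ⊤ ↔ UnboundedAlong 1 1 u := by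
  constructor
  · intro h N
    have hf : ∃ᶠ t in atTop, ((N : ℝ) : EReal) < ((u t : ℝ) : EReal) :=
      frequently_lt_of_lt_limsup (by isBoundedDefault) (by rw [h]; exact EReal.coe_lt_top _)
    obtain ⟨t, h1, h2⟩ := (hf.and_eventually (eventually_gt_atTop (N : ℝ))).exists
    exact ⟨t, by simpa using h2, by simpa using EReal.coe_lt_coe_iff.1 h1⟩
  · intro h
    refine EReal.eq_top_iff_forall_lt _ |>.2 fun y => ?_
    obtain ⟨N, hN⟩ := exists_nat_gt y
    refine lt_of_lt_of_le (EReal.coe_lt_coe_iff.2 hN) (le_limsup_of_frequently_le ?_ (by isBoundedDefault))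
    rw [frequently_atTop]
    intro a
    obtain ⟨M, hM⟩ := exists_nat_gt (max a N)
    obtain ⟨t, h1, h2⟩ := h M
    refine ⟨t, ?_, ?_⟩
    · linarith [le_max_left a (N : ℝ)]
    · rw [EReal.coe_le_coe_iff]
      linarith [le_max_right a (N : ℝ)]

theorem limsup_atBot_eq_top_iff {u : ℝ → ℝ} :
    limsup (fun t => ((u t : ℝ) : EReal)) atBot = ⊤ ↔ UnboundedAlong (-1) 1 u := by
  have h : limsup (fun t => ((u t : ℝ) : EReal)) atBot =
      limsup (fun t => ((u (-t) : ℝ) : EReal)) atTop := by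
    rw [← map_neg_atTop]; rfl
  rw [h, limsup_atTop_eq_top_iff]
  refine forall_congr' fun N => ⟨fun ⟨t, h⟩ => ⟨-t, by simpa using h⟩, fun ⟨t, h⟩ => ⟨-t, by simpa using h⟩⟩

theorem liminf_atTop_eq_bot_iff {u : ℝ → ℝ} :
    liminf (fun t => ((u t : ℝ) : EReal)) atTop = ⊥ ↔ UnboundedAlong 1 (-1) u := by
  have h : limsup (fun t => ((-u t : ℝ) : EReal)) atTop =
      -liminf (fun t => ((u t : ℝ) : EReal)) atTop := by
    rw [← EReal.limsup_neg]; rfl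
  rw [← EReal.neg_eq_top_iff, ← h, limsup_atTop_eq_top_iff]
  simp [UnboundedAlong]

theorem liminf_atBot_eq_bot_iff {u : ℝ → ℝ} :
    liminf (fun t => ((u t : ℝ) : EReal)) atBot = ⊥ ↔ UnboundedAlong (-1) (-1) u := by
  have h : limsup (fun t => ((-u t : ℝ) : EReal)) atBot =
      -liminf (fun t => ((u t : ℝ) : EReal)) atBot := by
    rw [← EReal.limsup_neg]; rfl
  rw [← EReal.neg_eq_top_iff, ← h, limsup_atBot_eq_top_iff]
  simp [UnboundedAlong]

/-- The sign `±1` encoded by a Boolean. -/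
noncomputable def sgn (b : Bool) : ℝ := if b then 1 else -1

variable {d : ℕ} {hd : 4 ≤ d}

theorem escapes_iff {Φ : ℝ → Cover d → Cover d} {p : Cover d} :
    Escapes Φ p ↔ ∀ b, UnboundedAlong (sgn b) 1 fun t => ‖(Φ t p).2‖ := by
  rw [Escapes, limsup_atTop_eq_top_iff, limsup_atBot_eq_top_iff, Bool.forall_bool, and_comm]
  simp [sgn]

theorem actionOscillates_iff {Φ : ℝ → Cover d → Cover d} {p : Cover d} {j : Fin d} :
    ActionOscillates Φ p j ↔ ∀ b b', UnboundedAlong (sgn b) (sgn b') fun t => (Φ t p).2 j := by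
  rw [ActionOscillates, limsup_atTop_eq_top_iff, limsup_atBot_eq_top_iff, liminf_atTop_eq_bot_iff,
    liminf_atBot_eq_bot_iff]
  simp only [Bool.forall_bool, sgn]
  simp only [if_true, Bool.false_eq_true, if_false]
  tauto

theorem ActionOscillates.escapes {Φ : ℝ → Cover d → Cover d} {p : Cover d} {j : Fin d}
    (h : ActionOscillates Φ p j) : Escapes Φ p := by
  rw [actionOscillates_iff] at h
  refine escapes_iff.2 fun b N => ?_
  obtain ⟨t, h1, h2⟩ := h b true N
  refine ⟨t, h1, ?_⟩
  have := PiLp.norm_apply_le (Φ t p).2 j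
  simp only [sgn, if_true, one_mul] at *
  exact h2.trans_le ((le_abs_self _).trans this)

/-- A compact exhaustion of `{r_4 ≠ 0}`. -/
def exhaustion (hd : 4 ≤ d) (N : ℕ) : Set (Cover d) :=
  Metric.closedBall 0 N ∩ {x | 1 / ((N : ℝ) + 1) ≤ |r4 hd x|}

theorem continuous_r4 : Continuous (r4 (d := d) hd) :=
  (EuclideanSpace.proj (idx hd 3) : Act d →L[ℝ] ℝ).continuous.comp continuous_snd

theorem isCompact_exhaustion (N : ℕ) : IsCompact (exhaustion (d := d) hd N) :=
  (isCompact_closedBall _ _).inter_right (isClosed_le continuous_const continuous_r4.abs)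

theorem eventually_mem_exhaustion {p : Cover d} (hp : r4 hd p ≠ 0) :
    ∀ᶠ N : ℕ in atTop, p ∈ exhaustion hd N := by
  have h1 : ∀ᶠ N : ℕ in atTop, ‖p‖ ≤ N := tendsto_natCast_atTop_atTop.eventually_ge_atTop _
  have h2 : ∀ᶠ N : ℕ in atTop, 1 / ((N : ℝ) + 1) ≤ |r4 hd p| :=
    tendsto_one_div_add_atTop_nhds_zero_nat.eventually_le_const (abs_pos.2 hp)
  filter_upwards [h1, h2] with N h1 h2 using ⟨by simpa using h1, h2⟩

theorem exists_isHamFlow_iff (H : SmoothHam d) :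
    (∃ Φ, IsHamFlow H.1 Φ) ↔
      ∀ N : ℕ, ∀ p ∈ Metric.closedBall (0 : Cover d) N,
        Reaches (J := Unit) (ι := Empty) N (fun _ i => i.elim) H p := by
  constructor
  · rintro ⟨Φ, hΦ⟩ N p -
    exact ⟨N, le_rfl, _, (hΦ p).1, hΦ.isSolOn p N, (), fun i => i.elim⟩
  · intro h
    refine exists_isHamFlow H fun p T => ?_
    obtain ⟨N, hN⟩ := exists_nat_gt (max ‖p‖ T)
    obtain ⟨T', hT', γ, h0, hγ, -⟩ := h N p (by
      simpa using (lt_of_le_of_lt (le_max_left _ _) hN).le)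
    exact ⟨γ, h0, hγ.mono (by linarith [le_max_right ‖p‖ T])⟩

/-- Abstract form of the `Gδ` property: having a complete flow whose orbits off `{r_4 = 0}` visit, for
every `N`, one of finitely many systems of open sets that decrease with `N`. -/
theorem isGδ_setOf_flow {ι J : Type*} [Finite ι] [Finite J] (O : ℕ → J → ι → Set (ℝ × Cover d))
    (hO : ∀ N j i t, IsOpen {x | (t, x) ∈ O N j i}) (hmono : ∀ j i, Antitone fun N => O N j i) :
    IsGδ {H : SmoothHam d | ∃ Φ, IsHamFlow H.1 Φ ∧ ∀ p, r4 hd p ≠ 0 →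
      ∃ j, ∀ i N, ∃ t, (t, Φ t p) ∈ O N j i} := by
  have : {H : SmoothHam d | ∃ Φ, IsHamFlow H.1 Φ ∧ ∀ p, r4 hd p ≠ 0 →
      ∃ j, ∀ i N, ∃ t, (t, Φ t p) ∈ O N j i} =
      (⋂ N : ℕ, {H : SmoothHam d | ∀ p ∈ Metric.closedBall (0 : Cover d) N,
        Reaches (J := Unit) (ι := Empty) N (fun _ i => i.elim) H p}) ∩
      ⋂ N : ℕ, {H : SmoothHam d | ∀ p ∈ exhaustion hd N, Reaches 0 (O N) H p} := by
    ext H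
    simp only [Set.mem_ofPred_eq, Set.mem_inter_iff, Set.mem_iInter]
    rw [← exists_isHamFlow_iff]
    constructor
    · rintro ⟨Φ, hΦ, h⟩
      refine ⟨⟨Φ, hΦ⟩, fun N p hp => ?_⟩
      have hp0 : r4 hd p ≠ 0 := fun h0 => by
        have := hp.2
        simp only [Set.mem_ofPred_eq, h0, abs_zero] at this
        exact absurd this (not_le.2 (by positivity))
      obtain ⟨j, hj⟩ := h p hp0
      choose t ht using fun i => hj i N
      obtain ⟨T, hT⟩ := (Set.finite_range fun i => |t i|).bddAbove
      refine ⟨max T 0, le_max_right _ _, _, (hΦ p).1, hΦ.isSolOn p _, j, fun i => ⟨t i, ?_, ht i⟩⟩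
      exact abs_le.1 ((hT ⟨i, rfl⟩).trans (le_max_left _ _))
    · rintro ⟨⟨Φ, hΦ⟩, h⟩
      refine ⟨Φ, hΦ, fun p hp => ?_⟩
      -- some `j` serves infinitely many `N`, hence all `N`
      by_contra! hcon
      choose i N hN using hcon
      obtain ⟨M, hM⟩ := (Set.finite_range N).bddAbove
      obtain ⟨n, hn, hpn⟩ := ((eventually_ge_atTop M).and (eventually_mem_exhaustion hp)).exists
      obtain ⟨T, hT, γ, h0, hγ, j, hj⟩ := h n p hpn
      obtain ⟨t, ht, hto⟩ := hj (i j)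
      rw [← IsSolOn.eqOn (γ' := fun t => Φ t p) hT hγ (hΦ.isSolOn p T) (by rw [h0]; exact (hΦ p).1) ht]
        at hto
      exact hN j t (hmono j (i j) ((hM ⟨j, rfl⟩).trans hn) hto)
  rw [this]
  refine IsGδ.inter ?_ ?_
  · exact IsGδ.iInter_of_isOpen fun N => isOpen_reaches N.cast_nonneg
      (fun _ i => i.elim) (isCompact_closedBall _ _)
  · exact IsGδ.iInter_of_isOpen fun N => isOpen_reaches le_rfl (hO N) (isCompact_exhaustion N)

theorem isOpen_visit {g : Cover d → ℝ} (hg : Continuous g) (c : ℝ) (P : Prop) :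
    IsOpen {x | P ∧ c < g x} := by
  by_cases hP : P
  · simpa [hP] using isOpen_lt continuous_const hg
  · simp [hP]

theorem isGδ_escapingSet (ω₀ : Act d) (f : Fin 3 → ℝ → ℝ) : IsGδ (escapingSet hd ω₀ f) := by
  have h := isGδ_setOf_flow (d := d) (hd := hd) (ι := Bool) (J := Unit)
    (fun N _ b => {q | (N : ℝ) < sgn b * q.1 ∧ (N : ℝ) < 1 * ‖q.2.2‖})
    (fun N j i t => isOpen_visit (g := fun x => 1 * ‖x.2‖) (by fun_prop) N
      ((N : ℝ) < sgn i * t))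
    (fun j i N M hNM q hq => by
      have : (N : ℝ) ≤ M := by exact_mod_cast hNM
      exact ⟨this.trans_lt hq.1, this.trans_lt hq.2⟩)
  convert h.preimage (continuous_subtype_val (p := fun H => H ∈ closure (conjClass hd ω₀ f))) using 1
  ext H
  simp only [escapingSet, escapes_iff, UnboundedAlong, Set.mem_preimage, Set.mem_ofPred_eq,
    exists_const]

theorem isGδ_oscillatingSet (ω₀ : Act d) (f : Fin 3 → ℝ → ℝ) : IsGδ (oscillatingSet hd ω₀ f) := by
  have h := isGδ_setOf_flow (d := d) (hd := hd) (ι := Bool × Bool × Bool)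
    (J := {q : Fin 3 × Fin 3 // q.1 ≠ q.2})
    (fun N j b => {q | (N : ℝ) < sgn b.1 * q.1 ∧ (N : ℝ) < sgn b.2.1 *
      q.2.2 (idx hd (if b.2.2 then j.1.1 else j.1.2).castSucc)})
    (fun N j b t => isOpen_visit (g := fun x => sgn b.2.1 *
      x.2 (idx hd (if b.2.2 then j.1.1 else j.1.2).castSucc)) (by fun_prop)
        N ((N : ℝ) < sgn b.1 * t))
    (fun j i N M hNM q hq => by
      have : (N : ℝ) ≤ M := by exact_mod_cast hNM
      exact ⟨this.trans_lt hq.1, this.trans_lt hq.2⟩)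
  convert h.preimage (continuous_subtype_val (p := fun H => H ∈ closure (conjClass hd ω₀ f))) using 1
  ext H
  simp only [oscillatingSet, TwoActionsOscillate, actionOscillates_iff, UnboundedAlong,
    Set.mem_preimage, Set.mem_ofPred_eq, Prod.forall, Subtype.exists, Prod.exists]
  refine exists_congr fun Φ => and_congr_right fun _ => forall_congr' fun _ => forall_congr' fun _ =>
    imp_congr_right fun _ => exists_congr fun i₁ => exists_congr fun i₂ => ?_
  constructor
  · rintro ⟨hne, h1, h2⟩
    exact ⟨hne, fun b b' c => by cases c; exacts [h2 b b', h1 b b']⟩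
  · rintro ⟨hne, h1⟩
    exact ⟨hne, fun b b' => h1 b b' true, fun b b' => h1 b b' false⟩

end GDelta

/-! ### Flows of perturbations that depend on `φ_1, φ_2, φ_3, r_4` only -/

section Triangular

variable {d : ℕ} (hd : 4 ≤ d)

/-- The points `x`, `x'` have the same coordinates `φ_1, φ_2, φ_3, r_4`. -/
def SameBase (x x' : Cover d) : Prop :=
  (∀ i, x.1 (e3 hd i) = x'.1 (e3 hd i)) ∧ r4 hd x = r4 hd x'

variable {hd}

/-- A vector field with a triangular structure is integrated by successive quadratures. -/
theorem exists_flow_of_triangular {X : Cover d → Cover d} (cX : Continuous X)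
    (h1 : ∀ x x', SameBase hd x x' → (X x).2 = (X x').2)
    (h2 : ∀ x x', SameBase hd x x' → x.2 = x'.2 → (X x).1 = (X x').1)
    (h3 : ∀ x x', r4 hd x = r4 hd x' → ∀ i, (X x).1 (e3 hd i) = (X x').1 (e3 hd i))
    (h4 : ∀ x, (X x).2 (idx hd 3) = 0) :
    ∃ Φ : ℝ → Cover d → Cover d, ∀ p, Φ 0 p = p ∧
      (∀ t, HasDerivAt (fun τ => Φ τ p) (X (Φ t p)) t) ∧
      (∀ t i, (Φ t p).1 (e3 hd i) = p.1 (e3 hd i) + t * (X p).1 (e3 hd i)) ∧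
      ∀ t, r4 hd (Φ t p) = r4 hd p := by
  -- the angles `φ_1, φ_2, φ_3` move linearly; then the actions, then the other angles follow
  let z : Cover d → ℝ → Cover d := fun p t => (p.1 + t • (X p).1, p.2)
  have cz : ∀ p, Continuous (z p) := fun p => by fun_prop
  let r : Cover d → ℝ → Act d := fun p t => p.2 + ∫ τ in (0 : ℝ)..t, (X (z p τ)).2
  have cF : ∀ p, Continuous fun τ => (X (z p τ)).2 := fun p => (cX.comp (cz p)).snd
  have dr : ∀ p t, HasDerivAt (r p) (X (z p t)).2 t := fun p t =>
    ((cF p).integral_hasStrictDerivAt 0 t).hasDerivAt.const_add _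
  have cr : ∀ p, Continuous (r p) := fun p =>
    continuous_iff_continuousAt.2 fun t => (dr p t).continuousAt
  let z' : Cover d → ℝ → Cover d := fun p t => (p.1 + t • (X p).1, r p t)
  have cz' : ∀ p, Continuous (z' p) := fun p =>
    (by fun_prop : Continuous fun t : ℝ => p.1 + t • (X p).1).prodMk (cr p)
  have cF' : ∀ p, Continuous fun τ => (X (z' p τ)).1 := fun p => (cX.comp (cz' p)).fst
  let q : Cover d → ℝ → Act d := fun p t => p.1 + ∫ τ in (0 : ℝ)..t, (X (z' p τ)).1
  have dq : ∀ p t, HasDerivAt (q p) (X (z' p t)).1 t := fun p t =>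
    ((cF' p).integral_hasStrictDerivAt 0 t).hasDerivAt.const_add _
  have r4r : ∀ p t, r p t (idx hd 3) = p.2 (idx hd 3) := fun p t => by
    have := (EuclideanSpace.proj (idx hd 3) : Act d →L[ℝ] ℝ).intervalIntegral_comp_comm
      ((cF p).intervalIntegrable (μ := volume) 0 t)
    simp only [PiLp.proj_apply, h4, intervalIntegral.integral_zero] at this
    simp [r, ← this]
  have q3 : ∀ p t i, q p t (e3 hd i) = p.1 (e3 hd i) + t * (X p).1 (e3 hd i) := fun p t i => by
    have := (EuclideanSpace.proj (e3 hd i) : Act d →L[ℝ] ℝ).intervalIntegral_comp_comm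
      ((cF' p).intervalIntegrable (μ := volume) 0 t)
    simp only [PiLp.proj_apply] at this
    have e : ∀ τ, (X (z' p τ)).1 (e3 hd i) = (X p).1 (e3 hd i) := fun τ =>
      h3 (z' p τ) p (r4r p τ) i
    simp only [e, intervalIntegral.integral_const, sub_zero, smul_eq_mul] at this
    simp [q, ← this]
  refine ⟨fun t p => (q p t, r p t), fun p => ⟨by simp [q, r], fun t => ?_, q3 p, r4r p⟩⟩
  have e1 : (X (z p t)).2 = (X (q p t, r p t)).2 := h1 _ _
    ⟨fun i => by simp [z, q3], (r4r p t).symm⟩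
  have e2 : (X (z' p t)).1 = (X (q p t, r p t)).1 := h2 _ _
    ⟨fun i => by simp [z', q3], rfl⟩ rfl
  have d1 := dq p t
  have d2 := dr p t
  rw [e1] at d2
  rw [e2] at d1
  exact d1.prodMk d2

theorem fderiv_eq_of_forall_add_eq {E : Type*} [NormedAddCommGroup E] [NormedSpace ℝ E] {G : E → ℝ}
    {x x' : E} (h : ∀ y, G (y + (x' - x)) = G y) : fderiv ℝ G x = fderiv ℝ G x' := by
  have e : (fun y => G (y + (x' - x))) = G := funext h
  conv_lhs => rw [← e]
  rw [fderiv_comp_add_right, add_sub_cancel]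

theorem fderiv_apply_of_forall_line {E : Type*} [NormedAddCommGroup E] [NormedSpace ℝ E] {G : E → ℝ}
    {x v : E} (hG : DifferentiableAt ℝ G x) {c : ℝ} (h : ∀ s : ℝ, G (x + s • v) = G x + s * c) :
    fderiv ℝ G x v = c := by
  have h1 : HasDerivAt (fun s : ℝ => x + s • v) v 0 := by
    simpa using ((hasDerivAt_id (0 : ℝ)).smul_const v).const_add x
  have h2 : HasDerivAt (fun s : ℝ => G (x + s • v)) (fderiv ℝ G x v) 0 := by
    have h3 : HasFDerivAt G (fderiv ℝ G x) (x + (0 : ℝ) • v) := by simpa using hG.hasFDerivAt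
    exact h3.comp_hasDerivAt 0 h1
  have h3 : HasDerivAt (fun s : ℝ => G (x + s • v)) c 0 := by
    simp only [h]
    simpa using ((hasDerivAt_id (0 : ℝ)).mul_const c).const_add (G x)
  exact h2.unique h3

variable {ω₀ : Act d} {f : Fin 3 → ℝ → ℝ}

theorem contDiff_H0 (hf : ∀ i, ContDiff ℝ ∞ (f i)) : ContDiff ℝ ∞ (H0 hd ω₀ f) := by
  have h1 : ContDiff ℝ ∞ fun x : Cover d => inner ℝ ω₀ x.2 := contDiff_const.inner ℝ contDiff_snd
  have h2 : ∀ j, ContDiff ℝ ∞ fun x : Cover d => x.2 j := fun j =>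
    ((EuclideanSpace.proj j : Act d →L[ℝ] ℝ).comp
      (ContinuousLinearMap.snd ℝ (Act d) (Act d))).contDiff
  exact h1.add (ContDiff.sum fun i _ => ((hf i).comp (h2 _)).mul (h2 _))

theorem H0_add_smul_single (ω₀ : Act d) (f : Fin 3 → ℝ → ℝ) (x : Cover d) (i : Fin 3) (s : ℝ) :
    H0 hd ω₀ f (x + s • ((0, EuclideanSpace.single (e3 hd i) 1) : Cover d)) =
      H0 hd ω₀ f x + s * (freq3 hd ω₀ i + f i (r4 hd x)) := by
  rw [H0_add_kick ω₀ f x _ (Pi.single i s)]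
  · simp [Pi.single_apply, r4_eq]; ring
  · simp [vec3, Pi.single_apply]

/-- The flow of `H_0 + G` for a function `G` of `φ_1, φ_2, φ_3, r_4`. -/
theorem exists_isHamFlow_of_sameBase (hf : ∀ i, ContDiff ℝ ∞ (f i)) {G : Cover d → ℝ}
    (cG : ContDiff ℝ ∞ G) (hG : ∀ x x', SameBase hd x x' → G x = G x') :
    ∃ Φ : ℝ → Cover d → Cover d, IsHamFlow (fun x => H0 hd ω₀ f x + G x) Φ ∧ ∀ p,
      (∀ t i, (Φ t p).1 (e3 hd i) = p.1 (e3 hd i) + t * (freq3 hd ω₀ i + f i (r4 hd p))) ∧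
      (∀ t, r4 hd (Φ t p) = r4 hd p) ∧
      ∀ j t, HasDerivAt (fun τ => (Φ τ p).2 j)
        (-fderiv ℝ G (Φ t p) (EuclideanSpace.single j 1, 0)) t := by
  have cH0 := contDiff_H0 (hd := hd) (ω₀ := ω₀) hf
  set H : Cover d → ℝ := fun x => H0 hd ω₀ f x + G x
  have cH : ContDiff ℝ ∞ H := cH0.add cG
  have dH : ∀ x, fderiv ℝ H x = fderiv ℝ (H0 hd ω₀ f) x + fderiv ℝ G x := fun x =>
    fderiv_fun_add (cH0.differentiable (by simp) x) (cG.differentiable (by simp) x)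
  -- the structure of the vector field: `G` sees `φ_1, φ_2, φ_3, r_4` only, `H_0` sees the actions only
  have G1 : ∀ x x', SameBase hd x x' → fderiv ℝ G x = fderiv ℝ G x' := fun x x' h =>
    fderiv_eq_of_forall_add_eq fun y => hG _ _
      ⟨fun i => by simp [h.1 i], by have := h.2; simp [r4] at *; simp [this]⟩
  have G2 : ∀ x v, SameBase hd v 0 → fderiv ℝ G x v = 0 := fun x v hv =>
    fderiv_apply_of_forall_line (cG.differentiable (by simp) x) fun s => by
      rw [mul_zero, add_zero]
      exact hG _ _ ⟨fun i => by simp [hv.1 i], by have := hv.2; simp [r4] at *; simp [this]⟩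
  have K1 : ∀ x x' : Cover d, x.2 = x'.2 → fderiv ℝ (H0 hd ω₀ f) x = fderiv ℝ (H0 hd ω₀ f) x' :=
    fun x x' h => fderiv_eq_of_forall_add_eq fun y => by
      simp [H0, twistPart, r4, h]
  have K2 : ∀ (x : Cover d) (v : Act d), fderiv ℝ (H0 hd ω₀ f) x (v, 0) = 0 := fun x v =>
    fderiv_apply_of_forall_line (cH0.differentiable (by simp) x) fun s => by
      simp [H0, twistPart, r4]
  have K3 : ∀ (x : Cover d) (i : Fin 3), fderiv ℝ (H0 hd ω₀ f) x
      (0, EuclideanSpace.single (e3 hd i) 1) = freq3 hd ω₀ i + f i (r4 hd x) := fun x i =>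
    fderiv_apply_of_forall_line (cH0.differentiable (by simp) x) fun s =>
      H0_add_smul_single ω₀ f x i s
  have X3 : ∀ x i, (hamJ (fderiv ℝ H x)).1 (e3 hd i) = freq3 hd ω₀ i + f i (r4 hd x) :=
    fun x i => by
      rw [hamJ_fst, dH, _root_.add_apply, K3, G2 _ _ ⟨fun j => by simp, ?_⟩, add_zero]
      simp [r4, (e3_ne hd i).symm]
  have X2 : ∀ x j, (hamJ (fderiv ℝ H x)).2 j = -fderiv ℝ G x (EuclideanSpace.single j 1, 0) :=
    fun x j => by
      rw [hamJ_snd, dH, _root_.add_apply, K2, zero_add]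
  obtain ⟨Φ, hΦ⟩ := exists_flow_of_triangular (hd := hd) (X := fun x => hamJ (fderiv ℝ H x))
    (contDiff_hamJ_fderiv cH).continuous
    (fun x x' h => by ext j; rw [X2, X2, G1 x x' h])
    (fun x x' h h' => by
      have : fderiv ℝ H x = fderiv ℝ H x' := by rw [dH, dH, G1 x x' h, K1 x x' h']
      simp only [this])
    (fun x x' h i => by rw [X3, X3, h])
    (fun x => by
      rw [X2, G2 _ _ ⟨fun j => by simp [e3_ne hd j], by simp [r4]⟩, neg_zero])
  refine ⟨Φ, fun p => ⟨(hΦ p).1, fun t => ?_⟩, fun p => ⟨fun t i => ?_, (hΦ p).2.2.2, fun j t => ?_⟩⟩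
  · rw [hamVec_eq (cH.differentiable (by simp) _)]; exact (hΦ p).2.1 t
  · rw [(hΦ p).2.2.1 t i, X3]
  · rw [← X2]
    exact ((EuclideanSpace.proj j : Act d →L[ℝ] ℝ).comp
      (ContinuousLinearMap.snd ℝ _ _)).hasFDerivAt.comp_hasDerivAt t ((hΦ p).2.1 t)

end Triangular

/-! ### Lacunary sums of resonant terms -/

section Lacunary

variable {d : ℕ} (hd : 4 ≤ d)

/-- The resonant term `2π δ |δ|^{-1/2} χ(r_4) sin (2π ⟨m, φ⟩)`. When the frequency of the angle
`⟨m, φ⟩` on the support of `χ` is `δ`, it is the change of `H_0` under the shear generated by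
`|δ|^{-1/2} χ(r_4) cos (2π ⟨m, φ⟩)`, which is large while the term itself is small. -/
noncomputable def baseTerm (χ : ℝ → ℝ) (m : Fin 3 → ℤ) (δ : ℝ) (x : Cover d) : ℝ :=
  2 * Real.pi * (δ / √|δ|) * (χ (r4L hd x) * Real.sin (2 * Real.pi * phaseL hd m x))

/-- The `ℓ^1` norm of an integer vector. -/
noncomputable def mag (m : Fin 3 → ℤ) : ℝ := ∑ i, |(m i : ℝ)|

/-- The data of a sum of resonant terms, with divisors `δ_s` that decrease so fast that the
contributions of the different terms to the motion are visible at different times: on the support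
of the cut-off `χ_s` the angle `⟨m_s, φ⟩` has frequency `δ_s`, every `r_4 ≠ 0` is in the support of
infinitely many cut-offs, uniformly, and the sum converges in `C^∞`. The bound `B s` for the
amplitudes and periods of the first `s` terms is negligible against the amplitude `|δ_s|^{-1/2}`. -/
structure IsLacunary (ω₀ : Act d) (f : Fin 3 → ℝ → ℝ) (χ : ℕ → ℝ → ℝ) (m : ℕ → Fin 3 → ℤ)
    (δ : ℕ → ℝ) : Prop where
  contDiff : ∀ s, ContDiff ℝ ∞ (χ s)
  mem_Icc : ∀ s x, χ s x ∈ Set.Icc (0 : ℝ) 1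
  flatAt : ∀ s, FlatAt (χ s) 0
  resonant : ∀ s x, χ s x ≠ 0 → ∑ i, (freq3 hd ω₀ i + f i x) * m s i = δ s
  ne_zero : ∀ s, δ s ≠ 0
  sum_ne : ∀ s, ∑ i, m s i ≠ 0
  recurrent : ∀ x, x ≠ 0 → ∃ c > 0, ∃ᶠ s in atTop, c ≤ χ s x
  bounds : ∀ n : ℕ, ∃ u : ℕ → ℝ, Summable u ∧
    ∀ s x, ‖iteratedFDeriv ℝ n (baseTerm hd (χ s) (m s) (δ s)) x‖ ≤ u s
  lacunary : ∃ B : ℕ → ℝ, (∀ s, 1 ≤ B s) ∧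
    (∀ s, B s + mag (m s) / √|δ s| + 1 / |δ s| ≤ B (s + 1)) ∧
    ∀ s, (1 + mag (m s)) * √|δ s| * B s * 2 ^ s ≤ 1

variable {hd}

theorem contDiff_baseTerm {χ : ℝ → ℝ} (hχ : ContDiff ℝ ∞ χ) (m : Fin 3 → ℤ) (δ : ℝ) :
    ContDiff ℝ ∞ (baseTerm hd χ m δ) :=
  contDiff_const.mul ((hχ.comp (r4L hd).contDiff).mul
    (Real.contDiff_sin.comp (contDiff_const.mul (phaseL hd m).contDiff)))

theorem anglePeriodic_baseTerm (χ : ℝ → ℝ) (m : Fin 3 → ℤ) (δ : ℝ) :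
    AnglePeriodic (baseTerm hd χ m δ) := fun k x => by
  unfold baseTerm
  rw [phaseL_intVec, show r4L hd (x.1 + intVec k, x.2) = r4L hd x from rfl, mul_add,
    show 2 * Real.pi * ((∑ i, m i * k (e3 hd i) : ℤ) : ℝ) =
    ((∑ i, m i * k (e3 hd i) : ℤ) : ℝ) * (2 * Real.pi) by ring, Real.sin_add_int_mul_two_pi]

theorem SameBase.phaseL_eq {x x' : Cover d} (h : SameBase hd x x') (m : Fin 3 → ℤ) :
    phaseL hd m x = phaseL hd m x' := by
  simp only [phaseL_apply, h.1]

theorem SameBase.baseTerm_eq {x x' : Cover d} (h : SameBase hd x x') (χ : ℝ → ℝ) (m : Fin 3 → ℤ)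
    (δ : ℝ) : baseTerm hd χ m δ x = baseTerm hd χ m δ x' := by
  unfold baseTerm
  rw [h.phaseL_eq, ← r4_eq, h.2, r4_eq]

theorem fderiv_baseTerm {χ : ℝ → ℝ} (hχ : ContDiff ℝ ∞ χ) (m : Fin 3 → ℤ) (δ : ℝ) (x : Cover d)
    (i : Fin 3) :
    fderiv ℝ (baseTerm hd χ m δ) x (EuclideanSpace.single (e3 hd i) 1, 0) =
      2 * Real.pi * (δ / √|δ|) * (χ (r4L hd x) * (Real.cos (2 * Real.pi * phaseL hd m x) *
        (2 * Real.pi * m i))) := by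
  have h1 : HasFDerivAt (fun x => χ (r4L hd x)) (deriv χ (r4L hd x) • r4L hd) x :=
    HasDerivAt.comp_hasFDerivAt x (hχ.differentiable (by simp) _).hasDerivAt
      (r4L hd).hasFDerivAt
  have h3 : HasFDerivAt (fun x => Real.sin (2 * Real.pi * phaseL hd m x))
      (Real.cos (2 * Real.pi * phaseL hd m x) • ((2 * Real.pi) • phaseL hd m)) x :=
    HasDerivAt.comp_hasFDerivAt x (Real.hasDerivAt_sin _)
      ((phaseL hd m).hasFDerivAt.const_mul (2 * Real.pi))
  have h4 : HasFDerivAt (baseTerm hd χ m δ) _ x :=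
    (h1.mul h3).const_mul (2 * Real.pi * (δ / √|δ|))
  rw [h4.fderiv]
  have e1 : r4L hd ((EuclideanSpace.single (e3 hd i) 1, 0) : Cover d) = 0 := by simp [r4L_apply]
  have e2 : phaseL hd m ((EuclideanSpace.single (e3 hd i) 1, 0) : Cover d) = m i := by
    rw [phaseL_apply, Finset.sum_eq_single i]
    · simp
    · intro j _ hj
      simp [(e3_injective hd).eq_iff, hj]
    · simp
  simp [e1, e2]

theorem div_sqrt_abs (δ : ℝ) : abs (δ / √|δ|) = √|δ| := by
  rw [abs_div, abs_of_nonneg (Real.sqrt_nonneg _)]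
  exact Real.div_sqrt

namespace IsLacunary

variable {ω₀ : Act d} {f : Fin 3 → ℝ → ℝ} {χ : ℕ → ℝ → ℝ} {m : ℕ → Fin 3 → ℤ} {δ : ℕ → ℝ}

theorem hasFDerivAt_tsum (h : IsLacunary hd ω₀ f χ m δ) (x : Cover d) :
    HasFDerivAt (fun x => ∑' s, baseTerm hd (χ s) (m s) (δ s) x)
      (∑' s, fderiv ℝ (baseTerm hd (χ s) (m s) (δ s)) x) x := by
  obtain ⟨u, hu, hb⟩ := h.bounds 1
  obtain ⟨u', hu', hb'⟩ := h.bounds 0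
  refine _root_.hasFDerivAt_tsum hu (fun s x =>
    ((contDiff_baseTerm (h.contDiff s) (m s) (δ s)).differentiable (by simp) x).hasFDerivAt)
    (fun s x => ?_) (x₀ := 0) (Summable.of_norm_bounded hu' fun s => ?_) x
  · rw [← norm_iteratedFDeriv_one]; exact hb s x
  · rw [← norm_iteratedFDeriv_zero (𝕜 := ℝ) (f := baseTerm hd (χ s) (m s) (δ s))]; exact hb' s 0

theorem contDiff_tsum (h : IsLacunary hd ω₀ f χ m δ) :
    ContDiff ℝ ∞ fun x => ∑' s, baseTerm hd (χ s) (m s) (δ s) x := by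
  choose u hu hb using h.bounds
  exact _root_.contDiff_tsum (fun s => contDiff_baseTerm (h.contDiff s) (m s) (δ s))
    (fun k _ => hu k) (fun k s x _ => hb k s x)

theorem iteratedFDeriv_tsum (h : IsLacunary hd ω₀ f χ m δ) (k : ℕ) (x : Cover d) :
    iteratedFDeriv ℝ k (fun x => ∑' s, baseTerm hd (χ s) (m s) (δ s) x) x =
      ∑' s, iteratedFDeriv ℝ k (baseTerm hd (χ s) (m s) (δ s)) x := by
  choose u hu hb using h.bounds
  rw [_root_.iteratedFDeriv_tsum (N := ⊤)
    (fun s => contDiff_baseTerm (h.contDiff s) (m s) (δ s)) (fun k _ => hu k)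
    (fun k s x _ => hb k s x) (mod_cast le_top)]

theorem anglePeriodic_tsum (χ : ℕ → ℝ → ℝ) (m : ℕ → Fin 3 → ℤ) (δ : ℕ → ℝ) :
    AnglePeriodic fun x => ∑' s, baseTerm hd (χ s) (m s) (δ s) x := fun k x => by
  simp only [anglePeriodic_baseTerm _ _ _ k x]

theorem flatAlong_tsum (h : IsLacunary hd ω₀ f χ m δ) :
    FlatAlong hd fun x => ∑' s, baseTerm hd (χ s) (m s) (δ s) x := by
  intro k x hx
  rw [h.iteratedFDeriv_tsum]
  have : ∀ s, iteratedFDeriv ℝ k (baseTerm hd (χ s) (m s) (δ s)) x = 0 := fun s => by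
    have c1 : ContDiff ℝ ∞ fun x => χ s (r4L hd x) := (h.contDiff s).comp (r4L hd).contDiff
    have c2 : ContDiff ℝ ∞ fun x => Real.sin (2 * Real.pi * phaseL hd (m s) x) :=
      Real.contDiff_sin.comp (contDiff_const.mul (phaseL hd (m s)).contDiff)
    have h2 : FlatAt (fun x => χ s (r4L hd x)) x :=
      FlatAt.comp (by rw [← r4_eq, hx]; exact h.flatAt s) (h.contDiff s) (r4L hd).contDiff
    exact (h2.smul_left c1 c2).smul_right
      (f := fun _ => 2 * Real.pi * (δ s / √|δ s|)) contDiff_const (c1.mul c2) k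
  simp [this]

/-- The perturbed Hamiltonian is the limit of conjugates of `H_0` by shears. -/
theorem mem_closure (h : IsLacunary hd ω₀ f χ m δ) (hf : ∀ i, ContDiff ℝ ∞ (f i)) {κ : ℝ}
    {H : SmoothHam d}
    (hH : ∀ x, H.1 x = H0 hd ω₀ f x + κ * ∑' s, baseTerm hd (χ s) (m s) (δ s) x) :
    H ∈ closure (conjClass hd ω₀ f) := by
  have cT : ∀ s, ContDiff ℝ ∞ (baseTerm hd (χ s) (m s) (δ s)) := fun s =>
    contDiff_baseTerm (h.contDiff s) (m s) (δ s)
  have cH0 := contDiff_H0 (hd := hd) (ω₀ := ω₀) hf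
  have cS : ∀ N : ℕ, ContDiff ℝ ∞ fun x => κ * ∑ s ∈ Finset.range N, baseTerm hd (χ s) (m s) (δ s) x :=
    fun N => contDiff_const.mul (ContDiff.sum fun s _ => cT s)
  have pH0 : AnglePeriodic (H0 hd ω₀ f) := fun k x => rfl
  let F : ℕ → SmoothHam d := fun N => ⟨fun x => H0 hd ω₀ f x +
    κ * ∑ s ∈ Finset.range N, baseTerm hd (χ s) (m s) (δ s) x, cH0.add (cS N), fun k x => by
      simp only [anglePeriodic_baseTerm _ _ _ k x, pH0 k x]⟩
  have hF : ∀ N, F N ∈ conjClass hd ω₀ f := fun N => by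
    -- the generating functions of the shears commute, since they depend on `φ` and `r_4` only
    let c : ℕ → ℝ → ℝ := fun s r => κ / √|δ s| * χ s r
    have hc : ∀ s ∈ Finset.range N, ContDiff ℝ ∞ (c s) := fun s _ =>
      contDiff_const.mul (h.contDiff s)
    have hfl : ∀ s ∈ Finset.range N, FlatAt (c s) 0 := fun s _ =>
      (h.flatAt s).smul_right (f := fun _ => κ / √|δ s|) contDiff_const (h.contDiff s)
    refine ⟨_, isFlatExactDiffeo_shear (hd := hd) (n := 0) (m := m) hc hfl (Or.inl rfl), fun x => ?_⟩
    rw [H0_add_kick ω₀ f x _ (shearKick hd (Finset.range N) c 0 m x) rfl]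
    change H0 hd ω₀ f x + _ = _
    congr 1
    simp only [shearKick, Finset.sum_apply, Finset.mul_sum, Pi.smul_apply, smul_eq_mul]
    rw [Finset.sum_comm]
    refine Finset.sum_congr rfl fun s _ => ?_
    have e : ∀ i, (freq3 hd ω₀ i + f i (r4L hd x)) * (2 * Real.pi * (c s (r4L hd x) *
        yL hd x ^ 0 * Real.sin (2 * Real.pi * phaseL hd (m s) x)) * m s i) =
        (2 * Real.pi * (c s (r4L hd x) * Real.sin (2 * Real.pi * phaseL hd (m s) x))) *
          ((freq3 hd ω₀ i + f i (r4L hd x)) * m s i) := fun i => by ring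
    simp only [e, ← Finset.mul_sum, c, baseTerm]
    by_cases h0 : χ s (r4L hd x) = 0
    · simp [h0]
    · rw [h.resonant s _ h0]; ring
  refine mem_closure_of_tendsto (b := atTop) (f := F) ?_ (Eventually.of_forall hF)
  refine SmoothHam.tendsto_nhds_of fun k K hK ε hε => ?_
  obtain ⟨u, hu, hb⟩ := h.bounds k
  have hunif := Metric.tendstoUniformly_iff.1 (tendstoUniformly_tsum_nat hu fun s x => hb s x)
    (ε / (|κ| + 1)) (by positivity)
  filter_upwards [hunif] with N hN x _
  have e1 : iteratedFDeriv ℝ k (F N).1 x = iteratedFDeriv ℝ k (H0 hd ω₀ f) x +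
      κ • ∑ s ∈ Finset.range N, iteratedFDeriv ℝ k (baseTerm hd (χ s) (m s) (δ s)) x := by
    have h1 := iteratedFDeriv_add_apply (i := k) (x := x)
      (cH0.of_le (mod_cast le_top)).contDiffAt ((cS N).of_le (mod_cast le_top)).contDiffAt
    have h2 := iteratedFDeriv_const_smul_apply (𝕜 := ℝ) (i := k) (x := x) (a := κ)
      (f := fun x => ∑ s ∈ Finset.range N, baseTerm hd (χ s) (m s) (δ s) x)
      ((ContDiff.sum fun s _ => cT s).of_le (mod_cast le_top)).contDiffAt
    have h3 := iteratedFDeriv_sum (𝕜 := ℝ) (i := k) (u := Finset.range N)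
      (f := fun s => baseTerm hd (χ s) (m s) (δ s)) fun s _ => (cT s).of_le (mod_cast le_top)
    have h4 := congrFun h3 x
    rw [Finset.sum_apply] at h4
    rw [← h4]
    exact h1.trans (congrArg _ h2)
  have e2 : iteratedFDeriv ℝ k H.1 x = iteratedFDeriv ℝ k (H0 hd ω₀ f) x +
      κ • ∑' s, iteratedFDeriv ℝ k (baseTerm hd (χ s) (m s) (δ s)) x := by
    have h0 : H.1 = fun x => H0 hd ω₀ f x + κ * ∑' s, baseTerm hd (χ s) (m s) (δ s) x := funext hH
    have h1 := iteratedFDeriv_add_apply (i := k) (x := x)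
      (cH0.of_le (mod_cast le_top)).contDiffAt
      ((contDiff_const (c := κ)).mul h.contDiff_tsum |>.of_le (mod_cast le_top)).contDiffAt
    have h2 := iteratedFDeriv_const_smul_apply (𝕜 := ℝ) (i := k) (x := x) (a := κ)
      (h.contDiff_tsum.of_le (mod_cast le_top)).contDiffAt
    rw [h0, ← h.iteratedFDeriv_tsum]
    exact h1.trans (congrArg _ h2)
  rw [e1, e2, add_sub_add_left_eq_sub, ← smul_sub, norm_smul, Real.norm_eq_abs]
  have := hN x
  rw [dist_comm, dist_eq_norm] at this
  calc _ ≤ |κ| * (ε / (|κ| + 1)) := by gcongr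
    _ < (|κ| + 1) * (ε / (|κ| + 1)) := by gcongr; linarith
    _ = ε := by field_simp

end IsLacunary

end Lacunary

/-! ### Unbounded motion -/

section Drift

theorem sgn_eq (b : Bool) : sgn b = 1 ∨ sgn b = -1 := by cases b <;> simp [sgn]

theorem sgn_mul_sgn (b : Bool) : sgn b * sgn b = 1 := by cases b <;> simp [sgn]

theorem abs_sgn_mul (b : Bool) (t : ℝ) : |sgn b * t| = |t| := by cases b <;> simp [sgn]

/-- An oscillation of a slow angle is visible, in either direction of time, before that angle has
made one turn. -/
theorem exists_time_half_le (θ : ℝ) {δ : ℝ} (hδ : δ ≠ 0) (b : Bool) :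
    ∃ t, 0 ≤ sgn b * t ∧ |δ| * |t| ≤ 1 ∧
      1 / 2 ≤ |Real.sin (θ + 2 * Real.pi * (δ * t)) - Real.sin θ| := by
  obtain ⟨e, he1, he⟩ : ∃ e : ℝ, (e = 1 ∨ e = -1) ∧ e * |δ| = sgn b * δ := by
    rcases abs_cases δ with ⟨h, -⟩ | ⟨h, -⟩
    · exact ⟨sgn b, sgn_eq b, by rw [h]⟩
    · exact ⟨-sgn b, by rcases sgn_eq b with h | h <;> simp [h], by rw [h]; ring⟩
  have hδ' : 0 < |δ| := abs_pos.2 hδ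
  -- it is enough to find the increment `u` of the angle, up to sign
  suffices h : ∃ u, 0 ≤ u ∧ u ≤ 1 ∧
      1 / 2 ≤ |Real.sin (θ + 2 * Real.pi * (e * u)) - Real.sin θ| by
    obtain ⟨u, h0, h1, h2⟩ := h
    refine ⟨sgn b * (u / |δ|), ?_, ?_, ?_⟩
    · rw [← mul_assoc, sgn_mul_sgn, one_mul]; positivity
    · rw [abs_sgn_mul, abs_div, abs_abs, abs_of_nonneg h0, mul_div_cancel₀ _ hδ'.ne']; exact h1
    · rwa [show δ * (sgn b * (u / |δ|)) = e * u by
        rw [show δ * (sgn b * (u / |δ|)) = (sgn b * δ) * (u / |δ|) by ring, ← he]; field_simp]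
  have hpi : Real.sin (θ + 2 * Real.pi * (e * (1 / 2))) = -Real.sin θ ∧
      Real.sin (θ + 2 * Real.pi * (e * (1 / 4))) = e * Real.cos θ ∧
      Real.sin (θ + 2 * Real.pi * (e * (3 / 4))) = -(e * Real.cos θ) := by
    rcases he1 with rfl | rfl
    · refine ⟨?_, ?_, ?_⟩
      · rw [show θ + 2 * Real.pi * (1 * (1 / 2)) = θ + Real.pi by ring, Real.sin_add_pi]
      · rw [show θ + 2 * Real.pi * (1 * (1 / 4)) = θ + Real.pi / 2 by ring, Real.sin_add_pi_div_two,
          one_mul]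
      · rw [show θ + 2 * Real.pi * (1 * (3 / 4)) = (θ + Real.pi / 2) + Real.pi by ring,
          Real.sin_add_pi, Real.sin_add_pi_div_two, one_mul]
    · refine ⟨?_, ?_, ?_⟩
      · rw [show θ + 2 * Real.pi * (-1 * (1 / 2)) = θ - Real.pi by ring, Real.sin_sub_pi]
      · rw [show θ + 2 * Real.pi * (-1 * (1 / 4)) = θ - Real.pi / 2 by ring, Real.sin_sub_pi_div_two]
        ring
      · rw [show θ + 2 * Real.pi * (-1 * (3 / 4)) = (θ - Real.pi / 2) - Real.pi by ring,
          Real.sin_sub_pi, Real.sin_sub_pi_div_two]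
        ring
  obtain ⟨p1, p2, p3⟩ := hpi
  -- half a turn serves if `sin θ` is not small; else `cos θ` is large, and a quarter or three quarters
  -- of a turn, depending on the signs, do
  by_cases hs : 1 / 4 ≤ |Real.sin θ|
  · refine ⟨1 / 2, by norm_num, by norm_num, ?_⟩
    rw [p1, show -Real.sin θ - Real.sin θ = -(2 * Real.sin θ) by ring, abs_neg, abs_mul]
    norm_num; linarith
  · push Not at hs
    have hc : 1 / 2 ≤ |e * Real.cos θ| := by
      have h1 := Real.sin_sq_add_cos_sq θ
      have h2 : |e * Real.cos θ| = |Real.cos θ| := by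
        rcases he1 with rfl | rfl <;> simp
      rw [h2]
      have h3 := sq_abs (Real.sin θ)
      have h4 := sq_abs (Real.cos θ)
      nlinarith [abs_nonneg (Real.sin θ), abs_nonneg (Real.cos θ)]
    rcases le_total 0 (e * Real.cos θ * Real.sin θ) with h | h
    · refine ⟨3 / 4, by norm_num, by norm_num, hc.trans ?_⟩
      rw [p3]
      exact sq_le_sq.1 (by nlinarith [sq_nonneg (Real.sin θ)])
    · refine ⟨1 / 4, by norm_num, by norm_num, hc.trans ?_⟩
      rw [p2]
      exact sq_le_sq.1 (by nlinarith [sq_nonneg (Real.sin θ)])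

/-- The quantitative comparison of the main term, of size `a`, with the other contributions. -/
theorem eventually_main_term_dominates {κ c : ℝ} (hκ : 0 < κ) (hc : 0 < c) (K M : ℝ) (hM : 1 ≤ M)
    (hK : 0 ≤ K) :
    ∀ᶠ n : ℕ in atTop, ∀ a B : ℝ, 2 ^ n ≤ a → 0 ≤ B → B ≤ a / 2 ^ n →
      M ≤ κ * (Real.pi * c * a - 3 * (4 * Real.pi * B + 8 * Real.pi ^ 2)) - K ∧
      M * (K + κ * (4 * Real.pi * (a * (a / 2 ^ n)) + (4 * Real.pi * B + 8 * Real.pi ^ 2))) ≤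
        (κ * (Real.pi * c * a - 3 * (4 * Real.pi * B + 8 * Real.pi ^ 2)) - K) ^ 2 := by
  have hpi := Real.pi_pos
  have hpi4 := Real.pi_lt_four
  set L := K + 3 * κ * (8 * Real.pi ^ 2) with hL
  have hL0 : 0 ≤ L := by positivity
  have hinv : Tendsto (fun n : ℕ => ((2 : ℝ) ^ n)⁻¹) atTop (𝓝 0) :=
    tendsto_inv_atTop_zero.comp (tendsto_pow_atTop_atTop_of_one_lt one_lt_two)
  have hbig := tendsto_pow_atTop_atTop_of_one_lt (one_lt_two : (1 : ℝ) < 2)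
  have q1 : 0 < c / 24 := by positivity
  have q2 : 0 < κ * Real.pi * c ^ 2 / (256 * M) := by positivity
  filter_upwards [hinv.eventually_le_const q1, hinv.eventually_le_const q2,
    hbig.eventually_ge_atTop 1, hbig.eventually_ge_atTop (4 * L / (κ * Real.pi * c)),
    hbig.eventually_ge_atTop (4 * M / (κ * Real.pi * c)),
    hbig.eventually_ge_atTop (32 * (M * L) / (κ * Real.pi * c) ^ 2)] with n h1 h2 h3 h4 h5 h6
  intro a B ha hB hBa
  set e := ((2 : ℝ) ^ n)⁻¹ with he
  have he0 : 0 < e := by positivity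
  simp only [div_eq_mul_inv _ ((2 : ℝ) ^ n), ← he] at hBa ⊢
  have ha1 : 1 ≤ a := h3.trans ha
  have hX : 0 < κ * Real.pi * c := by positivity
  set X := κ * Real.pi * c with hXdef
  have hY : X * a / 4 ≤ κ * (Real.pi * c * a - 3 * (4 * Real.pi * B + 8 * Real.pi ^ 2)) - K := by
    have g1 : L ≤ X * a / 4 := by
      have := h4.trans ha
      rw [div_le_iff₀ hX] at this
      linarith
    have g2 : κ * (12 * Real.pi) * B ≤ X * a / 2 := by
      calc κ * (12 * Real.pi) * B ≤ κ * (12 * Real.pi) * (a * (c / 24)) := by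
            gcongr
            exact hBa.trans (by gcongr)
        _ = X * a / 2 := by rw [hXdef]; ring
    have : κ * (Real.pi * c * a - 3 * (4 * Real.pi * B + 8 * Real.pi ^ 2)) - K =
      X * a - κ * (12 * Real.pi) * B - L := by rw [hL, hXdef]; ring
    rw [this]; linarith
  have hY0 : 0 ≤ X * a / 4 := by positivity
  constructor
  · refine le_trans ?_ hY
    have := h5.trans ha
    rw [div_le_iff₀ hX] at this
    linarith
  · refine le_trans ?_ (pow_le_pow_left₀ hY0 hY 2)
    have g1 : M * L ≤ (X * a) ^ 2 / 32 := by
      have := h6.trans ha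
      rw [div_le_iff₀ (by positivity)] at this
      nlinarith [mul_nonneg (sq_nonneg X) (sub_nonneg.2 ha1), sq_nonneg X]
    have g2 : M * (κ * (8 * Real.pi * (a * (a * e)))) ≤ (X * a) ^ 2 / 32 := by
      calc M * (κ * (8 * Real.pi * (a * (a * e)))) ≤
            M * (κ * (8 * Real.pi * (a * (a * (κ * Real.pi * c ^ 2 / (256 * M)))))) := by gcongr
        _ = (X * a) ^ 2 / 32 := by rw [hXdef]; field_simp; norm_num
    have g3 : K + κ * (4 * Real.pi * (a * (a * e)) + (4 * Real.pi * B + 8 * Real.pi ^ 2)) ≤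
        L + κ * (8 * Real.pi * (a * (a * e))) := by
      have : B ≤ a * (a * e) := hBa.trans (le_mul_of_one_le_left (by positivity) ha1)
      have h8 : κ * (4 * Real.pi * B) ≤ κ * (4 * Real.pi * (a * (a * e))) := by gcongr
      have : 0 ≤ κ * Real.pi ^ 2 := by positivity
      rw [hL]; nlinarith
    calc _ ≤ M * (L + κ * (8 * Real.pi * (a * (a * e)))) := by gcongr
      _ = M * L + M * (κ * (8 * Real.pi * (a * (a * e)))) := by ring
      _ ≤ (X * a) ^ 2 / 32 + (X * a) ^ 2 / 32 := add_le_add g1 g2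
      _ = (X * a / 4) ^ 2 := by ring

end Drift

section Drift

variable {d : ℕ} (hd : 4 ≤ d)

/-- The displacement of `-r_i`, up to time `t`, that is due to one resonant term. -/
noncomputable def drift (χ : ℝ → ℝ) (m : Fin 3 → ℤ) (δ : ℝ) (p : Cover d) (i : Fin 3) (t : ℝ) : ℝ :=
  2 * Real.pi * (χ (r4L hd p) / √|δ|) * m i *
    (Real.sin (2 * Real.pi * phaseL hd m p + 2 * Real.pi * (δ * t)) -
      Real.sin (2 * Real.pi * phaseL hd m p))

theorem mag_nonneg (m : Fin 3 → ℤ) : 0 ≤ mag m := Finset.sum_nonneg fun _ _ => abs_nonneg _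

theorem abs_le_mag (m : Fin 3 → ℤ) (i : Fin 3) : |(m i : ℝ)| ≤ mag m :=
  Finset.single_le_sum (f := fun i => |(m i : ℝ)|) (fun _ _ => abs_nonneg _) (Finset.mem_univ i)

variable {hd}

theorem abs_drift_eq {χ : ℝ → ℝ} (hχ : ∀ x, χ x ∈ Set.Icc (0 : ℝ) 1) (m : Fin 3 → ℤ) (δ : ℝ)
    (p : Cover d) (i : Fin 3) (t : ℝ) : |drift hd χ m δ p i t| ≤ 2 * Real.pi * (mag m / √|δ|) *
      |Real.sin (2 * Real.pi * phaseL hd m p + 2 * Real.pi * (δ * t)) -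
      Real.sin (2 * Real.pi * phaseL hd m p)| := by
  have hpi := Real.pi_pos
  unfold drift
  rw [abs_mul]
  gcongr
  rw [abs_mul, abs_mul, abs_div, abs_of_nonneg (hχ _).1, abs_of_nonneg (Real.sqrt_nonneg _),
    abs_of_pos (by positivity)]
  calc 2 * Real.pi * (χ (r4L hd p) / √|δ|) * |(m i : ℝ)| ≤ 2 * Real.pi * (1 / √|δ|) * mag m := by
        gcongr
        · exact (hχ _).2
        · exact abs_le_mag m i
    _ = _ := by ring

theorem abs_drift_le {χ : ℝ → ℝ} (hχ : ∀ x, χ x ∈ Set.Icc (0 : ℝ) 1) (m : Fin 3 → ℤ) (δ : ℝ)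
    (p : Cover d) (i : Fin 3) (t : ℝ) : |drift hd χ m δ p i t| ≤ 4 * Real.pi * (mag m / √|δ|) := by
  refine (abs_drift_eq hχ m δ p i t).trans ?_
  have hpi := Real.pi_pos
  have : |Real.sin (2 * Real.pi * phaseL hd m p + 2 * Real.pi * (δ * t)) -
      Real.sin (2 * Real.pi * phaseL hd m p)| ≤ 2 := by
    refine (abs_sub _ _).trans ?_
    linarith [Real.abs_sin_le_one (2 * Real.pi * phaseL hd m p + 2 * Real.pi * (δ * t)),
      Real.abs_sin_le_one (2 * Real.pi * phaseL hd m p)]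
  calc _ ≤ 2 * Real.pi * (mag m / √|δ|) * 2 := by
        have := mag_nonneg m
        gcongr
    _ = _ := by ring

/-- For small times the bound by the speed is better than the one by the amplitude. -/
theorem abs_drift_le' {χ : ℝ → ℝ} (hχ : ∀ x, χ x ∈ Set.Icc (0 : ℝ) 1) (m : Fin 3 → ℤ) (δ : ℝ)
    (p : Cover d) (i : Fin 3) (t : ℝ) :
    |drift hd χ m δ p i t| ≤ 4 * Real.pi ^ 2 * (mag m * √|δ| * |t|) := by
  refine (abs_drift_eq hχ m δ p i t).trans ?_
  have hpi := Real.pi_pos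
  have hlip : ∀ a b : ℝ, |Real.sin a - Real.sin b| ≤ |a - b| := fun a b => by
    have := Real.lipschitzWith_sin.dist_le_mul a b
    simpa [Real.dist_eq] using this
  have h2 := hlip (2 * Real.pi * phaseL hd m p + 2 * Real.pi * (δ * t)) (2 * Real.pi * phaseL hd m p)
  rw [add_sub_cancel_left, abs_mul, abs_of_pos (by positivity : (0 : ℝ) < 2 * Real.pi), abs_mul] at h2
  calc _ ≤ 2 * Real.pi * (mag m / √|δ|) * (2 * Real.pi * (|δ| * |t|)) := by
        have := mag_nonneg m
        gcongr
    _ = 4 * Real.pi ^ 2 * (mag m * (|δ| / √|δ|) * |t|) := by ring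
    _ = _ := by rw [Real.div_sqrt]

namespace IsLacunary

variable {ω₀ : Act d} {f : Fin 3 → ℝ → ℝ} {χ : ℕ → ℝ → ℝ} {m : ℕ → Fin 3 → ℤ} {δ : ℕ → ℝ}

theorem sqrt_pos (h : IsLacunary hd ω₀ f χ m δ) (s : ℕ) : 0 < √|δ s| :=
  Real.sqrt_pos.2 (abs_pos.2 (h.ne_zero s))

/-- All terms but the `M`-th contribute little to the motion up to time `1 / |δ_M|`: the earlier ones
because their amplitudes are small, the later ones because they are too slow. -/
theorem abs_tsum_drift_sub_le (h : IsLacunary hd ω₀ f χ m δ) {B : ℕ → ℝ} (hB1 : ∀ s, 1 ≤ B s)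
    (hB2 : ∀ s, B s + mag (m s) / √|δ s| + 1 / |δ s| ≤ B (s + 1))
    (hB3 : ∀ s, (1 + mag (m s)) * √|δ s| * B s * 2 ^ s ≤ 1) (p : Cover d) (i : Fin 3) (M : ℕ) {t : ℝ}
    (ht : |δ M| * |t| ≤ 1) :
    |∑' s, drift hd (χ s) (m s) (δ s) p i t - drift hd (χ M) (m M) (δ M) p i t| ≤
      4 * Real.pi * B M + 8 * Real.pi ^ 2 := by
  have hpi := Real.pi_pos
  have hq : ∀ s, 0 ≤ mag (m s) / √|δ s| := fun s => div_nonneg (mag_nonneg _) (Real.sqrt_nonneg _)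
  have hmono : Monotone B := monotone_nat_of_le_succ fun s => by
    have : 0 ≤ 1 / |δ s| := by positivity
    linarith [hB2 s, hq s]
  have hsum : ∀ N, ∑ s ∈ Finset.range N, mag (m s) / √|δ s| ≤ B N := fun N => by
    induction N with
    | zero => simpa using zero_le_one.trans (hB1 0)
    | succ N ih =>
      rw [Finset.sum_range_succ]
      have : 0 ≤ 1 / |δ N| := by positivity
      linarith [hB2 N]
  -- for `s > M` the bound `B s` exceeds the period `1 / |δ_M|`
  have htB : ∀ s, M < s → |t| ≤ B s := fun s hs => by
    have h1 : |t| ≤ 1 / |δ M| := by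
      rw [le_div_iff₀ (abs_pos.2 (h.ne_zero M))]; linarith
    have h2 := hB2 M
    have h3 := hmono (Nat.succ_le_of_lt hs)
    have := hq M
    have := hB1 M
    simp only [Nat.succ_eq_add_one] at h3
    linarith
  have hlate : ∀ s, |drift hd (χ (s + (M + 1))) (m (s + (M + 1))) (δ (s + (M + 1))) p i t| ≤
      4 * Real.pi ^ 2 * (1 / 2) ^ s := fun s => by
    refine (abs_drift_le' (h.mem_Icc _) _ _ p i t).trans ?_
    gcongr
    set n := s + (M + 1)
    have h1 := hB3 n
    have h2 := htB n (by omega)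
    have h3 := mag_nonneg (m n)
    have h4 := Real.sqrt_nonneg |δ n|
    have h5 : mag (m n) * √|δ n| * |t| ≤ (1 + mag (m n)) * √|δ n| * B n := by
      gcongr; linarith
    have h6 : (1 + mag (m n)) * √|δ n| * B n ≤ (1 / 2) ^ n := by
      rw [one_div_pow, le_div_iff₀ (by positivity)]; exact h1
    exact h5.trans (h6.trans (pow_le_pow_of_le_one (by norm_num) (by norm_num) (by omega)))
  have hgeo : HasSum (fun s : ℕ => 4 * Real.pi ^ 2 * (1 / 2 : ℝ) ^ s) (4 * Real.pi ^ 2 * 2) :=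
    hasSum_geometric_two.mul_left _
  have hs' : Summable fun s => drift hd (χ (s + (M + 1))) (m (s + (M + 1))) (δ (s + (M + 1))) p i t :=
    Summable.of_norm_bounded hgeo.summable hlate
  have hs : Summable fun s => drift hd (χ s) (m s) (δ s) p i t :=
    (summable_nat_add_iff (M + 1)).1 hs'
  rw [← hs.sum_add_tsum_nat_add (M + 1), Finset.sum_range_succ]
  have e1 : |∑' s, drift hd (χ (s + (M + 1))) (m (s + (M + 1))) (δ (s + (M + 1))) p i t| ≤
      4 * Real.pi ^ 2 * 2 := by
    rw [← Real.norm_eq_abs]; exact tsum_of_norm_bounded hgeo hlate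
  have e2 : |∑ s ∈ Finset.range M, drift hd (χ s) (m s) (δ s) p i t| ≤ 4 * Real.pi * B M := by
    refine (Finset.abs_sum_le_sum_abs _ _).trans ?_
    calc _ ≤ ∑ s ∈ Finset.range M, 4 * Real.pi * (mag (m s) / √|δ s|) :=
          Finset.sum_le_sum fun s _ => abs_drift_le (h.mem_Icc s) _ _ p i t
      _ ≤ 4 * Real.pi * B M := by rw [← Finset.mul_sum]; gcongr; exact hsum M
  rw [add_sub_right_comm, add_sub_cancel_right]
  refine (abs_add_le _ _).trans ?_
  linarith

/-- The main properties of the flow of `H_0 + κ G` for a lacunary sum `G` of resonant terms: the angles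
`φ_1, φ_2, φ_3` move linearly, and off `{r_4 = 0}` there are arbitrarily large times, in either
direction, around which `r_1 + r_2 + r_3` is large and its square dominates the other actions. The
latter holds on intervals of prescribed length `2 τ`, which leaves time to adjust an angle. -/
theorem exists_flow (h : IsLacunary hd ω₀ f χ m δ) (hf : ∀ i, ContDiff ℝ ∞ (f i)) {κ : ℝ} (hκ : 0 < κ) :
    ∃ Φ : ℝ → Cover d → Cover d,
      IsHamFlow (fun x => H0 hd ω₀ f x + κ * ∑' s, baseTerm hd (χ s) (m s) (δ s) x) Φ ∧ ∀ p,
      (∀ t i, (Φ t p).1 (e3 hd i) = p.1 (e3 hd i) + t * (freq3 hd ω₀ i + f i (r4 hd p))) ∧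
      (∀ t, r4 hd (Φ t p) = r4 hd p) ∧
      (r4 hd p ≠ 0 → ∀ (b : Bool) (M τ : ℝ), ∃ t₀, M < sgn b * t₀ ∧ ∀ t, |t - t₀| ≤ τ →
        M ≤ |yL hd (Φ t p)| ∧ ∀ i, M * |(Φ t p).2 (e3 hd i)| ≤ yL hd (Φ t p) ^ 2) := by
  have hpi := Real.pi_pos
  have cG : ContDiff ℝ ∞ fun x => κ * ∑' s, baseTerm hd (χ s) (m s) (δ s) x :=
    contDiff_const.mul h.contDiff_tsum
  obtain ⟨Φ, hΦ, hp⟩ := exists_isHamFlow_of_sameBase (hd := hd) (ω₀ := ω₀) hf cG fun x x' hx => by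
    simp only [hx.baseTerm_eq]
  refine ⟨Φ, hΦ, fun p => ⟨(hp p).1, (hp p).2.1, fun hp0 b M τ => ?_⟩⟩
  obtain ⟨hph, hr4, hder⟩ := hp p
  obtain ⟨B, hB1, hB2, hB3⟩ := h.lacunary
  obtain ⟨u, hu, hub⟩ := h.bounds 1
  have hu0 : ∀ s, 0 ≤ u s := fun s => (norm_nonneg _).trans (hub s 0)
  set U := ∑' s, u s with hU
  have hU0 : 0 ≤ U := tsum_nonneg hu0
  -- the derivatives of the actions
  have hfd : ∀ i t, fderiv ℝ (fun x => κ * ∑' s, baseTerm hd (χ s) (m s) (δ s) x) (Φ t p)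
      (EuclideanSpace.single (e3 hd i) 1, 0) =
      κ * ∑' s, fderiv ℝ (baseTerm hd (χ s) (m s) (δ s)) (Φ t p)
        (EuclideanSpace.single (e3 hd i) 1, 0) := fun i t => by
    rw [((h.hasFDerivAt_tsum (Φ t p)).const_mul κ).fderiv]
    have hs : Summable fun s => fderiv ℝ (baseTerm hd (χ s) (m s) (δ s)) (Φ t p) :=
      Summable.of_norm_bounded hu fun s => by
        rw [← norm_iteratedFDeriv_one]; exact hub s _
    have := (ContinuousLinearMap.apply ℝ ℝ
      ((EuclideanSpace.single (e3 hd i) 1, 0) : Cover d)).map_tsum hs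
    simp only [ContinuousLinearMap.apply_apply] at this
    rw [← this]; rfl
  have hub' : ∀ i t s, ‖fderiv ℝ (baseTerm hd (χ s) (m s) (δ s)) (Φ t p)
      (EuclideanSpace.single (e3 hd i) 1, 0)‖ ≤ u s := fun i t s => by
    refine (ContinuousLinearMap.le_opNorm _ _).trans ?_
    have : ‖((EuclideanSpace.single (e3 hd i) 1, 0) : Cover d)‖ = 1 := by simp [Prod.norm_def]
    rw [this, mul_one, ← norm_iteratedFDeriv_one]
    exact hub s _
  -- the actions are Lipschitz in time, so that what happens at one time persists nearby
  have hlip : ∀ i t t', |(Φ t p).2 (e3 hd i) - (Φ t' p).2 (e3 hd i)| ≤ κ * U * |t - t'| :=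
    fun i t t' => by
    refine convex_univ.norm_image_sub_le_of_norm_hasDerivWithin_le
      (f := fun t => (Φ t p).2 (e3 hd i))
      (fun x _ => (hder (e3 hd i) x).hasDerivWithinAt) (fun x _ => ?_) trivial trivial
    rw [norm_neg, hfd, norm_mul, Real.norm_of_nonneg hκ.le]
    gcongr
    exact tsum_of_norm_bounded hu.hasSum (hub' i x)
  have hfreq : ∀ s t, χ s (r4 hd p) ≠ 0 →
      phaseL hd (m s) (Φ t p) = phaseL hd (m s) p + δ s * t := fun s t hs => by
    rw [phaseL_apply, phaseL_apply, ← h.resonant s _ hs, Finset.sum_mul, ← Finset.sum_add_distrib]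
    refine Finset.sum_congr rfl fun i _ => ?_
    rw [hph]; ring
  have hr4' : ∀ t, r4L hd (Φ t p) = r4L hd p := hr4
  have hdrift : ∀ i s t, HasDerivAt (drift hd (χ s) (m s) (δ s) p i)
      (fderiv ℝ (baseTerm hd (χ s) (m s) (δ s)) (Φ t p) (EuclideanSpace.single (e3 hd i) 1, 0)) t :=
    fun i s t => by
    rw [fderiv_baseTerm (h.contDiff s), hr4' t]
    by_cases h0 : χ s (r4L hd p) = 0
    · have e : drift hd (χ s) (m s) (δ s) p i = fun _ => 0 := by funext t; simp [drift, h0]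
      rw [e, h0]; simpa using hasDerivAt_const t (0 : ℝ)
    · rw [hfreq s t h0]
      have h1 : HasDerivAt (fun t => 2 * Real.pi * phaseL hd (m s) p + 2 * Real.pi * (δ s * t))
          (2 * Real.pi * (δ s * 1)) t :=
        (((hasDerivAt_id t).const_mul (δ s)).const_mul (2 * Real.pi)).const_add _
      have h2 := (h1.sin.sub_const (Real.sin (2 * Real.pi * phaseL hd (m s) p))).const_mul
        (2 * Real.pi * (χ s (r4L hd p) / √|δ s|) * m s i)
      refine h2.congr_deriv ?_
      rw [mul_add]
      ring
  have hdrift0 : ∀ i s, drift hd (χ s) (m s) (δ s) p i 0 = 0 := fun i s => by simp [drift]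
  -- the explicit formula for the actions
  have hact : ∀ i t, (Φ t p).2 (e3 hd i) =
      p.2 (e3 hd i) - κ * ∑' s, drift hd (χ s) (m s) (δ s) p i t := fun i t => by
    have h1 : ∀ t, HasDerivAt (fun t => (Φ t p).2 (e3 hd i) +
        κ * ∑' s, drift hd (χ s) (m s) (δ s) p i t) 0 t := fun t => by
      have h2 := hasDerivAt_tsum hu (hdrift i) (fun s y => hub' i y s)
        (y₀ := 0) (by simp only [hdrift0]; exact summable_zero) t
      refine ((hder (e3 hd i) t).add (h2.const_mul κ)).congr_deriv ?_
      rw [hfd]; ring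
    have h3 := is_const_of_deriv_eq_zero (fun t => (h1 t).differentiableAt)
      (fun t => (h1 t).deriv) t 0
    simp only [hdrift0, tsum_zero, mul_zero, add_zero, (hΦ p).1] at h3
    linarith
  have hy : ∀ t, yL hd (Φ t p) =
      yL hd p - κ * ∑ i, ∑' s, drift hd (χ s) (m s) (δ s) p i t := fun t => by
    simp only [yL_apply, hact, Finset.sum_sub_distrib, Finset.mul_sum]
  have hlipy : ∀ t t', |yL hd (Φ t p) - yL hd (Φ t' p)| ≤ 3 * (κ * U * |t - t'|) := fun t t' => by
    rw [yL_apply, yL_apply, ← Finset.sum_sub_distrib]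
    refine (Finset.abs_sum_le_sum_abs _ _).trans ((Finset.sum_le_sum fun i _ => hlip i t t').trans ?_)
    simp
  -- a term of large index, active at this value of `r_4`, whose amplitude `a` dominates everything else
  obtain ⟨c, hc, hrec⟩ := h.recurrent (r4 hd p) hp0
  set Mx := max M 1 with hMx
  set K := |yL hd p| + ∑ i, |p.2 (e3 hd i)| + 3 * (κ * U * |τ|) + 3 * (κ * U * Mx) with hK
  have hMx1 : 1 ≤ Mx := le_max_right _ _
  have hsum0 : 0 ≤ ∑ i, |p.2 (e3 hd i)| := Finset.sum_nonneg fun _ _ => abs_nonneg _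
  have hK1 : 0 ≤ 3 * (κ * U * |τ|) := by positivity
  have hK2 : 0 ≤ 3 * (κ * U * Mx) := by positivity
  have hK0 : 0 ≤ K := by have := abs_nonneg (yL hd p); rw [hK]; linarith
  obtain ⟨n, hcn, hn⟩ := (hrec.and_eventually (eventually_main_term_dominates hκ hc K Mx hMx1 hK0)).exists
  have hsq := h.sqrt_pos n
  have h2n : (0 : ℝ) < 2 ^ n := by positivity
  have hmag := mag_nonneg (m n)
  have hBn := hB1 n
  set a := 1 / √|δ n| with ha
  have ha2 : 2 ^ n ≤ a := by
    rw [ha, le_div_iff₀ hsq]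
    have : 2 ^ n * √|δ n| ≤ (1 + mag (m n)) * √|δ n| * B n * 2 ^ n := by
      calc 2 ^ n * √|δ n| = 1 * √|δ n| * 1 * 2 ^ n := by ring
        _ ≤ _ := by gcongr; linarith
    linarith [hB3 n]
  have haB : B n ≤ a / 2 ^ n := by
    rw [ha, div_div, le_div_iff₀ (by positivity)]
    have : B n * (√|δ n| * 2 ^ n) ≤ (1 + mag (m n)) * √|δ n| * B n * 2 ^ n := by
      calc B n * (√|δ n| * 2 ^ n) = 1 * √|δ n| * B n * 2 ^ n := by ring
        _ ≤ _ := by gcongr; linarith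
    linarith [hB3 n]
  have hmaga : mag (m n) / √|δ n| ≤ a * (a / 2 ^ n) := by
    have : mag (m n) ≤ a / 2 ^ n := by
      rw [ha, div_div, le_div_iff₀ (by positivity)]
      have : mag (m n) * (√|δ n| * 2 ^ n) ≤ (1 + mag (m n)) * √|δ n| * B n * 2 ^ n := by
        calc mag (m n) * (√|δ n| * 2 ^ n) = mag (m n) * √|δ n| * 1 * 2 ^ n := by ring
          _ ≤ _ := by gcongr; linarith
      linarith [hB3 n]
    calc mag (m n) / √|δ n| = a * mag (m n) := by rw [ha]; ring
      _ ≤ _ := by gcongr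
  obtain ⟨hn1, hn2⟩ := hn a (B n) ha2 (by linarith) haB
  obtain ⟨t₀, ht0, ht1, ht2⟩ := exists_time_half_le (2 * Real.pi * phaseL hd (m n) p) (h.ne_zero n) b
  have hdev := fun i => h.abs_tsum_drift_sub_le hB1 hB2 hB3 p i n ht1
  have hmain : Real.pi * c * a ≤ |∑ i, drift hd (χ n) (m n) (δ n) p i t₀| := by
    unfold drift
    rw [← Finset.sum_mul, ← Finset.mul_sum, abs_mul, abs_mul, abs_mul, abs_div, abs_of_pos hsq,
      abs_of_pos (by positivity : (0 : ℝ) < 2 * Real.pi), abs_of_nonneg (h.mem_Icc n _).1]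
    have h1 : (1 : ℝ) ≤ |∑ i, (m n i : ℝ)| := by
      rw [← Int.cast_sum, ← Int.cast_abs]
      exact_mod_cast Int.one_le_abs (h.sum_ne n)
    calc Real.pi * c * a = 2 * Real.pi * (c / √|δ n|) * 1 * (1 / 2) := by rw [ha]; ring
      _ ≤ _ := by
        have := (h.mem_Icc n (r4L hd p)).1
        gcongr
        exact hcn
  set P := 4 * Real.pi * B n + 8 * Real.pi ^ 2 with hP
  have hy0 : κ * (Real.pi * c * a - 3 * P) ≤ |yL hd (Φ t₀ p) - yL hd p| := by
    rw [hy, sub_sub_cancel_left, abs_neg, abs_mul, abs_of_pos hκ]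
    gcongr
    have e : ∑ i, drift hd (χ n) (m n) (δ n) p i t₀ = ∑ i, ∑' s, drift hd (χ s) (m s) (δ s) p i t₀ -
      ∑ i, (∑' s, drift hd (χ s) (m s) (δ s) p i t₀ - drift hd (χ n) (m n) (δ n) p i t₀) := by
      rw [Finset.sum_sub_distrib]; ring
    have h1 : |∑ i, (∑' s, drift hd (χ s) (m s) (δ s) p i t₀ - drift hd (χ n) (m n) (δ n) p i t₀)| ≤
        3 * P := by
      refine (Finset.abs_sum_le_sum_abs _ _).trans ((Finset.sum_le_sum fun i _ => hdev i).trans ?_)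
      simp
    rw [e] at hmain
    have := abs_sub (∑ i, ∑' s, drift hd (χ s) (m s) (δ s) p i t₀)
      (∑ i, (∑' s, drift hd (χ s) (m s) (δ s) p i t₀ - drift hd (χ n) (m n) (δ n) p i t₀))
    linarith
  refine ⟨t₀, ?_, fun t ht => ?_⟩
  -- `|t₀|` is large, since the Lipschitz function `r_1 + r_2 + r_3` has moved far
  · have e : sgn b * t₀ = |t₀| := by rw [← abs_sgn_mul b, abs_of_nonneg ht0]
    rw [e]
    by_contra! hcon
    have h1 := hlipy t₀ 0
    rw [(hΦ p).1, sub_zero] at h1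
    have h2 : 3 * (κ * U * |t₀|) ≤ 3 * (κ * U * Mx) := by
      gcongr; exact hcon.trans (le_max_left _ _)
    have := abs_nonneg (yL hd p)
    linarith
  · have hτ : |t - t₀| ≤ |τ| := ht.trans (le_abs_self τ)
    have h1 : 3 * (κ * U * |t - t₀|) ≤ 3 * (κ * U * |τ|) := by gcongr
    have hyt : κ * (Real.pi * c * a - 3 * P) - K ≤ |yL hd (Φ t p)| := by
      have h2 := hlipy t t₀
      have h3 : |yL hd (Φ t₀ p) - yL hd p| ≤
          |yL hd (Φ t p)| + |yL hd (Φ t p) - yL hd (Φ t₀ p)| + |yL hd p| := by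
        have := abs_sub (yL hd (Φ t p) - (yL hd (Φ t p) - yL hd (Φ t₀ p))) (yL hd p)
        have := abs_sub (yL hd (Φ t p)) (yL hd (Φ t p) - yL hd (Φ t₀ p))
        rw [sub_sub_cancel] at *
        linarith
      linarith
    refine ⟨(le_max_left _ _).trans (hn1.trans hyt), fun i => ?_⟩
    have hri : |(Φ t p).2 (e3 hd i)| ≤ K + κ * (4 * Real.pi * (a * (a / 2 ^ n)) + P) := by
      have h2 := hlip i t t₀
      have h3 := hact i t₀
      have h4 := abs_drift_le (hd := hd) (h.mem_Icc n) (m n) (δ n) p i t₀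
      have h5 := hdev i
      have h6 : |∑' s, drift hd (χ s) (m s) (δ s) p i t₀| ≤ 4 * Real.pi * (a * (a / 2 ^ n)) + P := by
        have := abs_add_le (∑' s, drift hd (χ s) (m s) (δ s) p i t₀ - drift hd (χ n) (m n) (δ n) p i t₀)
          (drift hd (χ n) (m n) (δ n) p i t₀)
        rw [sub_add_cancel] at this
        have : 4 * Real.pi * (mag (m n) / √|δ n|) ≤ 4 * Real.pi * (a * (a / 2 ^ n)) := by gcongr
        linarith
      have h7 : |(Φ t₀ p).2 (e3 hd i)| ≤
          |p.2 (e3 hd i)| + κ * (4 * Real.pi * (a * (a / 2 ^ n)) + P) := by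
        rw [h3]
        refine (abs_sub _ _).trans ?_
        rw [abs_mul, abs_of_pos hκ]
        gcongr
      have h8 : |p.2 (e3 hd i)| ≤ ∑ i, |p.2 (e3 hd i)| :=
        Finset.single_le_sum (f := fun i => |p.2 (e3 hd i)|) (fun _ _ => abs_nonneg _)
          (Finset.mem_univ i)
      have h9 := abs_add_le ((Φ t p).2 (e3 hd i) - (Φ t₀ p).2 (e3 hd i)) ((Φ t₀ p).2 (e3 hd i))
      rw [sub_add_cancel] at h9
      have := abs_nonneg (yL hd p)
      have : κ * U * |t - t₀| ≤ 3 * (κ * U * |τ|) := by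
        have : 0 ≤ κ * U * |t - t₀| := by positivity
        linarith
      linarith
    calc M * |(Φ t p).2 (e3 hd i)| ≤ Mx * |(Φ t p).2 (e3 hd i)| := by
          gcongr; exact le_max_left _ _
      _ ≤ Mx * (K + κ * (4 * Real.pi * (a * (a / 2 ^ n)) + P)) := by gcongr
      _ ≤ (κ * (Real.pi * c * a - 3 * P) - K) ^ 2 := hn2
      _ ≤ |yL hd (Φ t p)| ^ 2 := pow_le_pow_left₀ (by linarith) hyt 2
      _ = yL hd (Φ t p) ^ 2 := sq_abs _

end IsLacunary

end Drift

/-! ### The choice of the resonances -/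

section Selection

variable {d : ℕ} {hd : 4 ≤ d}

theorem norm_iteratedFDeriv_comp_clm_le {E F G : Type*} [NormedAddCommGroup E] [NormedSpace ℝ E]
    [NormedAddCommGroup F] [NormedSpace ℝ F] [NormedAddCommGroup G] [NormedSpace ℝ G] {g : F → G}
    (hg : ContDiff ℝ ∞ g) (l : E →L[ℝ] F) (n : ℕ) (x : E) :
    ‖iteratedFDeriv ℝ n (fun y => g (l y)) x‖ ≤ ‖iteratedFDeriv ℝ n g (l x)‖ * ‖l‖ ^ n := by
  have h := l.iteratedFDeriv_comp_right hg x (i := n) (mod_cast le_top)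
  have e : (fun y => g (l y)) = g ∘ l := rfl
  rw [e, h]
  refine (ContinuousMultilinearMap.norm_compContinuousLinearMap_le _ _).trans ?_
  simp

theorem norm_r4L_le : ‖r4L (d := d) hd‖ ≤ 1 := by
  refine ContinuousLinearMap.opNorm_le_bound _ zero_le_one fun x => ?_
  rw [one_mul, r4L_apply]
  exact (PiLp.norm_apply_le x.2 _).trans (norm_snd_le x)

theorem norm_phaseL_le (m : Fin 3 → ℤ) : ‖phaseL (d := d) hd m‖ ≤ mag m := by
  refine ContinuousLinearMap.opNorm_le_bound _ (mag_nonneg m) fun x => ?_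
  rw [phaseL_apply, mag, Finset.sum_mul]
  refine (norm_sum_le _ _).trans (Finset.sum_le_sum fun i _ => ?_)
  rw [norm_mul, Real.norm_eq_abs]
  gcongr
  exact (PiLp.norm_apply_le x.1 _).trans (norm_fst_le x)

theorem norm_iteratedFDeriv_sin_phaseL_le (m : Fin 3 → ℤ) (n : ℕ) (x : Cover d) :
    ‖iteratedFDeriv ℝ n (fun x => Real.sin (2 * Real.pi * phaseL hd m x)) x‖ ≤
      (2 * Real.pi * mag m) ^ n := by
  have hpi := Real.pi_pos
  have h := norm_iteratedFDeriv_comp_clm_le Real.contDiff_sin ((2 * Real.pi) • phaseL hd m) n x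
  have e : (fun y => Real.sin (((2 * Real.pi) • phaseL hd m) y)) =
      fun x => Real.sin (2 * Real.pi * phaseL hd m x) := by funext y; simp
  rw [e, norm_iteratedFDeriv_eq_norm_iteratedDeriv (𝕜 := ℝ)] at h
  refine h.trans ?_
  calc _ ≤ 1 * (2 * Real.pi * mag m) ^ n := by
        gcongr
        · exact Real.abs_iteratedDeriv_sin_le_one n _
        · rw [norm_smul, Real.norm_of_nonneg (by positivity)]
          gcongr
          exact norm_phaseL_le m
    _ = _ := one_mul _

/-- The factor `√|δ|` is the size of the term; each derivative in the angles costs a factor `mag m`. -/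
theorem norm_iteratedFDeriv_baseTerm_le {χ : ℝ → ℝ} (hχ : ContDiff ℝ ∞ χ) (m : Fin 3 → ℤ) (δ : ℝ)
    (n : ℕ) (x : Cover d) :
    ‖iteratedFDeriv ℝ n (baseTerm hd χ m δ) x‖ ≤ 2 * Real.pi * √|δ| *
      ∑ i ∈ Finset.range (n + 1), (n.choose i : ℝ) * ‖iteratedFDeriv ℝ i χ (r4L hd x)‖ *
        (2 * Real.pi * mag m) ^ (n - i) := by
  have hpi := Real.pi_pos
  have c1 : ContDiff ℝ ∞ fun x => χ (r4L hd x) := hχ.comp (r4L hd).contDiff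
  have c2 : ContDiff ℝ ∞ fun x => Real.sin (2 * Real.pi * phaseL hd m x) :=
    Real.contDiff_sin.comp (contDiff_const.mul (phaseL hd m).contDiff)
  have h1 := iteratedFDeriv_const_smul_apply (𝕜 := ℝ) (i := n) (x := x)
    (a := 2 * Real.pi * (δ / √|δ|)) ((c1.mul c2).of_le (mod_cast le_top)).contDiffAt
  have h2 : iteratedFDeriv ℝ n (baseTerm hd χ m δ) x = _ := h1
  rw [h2, norm_smul, Real.norm_eq_abs, abs_mul, div_sqrt_abs,
    abs_of_pos (by positivity : (0 : ℝ) < 2 * Real.pi)]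
  refine mul_le_mul_of_nonneg_left ?_ (by positivity)
  refine (norm_iteratedFDeriv_mul_le c1 c2 x (n := n) (mod_cast le_top)).trans ?_
  refine Finset.sum_le_sum fun i _ => ?_
  gcongr
  · refine (norm_iteratedFDeriv_comp_clm_le hχ (r4L hd) i x).trans ?_
    exact mul_le_of_le_one_right (norm_nonneg _) (pow_le_one₀ (norm_nonneg _) norm_r4L_le)
  · exact norm_iteratedFDeriv_sin_phaseL_le m _ x

/-- Resonances can be chosen one after the other so that the divisors are lacunary, every window
being used infinitely often. The
predicate `small` expresses any further smallness that the divisors can be asked for. -/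
theorem exists_isLacunary {ι : Type*} [Countable ι] [Nonempty ι] {ω₀ : Act d} {f : Fin 3 → ℝ → ℝ}
    {χ : ι → ℝ → ℝ} (hχ : ∀ w, ContDiff ℝ ∞ (χ w)) (hχI : ∀ w x, χ w x ∈ Set.Icc (0 : ℝ) 1)
    (hχ0 : ∀ w, FlatAt (χ w) 0) (hcov : ∀ x, x ≠ 0 → ∃ w, 0 < χ w x)
    (small : ℕ → ι → (Fin 3 → ℤ) → ℝ → Prop)
    (hsel : ∀ s w B, (1 : ℝ) ≤ B → ∃ m δ,
      (∀ x, χ w x ≠ 0 → ∑ i, (freq3 hd ω₀ i + f i x) * m i = δ) ∧ δ ≠ 0 ∧ ∑ i, m i ≠ 0 ∧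
      (1 + mag m) * √|δ| * B * 2 ^ s ≤ 1 ∧ small s w m δ) :
    ∃ (w : ℕ → ι) (m : ℕ → Fin 3 → ℤ) (δ : ℕ → ℝ), (∀ s, small s (w s) (m s) (δ s)) ∧
      ((∀ n : ℕ, ∃ u : ℕ → ℝ, Summable u ∧
        ∀ s x, ‖iteratedFDeriv ℝ n (baseTerm hd (χ (w s)) (m s) (δ s)) x‖ ≤ u s) →
      IsLacunary hd ω₀ f (fun s => χ (w s)) m δ) := by
  obtain ⟨e, he⟩ := exists_surjective_nat ι
  let w : ℕ → ι := fun s => e (Nat.unpair s).1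
  have hw : ∀ i, ∃ᶠ s in atTop, w s = i := fun i => by
    obtain ⟨j, rfl⟩ := he i
    rw [frequently_atTop]
    exact fun N => ⟨Nat.pair j N, Nat.right_le_pair j N, by simp [w]⟩
  have hsel' : ∀ (s : ℕ) (B : {B : ℝ // 1 ≤ B}), ∃ q : (Fin 3 → ℤ) × ℝ,
      (∀ x, χ (w s) x ≠ 0 → ∑ i, (freq3 hd ω₀ i + f i x) * q.1 i = q.2) ∧ q.2 ≠ 0 ∧
      ∑ i, q.1 i ≠ 0 ∧ (1 + mag q.1) * √|q.2| * B * 2 ^ s ≤ 1 ∧ small s (w s) q.1 q.2 := fun s B => by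
    obtain ⟨m, δ, h⟩ := hsel s (w s) B B.2
    exact ⟨(m, δ), h⟩
  choose q q1 q2 q3 q4 q5 using hsel'
  -- `B s` bounds the amplitudes and the periods of the terms of index less than `s`
  let B : ℕ → {B : ℝ // 1 ≤ B} := fun s => Nat.rec ⟨1, le_rfl⟩ (fun s B =>
    ⟨B + mag (q s B).1 / √|(q s B).2| + 1 / |(q s B).2|, by
      have h1 := mag_nonneg (q s B).1
      have h2 : 0 ≤ mag (q s B).1 / √|(q s B).2| := by positivity
      have h3 : 0 ≤ 1 / |(q s B).2| := by positivity
      linarith [B.2]⟩) s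
  have hlac : ∃ B' : ℕ → ℝ, (∀ s, 1 ≤ B' s) ∧
      (∀ s, B' s + mag (q s (B s)).1 / √|(q s (B s)).2| + 1 / |(q s (B s)).2| ≤ B' (s + 1)) ∧
      ∀ s, (1 + mag (q s (B s)).1) * √|(q s (B s)).2| * B' s * 2 ^ s ≤ 1 :=
    ⟨fun s => (B s).1, fun s => (B s).2, fun s => le_rfl, fun s => q4 s (B s)⟩
  refine ⟨w, fun s => (q s (B s)).1, fun s => (q s (B s)).2, fun s => q5 s _, fun hb =>
    ⟨fun s => hχ _, fun s => hχI _, fun s => hχ0 _, fun s => q1 s _, fun s => q2 s _,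
      fun s => q3 s _, fun x hx => ?_, hb, hlac⟩⟩
  obtain ⟨i, hi⟩ := hcov x hx
  exact ⟨χ i x, hi, (hw i).mono fun s hs => by simp only [hs]; exact le_rfl⟩

/-- In a Liouville window there are resonances with divisors smaller than any negative power. -/
theorem IsLiouvillePair.exists_small {α β : ℝ} (h : IsLiouvillePair α β) (C : ℝ) (p : ℕ) :
    ∃ k l : ℤ, k + l ≠ 0 ∧ k * α + l * β ≠ 0 ∧
      C * (1 + |(k : ℝ)| + |(l : ℝ)|) ^ p * √|k * α + l * β| ≤ 1 := by
  obtain ⟨h1, h2⟩ := h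
  have hαβ : 0 < |α - β| := abs_pos.2 fun h => by
    have := h1 1 (-1) (by push_cast; linarith)
    simp at this
  obtain ⟨q, hq⟩ := pow_unbounded_of_one_lt (max |C| (1 / |α - β|)) (one_lt_two : (1 : ℝ) < 2)
  obtain ⟨k, l, hK, hkl⟩ := h2 (2 * (3 * p + q + 1))
  set K : ℝ := ((max |k| |l| : ℤ) : ℝ) with hKdef
  have hK2 : (2 : ℝ) ≤ K := by rw [hKdef]; exact_mod_cast hK
  have hk : |(k : ℝ)| ≤ K := by rw [hKdef]; exact_mod_cast le_max_left _ _
  have hl : |(l : ℝ)| ≤ K := by rw [hKdef]; exact_mod_cast le_max_right _ _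
  have h2q : (2 : ℝ) ^ q ≤ K ^ q := by gcongr
  refine ⟨k, l, fun h0 => ?_, fun h0 => ?_, ?_⟩
  -- `k + l = 0` would make the divisor a multiple of `α - β`, hence not small
  · have hl' : (l : ℝ) = -k := by
      have : l = -k := by omega
      rw [this]; push_cast; ring
    have hk0 : k ≠ 0 := by
      rintro rfl
      have : l = 0 := by omega
      subst this; simp at hK
    have hk1 : (1 : ℝ) ≤ |(k : ℝ)| := by exact_mod_cast Int.one_le_abs hk0
    rw [hl', show (k : ℝ) * α + -k * β = k * (α - β) by ring, abs_mul] at hkl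
    have h3 : |α - β| < 1 / K ^ (2 * (3 * p + q + 1)) := by nlinarith
    have h4 : 1 / |α - β| < 2 ^ q := (le_max_right _ _).trans_lt hq
    rw [div_lt_iff₀ hαβ] at h4
    rw [lt_div_iff₀ (by positivity)] at h3
    have h5 : K ^ q ≤ K ^ (2 * (3 * p + q + 1)) :=
      pow_le_pow_right₀ (by linarith) (by omega)
    have h6 : (2 : ℝ) ^ q * |α - β| ≤ K ^ (2 * (3 * p + q + 1)) * |α - β| := by
      gcongr; exact h2q.trans h5
    linarith
  · obtain ⟨rfl, rfl⟩ := h1 k l h0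
    simp at hK
  · have h3 : √|k * α + l * β| ≤ 1 / K ^ (3 * p + q + 1) := by
      rw [Real.sqrt_le_left (by positivity)]
      rw [div_pow, one_pow, ← pow_mul, mul_comm _ 2]; exact hkl.le
    have h4 : 1 + |(k : ℝ)| + |(l : ℝ)| ≤ K ^ 3 := by nlinarith [sq_nonneg K]
    calc C * (1 + |(k : ℝ)| + |(l : ℝ)|) ^ p * √|k * α + l * β|
        ≤ 2 ^ q * (K ^ 3) ^ p * (1 / K ^ (3 * p + q + 1)) := by
          gcongr
          exact (le_abs_self C).trans ((le_max_left _ _).trans hq.le)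
      _ ≤ K ^ q * (K ^ 3) ^ p * (1 / K ^ (3 * p + q + 1)) := by gcongr
      _ = 1 / K := by rw [← pow_mul]; field_simp; ring
      _ ≤ 1 := by rw [div_le_one (by linarith)]; linarith

/-- The pairs of indices of the frequencies, for the three types of windows. -/
def windowPair : Fin 3 → Fin 3 × Fin 3 := ![(0, 1), (0, 2), (1, 2)]

/-- The type of the `n`-th window, which is `n` modulo `3`. -/
def windowType (n : ℤ) : Fin 3 := if n % 3 = 0 then 0 else if n % 3 = 1 then 1 else 2

theorem HalfLineTwist.exists_windows {w : Fin 3 → ℝ} {f : Fin 3 → ℝ → ℝ} (h : HalfLineTwist w f) :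
    ∃ a b : ℤ → ℝ, IsIncreasingCover a b ∧ ∀ n, LiouvilleOn w f (windowPair (windowType n)).1
      (windowPair (windowType n)).2 (Set.Ioo (a n) (b n)) := by
  obtain ⟨a, b, hab, h⟩ := h
  refine ⟨a, b, hab, fun n => ?_⟩
  obtain ⟨k, hk⟩ : ∃ k, n = 3 * k ∨ n = 3 * k + 1 ∨ n = 3 * k - 1 := by
    refine ⟨(n + 1) / 3, ?_⟩; omega
  rcases hk with rfl | rfl | rfl
  · have : windowType (3 * k) = 0 := by
      unfold windowType; rw [if_pos (by omega)]
    rw [this]; exact (h k).1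
  · have : windowType (3 * k + 1) = 1 := by
      unfold windowType; rw [if_neg (by omega), if_pos (by omega)]
    rw [this]; exact (h k).2.1
  · have : windowType (3 * k - 1) = 2 := by
      unfold windowType; rw [if_neg (by omega), if_neg (by omega)]
    rw [this]; exact (h k).2.2

namespace IsIncreasingCover

variable {a b : ℤ → ℝ}

theorem strictMono (h : IsIncreasingCover a b) : StrictMono a := strictMono_int_of_lt_succ fun n =>
  (h.2.2.2 n).1.trans (h.2.2.2 n).2.1

/-- The windows cover the half line: take the last one that starts before `x`. -/
theorem exists_mem (h : IsIncreasingCover a b) {x : ℝ} (hx : 0 < x) :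
    ∃ n, x ∈ Set.Ioo (a n) (b n) := by
  obtain ⟨n, hn1, hn2⟩ := Int.exists_greatest_of_bdd (P := fun n => a n < x) (by
      obtain ⟨N, hN⟩ := (h.2.2.1.eventually_ge_atTop x).exists
      exact ⟨N, fun z hz => by
        by_contra! hcon
        exact absurd (h.strictMono hcon) (by linarith)⟩)
    (h.2.1.eventually (gt_mem_nhds hx)).exists
  refine ⟨n, hn1, ?_⟩
  have : x ≤ a (n + 1) := by
    by_contra! hcon
    have := hn2 _ hcon
    omega
  exact this.trans_lt (h.2.2.2 n).2.2

/-- Two windows that intersect are equal or adjacent, because `b n < a (n + 2)`. -/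
theorem lt_add_two (h : IsIncreasingCover a b) {x : ℝ} {n k : ℤ} (hn : x ∈ Set.Ioo (a n) (b n))
    (hk : x ∈ Set.Ioo (a k) (b k)) : k < n + 2 := by
  by_contra! hcon
  have h1 := h.strictMono.monotone hcon
  have h2 := (h.2.2.2 (n + 1)).2.1
  rw [add_sub_cancel_right, add_assoc] at h2
  norm_num at h2
  linarith [hn.2, hk.1]

end IsIncreasingCover

end Selection

/-! ### Windows of a Liouville twist -/

section Windows

variable {d : ℕ} {hd : 4 ≤ d}

/-- The windows of a twist, on both half lines, indexed by a sign and an integer. -/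
structure IsWindowSystem (w : Fin 3 → ℝ) (f : Fin 3 → ℝ → ℝ) (a b : Bool → ℤ → ℝ) : Prop where
  cover : ∀ s, IsIncreasingCover (a s) (b s)
  liouville : ∀ s n, ∃ u v : ℝ, IsLiouvillePair u v ∧ ∀ x, sgn s * x ∈ Set.Ioo (a s n) (b s n) →
    w (windowPair (windowType n)).1 + f (windowPair (windowType n)).1 x = u ∧
    w (windowPair (windowType n)).2 + f (windowPair (windowType n)).2 x = v

theorem IsLiouvilleTwist.exists_windows {w : Fin 3 → ℝ} {f : Fin 3 → ℝ → ℝ}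
    (h : IsLiouvilleTwist w f) : ∃ a b, IsWindowSystem w f a b := by
  obtain ⟨a, b, hab, h1⟩ := h.2.2.2.1.exists_windows
  obtain ⟨a', b', hab', h2⟩ := h.2.2.2.2.exists_windows
  refine ⟨fun s => if s then a else a', fun s => if s then b else b', ⟨fun s => ?_, fun s n => ?_⟩⟩
  · cases s
    exacts [hab', hab]
  · cases s
    · obtain ⟨u, v, hu, hv, hL⟩ := h2 n
      refine ⟨_, _, hL, fun x hx => ?_⟩
      simp only [sgn, Bool.false_eq_true, if_false, neg_one_mul] at hx
      have e1 := hu (-x) hx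
      have e2 := hv (-x) hx
      simp only [neg_neg] at e1 e2
      rw [e1, e2]
      exact ⟨add_comm _ _, add_comm _ _⟩
    · obtain ⟨u, v, hu, hv, hL⟩ := h1 n
      refine ⟨_, _, hL, fun x hx => ?_⟩
      simp only [sgn, if_true, one_mul] at hx
      rw [hu x hx, hv x hx]
      exact ⟨add_comm _ _, add_comm _ _⟩

namespace IsWindowSystem

variable {w : Fin 3 → ℝ} {f : Fin 3 → ℝ → ℝ} {a b : Bool → ℤ → ℝ}

theorem exists_mem (h : IsWindowSystem w f a b) {x : ℝ} (hx : x ≠ 0) :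
    ∃ s n, sgn s * x ∈ Set.Ioo (a s n) (b s n) := by
  rcases lt_or_gt_of_ne hx with h0 | h0
  · exact ⟨false, (h.cover false).exists_mem (by simpa [sgn] using h0)⟩
  · exact ⟨true, (h.cover true).exists_mem (by simpa [sgn] using h0)⟩

theorem sgn_eq_of_mem (h : IsWindowSystem w f a b) {x : ℝ} {s s' : Bool} {n n' : ℤ}
    (hx : sgn s * x ∈ Set.Ioo (a s n) (b s n)) (hx' : sgn s' * x ∈ Set.Ioo (a s' n') (b s' n')) :
    s = s' := by
  have h1 := ((h.cover s).1 n).trans hx.1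
  have h2 := ((h.cover s').1 n').trans hx'.1
  cases s <;> cases s' <;> simp [sgn] at * <;> linarith

/-- No point lies in windows of all three types: the windows through a point are pairwise equal or
adjacent. -/
theorem exists_type_forall_notMem (h : IsWindowSystem w f a b) (x : ℝ) :
    ∃ c, ∀ s n, windowType n = c → sgn s * x ∉ Set.Ioo (a s n) (b s n) := by
  by_contra! hcon
  choose s n ht hx using hcon
  have e1 := h.sgn_eq_of_mem (hx 0) (hx 1)
  have e2 := h.sgn_eq_of_mem (hx 0) (hx 2)
  have x0 := hx 0
  have x1 := hx 1
  have x2 := hx 2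
  rw [← e1] at x1
  rw [← e2] at x2
  have l01 := (h.cover (s 0)).lt_add_two x0 x1
  have l10 := (h.cover (s 0)).lt_add_two x1 x0
  have l02 := (h.cover (s 0)).lt_add_two x0 x2
  have l20 := (h.cover (s 0)).lt_add_two x2 x0
  have l12 := (h.cover (s 0)).lt_add_two x1 x2
  have l21 := (h.cover (s 0)).lt_add_two x2 x1
  have hmod : ∀ c : Fin 3, n c % 3 = (c.val : ℤ) := fun c => by
    have := ht c
    unfold windowType at this
    split_ifs at this with g1 g2
    · rw [g1, ← this]; rfl
    · rw [g2, ← this]; rfl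
    · subst this
      change _ = (2 : ℤ)
      omega
  have m0 := hmod 0
  have m1 := hmod 1
  have m2 := hmod 2
  simp at m0 m1 m2
  omega

theorem isOpen_window (s : Bool) (p q : ℝ) : IsOpen {x : ℝ | sgn s * x ∈ Set.Ioo p q} :=
  isOpen_Ioo.preimage (continuous_const.mul continuous_id)

/-- A function supported in a window is flat at `0`. -/
theorem flatAt_zero_of_support (h : IsWindowSystem w f a b) {s : Bool} {n : ℤ} {χ : ℝ → ℝ}
    (hχ : ∀ x, χ x ≠ 0 → sgn s * x ∈ Set.Ioo (a s n) (b s n)) : FlatAt χ 0 := by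
  refine (flatAt_zero 0).congr ?_
  have h1 : ∀ᶠ x : ℝ in 𝓝 0, sgn s * x < a s n := by
    refine (continuous_const.mul continuous_id).continuousAt.eventually_lt continuousAt_const ?_
    simpa using (h.cover s).1 n
  filter_upwards [h1] with x hx
  by_contra hne
  exact absurd (hχ x hne).1 (not_lt.2 hx.le)

theorem hasCompactSupport_of_support {s : Bool} {p q : ℝ} {χ : ℝ → ℝ}
    (hχ : ∀ x, χ x ≠ 0 → sgn s * x ∈ Set.Ioo p q) : HasCompactSupport χ := by
  refine HasCompactSupport.intro (K := {x : ℝ | sgn s * x ∈ Set.Icc p q}) ?_ fun x hx => ?_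
  · have : {x : ℝ | sgn s * x ∈ Set.Icc p q} = (fun x => sgn s * x) '' Set.Icc p q := by
      ext x
      constructor
      · exact fun hx => ⟨sgn s * x, hx, by simp only [← mul_assoc, sgn_mul_sgn, one_mul]⟩
      · rintro ⟨y, hy, rfl⟩
        simpa only [Set.mem_ofPred_eq, ← mul_assoc, sgn_mul_sgn, one_mul] using hy
    rw [this]
    exact isCompact_Icc.image (continuous_const.mul continuous_id)
  · by_contra hne
    exact hx (Set.Ioo_subset_Icc_self (hχ x hne))

end IsWindowSystem

/-- The integer vector with entries `k`, `l` at the positions of the pair of type `c`. -/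
def pairVec (c : Fin 3) (k l : ℤ) : Fin 3 → ℤ := fun i =>
  (if i = (windowPair c).1 then k else 0) + if i = (windowPair c).2 then l else 0

theorem sum_pairVec (c : Fin 3) (k l : ℤ) : ∑ i, pairVec c k l i = k + l := by
  simp [pairVec, Finset.sum_add_distrib]

theorem sum_mul_pairVec (c : Fin 3) (k l : ℤ) (g : Fin 3 → ℝ) :
    ∑ i, g i * (pairVec c k l i : ℝ) = k * g (windowPair c).1 + l * g (windowPair c).2 := by
  simp [pairVec, Finset.sum_add_distrib, mul_add, mul_comm]

theorem mag_pairVec_le (c : Fin 3) (k l : ℤ) : mag (pairVec c k l) ≤ |(k : ℝ)| + |(l : ℝ)| := by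
  unfold mag pairVec
  calc _ ≤ ∑ i, ((if i = (windowPair c).1 then |(k : ℝ)| else 0) +
        if i = (windowPair c).2 then |(l : ℝ)| else 0) := by
        refine Finset.sum_le_sum fun i _ => ?_
        push_cast
        refine (abs_add_le _ _).trans (add_le_add ?_ ?_) <;> split_ifs <;> simp
    _ = _ := by simp [Finset.sum_add_distrib]

/-- Every Liouville twist admits a lacunary sum of resonant terms. -/
theorem IsLiouvilleTwist.exists_isLacunary {ω₀ : Act d} {f : Fin 3 → ℝ → ℝ}
    (hf : IsLiouvilleTwist (freq3 hd ω₀) f) : ∃ χ m δ, IsLacunary hd ω₀ f χ m δ := by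
  have hpi := Real.pi_pos
  obtain ⟨a, b, hW⟩ := hf.exists_windows
  have hex : ∀ q : Bool × ℤ, ∃ χ : ℝ → ℝ, Function.support χ =
      {x | sgn q.1 * x ∈ Set.Ioo (a q.1 q.2) (b q.1 q.2)} ∧ ContDiff ℝ ∞ χ ∧
      Set.range χ ⊆ Set.Icc 0 1 := fun q =>
    (IsWindowSystem.isOpen_window q.1 _ _).exists_contDiff_support_eq
  choose χ hs hc hr using hex
  have hsupp : ∀ q x, χ q x ≠ 0 → sgn q.1 * x ∈ Set.Ioo (a q.1 q.2) (b q.1 q.2) := fun q x hx => by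
    have : x ∈ Function.support (χ q) := hx
    rw [hs q] at this
    exact this
  have hcs : ∀ q, HasCompactSupport (χ q) := fun q =>
    IsWindowSystem.hasCompactSupport_of_support (hsupp q)
  have hbd : ∀ q (s : ℕ), ∃ D : ℝ, 0 ≤ D ∧ ∀ i ≤ s, ∀ x, ‖iteratedFDeriv ℝ i (χ q) x‖ ≤ D :=
    fun q s => by
      have : ∀ i, ∃ D : ℝ, ∀ x, ‖iteratedFDeriv ℝ i (χ q) x‖ ≤ D := fun i =>
        ((hcs q).iteratedFDeriv i).exists_bound_of_continuous
          ((hc q).continuous_iteratedFDeriv (mod_cast le_top))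
      choose D hD using this
      refine ⟨∑ i ∈ Finset.range (s + 1), |D i|, Finset.sum_nonneg fun _ _ => abs_nonneg _,
        fun i hi x => (hD i x).trans ((le_abs_self _).trans ?_)⟩
      exact Finset.single_le_sum (f := fun i => |D i|) (fun _ _ => abs_nonneg _)
        (Finset.mem_range.2 (Nat.lt_succ_of_le hi))
  -- a bound for the derivatives of the terms, polynomial in the resonance
  have hterm : ∀ q (s : ℕ), ∃ E : ℝ, 0 ≤ E ∧ ∀ m δ, ∀ n ≤ s, ∀ x : Cover d,
      ‖iteratedFDeriv ℝ n (baseTerm hd (χ q) m δ) x‖ ≤ E * (1 + mag m) ^ s * √|δ| := fun q s => by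
    obtain ⟨D, hD0, hD⟩ := hbd q s
    refine ⟨2 * Real.pi * ∑ i ∈ Finset.range (s + 1), (2 : ℝ) ^ s * D * (2 * Real.pi + 1) ^ s,
      by positivity, fun m δ n hn x => ?_⟩
    have hm := mag_nonneg m
    refine (norm_iteratedFDeriv_baseTerm_le (hc q) m δ n x).trans ?_
    calc _ ≤ 2 * Real.pi * √|δ| * ∑ i ∈ Finset.range (s + 1),
          (2 : ℝ) ^ s * D * ((2 * Real.pi + 1) ^ s * (1 + mag m) ^ s) := by
          gcongr
          refine (Finset.sum_le_sum fun i hi => ?_).trans (Finset.sum_le_sum_of_subset_of_nonneg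
            (Finset.range_subset_range.2 (Nat.succ_le_succ hn)) fun _ _ _ => by positivity)
          have hin : i ≤ n := Nat.lt_succ_iff.1 (Finset.mem_range.1 hi)
          gcongr
          · calc (n.choose i : ℝ) ≤ 2 ^ n := by exact_mod_cast Nat.choose_le_two_pow n i
              _ ≤ 2 ^ s := pow_le_pow_right₀ one_le_two hn
          · exact hD i (hin.trans hn) _
          · rw [← mul_pow]
            calc (2 * Real.pi * mag m) ^ (n - i) ≤ ((2 * Real.pi + 1) * (1 + mag m)) ^ (n - i) := by
                  gcongr <;> linarith
              _ ≤ ((2 * Real.pi + 1) * (1 + mag m)) ^ s :=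
                  pow_le_pow_right₀ (by nlinarith) (by omega)
      _ = _ := by rw [Finset.mul_sum, Finset.mul_sum, Finset.sum_mul, Finset.sum_mul]
                  exact Finset.sum_congr rfl fun i _ => by ring
  obtain ⟨w, m, δ, hsmall, hlac⟩ := _root_.exists_isLacunary (hd := hd) (ω₀ := ω₀) (f := f) (χ := χ) hc
    (fun q x => hr q ⟨x, rfl⟩) (fun q => hW.flatAt_zero_of_support (hsupp q))
    (fun x hx => by
      obtain ⟨s, n, hx⟩ := hW.exists_mem hx
      refine ⟨(s, n), lt_of_le_of_ne (hr (s, n) ⟨x, rfl⟩).1 (Ne.symm ?_)⟩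
      have : x ∈ Function.support (χ (s, n)) := by rw [hs]; exact hx
      exact this)
    (fun s q m δ => ∀ n ≤ s, ∀ x : Cover d,
      ‖iteratedFDeriv ℝ n (baseTerm hd (χ q) m δ) x‖ ≤ (1 / 2) ^ s)
    (fun s q B hB => by
      obtain ⟨E, hE0, hE⟩ := hterm q s
      obtain ⟨u, v, hL, huv⟩ := hW.liouville q.1 q.2
      obtain ⟨k, l, hkl, hδ, hsm⟩ := hL.exists_small ((B + E) * 2 ^ s) (s + 1)
      set δ := k * u + l * v with hδdef
      set m := pairVec (windowType q.2) k l with hm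
      have hmag : 1 + mag m ≤ 1 + |(k : ℝ)| + |(l : ℝ)| := by
        linarith [mag_pairVec_le (windowType q.2) k l]
      have hmag0 : 1 ≤ 1 + mag m := by linarith [mag_nonneg m]
      have key : (B + E) * 2 ^ s * (1 + mag m) ^ (s + 1) * √|δ| ≤ 1 := by
        refine le_trans ?_ hsm
        gcongr
      refine ⟨m, δ, fun x hx => ?_, hδ, ?_, ?_, fun n hn x => (hE m δ n hn x).trans ?_⟩
      · rw [hm, sum_mul_pairVec, (huv x (hsupp q x hx)).1, (huv x (hsupp q x hx)).2]
      · rw [hm, sum_pairVec]; exact hkl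
      · refine le_trans ?_ key
        calc (1 + mag m) * √|δ| * B * 2 ^ s = B * 2 ^ s * (1 + mag m) ^ 1 * √|δ| := by ring
          _ ≤ _ := by gcongr <;> linarith
      · rw [one_div_pow, le_div_iff₀ (by positivity)]
        refine le_trans ?_ key
        calc E * (1 + mag m) ^ s * √|δ| * 2 ^ s = E * 2 ^ s * (1 + mag m) ^ s * √|δ| := by ring
          _ ≤ _ := by gcongr <;> linarith)
  refine ⟨_, m, δ, hlac fun n => ?_⟩
  choose E hE0 hE using hterm
  -- the `n`-th derivatives are controlled for the terms of index at least `n`; finitely many remain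
  refine ⟨fun s => if n ≤ s then (1 / 2) ^ s else E (w s) n * (1 + mag (m s)) ^ n * √|δ s|, ?_,
    fun s x => ?_⟩
  · refine (summable_nat_add_iff n).1 (((summable_nat_add_iff n).2 summable_geometric_two).congr
      fun s => ?_)
    simp
  · dsimp only
    split_ifs with hns
    · exact hsmall s n hns x
    · exact hE _ _ _ _ n le_rfl x

end Windows

/-! ### Oscillating orbits -/

section Oscillation

variable {d : ℕ} {hd : 4 ≤ d}

/-- The derivatives vanish to the left of `0`, hence at `0`. -/
theorem flatAt_expNegInvGlue : FlatAt expNegInvGlue 0 := by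
  refine FlatAt.of_mem_closure expNegInvGlue.contDiff ?_
  have h : Set.Iio (0 : ℝ) ⊆ interior {y | expNegInvGlue y = 0} :=
    interior_maximal (fun y hy => expNegInvGlue.zero_of_nonpos (le_of_lt hy)) isOpen_Iio
  refine closure_mono h ?_
  rw [closure_Iio]
  exact Set.mem_Iic.2 le_rfl

/-- Any open set not containing `0` is the positivity set of a smooth function that is flat at `0`. -/
theorem exists_flat_support {s : Set ℝ} (hs : IsOpen s) (h0 : (0 : ℝ) ∉ s) :
    ∃ C : ℝ → ℝ, ContDiff ℝ ∞ C ∧ FlatAt C 0 ∧ (∀ x, 0 ≤ C x) ∧ (∀ x ∈ s, 0 < C x) ∧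
      ∀ x ∉ s, C x = 0 := by
  obtain ⟨g, hg, cg, hr⟩ := hs.exists_contDiff_support_eq (n := ⊤)
  have c1 : ContDiff ℝ ∞ fun x : ℝ => expNegInvGlue (x ^ 2) :=
    expNegInvGlue.contDiff.comp (contDiff_id.pow 2)
  have g0 : ∀ x, 0 ≤ g x := fun x => (hr ⟨x, rfl⟩).1
  refine ⟨fun x => expNegInvGlue (x ^ 2) * g x, c1.mul cg, ?_, fun x =>
    mul_nonneg (expNegInvGlue.nonneg _) (g0 x), fun x hx => mul_pos (expNegInvGlue.pos_of_pos ?_) ?_,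
    fun x hx => ?_⟩
  · refine FlatAt.smul_left ?_ c1 cg
    exact FlatAt.comp (f := fun x : ℝ => x ^ 2) (by simpa using flatAt_expNegInvGlue)
      expNegInvGlue.contDiff (contDiff_id.pow 2)
  · have : x ≠ 0 := fun h => h0 (h ▸ hx)
    positivity
  · refine lt_of_le_of_ne (g0 x) (Ne.symm ?_)
    have : x ∈ Function.support g := hg ▸ hx
    exact this
  · have : x ∉ Function.support g := hg ▸ hx
    change expNegInvGlue (x ^ 2) * g x = 0
    rw [Function.notMem_support.1 this, mul_zero]

/-- The resonance `(1, -1)` in the pair of type `c`. -/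
abbrev diffVec (c : Fin 3) : Fin 3 → ℤ := pairVec c 1 (-1)

/-- If one or two of the three pairs are active, two indices belong to exactly one active pair. -/
theorem exists_two_indices (A : Finset (Fin 3)) (h1 : A.Nonempty) (h2 : A ≠ Finset.univ) :
    ∃ i₁ i₂ : Fin 3, i₁ ≠ i₂ ∧ ∀ i, i = i₁ ∨ i = i₂ →
      ∃ c ∈ A, (diffVec c i = 1 ∨ diffVec c i = -1) ∧ ∀ c' ∈ A, c' ≠ c → diffVec c' i = 0 := by
  revert A
  decide

/-- A uniformly rotating angle reaches any phase within one period of any given time; the phases needed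
are those where the sine is `±1`. -/
theorem exists_sin_eq (θ : ℝ) {ν : ℝ} (hν : ν ≠ 0) (t₀ : ℝ) {e : ℝ} (he : e = 1 ∨ e = -1) :
    ∃ t, |t - t₀| ≤ 1 / |ν| ∧ Real.sin (2 * Real.pi * (θ + t * ν)) = e := by
  -- move `t₀` forward until the angle takes the required value
  obtain ⟨q, hq⟩ : ∃ q : ℝ, Real.sin (2 * Real.pi * q) = e := by
    rcases he with rfl | rfl
    · exact ⟨1 / 4, by rw [show 2 * Real.pi * (1 / 4) = Real.pi / 2 by ring, Real.sin_pi_div_two]⟩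
    · exact ⟨-1 / 4, by
        rw [show 2 * Real.pi * (-1 / 4) = -(Real.pi / 2) by ring, Real.sin_neg, Real.sin_pi_div_two]⟩
  set z := q - (θ + t₀ * ν)
  refine ⟨t₀ + Int.fract z / ν, ?_, ?_⟩
  · rw [add_sub_cancel_left, abs_div, abs_of_nonneg (Int.fract_nonneg z)]
    gcongr
    exact (Int.fract_lt_one z).le
  · have : 2 * Real.pi * (θ + (t₀ + Int.fract z / ν) * ν) =
        2 * Real.pi * q + ((-⌊z⌋ : ℤ) : ℝ) * (2 * Real.pi) := by
      have h1 := Int.floor_add_fract z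
      have h2 : (t₀ + Int.fract z / ν) * ν = t₀ * ν + Int.fract z := by field_simp
      rw [h2]
      have h3 : θ + t₀ * ν = q - z := by simp [z]
      push_cast
      linear_combination (2 * Real.pi) * h3 + (2 * Real.pi) * h1
    rw [this, Real.sin_add_int_mul_two_pi, hq]

/-- After the shear, two actions oscillate along every orbit on which `r_1 + r_2 + r_3` is unbounded
and dominates the other actions; a bounded error is allowed. -/
theorem exists_two_oscillating {Φ : ℝ → Cover d → Cover d} {p : Cover d} {fr : Fin 3 → ℝ}
    (hph : ∀ t i, (Φ t p).1 (e3 hd i) = p.1 (e3 hd i) + t * fr i)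
    (hr4 : ∀ t, r4 hd (Φ t p) = r4 hd p)
    (hkey : ∀ (b : Bool) (M τ : ℝ), ∃ t₀, M < sgn b * t₀ ∧ ∀ t, |t - t₀| ≤ τ →
        M ≤ |yL hd (Φ t p)| ∧ ∀ i, M * |(Φ t p).2 (e3 hd i)| ≤ yL hd (Φ t p) ^ 2)
    {C : Fin 3 → ℝ → ℝ} (hC : ∀ c x, 0 ≤ C c x)
    (hfr : ∀ c, 0 < C c (r4 hd p) → fr (windowPair c).1 ≠ fr (windowPair c).2)
    (hne : ∃ c, 0 < C c (r4 hd p)) (hne' : ∃ c, C c (r4 hd p) = 0) {ε : ℝ} (hε : 0 < ε) :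
    ∃ i₁ i₂ : Fin 3, i₁ ≠ i₂ ∧ ∀ i, i = i₁ ∨ i = i₂ → ∀ (b b' : Bool) (N : ℝ), ∃ t, N < sgn b * t ∧
      N < sgn b' * ((Φ t p).2 (e3 hd i) - ε * shearKick hd Finset.univ C 2 diffVec (Φ t p) i) := by
  have hpi := Real.pi_pos
  set x := r4 hd p with hx
  let A : Finset (Fin 3) := Finset.univ.filter fun c => 0 < C c x
  have hA : ∀ c, c ∈ A ↔ 0 < C c x := fun c => by simp [A]
  obtain ⟨i₁, i₂, h12, hi⟩ := exists_two_indices A (by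
    obtain ⟨c, hc⟩ := hne; exact ⟨c, (hA c).2 hc⟩) (fun h => by
    obtain ⟨c, hc⟩ := hne'
    have := (hA c).1 (h ▸ Finset.mem_univ c)
    linarith)
  refine ⟨i₁, i₂, h12, fun i hi' b b' N => ?_⟩
  obtain ⟨c, hcA, hσ, hother⟩ := hi i hi'
  have hc0 := (hA c).1 hcA
  set ν := fr (windowPair c).1 - fr (windowPair c).2 with hν
  have hν0 : ν ≠ 0 := sub_ne_zero.2 (hfr c hc0)
  obtain ⟨σ, hσ1, hσ2⟩ : ∃ σ : ℝ, (diffVec c i : ℝ) = σ ∧ (σ = 1 ∨ σ = -1) := by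
    rcases hσ with h | h
    · exact ⟨1, by rw [h]; simp, Or.inl rfl⟩
    · exact ⟨-1, by rw [h]; simp, Or.inr rfl⟩
  have hkick : ∀ t, shearKick hd Finset.univ C 2 diffVec (Φ t p) i =
      2 * Real.pi * (C c x * yL hd (Φ t p) ^ 2 *
        Real.sin (2 * Real.pi * phaseL hd (diffVec c) (Φ t p))) * σ := fun t => by
    have e : r4L hd (Φ t p) = x := hr4 t
    simp only [shearKick, Finset.sum_apply, Pi.smul_apply, smul_eq_mul, e]
    rw [Finset.sum_eq_single c]
    · rw [hσ1]
    · intro c' _ hc'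
      by_cases h : c' ∈ A
      · rw [hother c' h hc']; simp
      · have : C c' x = 0 := le_antisymm (not_lt.1 fun h' => h ((hA c').2 h')) (hC c' x)
        rw [this]; simp
    · simp
  have hphase : ∀ t, phaseL hd (diffVec c) (Φ t p) = phaseL hd (diffVec c) p + t * ν := fun t => by
    have e : ∀ z : Cover d, phaseL hd (diffVec c) z =
        z.1 (e3 hd (windowPair c).1) - z.1 (e3 hd (windowPair c).2) := fun z => by
      rw [phaseL_apply]
      have := sum_mul_pairVec c 1 (-1) (fun i => z.1 (e3 hd i))
      simp only [mul_comm (z.1 _)] at this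
      rw [this]; push_cast; ring
    rw [e, e, hph, hph, hν]; ring
  have hD : 0 < 2 * Real.pi * ε * C c x := by positivity
  set D := 2 * Real.pi * ε * C c x with hDdef
  -- the kick is `D Y` at the right phase, `Y = (r_1 + r_2 + r_3)²`; this choice makes `D Y / 2` exceed
  -- both the action before the kick and `N`
  obtain ⟨t₀, ht0, h⟩ := hkey b (max (2 / D) (|N| + 1 + 1 / |ν| + 2 * (|N| + 1) / D)) (1 / |ν|)
  set M := max (2 / D) (|N| + 1 + 1 / |ν| + 2 * (|N| + 1) / D) with hM
  obtain ⟨t, ht, hsin⟩ := exists_sin_eq (phaseL hd (diffVec c) p) hν0 t₀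
    (e := -(sgn b' * σ)) (by
      rcases sgn_eq b' with h | h <;> rcases hσ2 with h' | h' <;> simp [h, h'])
  obtain ⟨hy, hr⟩ := h t ht
  have hν1 : 0 < 1 / |ν| := by positivity
  have hM1 : 2 / D ≤ M := le_max_left _ _
  have hM2 : |N| + 1 + 1 / |ν| + 2 * (|N| + 1) / D ≤ M := le_max_right _ _
  have hND : 0 ≤ 2 * (|N| + 1) / D := by positivity
  have hN := le_abs_self N
  have hN0 := abs_nonneg N
  refine ⟨t, ?_, ?_⟩
  · have h1 : |sgn b * (t - t₀)| ≤ 1 / |ν| := by rw [abs_sgn_mul]; exact ht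
    have h2 := (abs_le.1 h1).1
    rw [mul_sub] at h2
    linarith
  · rw [hkick, hphase, hsin]
    have hss : σ * σ = 1 := by rcases hσ2 with h | h <;> rw [h] <;> norm_num
    set Y := yL hd (Φ t p) ^ 2 with hY
    have hY1 : M ≤ Y := by
      have h3 : 1 ≤ M := by linarith
      have h4 : M ^ 2 ≤ Y := by
        rw [hY, ← sq_abs (yL hd _)]; exact pow_le_pow_left₀ (by linarith) hy 2
      nlinarith
    have e : sgn b' * ((Φ t p).2 (e3 hd i) - ε * (2 * Real.pi * (C c x * Y * -(sgn b' * σ)) * σ)) =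
        sgn b' * (Φ t p).2 (e3 hd i) + D * Y := by
      rw [hDdef]
      linear_combination (2 * Real.pi * ε * C c x * Y * (sgn b' * sgn b')) * hss +
        (2 * Real.pi * ε * C c x * Y) * sgn_mul_sgn b'
    rw [e]
    have h5 : |sgn b' * (Φ t p).2 (e3 hd i)| ≤ D * Y / 2 := by
      rw [abs_sgn_mul]
      have h6 : 2 / D * |(Φ t p).2 (e3 hd i)| ≤ Y :=
        (mul_le_mul_of_nonneg_right hM1 (abs_nonneg _)).trans (hr i)
      rw [div_mul_eq_mul_div, div_le_iff₀ hD] at h6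
      linarith
    have h7 : N < D * Y / 2 := by
      have h8 : 2 * (|N| + 1) / D ≤ Y := by linarith
      rw [div_le_iff₀ hD] at h8
      linarith
    linarith [(abs_le.1 h5).1]

/-! ### Density -/

/-- The Hamiltonians `(H_0 + ε G) ∘ (Id + ε Z) ∘ U'` oscillate and approximate `H_0 ∘ U`. Here `G` is a
lacunary sum of resonant terms, `Id + ε Z` a shear whose size is quadratic in `r_1 + r_2 + r_3`, and
`U'` agrees with `U` on a large set and moves the actions by a bounded amount, so that it does not
affect oscillations. -/
theorem dense_oscillatingSet {ω₀ : Act d} {f : Fin 3 → ℝ → ℝ}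
    (hf : IsLiouvilleTwist (freq3 hd ω₀) f) : Dense (oscillatingSet hd ω₀ f) := by
  obtain ⟨χ, m, δ, hL⟩ := hf.exists_isLacunary
  obtain ⟨a, b, hW⟩ := hf.exists_windows
  have cf := hf.1
  have cH0 := contDiff_H0 (hd := hd) (ω₀ := ω₀) cf
  set G : Cover d → ℝ := fun x => ∑' s, baseTerm hd (χ s) (m s) (δ s) x with hG
  have cG : ContDiff ℝ ∞ G := hL.contDiff_tsum
  have pG : AnglePeriodic G := IsLacunary.anglePeriodic_tsum χ m δ
  have pH0 : AnglePeriodic (H0 hd ω₀ f) := fun k x => rfl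
  -- the coefficients of the shear are positive exactly on the windows of the given type
  let S : Fin 3 → Set ℝ := fun c => {x | ∃ s n, windowType n = c ∧ sgn s * x ∈ Set.Ioo (a s n) (b s n)}
  have hS : ∀ c, IsOpen (S c) := fun c => by
    have : S c = ⋃ s, ⋃ n, ⋃ (_ : windowType n = c), {x | sgn s * x ∈ Set.Ioo (a s n) (b s n)} := by
      ext x; simp only [S, Set.mem_iUnion, Set.mem_ofPred_eq, exists_prop]
    rw [this]
    exact isOpen_iUnion fun s => isOpen_iUnion fun n => isOpen_iUnion fun _ =>
      IsWindowSystem.isOpen_window s _ _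
  have hS0 : ∀ c, (0 : ℝ) ∉ S c := fun c ⟨s, n, _, h⟩ => by
    have h1 := (hW.cover s).1 n
    have h2 := h.1
    rw [mul_zero] at h2
    linarith
  choose C cC fC C0 Cpos Czero using fun c => exists_flat_support (hS c) (hS0 c)
  have hsum : ∀ c ∈ (Finset.univ : Finset (Fin 3)), ∑ i, diffVec c i = 0 := fun c _ => by
    rw [sum_pairVec]; rfl
  set Z : Cover d → Cover d := shearVec hd Finset.univ C 2 diffVec with hZ
  have hZZ : ∀ (c : ℝ) x, Z (x + c • Z x) = Z x := fun c x => shearVec_add_shearVec (Or.inr hsum) c x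
  have hZε : ∀ (ε : ℝ) x, shearVec hd Finset.univ (fun c r => ε * C c r) 2 diffVec x = ε • Z x :=
    fun ε x => by
      have e : ∀ c r, deriv (fun r => ε * C c r) r = ε * deriv (C c) r := fun c r => by
        simp
      have hk : shearKick hd Finset.univ (fun c r => ε * C c r) 2 diffVec x =
          ε • shearKick hd Finset.univ C 2 diffVec x := by
        simp only [shearKick, Finset.smul_sum, smul_smul]
        exact Finset.sum_congr rfl fun c _ => by congr 1; ring
      simp only [hZ, shearVec, e, hk, vec3_smul, mul_assoc, ← Finset.mul_sum, Prod.smul_mk, smul_add,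
        smul_smul]
  have cZ : ContDiff ℝ ∞ Z := by
    have := contDiff_hamJ_fderiv (contDiff_shearHam (hd := hd) (s := Finset.univ) (n := 2)
      (m := diffVec) fun c _ => cC c)
    have e : (fun x => hamJ (fderiv ℝ (shearHam hd Finset.univ C 2 diffVec) x)) = Z :=
      funext (hamJ_fderiv_shearHam (hd := hd) (n := 2) (m := diffVec) fun c _ => cC c)
    rwa [e] at this
  have hT : ∀ ε : ℝ, IsFlatExactDiffeo hd fun x => x + ε • Z x := fun ε => by
    simp only [← hZε]
    exact isFlatExactDiffeo_shear (fun c _ => contDiff_const.mul (cC c))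
      (fun c _ => (fC c).smul_right (f := fun _ => ε) contDiff_const (cC c)) (Or.inr hsum)
  have rT : ∀ ε : ℝ, Function.RightInverse (fun x => x - ε • Z x) fun x => x + ε • Z x :=
    fun ε x => by
      have := hZZ (-ε) x
      rw [neg_smul, ← sub_eq_add_neg] at this
      simp only [this, sub_add_cancel]
  -- the oscillating Hamiltonians
  have main : ∀ U', IsFlatExactDiffeo hd U' → Tame U' → ∀ ε : ℝ, 0 < ε → ∀ H : SmoothHam d,
      (∀ x, H.1 x = H0 hd ω₀ f (U' x + ε • Z (U' x)) + ε * G (U' x + ε • Z (U' x))) →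
      H ∈ Subtype.val '' oscillatingSet hd ω₀ f := by
    intro U' hU' tU' ε hε H hH
    let K : SmoothHam d := ⟨fun x => H0 hd ω₀ f x + ε * G x, cH0.add (contDiff_const.mul cG),
      fun k x => by simp only [pG k x, pH0 k x]⟩
    have hK : K ∈ closure (conjClass hd ω₀ f) := hL.mem_closure cf fun x => rfl
    have hX := (hT ε).comp hU'
    have hHc : H ∈ closure (conjClass hd ω₀ f) := mem_closure_conjClass_precomp hK hX hH
    refine ⟨⟨H, hHc⟩, ?_, rfl⟩
    obtain ⟨Φ, hΦ, hp⟩ := hL.exists_flow cf hε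
    obtain ⟨W', cW', lW', rW'⟩ := hU'.2.1
    have hflow := hΦ.conj K.2.1 hX (W := fun x => W' (x - ε • Z x))
      (cW'.comp (contDiff_id.sub (cZ.const_smul ε)))
      (fun x => by simp only [hZZ, add_sub_cancel_right, lW' x])
      (fun x => by
        simp only [rW' (x - ε • Z x)]
        exact rT ε x)
    have e : (fun x => H0 hd ω₀ f (U' x + ε • Z (U' x)) +
      ε * ∑' s, baseTerm hd (χ s) (m s) (δ s) (U' x + ε • Z (U' x))) = H.1 := (funext hH).symm
    rw [e] at hflow
    refine ⟨_, hflow, fun p hp0 => ?_⟩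
    set z := U' p + ε • Z (U' p) with hz
    have hz0 : r4 hd z ≠ 0 := by rw [hz, hX.2.2.2.2.1]; exact hp0
    obtain ⟨h1, h2, h3⟩ := hp z
    obtain ⟨i₁, i₂, h12, hosc⟩ := exists_two_oscillating (hd := hd) (p := z)
      (fr := fun i => freq3 hd ω₀ i + f i (r4 hd z)) h1 h2 (h3 hz0) (C := C) C0
      (fun c hc => by
        have hmem : r4 hd z ∈ S c := by
          by_contra hcon
          rw [Czero c _ hcon] at hc
          exact lt_irrefl _ hc
        obtain ⟨s, n, rfl, hx⟩ := hmem
        obtain ⟨u, v, hL', huv⟩ := hW.liouville s n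
        obtain ⟨e1, e2⟩ := huv _ hx
        intro heq
        rw [← e1, ← e2, heq] at hL'
        have := hL'.1 1 (-1) (by push_cast; ring)
        simp at this)
      (by
        obtain ⟨s, n, hx⟩ := hW.exists_mem hz0
        exact ⟨windowType n, Cpos _ _ ⟨s, n, rfl, hx⟩⟩)
      (by
        obtain ⟨c, hc⟩ := hW.exists_type_forall_notMem (r4 hd z)
        exact ⟨c, Czero _ _ fun ⟨s, n, ht, hx⟩ => hc s n ht hx⟩) hε
    obtain ⟨D, hD⟩ := tU'
    have hbound : ∀ (x : Cover d) (j : Fin d), |(W' x).2 j - x.2 j| ≤ D := fun x j => by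
      have h4 := hD (W' x)
      rw [rW' x, norm_sub_rev] at h4
      exact (PiLp.norm_apply_le ((W' x).2 - x.2) j).trans h4
    have hfin : ∀ i, i = i₁ ∨ i = i₂ →
        ActionOscillates (fun t x => W' (Φ t (U' x + ε • Z (U' x)) - ε • Z (Φ t (U' x + ε • Z (U' x))))) p
          (e3 hd i) := fun i hi => by
      rw [actionOscillates_iff]
      intro b b' N
      obtain ⟨t, ht1, ht2⟩ := hosc i hi b b' (N + |D|)
      refine ⟨t, by linarith [abs_nonneg D], ?_⟩
      have h5 := hbound (Φ t z - ε • Z (Φ t z)) (e3 hd i)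
      rw [← abs_sgn_mul b'] at h5
      have h6 := (abs_le.1 h5).1
      have h7 : (Φ t z - ε • Z (Φ t z)).2 (e3 hd i) = (Φ t z).2 (e3 hd i) -
          ε * shearKick hd Finset.univ C 2 diffVec (Φ t z) i := by
        simp [hZ, shearVec, vec3_e3]
      rw [mul_sub, h7] at h6
      have := le_abs_self D
      dsimp only
      rw [← hz]
      linarith
    exact ⟨i₁, i₂, h12, hfin i₁ (Or.inl rfl), hfin i₂ (Or.inr rfl)⟩
  -- for `ε → 0` one obtains `H_0 ∘ U'`, which agrees with `H_0 ∘ U` on large sets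
  refine Subtype.dense_iff.2 (closure_minimal ?_ isClosed_closure)
  rintro H ⟨U, hU, hH⟩
  have htame := fun R : ℕ => exists_tame_eq hU ((R : ℝ) + 1) (by positivity)
  choose U' hU' tU' hUU' using htame
  have pU' := fun R => (hU' R).2.2.1
  let F : ℕ → ℝ → SmoothHam d := fun R ε =>
    ⟨fun x => H0 hd ω₀ f (U' R x + ε • Z (U' R x)) + ε * G (U' R x + ε • Z (U' R x)),
      (cH0.comp ((hT ε).comp (hU' R)).1).add (contDiff_const.mul (cG.comp ((hT ε).comp (hU' R)).1)),
      fun k x => by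
        have := ((hT ε).comp (hU' R)).2.2.1 k x
        dsimp only at this ⊢
        rw [this, pH0 k (U' R x + ε • Z (U' R x)), pG k (U' R x + ε • Z (U' R x))]⟩
  have hF : ∀ R, Continuous (F R) := fun R => by
    refine SmoothHam.continuous_of_contDiff ?_
    have c1 : ContDiff ℝ ∞ fun q : ℝ × Cover d => U' R q.2 := (hU' R).1.comp contDiff_snd
    have c2 : ContDiff ℝ ∞ fun q : ℝ × Cover d => U' R q.2 + q.1 • Z (U' R q.2) :=
      c1.add (contDiff_fst.smul (cZ.comp c1))
    exact (cH0.comp c2).add (contDiff_fst.mul (cG.comp c2))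
  have h0 : ∀ R, F R 0 ∈ closure (Subtype.val '' oscillatingSet hd ω₀ f) := fun R => by
    refine mem_closure_of_tendsto (b := 𝓝[>] (0 : ℝ)) (f := F R)
      ((hF R).continuousAt.mono_left nhdsWithin_le_nhds) ?_
    filter_upwards [self_mem_nhdsWithin] with ε hε
    exact main _ (hU' R) (tU' R) ε hε _ fun x => rfl
  refine isClosed_closure.mem_of_tendsto (b := atTop) (f := fun R => F R 0) ?_ (Eventually.of_forall h0)
  refine SmoothHam.tendsto_nhds_of fun k K hK ε hε => ?_
  obtain ⟨R₀, hR₀⟩ := hK.isBounded.exists_norm_le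
  obtain ⟨N, hN⟩ := exists_nat_ge R₀
  filter_upwards [eventually_ge_atTop N] with R hR x hx
  have heq : (F R 0).1 =ᶠ[𝓝 x] H.1 := by
    have hxR : ‖x.2‖ < (R : ℝ) + 1 := by
      have h1 := norm_snd_le x
      have h2 := hR₀ x hx
      have h3 : (N : ℝ) ≤ R := by exact_mod_cast hR
      linarith
    have : ∀ᶠ y : Cover d in 𝓝 x, ‖y.2‖ < (R : ℝ) + 1 :=
      continuous_snd.norm.continuousAt.eventually_lt continuousAt_const hxR
    filter_upwards [this] with y hy
    simp [F, hH, hUU' R y hy]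
  rw [(heq.iteratedFDeriv ℝ k).self_of_nhds, sub_self, norm_zero]
  exact hε

theorem oscillatingSet_subset_escapingSet (ω₀ : Act d) (f : Fin 3 → ℝ → ℝ) :
    oscillatingSet hd ω₀ f ⊆ escapingSet hd ω₀ f := by
  rintro H ⟨Φ, hΦ, h⟩
  refine ⟨Φ, hΦ, fun p hp => ?_⟩
  obtain ⟨i, -, -, h1, -⟩ := h p hp
  exact h1.escapes

end Oscillation

/-! ### Gevrey functions -/

section Gevrey

variable {E : Type*} [NormedAddCommGroup E] [NormedSpace ℝ E] {σ : ℝ}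

/-- The functions whose Gevrey norms `‖F‖_{σ,L}` are finite for every `L`. The class is invariant
under scaling, which is what makes it convenient for bump functions of arbitrary width. -/
def IsGevrey (σ : ℝ) (F : E → ℝ) : Prop :=
  ContDiff ℝ ∞ F ∧ ∀ L : ℝ, 0 < L → ∃ C : ℝ, 0 ≤ C ∧ ∀ (k : ℕ) (x : E),
    L ^ k * ‖iteratedFDeriv ℝ k F x‖ ≤ C * (k.factorial : ℝ) ^ σ

/-- The exponent `σ ≥ 1` absorbs the binomial coefficient. -/
theorem choose_mul_rpow_factorial_le (hσ : 1 ≤ σ) {i n : ℕ} (h : i ≤ n) :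
    (n.choose i : ℝ) * ((i.factorial : ℝ) ^ σ * ((n - i).factorial : ℝ) ^ σ) ≤
      (n.factorial : ℝ) ^ σ := by
  have h1 : (n.factorial : ℝ) = n.choose i * (i.factorial * (n - i).factorial) := by
    rw [← mul_assoc]
    exact_mod_cast (Nat.choose_mul_factorial_mul_factorial h).symm
  rw [h1, Real.mul_rpow (by positivity) (by positivity), Real.mul_rpow (by positivity) (by positivity)]
  gcongr
  exact Real.self_le_rpow_of_one_le (by exact_mod_cast Nat.choose_pos h) hσ

theorem one_le_rpow_factorial (hσ : 0 ≤ σ) (n : ℕ) : 1 ≤ (n.factorial : ℝ) ^ σ :=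
  Real.one_le_rpow (by exact_mod_cast n.factorial_pos) hσ

/-- The Leibniz sum of two sequences with Gevrey bounds at `2 L` satisfies a Gevrey bound at `L`. -/
theorem gevrey_leibniz (hσ : 1 ≤ σ) {L : ℝ} (hL : 0 < L) {p q : ℕ → ℝ} {A B : ℝ} (hA : 0 ≤ A)
    (hB : 0 ≤ B) (hp0 : ∀ n, 0 ≤ p n) (hq0 : ∀ n, 0 ≤ q n)
    (hp : ∀ n, (2 * L) ^ n * p n ≤ A * (n.factorial : ℝ) ^ σ)
    (hq : ∀ n, (2 * L) ^ n * q n ≤ B * (n.factorial : ℝ) ^ σ) (n : ℕ) :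
    L ^ n * ∑ i ∈ Finset.range (n + 1), (n.choose i : ℝ) * p i * q (n - i) ≤
      A * B * (n.factorial : ℝ) ^ σ := by
  have h2 : (0 : ℝ) < 2 ^ n := by positivity
  rw [← mul_le_mul_iff_right₀ h2]
  calc (2 : ℝ) ^ n * (L ^ n * ∑ i ∈ Finset.range (n + 1), (n.choose i : ℝ) * p i * q (n - i))
      = ∑ i ∈ Finset.range (n + 1),
          (n.choose i : ℝ) * (((2 * L) ^ i * p i) * ((2 * L) ^ (n - i) * q (n - i))) := by
        rw [← mul_assoc, ← mul_pow, Finset.mul_sum]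
        refine Finset.sum_congr rfl fun i hi => ?_
        have hin : i ≤ n := Nat.lt_succ_iff.1 (Finset.mem_range.1 hi)
        rw [← pow_sub_mul_pow (2 * L) hin]
        ring
    _ ≤ ∑ i ∈ Finset.range (n + 1), A * B * (n.factorial : ℝ) ^ σ := by
        refine Finset.sum_le_sum fun i hi => ?_
        have hin : i ≤ n := Nat.lt_succ_iff.1 (Finset.mem_range.1 hi)
        calc (n.choose i : ℝ) * (((2 * L) ^ i * p i) * ((2 * L) ^ (n - i) * q (n - i)))
            ≤ (n.choose i : ℝ) * ((A * (i.factorial : ℝ) ^ σ) * (B * ((n - i).factorial : ℝ) ^ σ)) := by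
              have := hp0 i
              have := hq0 (n - i)
              exact mul_le_mul_of_nonneg_left (mul_le_mul (hp i) (hq _) (by positivity) (by positivity))
                (by positivity)
          _ = A * B * ((n.choose i : ℝ) * ((i.factorial : ℝ) ^ σ * ((n - i).factorial : ℝ) ^ σ)) := by
              ring
          _ ≤ _ := by gcongr; exact choose_mul_rpow_factorial_le hσ hin
    _ = (n + 1 : ℕ) * (A * B * (n.factorial : ℝ) ^ σ) := by simp
    _ ≤ 2 ^ n * (A * B * (n.factorial : ℝ) ^ σ) := by
        gcongr
        exact_mod_cast Nat.lt_two_pow_self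

namespace IsGevrey

theorem const (hσ : 0 ≤ σ) (c : ℝ) : IsGevrey σ fun _ : E => c := by
  refine ⟨contDiff_const, fun L _ => ⟨|c|, abs_nonneg c, fun k x => ?_⟩⟩
  have h1 := one_le_rpow_factorial hσ k
  rcases k with _ | k
  · simp
  · rw [iteratedFDeriv_const_of_ne (Nat.succ_ne_zero k)]
    simp only [Pi.zero_apply, norm_zero, mul_zero]
    positivity

theorem mul (hσ : 1 ≤ σ) {F G : E → ℝ} (hF : IsGevrey σ F) (hG : IsGevrey σ G) :
    IsGevrey σ fun x => F x * G x := by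
  refine ⟨hF.1.mul hG.1, fun L hL => ?_⟩
  obtain ⟨A, hA, hFA⟩ := hF.2 (2 * L) (by positivity)
  obtain ⟨B, hB, hGB⟩ := hG.2 (2 * L) (by positivity)
  refine ⟨A * B, by positivity, fun n x => ?_⟩
  refine le_trans ?_ (gevrey_leibniz hσ hL hA hB (fun _ => norm_nonneg _) (fun _ => norm_nonneg _)
    (fun k => hFA k x) (fun k => hGB k x) n)
  gcongr
  exact norm_iteratedFDeriv_mul_le hF.1 hG.1 x (mod_cast le_top)

theorem comp_affine {F : ℝ → ℝ} (hF : IsGevrey σ F) (a b : ℝ) : IsGevrey σ fun x => F (a * x + b) := by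
  have hb : ContDiff ℝ ∞ fun x => F (x + b) := hF.1.comp (contDiff_id.add contDiff_const)
  refine ⟨hF.1.comp ((contDiff_const.mul contDiff_id).add contDiff_const), fun L hL => ?_⟩
  obtain ⟨C, hC, h⟩ := hF.2 (L * (|a| + 1)) (by positivity)
  refine ⟨C, hC, fun k x => le_trans ?_ (h k (a * x + b))⟩
  have h1 := norm_iteratedFDeriv_comp_clm_le hb (ContinuousLinearMap.mul ℝ ℝ a) k x
  have h2 : iteratedFDeriv ℝ k (fun x => F (x + b)) (a * x) = iteratedFDeriv ℝ k F (a * x + b) := by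
    rw [iteratedFDeriv_comp_add_right]
  simp only [ContinuousLinearMap.mul_apply'] at h1
  rw [h2] at h1
  have h3 : ‖ContinuousLinearMap.mul ℝ ℝ a‖ ≤ |a| + 1 := by
    rw [ContinuousLinearMap.opNorm_mul_apply, Real.norm_eq_abs]; linarith
  calc _ ≤ L ^ k * (‖iteratedFDeriv ℝ k F (a * x + b)‖ * (|a| + 1) ^ k) := by
        gcongr
        exact h1.trans (by gcongr)
    _ = _ := by rw [mul_pow]; ring

/-- A bounded antiderivative of a Gevrey function is Gevrey. -/
theorem of_deriv (hσ : 0 ≤ σ) {F f : ℝ → ℝ} (hf : IsGevrey σ f) (hF : ∀ x, HasDerivAt F (f x) x)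
    {B : ℝ} (hB : ∀ x, |F x| ≤ B) : IsGevrey σ F := by
  have hd : deriv F = f := funext fun x => (hF x).deriv
  have cF : ContDiff ℝ ∞ F := contDiff_infty_iff_deriv.2
    ⟨fun x => (hF x).differentiableAt, hd ▸ hf.1⟩
  refine ⟨cF, fun L hL => ?_⟩
  obtain ⟨C, hC, h⟩ := hf.2 L hL
  have hB0 : 0 ≤ B := (abs_nonneg _).trans (hB 0)
  refine ⟨B + L * C, by positivity, fun k x => ?_⟩
  rcases k with _ | k
  · simp only [pow_zero, norm_iteratedFDeriv_zero, one_mul, Nat.factorial_zero, Nat.cast_one,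
      Real.one_rpow, mul_one, Real.norm_eq_abs]
    have := hB x
    nlinarith
  · rw [norm_iteratedFDeriv_eq_norm_iteratedDeriv, iteratedDeriv_succ', hd,
      ← norm_iteratedFDeriv_eq_norm_iteratedDeriv (𝕜 := ℝ)]
    calc L ^ (k + 1) * ‖iteratedFDeriv ℝ k f x‖ = L * (L ^ k * ‖iteratedFDeriv ℝ k f x‖) := by ring
      _ ≤ L * (C * (k.factorial : ℝ) ^ σ) := mul_le_mul_of_nonneg_left (h k x) hL.le
      _ ≤ L * (C * ((k + 1).factorial : ℝ) ^ σ) := by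
          gcongr
          exact Nat.le_succ k
      _ ≤ (B + L * C) * ((k + 1).factorial : ℝ) ^ σ := by
          have := one_le_rpow_factorial hσ (k + 1)
          nlinarith

end IsGevrey

/-- A series whose terms satisfy summable Gevrey bounds may be differentiated term by term. -/
theorem summable_gevrey {ι : Type*} {F : ι → E → ℝ} (hF : ∀ i, ContDiff ℝ ∞ (F i)) {v : ι → ℝ}
    (hv : Summable v) {L : ℝ} (hL : 0 < L)
    (h : ∀ i (k : ℕ) x, L ^ k * ‖iteratedFDeriv ℝ k (F i) x‖ ≤ v i * (k.factorial : ℝ) ^ σ) :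
    ContDiff ℝ ∞ (fun x => ∑' i, F i x) ∧
    (∀ (k : ℕ) x, iteratedFDeriv ℝ k (fun x => ∑' i, F i x) x = ∑' i, iteratedFDeriv ℝ k (F i) x) ∧
    ∀ (k : ℕ) x, L ^ k * ‖iteratedFDeriv ℝ k (fun x => ∑' i, F i x) x‖ ≤
      (∑' i, v i) * (k.factorial : ℝ) ^ σ := by
  have hs : ∀ k : ℕ, Summable fun i => v i * ((k.factorial : ℝ) ^ σ / L ^ k) := fun k =>
    hv.mul_right _
  have hb : ∀ (k : ℕ) i x, ‖iteratedFDeriv ℝ k (F i) x‖ ≤ v i * ((k.factorial : ℝ) ^ σ / L ^ k) :=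
    fun k i x => by
      rw [← mul_div_assoc, le_div_iff₀ (by positivity), mul_comm]
      exact h i k x
  have h2 : ∀ (k : ℕ) x, iteratedFDeriv ℝ k (fun x => ∑' i, F i x) x =
      ∑' i, iteratedFDeriv ℝ k (F i) x := fun k x => by
    rw [iteratedFDeriv_tsum (N := ⊤) hF (fun k _ => hs k) (fun k i x _ => hb k i x)
      (mod_cast le_top)]
  refine ⟨contDiff_tsum hF (fun k _ => hs k) (fun k i x _ => hb k i x), h2, fun k x => ?_⟩
  rw [h2]
  calc _ ≤ L ^ k * ∑' i, v i * ((k.factorial : ℝ) ^ σ / L ^ k) := by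
        gcongr
        exact tsum_of_norm_bounded (hs k).hasSum fun i => hb k i x
    _ = _ := by rw [tsum_mul_right]; field_simp

end Gevrey

/-! ### Gevrey bump functions -/

section Bump

/-- The coefficients of the derivatives of `exp (-x⁻ᵖ)`: for `x > 0`, the `k`-th derivative is
`∑ j, flatCoeff p k j * x ^ (-(k + p j)) * exp (-x⁻ᵖ)`. -/
noncomputable def flatCoeff (p : ℕ) : ℕ → ℕ → ℝ
  | 0, 0 => 1
  | 0, _ + 1 => 0
  | k + 1, 0 => -k * flatCoeff p k 0
  | k + 1, j + 1 => -(k + p * (j + 1) : ℕ) * flatCoeff p k (j + 1) + p * flatCoeff p k j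

theorem flatCoeff_eq_zero (p : ℕ) {k j : ℕ} (h : k < j) : flatCoeff p k j = 0 := by
  induction k generalizing j with
  | zero => obtain ⟨j, rfl⟩ := Nat.exists_eq_succ_of_ne_zero (Nat.pos_iff_ne_zero.1 h); rfl
  | succ k ih =>
    obtain ⟨j, rfl⟩ := Nat.exists_eq_succ_of_ne_zero (Nat.pos_iff_ne_zero.1 (Nat.zero_lt_of_lt h))
    simp only [flatCoeff]
    rw [ih (by omega), ih (by omega)]
    simp

/-- The weight `j! 2^j` turns the sum over `j` into the series of `exp (x⁻ᵖ / 2)`, which half of the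
exponential decay absorbs. -/
theorem abs_flatCoeff_le (p k j : ℕ) :
    |flatCoeff p k j| * (j.factorial * 2 ^ j) ≤ (1 + 3 * p) ^ k * k.factorial := by
  induction k generalizing j with
  | zero => rcases j with _ | j <;> simp [flatCoeff]
  | succ k ih =>
    have hR : (1 + 3 * (p : ℝ)) ^ (k + 1) * ((k + 1).factorial : ℝ) =
        ((1 + 3 * p) * (k + 1)) * ((1 + 3 * p) ^ k * k.factorial) := by
      push_cast [Nat.factorial_succ]; ring
    have hP : 0 ≤ (1 + 3 * (p : ℝ)) ^ k * k.factorial := by positivity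
    rw [hR]
    rcases j with _ | j
    · have := ih 0
      simp only [flatCoeff, abs_mul, abs_neg, Nat.abs_cast] at this ⊢
      calc _ = (k : ℝ) * (|flatCoeff p k 0| * ((0 : ℕ).factorial * 2 ^ 0)) := by ring
        _ ≤ (k : ℝ) * ((1 + 3 * p) ^ k * k.factorial) := by gcongr
        _ ≤ _ := by gcongr; nlinarith [(Nat.cast_nonneg p : (0 : ℝ) ≤ p), (Nat.cast_nonneg k : (0 : ℝ) ≤ k)]
    · rcases lt_or_ge (k + 1) (j + 1) with h | h
      · rw [flatCoeff_eq_zero p h]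
        simp only [abs_zero, zero_mul]
        positivity
      · have h1 : ((k + p * (j + 1) : ℕ) : ℝ) * (|flatCoeff p k (j + 1)| *
            ((j + 1).factorial * 2 ^ (j + 1))) ≤ ((1 + p) * (k + 1)) * ((1 + 3 * p) ^ k * k.factorial) := by
          have e : ((k + p * (j + 1) : ℕ) : ℝ) ≤ (1 + p) * (k + 1) := by
            have : k + p * (j + 1) ≤ (1 + p) * (k + 1) := by nlinarith
            exact_mod_cast this
          exact mul_le_mul e (ih (j + 1)) (by positivity) (by positivity)
        have h2 : (2 * p * (j + 1) : ℝ) * (|flatCoeff p k j| * (j.factorial * 2 ^ j)) ≤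
            (2 * p * (k + 1)) * ((1 + 3 * p) ^ k * k.factorial) := by
          have e : (j : ℝ) ≤ k := by exact_mod_cast Nat.succ_le_succ_iff.1 h
          exact mul_le_mul (by gcongr) (ih j) (by positivity) (by positivity)
        have h3 : |flatCoeff p (k + 1) (j + 1)| ≤ ((k + p * (j + 1) : ℕ) : ℝ) * |flatCoeff p k (j + 1)| +
            p * |flatCoeff p k j| := by
          simp only [flatCoeff]
          refine (abs_add_le _ _).trans (le_of_eq ?_)
          rw [abs_mul, abs_mul, abs_neg, Nat.abs_cast, Nat.abs_cast]
        calc _ ≤ (((k + p * (j + 1) : ℕ) : ℝ) * |flatCoeff p k (j + 1)| + p * |flatCoeff p k j|) *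
              ((j + 1).factorial * 2 ^ (j + 1)) := by gcongr
          _ = ((k + p * (j + 1) : ℕ) : ℝ) * (|flatCoeff p k (j + 1)| *
              ((j + 1).factorial * 2 ^ (j + 1))) +
              (2 * p * (j + 1) : ℝ) * (|flatCoeff p k j| * (j.factorial * 2 ^ j)) := by
            push_cast [Nat.factorial_succ]; ring
          _ ≤ _ := add_le_add h1 h2
          _ = _ := by ring

theorem hasDerivAt_inv_pow {x : ℝ} (hx : x ≠ 0) (n : ℕ) :
    HasDerivAt (fun x : ℝ => x⁻¹ ^ n) (-n * x⁻¹ ^ (n + 1)) x := by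
  have h := (hasDerivAt_inv hx).pow n
  refine h.congr_deriv ?_
  rcases n with _ | n
  · simp
  · simp only [Nat.add_sub_cancel]
    rw [← inv_pow]; ring

theorem iteratedDeriv_exp_neg_inv_pow (p k : ℕ) {x : ℝ} (hx : 0 < x) :
    iteratedDeriv k (fun x : ℝ => expNegInvGlue (x ^ p)) x =
      (∑ j ∈ Finset.range (k + 1), flatCoeff p k j * x⁻¹ ^ (k + p * j)) * Real.exp (-x⁻¹ ^ p) := by
  induction k generalizing x with
  | zero =>
    have : ¬ x ^ p ≤ 0 := not_le.2 (by positivity)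
    simp [flatCoeff, expNegInvGlue, this, inv_pow]
  | succ k ih =>
    rw [iteratedDeriv_succ]
    have he : iteratedDeriv k (fun x : ℝ => expNegInvGlue (x ^ p)) =ᶠ[𝓝 x] fun x =>
        (∑ j ∈ Finset.range (k + 1), flatCoeff p k j * x⁻¹ ^ (k + p * j)) * Real.exp (-x⁻¹ ^ p) := by
      filter_upwards [lt_mem_nhds hx] with z hz using ih hz
    rw [he.deriv_eq]
    have h1 : HasDerivAt (fun x : ℝ => ∑ j ∈ Finset.range (k + 1), flatCoeff p k j * x⁻¹ ^ (k + p * j))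
        (∑ j ∈ Finset.range (k + 1), flatCoeff p k j * (-(k + p * j : ℕ) * x⁻¹ ^ (k + p * j + 1))) x :=
      HasDerivAt.fun_sum fun j _ => (hasDerivAt_inv_pow hx.ne' _).const_mul _
    have h2 : HasDerivAt (fun x : ℝ => Real.exp (-x⁻¹ ^ p))
        (Real.exp (-x⁻¹ ^ p) * -(-p * x⁻¹ ^ (p + 1))) x := (hasDerivAt_inv_pow hx.ne' p).neg.exp
    rw [(h1.fun_mul h2).deriv]
    set y := x⁻¹
    have h3 : ∑ j ∈ Finset.range (k + 2), flatCoeff p (k + 1) j * y ^ (k + 1 + p * j) =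
        (∑ j ∈ Finset.range (k + 1), flatCoeff p k j * (-(k + p * j : ℕ) * y ^ (k + p * j + 1))) +
        ∑ j ∈ Finset.range (k + 1), flatCoeff p k j * (p * y ^ (k + p * j + (p + 1))) := by
      rw [Finset.sum_range_succ']
      have e1 : ∀ j, flatCoeff p (k + 1) (j + 1) * y ^ (k + 1 + p * (j + 1)) =
          flatCoeff p k (j + 1) * (-(k + p * (j + 1) : ℕ) * y ^ (k + p * (j + 1) + 1)) +
          flatCoeff p k j * (p * y ^ (k + p * j + (p + 1))) := fun j => by
        rw [show k + 1 + p * (j + 1) = k + p * (j + 1) + 1 by ring,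
          show k + p * j + (p + 1) = k + p * (j + 1) + 1 by ring]
        simp only [flatCoeff]
        ring
      simp only [e1, Finset.sum_add_distrib]
      have e2 := Finset.sum_range_succ'
        (fun j => flatCoeff p k j * (-(k + p * j : ℕ) * y ^ (k + p * j + 1))) (k + 1)
      rw [Finset.sum_range_succ, flatCoeff_eq_zero p (Nat.lt_succ_self k), zero_mul, add_zero] at e2
      rw [e2]
      simp only [flatCoeff, mul_zero, add_zero]
      ring
    rw [h3, add_mul]
    congr 1
    rw [Finset.sum_mul, Finset.sum_mul]
    refine Finset.sum_congr rfl fun j _ => ?_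
    rw [pow_add y (k + p * j) (p + 1)]
    ring

theorem abs_iteratedDeriv_exp_neg_inv_pow_le (p k : ℕ) {x : ℝ} (hx : 0 < x) :
    |iteratedDeriv k (fun x : ℝ => expNegInvGlue (x ^ p)) x| ≤
      (1 + 3 * p) ^ k * k.factorial * x⁻¹ ^ k * Real.exp (-(x⁻¹ ^ p / 2)) := by
  rw [iteratedDeriv_exp_neg_inv_pow p k hx, abs_mul, Real.abs_exp]
  set y := x⁻¹
  have hy : 0 < y := inv_pos.2 hx
  have h1 : |∑ j ∈ Finset.range (k + 1), flatCoeff p k j * y ^ (k + p * j)| ≤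
      (1 + 3 * p) ^ k * k.factorial * y ^ k * Real.exp (y ^ p / 2) := by
    calc _ ≤ ∑ j ∈ Finset.range (k + 1), |flatCoeff p k j * y ^ (k + p * j)| :=
          Finset.abs_sum_le_sum_abs _ _
      _ ≤ ∑ j ∈ Finset.range (k + 1), (1 + 3 * p) ^ k * k.factorial * y ^ k *
            ((y ^ p / 2) ^ j / j.factorial) := by
          refine Finset.sum_le_sum fun j _ => ?_
          have h2 := abs_flatCoeff_le p k j
          rw [← le_div_iff₀ (by positivity)] at h2
          rw [abs_mul, abs_of_pos (by positivity : 0 < y ^ (k + p * j))]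
          calc _ ≤ (1 + 3 * p) ^ k * k.factorial / (j.factorial * 2 ^ j) * y ^ (k + p * j) := by gcongr
            _ = _ := by rw [pow_add, pow_mul, div_pow]; field_simp
      _ ≤ _ := by
          rw [← Finset.mul_sum]
          gcongr
          exact Real.sum_le_exp_of_nonneg (by positivity) _
  calc _ ≤ (1 + 3 * p) ^ k * k.factorial * y ^ k * Real.exp (y ^ p / 2) * Real.exp (-y ^ p) := by gcongr
    _ = _ := by rw [mul_assoc, ← Real.exp_add]; congr 2; ring

/-- The power `k! ^ s` pays for `y ^ k` up to `exp (C y ^ (1 / s))`, which is dominated by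
`exp (y ^ p / 2)` because `1 / s ≤ p / 2`. -/
theorem exists_pow_le_factorial_rpow {s : ℝ} (hs : 0 < s) {p : ℕ} (hp : 2 ≤ p * s) {L : ℝ} (hL : 0 < L) :
    ∃ C : ℝ, 0 ≤ C ∧ ∀ (k : ℕ) (y : ℝ), 0 < y →
      (L * y) ^ k ≤ C * (k.factorial : ℝ) ^ s * Real.exp (y ^ p / 2) := by
  set A := s * L ^ (1 / s) with hA
  have hA0 : 0 < A := by positivity
  refine ⟨Real.exp (A + A ^ 2 / 2), (Real.exp_pos _).le, fun k y hy => ?_⟩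
  set z := (L * y) ^ (1 / s) with hz
  have hz0 : 0 < z := by positivity
  have h1 : z ^ k ≤ k.factorial * Real.exp z := by
    have := Real.pow_div_factorial_le_exp z hz0.le k
    rwa [div_le_iff₀ (by positivity), mul_comm] at this
  have h2 : (L * y) ^ k = (z ^ k) ^ s := by
    rw [hz, ← Real.rpow_natCast, ← Real.rpow_natCast, ← Real.rpow_mul (by positivity),
      ← Real.rpow_mul (by positivity)]
    congr 1
    field_simp
  have h3 : s * z ≤ A + A ^ 2 / 2 + y ^ p / 2 := by
    have e1 : s * z = A * y ^ (1 / s) := by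
      rw [hz, Real.mul_rpow hL.le hy.le, hA]; ring
    set t := y ^ ((p : ℝ) / 2) with ht
    have ht0 : 0 < t := by positivity
    have e2 : y ^ p = t ^ 2 := by
      rw [ht, ← Real.rpow_natCast, ← Real.rpow_natCast, ← Real.rpow_mul hy.le]
      congr 1
      push_cast; ring
    have e3 : y ^ (1 / s) ≤ 1 + t := by
      rcases le_total y 1 with h | h
      · exact (Real.rpow_le_one hy.le h (by positivity)).trans (by linarith)
      · have : y ^ (1 / s) ≤ t := by
          refine Real.rpow_le_rpow_of_exponent_le h ?_
          rw [div_le_div_iff₀ hs two_pos]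
          linarith
        linarith
    rw [e1, e2]
    nlinarith [sq_nonneg (A - t), mul_le_mul_of_nonneg_left e3 hA0.le]
  calc (L * y) ^ k = (z ^ k) ^ s := h2
    _ ≤ (k.factorial * Real.exp z) ^ s := by gcongr
    _ = (k.factorial : ℝ) ^ s * Real.exp (s * z) := by
        rw [Real.mul_rpow (by positivity) (Real.exp_pos _).le, ← Real.exp_mul, mul_comm z]
    _ ≤ (k.factorial : ℝ) ^ s * Real.exp (A + A ^ 2 / 2 + y ^ p / 2) := by gcongr
    _ = _ := by rw [Real.exp_add]; ring

/-- The function `exp (-x⁻ᵖ)`, extended by `0` to `x ≤ 0`, is Gevrey-`σ` at all scales when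
`p (σ - 1) ≥ 2`. -/
theorem exists_gevrey_flat {σ : ℝ} (hσ : 1 < σ) : ∃ ψ : ℝ → ℝ, IsGevrey σ ψ ∧ (∀ x ≤ 0, ψ x = 0) ∧
    (∀ x, 0 < x → 0 < ψ x) ∧ ∀ x, ψ x ≤ 1 := by
  obtain ⟨n, hn⟩ := exists_nat_gt (2 / (σ - 1))
  have hs : 0 < σ - 1 := by linarith
  rw [div_lt_iff₀ hs] at hn
  -- an odd exponent makes `x ↦ x ^ p` preserve signs
  have hodd : Odd (2 * n + 1) := odd_two_mul_add_one n
  set p := 2 * n + 1 with hpdef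
  have hp : 2 ≤ p * (σ - 1) := by
    rw [hpdef]; push_cast
    nlinarith [(Nat.cast_nonneg n : (0 : ℝ) ≤ n)]
  have cψ : ContDiff ℝ ∞ fun x : ℝ => expNegInvGlue (x ^ p) :=
    expNegInvGlue.contDiff.comp (contDiff_id.pow p)
  have hzero : ∀ x : ℝ, x ≤ 0 → expNegInvGlue (x ^ p) = 0 := fun x hx =>
    expNegInvGlue.zero_of_nonpos (hodd.pow_nonpos_iff.2 hx)
  refine ⟨fun x => expNegInvGlue (x ^ p), ⟨cψ, fun L hL => ?_⟩, hzero,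
    fun x hx => expNegInvGlue.pos_of_pos (by positivity), fun x => ?_⟩
  · obtain ⟨C, hC, h⟩ := exists_pow_le_factorial_rpow hs hp
      (by positivity : 0 < L * (1 + 3 * (p : ℝ)))
    refine ⟨C, hC, fun k x => ?_⟩
    rcases le_or_gt x 0 with hx | hx
    · have : FlatAt (fun x : ℝ => expNegInvGlue (x ^ p)) x := by
        refine FlatAt.of_mem_closure cψ (closure_mono (s := Set.Iio 0)
          (interior_maximal (fun y hy => hzero y (le_of_lt hy)) isOpen_Iio) ?_)
        rw [closure_Iio]
        exact Set.mem_Iic.2 hx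
      rw [this k, norm_zero, mul_zero]
      positivity
    · rw [norm_iteratedFDeriv_eq_norm_iteratedDeriv, Real.norm_eq_abs]
      have h1 := abs_iteratedDeriv_exp_neg_inv_pow_le p k hx
      have h2 := h k x⁻¹ (inv_pos.2 hx)
      have e : (k.factorial : ℝ) ^ σ = (k.factorial : ℝ) ^ (σ - 1) * k.factorial := by
        rw [← Real.rpow_add_one (by positivity), sub_add_cancel]
      calc _ ≤ L ^ k * ((1 + 3 * p) ^ k * k.factorial * x⁻¹ ^ k * Real.exp (-(x⁻¹ ^ p / 2))) := by gcongr
        _ = (L * (1 + 3 * p) * x⁻¹) ^ k * k.factorial * Real.exp (-(x⁻¹ ^ p / 2)) := by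
            rw [mul_pow, mul_pow]; ring
        _ ≤ C * (k.factorial : ℝ) ^ (σ - 1) * Real.exp (x⁻¹ ^ p / 2) * k.factorial *
              Real.exp (-(x⁻¹ ^ p / 2)) := by gcongr
        _ = C * ((k.factorial : ℝ) ^ (σ - 1) * k.factorial) *
              (Real.exp (x⁻¹ ^ p / 2) * Real.exp (-(x⁻¹ ^ p / 2))) := by ring
        _ = C * (k.factorial : ℝ) ^ σ := by rw [← Real.exp_add, add_neg_cancel, Real.exp_zero, e, mul_one]
  · dsimp only [expNegInvGlue]
    split_ifs with h
    · exact zero_le_one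
    · exact Real.exp_le_one_iff.2 (neg_nonpos.2 (inv_nonneg.2 (not_le.1 h).le))

/-- A Gevrey function that is positive exactly on `(a, b)`. -/
theorem exists_gevrey_window {σ : ℝ} (hσ : 1 < σ) (a b : ℝ) : ∃ χ : ℝ → ℝ, IsGevrey σ χ ∧
    (∀ x, χ x ∈ Set.Icc (0 : ℝ) 1) ∧ (∀ x, χ x ≠ 0 → x ∈ Set.Ioo a b) ∧
    ∀ x ∈ Set.Ioo a b, 0 < χ x := by
  obtain ⟨ψ, hψ, h0, hpos, h1⟩ := exists_gevrey_flat hσ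
  have hnn : ∀ x, 0 ≤ ψ x := fun x => (le_or_gt x 0).elim (fun h => (h0 x h).ge) fun h => (hpos x h).le
  refine ⟨fun x => ψ (1 * x + -a) * ψ (-1 * x + b),
    (hψ.comp_affine 1 (-a)).mul hσ.le (hψ.comp_affine (-1) b), fun x =>
      ⟨mul_nonneg (hnn _) (hnn _), mul_le_one₀ (h1 _) (hnn _) (h1 _)⟩, fun x hx => ?_, fun x hx =>
      mul_pos (hpos _ (by linarith [hx.1])) (hpos _ (by linarith [hx.2]))⟩
  constructor
  · by_contra h
    exact hx (mul_eq_zero_of_left (h0 _ (by linarith)) _)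
  · by_contra h
    exact hx (mul_eq_zero_of_right _ (h0 _ (by linarith)))

/-- A Gevrey step: `0` up to `0` and `1` from `1` on. -/
theorem exists_gevrey_step {σ : ℝ} (hσ : 1 < σ) : ∃ S : ℝ → ℝ, IsGevrey σ S ∧
    (∀ x, S x ∈ Set.Icc (0 : ℝ) 1) ∧ (∀ x ≤ 0, S x = 0) ∧ ∀ x, 1 ≤ x → S x = 1 := by
  obtain ⟨χ, hχ, hI, hsupp, hpos⟩ := exists_gevrey_window hσ 0 1
  have cχ : Continuous χ := hχ.1.continuous
  have hint : ∀ a b, IntervalIntegrable χ volume a b := fun a b => cχ.intervalIntegrable a b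
  set I := ∫ x in (0 : ℝ)..1, χ x with hIdef
  have hI0 : 0 < I := intervalIntegral.intervalIntegral_pos_of_pos_on (hint 0 1) hpos zero_lt_one
  have hz : ∀ x ≤ 0, (∫ t in (0 : ℝ)..x, χ t) = 0 := fun x hx => by
    refine intervalIntegral.integral_zero_ae (Eventually.of_forall fun t ht => ?_)
    rw [Set.uIoc_of_ge hx] at ht
    by_contra h
    exact absurd (hsupp t h).1 (not_lt.2 ht.2)
  have ho : ∀ x, 1 ≤ x → (∫ t in (0 : ℝ)..x, χ t) = I := fun x hx => by
    rw [← intervalIntegral.integral_add_adjacent_intervals (hint 0 1) (hint 1 x),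
      intervalIntegral.integral_zero_ae (a := 1) (Eventually.of_forall fun t ht => ?_), add_zero]
    rw [Set.uIoc_of_le hx] at ht
    by_contra h
    exact absurd (hsupp t h).2 (not_lt.2 ht.1.le)
  have hmono : Monotone fun x => ∫ t in (0 : ℝ)..x, χ t := fun x y hxy => by
    dsimp only
    rw [← intervalIntegral.integral_add_adjacent_intervals (hint 0 x) (hint x y)]
    have := intervalIntegral.integral_nonneg (μ := volume) hxy fun t _ => (hI t).1
    linarith
  have hmem : ∀ x, (∫ t in (0 : ℝ)..x, χ t) / I ∈ Set.Icc (0 : ℝ) 1 := fun x => by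
    constructor
    · refine div_nonneg ?_ hI0.le
      have := hmono (min_le_left x 0)
      dsimp only at this
      rwa [hz (min x 0) (min_le_right _ _)] at this
    · rw [div_le_one hI0]
      have := hmono (le_max_left x 1)
      dsimp only at this
      rwa [ho (max x 1) (le_max_right _ _)] at this
  refine ⟨fun x => (∫ t in (0 : ℝ)..x, χ t) / I, ?_, hmem, fun x hx => ?_, fun x hx => ?_⟩
  · refine IsGevrey.of_deriv (B := 1) (f := fun x => I⁻¹ * χ x) (by linarith)
      ((IsGevrey.const (by linarith) I⁻¹).mul hσ.le hχ) (fun x => ?_) fun x => ?_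
    · refine ((intervalIntegral.integral_hasDerivAt_right (hint 0 x)
        (cχ.stronglyMeasurableAtFilter _ _) cχ.continuousAt).div_const I).congr_deriv ?_
      ring
    · rw [abs_of_nonneg (hmem x).1]
      exact (hmem x).2
  · dsimp only
    rw [hz x hx, zero_div]
  · dsimp only
    rw [ho x hx, div_self hI0.ne']

end Bump

/-! ### Pairs with exponentially small divisors -/

section ExpLiouville

/-- `(α, β)` is rationally independent and has exponentially small divisors, at every exponential
rate. -/
def IsExpLiouvillePair (α β : ℝ) : Prop :=
  (∀ k l : ℤ, k * α + l * β = 0 → k = 0 ∧ l = 0) ∧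
  ∀ C : ℝ, ∃ k l : ℤ, 2 ≤ max |k| |l| ∧ |k * α + l * β| < Real.exp (-(C * (|(k : ℝ)| + |(l : ℝ)|)))

namespace IsExpLiouvillePair

variable {α β : ℝ}

theorem symm (h : IsExpLiouvillePair α β) : IsExpLiouvillePair β α := by
  refine ⟨fun k l hkl => (h.1 l k (by linarith)).symm, fun C => ?_⟩
  obtain ⟨k, l, h1, h2⟩ := h.2 C
  exact ⟨l, k, by rwa [max_comm], by rwa [add_comm, add_comm |(l : ℝ)|]⟩

theorem abs_add_abs_ge {k l : ℤ} (h : 2 ≤ max |k| |l|) : 2 ≤ |(k : ℝ)| + |(l : ℝ)| := by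
  have : max |k| |l| ≤ |k| + |l| := max_le_add_of_nonneg (abs_nonneg _) (abs_nonneg _)
  exact_mod_cast h.trans this

theorem smul_int (h : IsExpLiouvillePair α β) {a b : ℤ} (ha : a ≠ 0) (hb : b ≠ 0) :
    IsExpLiouvillePair (a * α) (b * β) := by
  refine ⟨fun k l hkl => ?_, fun C => ?_⟩
  · obtain ⟨h1, h2⟩ := h.1 (k * a) (l * b) (by push_cast; linarith)
    exact ⟨(mul_eq_zero.1 h1).resolve_right ha, (mul_eq_zero.1 h2).resolve_right hb⟩
  · set D : ℝ := |(a : ℝ)| + |(b : ℝ)| with hD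
    have ha1 : (1 : ℝ) ≤ |(a : ℝ)| := by exact_mod_cast Int.one_le_abs ha
    have hb1 : (1 : ℝ) ≤ |(b : ℝ)| := by exact_mod_cast Int.one_le_abs hb
    obtain ⟨k, l, h1, h2⟩ := h.2 (|C| * D + D ^ 2)
    refine ⟨k * b, l * a, ?_, ?_⟩
    · refine h1.trans (max_le_max ?_ ?_)
      · rw [abs_mul]; exact le_mul_of_one_le_right (abs_nonneg _) (Int.one_le_abs hb)
      · rw [abs_mul]; exact le_mul_of_one_le_right (abs_nonneg _) (Int.one_le_abs ha)
    · have h3 := abs_add_abs_ge h1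
      set S := |(k : ℝ)| + |(l : ℝ)| with hS
      have e : ((k * b : ℤ) : ℝ) * (a * α) + ((l * a : ℤ) : ℝ) * (b * β) =
          (a * b) * (k * α + l * β) := by push_cast; ring
      have h4 : |((k * b : ℤ) : ℝ)| + |((l * a : ℤ) : ℝ)| ≤ D * S := by
        push_cast
        rw [abs_mul, abs_mul]
        nlinarith [abs_nonneg (k : ℝ), abs_nonneg (l : ℝ), abs_nonneg (a : ℝ), abs_nonneg (b : ℝ)]
      have h5 : |(a : ℝ) * b| ≤ Real.exp (D ^ 2 * S) := by
        have h6 := Real.add_one_le_exp (D ^ 2 * S)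
        rw [abs_mul]
        nlinarith
      rw [e, abs_mul]
      calc _ < Real.exp (D ^ 2 * S) * Real.exp (-((|C| * D + D ^ 2) * S)) := by
            refine mul_lt_mul' h5 h2 (abs_nonneg _) (Real.exp_pos _)
        _ ≤ _ := by
            rw [← Real.exp_add, Real.exp_le_exp]
            have h7 : C * (|((k * b : ℤ) : ℝ)| + |((l * a : ℤ) : ℝ)|) ≤ |C| * (D * S) :=
              mul_le_mul (le_abs_self C) h4 (by positivity) (abs_nonneg C)
            linarith

theorem of_smul (h : IsExpLiouvillePair α β) {D : ℤ} (hD : 0 < D) :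
    IsExpLiouvillePair (α / D) (β / D) := by
  have hD' : (1 : ℝ) ≤ D := by exact_mod_cast hD
  have e : ∀ k l : ℤ, (k : ℝ) * (α / D) + l * (β / D) = (k * α + l * β) / D := fun k l => by ring
  refine ⟨fun k l hkl => h.1 k l ?_, fun C => ?_⟩
  · rw [e, div_eq_zero_iff] at hkl
    exact hkl.resolve_right (by positivity)
  · obtain ⟨k, l, h1, h2⟩ := h.2 C
    refine ⟨k, l, h1, lt_of_le_of_lt ?_ h2⟩
    rw [e, abs_div, abs_of_pos (by positivity : (0 : ℝ) < D)]
    exact div_le_self (abs_nonneg _) hD'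

/-- Rational multiples preserve exponentially small divisors. -/
theorem smul_rat (h : IsExpLiouvillePair α β) {a b : ℚ} (ha : a ≠ 0) (hb : b ≠ 0) :
    IsExpLiouvillePair (a * α) (b * β) := by
  have h1 := (h.smul_int (a := a.num * b.den) (b := b.num * a.den)
    (mul_ne_zero (Rat.num_ne_zero.2 ha) (by exact_mod_cast b.den_nz))
    (mul_ne_zero (Rat.num_ne_zero.2 hb) (by exact_mod_cast a.den_nz))).of_smul
    (D := a.den * b.den) (by have := a.den_pos; have := b.den_pos; positivity)
  have da : (a.den : ℝ) ≠ 0 := by exact_mod_cast a.den_nz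
  have db : (b.den : ℝ) ≠ 0 := by exact_mod_cast b.den_nz
  have ea : (a : ℝ) = a.num / a.den := by exact_mod_cast (Rat.num_div_den a).symm
  have eb : (b : ℝ) = b.num / b.den := by exact_mod_cast (Rat.num_div_den b).symm
  convert h1 using 1
  · rw [ea]; push_cast; field_simp
  · rw [eb]; push_cast; field_simp

/-- The resonances can be chosen so that their entries do not sum to zero. -/
theorem exists_small (h : IsExpLiouvillePair α β) (C : ℝ) :
    ∃ k l : ℤ, k + l ≠ 0 ∧ k * α + l * β ≠ 0 ∧ 2 ≤ max |k| |l| ∧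
      |k * α + l * β| < Real.exp (-(C * (1 + |(k : ℝ)| + |(l : ℝ)|))) := by
  have hαβ : 0 < |α - β| := abs_pos.2 fun h0 => by
    have := h.1 1 (-1) (by push_cast; linarith)
    simp at this
  obtain ⟨k, l, hK, hkl⟩ := h.2 (2 * (|C| + 1 / |α - β|))
  have h2 := abs_add_abs_ge hK
  set S := |(k : ℝ)| + |(l : ℝ)| with hS
  have hC := abs_nonneg C
  have hi : 0 < 1 / |α - β| := by positivity
  refine ⟨k, l, fun h0 => ?_, fun h0 => ?_, hK, hkl.trans_le ?_⟩
  · -- otherwise the divisor is a nonzero multiple of `α - β`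
    have hl' : (l : ℝ) = -k := by
      have : l = -k := by omega
      rw [this]; push_cast; ring
    have hk0 : k ≠ 0 := by
      rintro rfl
      have : l = 0 := by omega
      subst this; simp at hK
    have hk1 : (1 : ℝ) ≤ |(k : ℝ)| := by exact_mod_cast Int.one_le_abs hk0
    rw [hl', show (k : ℝ) * α + -k * β = k * (α - β) by ring, abs_mul] at hkl
    have h3 : |α - β| < Real.exp (-(2 * (|C| + 1 / |α - β|) * S)) := by nlinarith
    have h4 : Real.exp (-(2 * (|C| + 1 / |α - β|) * S)) ≤ Real.exp (-(1 / |α - β|)) := by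
      rw [Real.exp_le_exp]
      nlinarith
    have h5 : Real.exp (-(1 / |α - β|)) < |α - β| := by
      rw [Real.exp_neg, inv_lt_comm₀ (Real.exp_pos _) hαβ, ← one_div]
      linarith [Real.add_one_le_exp (1 / |α - β|)]
    linarith
  · obtain ⟨rfl, rfl⟩ := h.1 k l h0
    simp at hK
  · rw [Real.exp_le_exp, neg_le_neg_iff, add_assoc]
    have h6 : C * (1 + S) ≤ |C| * (1 + S) := by
      gcongr; exact le_abs_self C
    nlinarith

theorem isLiouvillePair (h : IsExpLiouvillePair α β) : IsLiouvillePair α β := by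
  refine ⟨h.1, fun N => ?_⟩
  obtain ⟨k, l, h1, h2⟩ := h.2 N
  refine ⟨k, l, h1, h2.trans_le ?_⟩
  set K : ℝ := ((max |k| |l| : ℤ) : ℝ) with hK
  have hK2 : (2 : ℝ) ≤ K := by rw [hK]; exact_mod_cast h1
  have hKS : K ≤ |(k : ℝ)| + |(l : ℝ)| := by
    rw [hK]
    exact_mod_cast max_le_add_of_nonneg (abs_nonneg k) (abs_nonneg l)
  rw [one_div, Real.exp_neg]
  gcongr
  calc K ^ N ≤ Real.exp K ^ N := by gcongr; linarith [Real.add_one_le_exp K]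
    _ = Real.exp (N * K) := by rw [← Real.exp_nat_mul]
    _ ≤ _ := by gcongr

end IsExpLiouvillePair

/-- By the Baire category theorem, some `ξ` makes `(1, ξ)` a pair with exponentially small
divisors. -/
theorem exists_isExpLiouvillePair : ∃ ξ : ℝ, IsExpLiouvillePair 1 ξ := by
  let V : ℤ × ℤ → ℕ → Set ℝ := fun q C =>
    {ξ | |(q.1 : ℝ) * 1 + q.2 * ξ| < Real.exp (-(C * (|(q.1 : ℝ)| + |(q.2 : ℝ)|)))}
  let U : ℕ → Set ℝ := fun C => ⋃ q : ℤ × ℤ, ⋃ _ : 2 ≤ max |q.1| |q.2|, V q C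
  have hU : ∀ C, IsOpen (U C) := fun C => isOpen_iUnion fun q => isOpen_iUnion fun _ =>
    isOpen_lt (by fun_prop) (by fun_prop)
  have hd : ∀ C, Dense (U C) := fun C => by
    refine Rat.denseRange_cast.mono ?_
    rintro _ ⟨q, rfl⟩
    refine Set.mem_iUnion₂.2 ⟨(-(2 * q.num), 2 * q.den), ?_, ?_⟩
    · refine le_trans ?_ (le_max_right _ _)
      have : (1 : ℤ) ≤ q.den := by exact_mod_cast q.den_pos
      rw [abs_of_nonneg (by positivity)]
      linarith
    · have dq : (q.den : ℝ) ≠ 0 := by exact_mod_cast q.den_nz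
      have eq : (q : ℝ) = q.num / q.den := by exact_mod_cast (Rat.num_div_den q).symm
      have : (((-(2 * q.num) : ℤ) : ℝ)) * 1 + ((2 * q.den : ℤ) : ℝ) * (q : ℝ) = 0 := by
        rw [eq]; push_cast; field_simp; ring
      change |((-(2 * q.num) : ℤ) : ℝ) * 1 + ((2 * q.den : ℤ) : ℝ) * (q : ℝ)| < Real.exp _
      rw [this, abs_zero]
      exact Real.exp_pos _
  have hres : ∀ᶠ ξ : ℝ in residual ℝ, Irrational ξ ∧ ∀ C, ξ ∈ U C :=
    eventually_residual_irrational.and (eventually_countable_forall.2 fun C =>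
      residual_of_dense_open (hU C) (hd C))
  obtain ⟨ξ, hξ, h⟩ := (dense_of_mem_residual hres).nonempty
  refine ⟨ξ, fun k l hkl => ?_, fun C => ?_⟩
  · have hl : l = 0 := by
      by_contra hl
      refine hξ ⟨-k / l, ?_⟩
      have : (l : ℝ) ≠ 0 := by exact_mod_cast hl
      push_cast
      rw [div_eq_iff this]
      linarith
    subst hl
    simpa using hkl
  · obtain ⟨N, hN⟩ := exists_nat_ge C
    obtain ⟨q, hq, hξq⟩ := Set.mem_iUnion₂.1 (h N)
    refine ⟨q.1, q.2, hq, lt_of_lt_of_le hξq ?_⟩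
    gcongr

end ExpLiouville

/-! ### Gevrey-small Liouville twists -/

section GevreyTwist

variable {σ : ℝ}

theorem IsGevrey.add {E : Type*} [NormedAddCommGroup E] [NormedSpace ℝ E] {F G : E → ℝ}
    (hF : IsGevrey σ F) (hG : IsGevrey σ G) : IsGevrey σ fun x => F x + G x := by
  refine ⟨hF.1.add hG.1, fun L hL => ?_⟩
  obtain ⟨A, hA, h1⟩ := hF.2 L hL
  obtain ⟨B, hB, h2⟩ := hG.2 L hL
  refine ⟨A + B, by positivity, fun k x => ?_⟩
  have e := iteratedFDeriv_add_apply (i := k) (x := x) ((hF.1.of_le (mod_cast le_top)).contDiffAt)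
    ((hG.1.of_le (mod_cast le_top)).contDiffAt)
  have e' : iteratedFDeriv ℝ k (fun x => F x + G x) x = _ := e
  rw [e']
  calc _ ≤ L ^ k * (‖iteratedFDeriv ℝ k F x‖ + ‖iteratedFDeriv ℝ k G x‖) := by
        gcongr; exact norm_add_le _ _
    _ ≤ _ := by linarith [h1 k x, h2 k x]

/-- An even Gevrey bump, equal to `1` for `1 ≤ |x| ≤ 6` and to `0` unless `3/4 < |x| < 8`. -/
theorem exists_gevrey_bump (hσ : 1 < σ) : ∃ B : ℝ → ℝ, IsGevrey σ B ∧ (∀ x, 0 ≤ B x) ∧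
    (∀ x, B (-x) = B x) ∧ (∀ x, 1 ≤ x → x ≤ 6 → B x = 1) ∧ (∀ x, |x| ≤ 3 / 4 → B x = 0) ∧
    ∀ x, 8 ≤ x → B x = 0 := by
  obtain ⟨S, hS, hI, h0, h1⟩ := exists_gevrey_step hσ
  have hP := (hS.comp_affine 4 (-3)).mul hσ.le (hS.comp_affine (-1 / 2) 4)
  have hN := (hS.comp_affine (-4) (-3)).mul hσ.le (hS.comp_affine (1 / 2) 4)
  refine ⟨_, hP.add hN, fun x => add_nonneg (mul_nonneg (hI _).1 (hI _).1)
    (mul_nonneg (hI _).1 (hI _).1), fun x => ?_, fun x hx hx' => ?_, fun x hx => ?_, fun x hx => ?_⟩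
  · rw [add_comm]
    congr 3 <;> ring
  · rw [h1 (4 * x + -3) (by linarith), h1 (-1 / 2 * x + 4) (by linarith),
      h0 (-4 * x + -3) (by linarith)]
    simp
  · obtain ⟨hl, hr⟩ := abs_le.1 hx
    rw [h0 (4 * x + -3) (by linarith), h0 (-4 * x + -3) (by linarith)]
    simp
  · rw [h0 (-1 / 2 * x + 4) (by linarith), h0 (-4 * x + -3) (by linarith)]
    simp

/-- The nonzero rational multiples of `β` are dense. -/
theorem exists_rat_mul_mem {β : ℝ} (hβ : 0 < β) (w : ℝ) {u : ℝ} (hu : 0 < u) :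
    ∃ r : ℚ, r ≠ 0 ∧ w < r * β ∧ r * β < w + u := by
  have hlt : w / β < (w + u) / β := by gcongr; linarith
  rcases lt_or_ge 0 ((w + u) / β) with h | h
  · obtain ⟨r, h1, h2⟩ := exists_rat_btwn (max_lt hlt h)
    obtain ⟨h3, h4⟩ := max_lt_iff.1 h1
    exact ⟨r, by exact_mod_cast h4.ne', (div_lt_iff₀ hβ).1 h3, (lt_div_iff₀ hβ).1 h2⟩
  · obtain ⟨r, h1, h2⟩ := exists_rat_btwn hlt
    exact ⟨r, by exact_mod_cast (h2.trans_le h).ne, (div_lt_iff₀ hβ).1 h1, (lt_div_iff₀ hβ).1 h2⟩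

/-- The index of the frequency that changes its value at the beginning of the `m`-th dyadic
window. -/
def slot (m : ℤ) : Fin 3 := if m % 3 = 0 then 0 else if m % 3 = 1 then 2 else 1

theorem slot_eq_iff {m n : ℤ} : slot m = slot n ↔ m % 3 = n % 3 := by
  unfold slot
  have h1 := Int.emod_nonneg m (by norm_num : (3 : ℤ) ≠ 0)
  have h2 := Int.emod_lt_of_pos m (by norm_num : (0 : ℤ) < 3)
  have h3 := Int.emod_nonneg n (by norm_num : (3 : ℤ) ≠ 0)
  have h4 := Int.emod_lt_of_pos n (by norm_num : (0 : ℤ) < 3)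
  split_ifs <;> simp <;> omega

/-- In the `n`-th window, the pair of constant frequencies consists of the one just changed and the
one changed one window before. -/
theorem windowPair_windowType (n : ℤ) :
    windowPair (windowType n) = (slot n, slot (n - 1)) ∨
      windowPair (windowType n) = (slot (n - 1), slot n) := by
  have h1 : n % 3 = 0 ∨ n % 3 = 1 ∨ n % 3 = 2 := by omega
  unfold windowType slot
  rcases h1 with h | h | h
  · have h' : (n - 1) % 3 = 2 := by omega
    rw [h, h']; left; rfl
  · have h' : (n - 1) % 3 = 0 := by omega
    rw [h, h']; right; rfl
  · have h' : (n - 1) % 3 = 1 := by omega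
    rw [h, h']; left; rfl

theorem tendsto_two_zpow_atTop : Tendsto (fun n : ℤ => (2 : ℝ) ^ n) atTop atTop := by
  refine tendsto_atTop_mono (fun n => ?_) tendsto_intCast_atTop_atTop
  rcases le_total 0 n with h | h
  · lift n to ℕ using h
    rw [zpow_natCast]
    exact_mod_cast (Nat.lt_two_pow_self (n := n)).le
  · exact le_trans (b := (0 : ℝ)) (by exact_mod_cast h) (by positivity)

theorem isIncreasingCover_dyadic :
    IsIncreasingCover (fun n => (2 : ℝ) ^ n) fun n => 3 * (2 : ℝ) ^ n := by
  refine ⟨fun n => by positivity, ?_, tendsto_two_zpow_atTop, fun n => ?_⟩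
  · have := tendsto_inv_atTop_zero.comp (tendsto_two_zpow_atTop.comp tendsto_neg_atBot_atTop)
    refine this.congr fun n => ?_
    simp
  · have h : (0 : ℝ) < 2 ^ (n - 1) := by positivity
    have e1 : (2 : ℝ) ^ n = 2 * 2 ^ (n - 1) := by
      rw [← zpow_one_add₀ two_ne_zero]; congr 1; ring
    have e2 : (2 : ℝ) ^ (n + 1) = 4 * 2 ^ (n - 1) := by
      rw [zpow_add_one₀ two_ne_zero, e1]; ring
    dsimp only
    rw [e2, e1]
    refine ⟨?_, ?_, ?_⟩ <;> linarith

/-- The two frequencies that are constant on the `n`-th window, on either half line, have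
exponentially small divisors. -/
def ExpWindows (w : Fin 3 → ℝ) (f : Fin 3 → ℝ → ℝ) (a b : ℤ → ℝ) : Prop :=
  ∀ n, ∃ u v : ℝ, IsExpLiouvillePair u v ∧ ∀ x, |x| ∈ Set.Ioo (a n) (b n) →
    w (windowPair (windowType n)).1 + f (windowPair (windowType n)).1 x = u ∧
    w (windowPair (windowType n)).2 + f (windowPair (windowType n)).2 x = v

theorem ExpWindows.liouvilleOn {w : Fin 3 → ℝ} {f : Fin 3 → ℝ → ℝ} {a b : ℤ → ℝ}
    (h : ExpWindows w f a b) (ha : ∀ n, 0 < a n) (n : ℤ) {i j : Fin 3}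
    (hij : windowPair (windowType n) = (i, j)) : LiouvilleOn w f i j (Set.Ioo (a n) (b n)) := by
  obtain ⟨u, v, hL, huv⟩ := h n
  rw [hij] at huv
  have key : ∀ x ∈ Set.Ioo (a n) (b n), w i + f i x = u ∧ w j + f j x = v := fun x hx =>
    huv x (by rwa [abs_of_pos ((ha n).trans hx.1)])
  exact ⟨u - w i, v - w j, fun x hx => by linarith [(key x hx).1],
    fun x hx => by linarith [(key x hx).2], by simpa using hL.isLiouvillePair⟩

theorem ExpWindows.halfLineTwist {w : Fin 3 → ℝ} {f : Fin 3 → ℝ → ℝ} {a b : ℤ → ℝ}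
    (h : ExpWindows w f a b) (hab : IsIncreasingCover a b) : HalfLineTwist w f := by
  refine ⟨a, b, hab, fun n => ⟨h.liouvilleOn hab.1 _ ?_, h.liouvilleOn hab.1 _ ?_,
    h.liouvilleOn hab.1 _ ?_⟩⟩
  · have : (3 * n) % 3 = 0 := by omega
    simp [windowType, this, windowPair]
  · have : (3 * n + 1) % 3 = 1 := by omega
    simp [windowType, this, windowPair]
  · have : (3 * n - 1) % 3 = 2 := by omega
    simp [windowType, this, windowPair]

theorem ExpWindows.isWindowSystem {w : Fin 3 → ℝ} {f : Fin 3 → ℝ → ℝ} {a b : ℤ → ℝ}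
    (h : ExpWindows w f a b) (hab : IsIncreasingCover a b) :
    IsWindowSystem w f (fun _ => a) fun _ => b := by
  refine ⟨fun _ => hab, fun s n => ?_⟩
  obtain ⟨u, v, hL, huv⟩ := h n
  refine ⟨u, v, hL.isLiouvillePair, fun x hx => huv x ?_⟩
  have h0 : 0 < sgn s * x := (hab.1 n).trans hx.1
  rwa [← abs_sgn_mul s, abs_of_pos h0]

/-- There are Liouville twists with exponentially small divisors that are as small as desired in
any Gevrey norm. -/
theorem exists_gevrey_twist (hσ : 1 < σ) (w : Fin 3 → ℝ) {L η : ℝ} (hL : 0 < L) (hη : 0 < η)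
    (hη1 : η ≤ 1) : ∃ (f : Fin 3 → ℝ → ℝ) (a b : ℤ → ℝ), IsIncreasingCover a b ∧
      ExpWindows w f a b ∧ IsLiouvilleTwist w f ∧ (∀ i, FlatAt (f i) 0) ∧
      ∀ i, ∃ δ < η, ∀ (k : ℕ) x, L ^ k * ‖iteratedFDeriv ℝ k (f i) x‖ ≤ δ * (k.factorial : ℝ) ^ σ := by
  obtain ⟨B, hB, hB0, heven, hB1, hBin, hBout⟩ := exists_gevrey_bump hσ
  obtain ⟨ξ, hξ0, hξ⟩ : ∃ ξ : ℝ, 0 < ξ ∧ IsExpLiouvillePair 1 ξ := by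
    obtain ⟨ξ, hξ⟩ := exists_isExpLiouvillePair
    have hne : ξ ≠ 0 := fun h => by
      have := hξ.1 0 1 (by simp [h])
      simp at this
    rcases lt_or_gt_of_ne hne with h | h
    · exact ⟨-ξ, by linarith, by simpa using hξ.smul_rat (a := 1) (b := -1) (by simp) (by simp)⟩
    · exact ⟨ξ, h, hξ⟩
  obtain ⟨v, hv0, c, hvc, hc⟩ := NNReal.exists_pos_sum_of_countable
    (ε := η.toNNReal) (by simpa using hη) ℤ
  have hvs : HasSum (fun m => (v m : ℝ)) c := NNReal.hasSum_coe.2 hvc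
  have hcη : (c : ℝ) < η := by
    rw [← Real.coe_toNNReal η hη.le]; exact_mod_cast hc
  -- the dilated bumps and their Gevrey bounds
  let D : ℤ → ℝ → ℝ := fun m x => B ((2 : ℝ) ^ (-m) * x + 0)
  have hD : ∀ m, IsGevrey σ (D m) := fun m => hB.comp_affine _ _
  choose K hK0 hK using fun m => (hD m).2 L hL
  -- the heights `q m` are small, and `w + q m` is a rational multiple of `1` or `ξ`, alternately
  have hq : ∀ m : ℤ, ∃ (r : ℚ) (q : ℝ), r ≠ 0 ∧ 0 < q ∧ q * K m ≤ v m ∧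
      w (slot m) + q = r * (if Even m then 1 else ξ) := fun m => by
    have hv : (0 : ℝ) < v m := by exact_mod_cast hv0 m
    have hK' : 0 < K m + 1 := by linarith [hK0 m]
    obtain ⟨r, h1, h2, h3⟩ := exists_rat_mul_mem (β := if Even m then 1 else ξ)
      (by split_ifs <;> [exact one_pos; exact hξ0]) (w (slot m)) (u := v m / (K m + 1)) (by positivity)
    refine ⟨r, r * (if Even m then 1 else ξ) - w (slot m), h1, by linarith, ?_, by ring⟩
    set q := r * (if Even m then 1 else ξ) - w (slot m)
    have h4 : q * (K m + 1) ≤ v m := by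
      rw [← le_div_iff₀ hK']; linarith
    have h5 : 0 ≤ q := by linarith
    nlinarith
  choose r q hr hq0 hqK hw using hq
  have hexp : ∀ m, IsExpLiouvillePair (w (slot m) + q m) (w (slot (m - 1)) + q (m - 1)) := fun m => by
    rw [hw, hw]
    by_cases hm : Even m
    · have hm' : ¬ Even (m - 1) := by
        rw [Int.not_even_iff_odd]; exact hm.sub_odd odd_one
      rw [if_pos hm, if_neg hm']
      exact hξ.smul_rat (hr _) (hr _)
    · have hm' : Even (m - 1) := (Int.not_even_iff_odd.1 hm).sub_odd odd_one
      rw [if_neg hm, if_pos hm']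
      exact (hξ.smul_rat (hr _) (hr _)).symm
  let T : Fin 3 → ℤ → ℝ → ℝ := fun i m x => (if slot m = i then q m else 0) * D m x
  let f : Fin 3 → ℝ → ℝ := fun i x => ∑' m, T i m x
  have cT : ∀ i m, ContDiff ℝ ∞ (T i m) := fun i m => contDiff_const.mul (hD m).1
  have bT : ∀ i m (k : ℕ) x, L ^ k * ‖iteratedFDeriv ℝ k (T i m) x‖ ≤ v m * (k.factorial : ℝ) ^ σ :=
    fun i m k x => by
      have h2 := iteratedFDeriv_const_smul_apply (𝕜 := ℝ) (i := k) (x := x)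
        (a := if slot m = i then q m else 0) ((hD m).1.of_le (mod_cast le_top)).contDiffAt
      have h3 : iteratedFDeriv ℝ k (T i m) x = _ := h2
      have h4 : ‖if slot m = i then q m else 0‖ ≤ q m := by
        split_ifs
        · rw [Real.norm_eq_abs, abs_of_pos (hq0 m)]
        · rw [norm_zero]; exact (hq0 m).le
      rw [h3, norm_smul]
      calc _ ≤ L ^ k * (q m * ‖iteratedFDeriv ℝ k (D m) x‖) := by gcongr
        _ = q m * (L ^ k * ‖iteratedFDeriv ℝ k (D m) x‖) := by ring
        _ ≤ q m * (K m * (k.factorial : ℝ) ^ σ) :=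
          mul_le_mul_of_nonneg_left (hK m k x) (hq0 m).le
        _ = q m * K m * (k.factorial : ℝ) ^ σ := by ring
        _ ≤ _ := by gcongr; exact hqK m
  have hsum := fun i => summable_gevrey (cT i) hvs.summable hL (bT i)
  rw [hvs.tsum_eq] at hsum
  have feven : ∀ i x, f i (-x) = f i x := fun i x => by
    refine tsum_congr fun m => ?_
    change _ * B ((2 : ℝ) ^ (-m) * -x + 0) = _ * B ((2 : ℝ) ^ (-m) * x + 0)
    rw [← heven]; congr 2; ring
  -- bumps with the same slot are a factor at least `8` apart, so only one of them matters at `x`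
  have hval : ∀ m x, 2 ^ m ≤ x → x ≤ 6 * 2 ^ m → f (slot m) x = q m := fun m x hx hx' => by
    have hz : ∀ m' ≠ m, T (slot m) m' x = 0 := fun m' hm' => by
      by_cases hs : slot m' = slot m
      · rw [slot_eq_iff] at hs
        refine mul_eq_zero_of_right _ ?_
        change B ((2 : ℝ) ^ (-m') * x + 0) = 0
        have hp : (0 : ℝ) < 2 ^ (-m') := by positivity
        have hx0 : 0 < x := lt_of_lt_of_le (by positivity) hx
        rw [add_zero]
        rcases lt_or_gt_of_ne hm' with h | h
        · refine hBout _ ?_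
          have h3 : (2 : ℝ) ^ (3 : ℤ) ≤ 2 ^ (-m' + m) := zpow_le_zpow_right₀ one_le_two (by omega)
          rw [zpow_add₀ two_ne_zero] at h3
          have h4 : (2 : ℝ) ^ (3 : ℤ) = 8 := by norm_num
          nlinarith
        · refine hBin _ ?_
          rw [abs_of_pos (by positivity)]
          have h3 : (2 : ℝ) ^ (-m' + m) ≤ 2 ^ (-3 : ℤ) := zpow_le_zpow_right₀ one_le_two (by omega)
          rw [zpow_add₀ two_ne_zero] at h3
          have h4 : (2 : ℝ) ^ (-3 : ℤ) = 1 / 8 := by norm_num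
          have h5 := mul_le_mul_of_nonneg_left hx' hp.le
          rw [h4] at h3
          linarith
      · change (if _ then _ else _) * _ = _
        rw [if_neg hs, zero_mul]
    have h1 : f (slot m) x = T (slot m) m x := tsum_eq_single m hz
    rw [h1]
    change (if slot m = slot m then q m else 0) * B ((2 : ℝ) ^ (-m) * x + 0) = q m
    have e : (2 : ℝ) ^ (-m) * 2 ^ m = 1 := by rw [← zpow_add₀ two_ne_zero]; simp
    have hp : (0 : ℝ) < 2 ^ (-m) := by positivity
    rw [if_pos rfl, hB1 _ (by nlinarith) (by nlinarith), mul_one]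
  have hwin : ExpWindows w f (fun n => (2 : ℝ) ^ n) fun n => 3 * (2 : ℝ) ^ n := fun n => by
    have e1 : (2 : ℝ) ^ n = 2 * 2 ^ (n - 1) := by
      rw [← zpow_one_add₀ two_ne_zero]; congr 1; ring
    have hp : (0 : ℝ) < 2 ^ (n - 1) := by positivity
    have fabs : ∀ i x, f i x = f i |x| := fun i x => by
      rcases abs_choice x with h | h
      · rw [h]
      · rw [h, feven]
    have key : ∀ x : ℝ, |x| ∈ Set.Ioo ((2 : ℝ) ^ n) (3 * (2 : ℝ) ^ n) →
        f (slot n) x = q n ∧ f (slot (n - 1)) x = q (n - 1) := fun x hx => by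
      rw [fabs, fabs (slot (n - 1))]
      obtain ⟨h1, h2⟩ := hx
      exact ⟨hval n _ h1.le (by linarith), hval (n - 1) _ (by linarith) (by linarith)⟩
    rcases windowPair_windowType n with h | h <;> rw [h]
    · exact ⟨_, _, hexp n, fun x hx => by rw [(key x hx).1, (key x hx).2]; exact ⟨rfl, rfl⟩⟩
    · exact ⟨_, _, (hexp n).symm, fun x hx => by rw [(key x hx).1, (key x hx).2]; exact ⟨rfl, rfl⟩⟩
  have hT0 : ∀ i m x, 0 ≤ T i m x := fun i m x =>
    mul_nonneg (by split_ifs <;> [exact (hq0 m).le; exact le_rfl]) (hB0 _)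
  have hhalf := hwin.halfLineTwist isIncreasingCover_dyadic
  refine ⟨f, _, _, isIncreasingCover_dyadic, hwin, ⟨fun i => (hsum i).1, fun i x => ⟨tsum_nonneg fun m =>
    hT0 i m x, ?_⟩, fun i => ?_, hhalf, ?_⟩, fun i k => ?_, fun i => ⟨c, hcη, (hsum i).2.2⟩⟩
  · have h1 := (hsum i).2.2 0 x
    simp only [pow_zero, norm_iteratedFDeriv_zero, one_mul, Nat.factorial_zero, Nat.cast_one,
      Real.one_rpow, mul_one, Real.norm_eq_abs] at h1
    exact (le_abs_self _).trans_lt (h1.trans_lt (hcη.trans_le hη1))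
  · have : ∀ m, T i m 0 = 0 := fun m => mul_eq_zero_of_right _ (hBin _ (by simp; norm_num))
    simp only [f, this, tsum_zero]
  · simpa only [feven] using hhalf
  · have h0 : ∀ m, FlatAt (T i m) 0 := fun m => by
      refine (flatAt_zero 0).congr ?_
      have h1 : ∀ᶠ x : ℝ in 𝓝 0, |(2 : ℝ) ^ (-m) * x + 0| < 3 / 4 := by
        refine ContinuousAt.eventually_lt (by fun_prop) continuousAt_const ?_
        simp
      filter_upwards [h1] with x hx
      exact mul_eq_zero_of_right _ (hBin _ hx.le)
    rw [(hsum i).2.1]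
    simp only [h0 _ k, tsum_zero]

end GevreyTwist

/-! ### Gevrey-small lacunary sums -/

section GevreyLacunary

variable {d : ℕ} {hd : 4 ≤ d} {σ : ℝ}

/-- A Gevrey bound for a resonant term: it is exponential in the resonance. -/
theorem gevrey_baseTerm_le (hσ : 1 ≤ σ) {χ : ℝ → ℝ} (hχ : ContDiff ℝ ∞ χ) {L A : ℝ} (hL : 0 < L)
    (hA : 0 ≤ A) (h : ∀ (k : ℕ) x, (2 * L) ^ k * ‖iteratedFDeriv ℝ k χ x‖ ≤ A * (k.factorial : ℝ) ^ σ)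
    (m : Fin 3 → ℤ) (δ : ℝ) (n : ℕ) (x : Cover d) :
    L ^ n * ‖iteratedFDeriv ℝ n (baseTerm hd χ m δ) x‖ ≤
      2 * Real.pi * √|δ| * (A * Real.exp (4 * Real.pi * L * mag m)) * (n.factorial : ℝ) ^ σ := by
  have hpi := Real.pi_pos
  have hm := mag_nonneg m
  have h1 := gevrey_leibniz hσ hL (p := fun i => ‖iteratedFDeriv ℝ i χ (r4L hd x)‖)
    (q := fun i => (2 * Real.pi * mag m) ^ i) (B := Real.exp (4 * Real.pi * L * mag m)) hA
    (Real.exp_pos _).le (fun _ => norm_nonneg _) (fun _ => by positivity) (fun k => h k _) (fun k => by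
      rw [← mul_pow]
      have h2 := Real.pow_div_factorial_le_exp (4 * Real.pi * L * mag m) (by positivity) k
      rw [div_le_iff₀ (by positivity)] at h2
      calc _ = (4 * Real.pi * L * mag m) ^ k := by congr 1; ring
        _ ≤ _ := h2
        _ ≤ _ := by
          gcongr
          exact Real.self_le_rpow_of_one_le (by exact_mod_cast k.factorial_pos) hσ) n
  calc _ ≤ L ^ n * (2 * Real.pi * √|δ| * ∑ i ∈ Finset.range (n + 1), (n.choose i : ℝ) *
        ‖iteratedFDeriv ℝ i χ (r4L hd x)‖ * (2 * Real.pi * mag m) ^ (n - i)) := by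
        gcongr
        exact norm_iteratedFDeriv_baseTerm_le hχ m δ n x
    _ = 2 * Real.pi * √|δ| * (L ^ n * ∑ i ∈ Finset.range (n + 1), (n.choose i : ℝ) *
        ‖iteratedFDeriv ℝ i χ (r4L hd x)‖ * (2 * Real.pi * mag m) ^ (n - i)) := by ring
    _ ≤ 2 * Real.pi * √|δ| * (A * Real.exp (4 * Real.pi * L * mag m) * (n.factorial : ℝ) ^ σ) := by
        gcongr
    _ = _ := by ring

/-- Exponentially small divisors beat the Gevrey norms of the resonant terms, which are exponential in
the resonance. -/
theorem exists_gevrey_isLacunary (hσ : 1 < σ) {ω₀ : Act d} {f : Fin 3 → ℝ → ℝ} {a b : ℤ → ℝ}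
    (hab : IsIncreasingCover a b) (hW : ExpWindows (freq3 hd ω₀) f a b) {L η : ℝ} (hL : 0 < L)
    (hη : 0 < η) : ∃ χ m δ, IsLacunary hd ω₀ f χ m δ ∧ ∀ s (n : ℕ) x,
      L ^ n * ‖iteratedFDeriv ℝ n (baseTerm hd (χ s) (m s) (δ s)) x‖ ≤
        η * (1 / 2) ^ s * (n.factorial : ℝ) ^ σ := by
  have hpi := Real.pi_pos
  choose X hX hXI hXs hXp using fun n : ℤ => exists_gevrey_window hσ (a n) (b n)
  let χ : Bool × ℤ → ℝ → ℝ := fun q x => X q.2 (sgn q.1 * x + 0)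
  have hχ : ∀ q, IsGevrey σ (χ q) := fun q => (hX q.2).comp_affine _ _
  have hsupp : ∀ q x, χ q x ≠ 0 → sgn q.1 * x ∈ Set.Ioo (a q.2) (b q.2) := fun q x hx => by
    simpa using hXs _ _ hx
  have hsys := hW.isWindowSystem hab
  choose A hA0 hA using fun q => (hχ q).2 (2 * L) (by positivity)
  obtain ⟨w, m, δ, hsmall, hlac⟩ := _root_.exists_isLacunary (hd := hd) (ω₀ := ω₀) (f := f) (χ := χ)
    (fun q => (hχ q).1) (fun q x => hXI _ _) (fun q => hsys.flatAt_zero_of_support (hsupp q))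
    (fun x hx => by
      obtain ⟨s, n, hx⟩ := hsys.exists_mem hx
      exact ⟨(s, n), hXp _ _ (by simpa using hx)⟩)
    (fun s q m δ => ∀ (n : ℕ) (x : Cover d), L ^ n * ‖iteratedFDeriv ℝ n (baseTerm hd (χ q) m δ) x‖ ≤
      η * (1 / 2) ^ s * (n.factorial : ℝ) ^ σ)
    (fun s q B hB => by
      obtain ⟨u, v, hE, huv⟩ := hW q.2
      -- `c₁`, `c₂` are the constants of the two smallness conditions, `c₃` the exponential rate
      set c₁ := B * 2 ^ s with hc₁
      set c₂ := 2 * Real.pi * A q * 2 ^ s / η with hc₂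
      set c₃ := 4 * Real.pi * L with hc₃
      have hA' := hA0 q
      have h1 : 0 < c₁ := by positivity
      have h2 : 0 ≤ c₂ := by positivity
      have h3 : 0 < c₃ := by positivity
      obtain ⟨k, l, hkl, hδ, -, hsm⟩ := hE.exists_small (2 * (c₁ + c₂ + c₃))
      set δ := k * u + l * v with hδdef
      set m := pairVec (windowType q.2) k l with hm
      set t := 1 + |(k : ℝ)| + |(l : ℝ)| with ht
      have ht1 : 1 ≤ t := by rw [ht]; linarith [abs_nonneg (k : ℝ), abs_nonneg (l : ℝ)]
      have hmag : 1 + mag m ≤ t := by linarith [mag_pairVec_le (windowType q.2) k l]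
      have hmag0 := mag_nonneg m
      have hsq : √|δ| ≤ Real.exp (-((c₁ + c₂ + c₃) * t)) := by
        rw [Real.sqrt_le_left (Real.exp_pos _).le, ← Real.exp_nat_mul]
        refine hsm.le.trans (Real.exp_le_exp.2 (le_of_eq ?_))
        push_cast; ring
      refine ⟨m, δ, fun x hx => ?_, hδ, ?_, ?_, fun n x =>
        (gevrey_baseTerm_le hσ.le (hχ q).1 hL hA' (hA q) m δ n x).trans ?_⟩
      · have hx' := hsupp q x hx
        obtain ⟨e1, e2⟩ := huv x (by
          rw [← abs_sgn_mul q.1, abs_of_pos ((hab.1 _).trans hx'.1)]; exact hx')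
        rw [hm, sum_mul_pairVec, e1, e2]
      · rw [hm, sum_pairVec]; exact hkl
      · calc (1 + mag m) * √|δ| * B * 2 ^ s = c₁ * (1 + mag m) * √|δ| := by rw [hc₁]; ring
          _ ≤ Real.exp ((c₁ + c₂ + c₃) * t) * Real.exp (-((c₁ + c₂ + c₃) * t)) := by
            gcongr
            have := Real.add_one_le_exp ((c₁ + c₂ + c₃) * t)
            nlinarith
          _ = 1 := by rw [← Real.exp_add, add_neg_cancel, Real.exp_zero]
      · refine mul_le_mul_of_nonneg_right ?_ (by positivity)
        have h4 : c₂ * Real.exp (c₃ * mag m) ≤ Real.exp ((c₁ + c₂ + c₃) * t) := by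
          calc _ ≤ Real.exp (c₂ * t) * Real.exp (c₃ * t) := by
                gcongr
                · have := Real.add_one_le_exp (c₂ * t)
                  nlinarith
                · linarith
            _ ≤ _ := by
                rw [← Real.exp_add, Real.exp_le_exp]
                nlinarith
        have h5 : c₂ * Real.exp (c₃ * mag m) * √|δ| ≤ 1 := by
          calc _ ≤ Real.exp ((c₁ + c₂ + c₃) * t) * Real.exp (-((c₁ + c₂ + c₃) * t)) := by gcongr
            _ = 1 := by rw [← Real.exp_add, add_neg_cancel, Real.exp_zero]
        have h6 : 2 * Real.pi * √|δ| * (A q * Real.exp (c₃ * mag m)) =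
            (η * (1 / 2) ^ s) * (c₂ * Real.exp (c₃ * mag m) * √|δ|) := by
          rw [hc₂, one_div_pow]; field_simp
        rw [h6]
        exact mul_le_of_le_one_right (by positivity) h5)
  refine ⟨_, m, δ, hlac fun n => ⟨fun s => η * (1 / 2) ^ s * ((n.factorial : ℝ) ^ σ / L ^ n),
    (summable_geometric_two.mul_left η).mul_right _, fun s x => ?_⟩, hsmall⟩
  dsimp only
  rw [← mul_div_assoc, le_div_iff₀ (by positivity), mul_comm]
  exact hsmall s n x

end GevreyLacunary

/-! ### Invariant tori -/

section Tori

variable {d : ℕ} {hd : 4 ≤ d}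

/-- Invariant tori are compact, so they lie in `{r_4 = 0}` when all other orbits are unbounded. -/
theorem volume_invariantTori {Φ : ℝ → Cover d → Cover d}
    (hΦ : ∀ p, r4 hd p ≠ 0 → Escapes Φ p) :
    volume {z : Phase d | ∃ T, IsInvariantTorus Φ T ∧ z ∈ T} = 0 := by
  let V : Submodule ℝ (Act d) :=
    LinearMap.ker (EuclideanSpace.proj (idx hd 3) : Act d →L[ℝ] ℝ).toLinearMap
  have hV : volume (V : Set (Act d)) = 0 := by
    refine Measure.addHaar_submodule volume V fun h => ?_
    have : EuclideanSpace.single (idx hd 3) (1 : ℝ) ∈ V := h ▸ Submodule.mem_top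
    simp [V] at this
  refine measure_mono_null (t := Set.univ ×ˢ (V : Set (Act d))) ?_ ?_
  · rintro z ⟨T, ⟨⟨ι, hι, -, rfl⟩, hinv⟩, hz⟩
    refine ⟨Set.mem_univ _, ?_⟩
    obtain ⟨x, rfl⟩ : ∃ x : Cover d, toPhase x = z := by
      choose y hy using fun i => QuotientAddGroup.mk_surjective (z.1 i)
      exact ⟨(WithLp.toLp 2 y, z.2), Prod.ext (funext hy) rfl⟩
    by_contra hne
    have hx : r4 hd x ≠ 0 := hne
    obtain ⟨R, hR⟩ := (isCompact_range (continuous_snd.comp hι)).isBounded.exists_norm_le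
    obtain ⟨N, hN⟩ := exists_nat_ge R
    obtain ⟨t, -, ht⟩ := escapes_iff.1 (hΦ x hx) true N
    obtain ⟨θ, hθ⟩ := hinv t x hz
    have h1 := hR (Φ t x).2 ⟨θ, congrArg Prod.snd hθ⟩
    rw [one_mul] at ht
    linarith
  · rw [Measure.volume_eq_prod, Measure.prod_prod, hV, mul_zero]

end Tori

/-! ### Smallness of the Hamiltonians -/

section Norms

variable {E : Type*} [NormedAddCommGroup E] [NormedSpace ℝ E]

theorem gevreyNormLT_of_le {σ L Λ δ η : ℝ} {F : E → ℝ} (hL : 0 < L) (hLΛ : L ≤ Λ) (hδ : δ < η)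
    (h : ∀ (k : ℕ) x, Λ ^ k * ‖iteratedFDeriv ℝ k F x‖ ≤ δ * (k.factorial : ℝ) ^ σ) :
    GevreyNormLT σ L η F :=
  ⟨δ, hδ, fun k x => le_trans (by gcongr) (h k x)⟩

/-- A Gevrey bound at a scale `Λ ≥ 1` bounds the `C^s` norm. -/
theorem norm_iteratedFDeriv_le_of_gevrey {σ Λ δ : ℝ} {F : E → ℝ} (hσ : 0 ≤ σ) (hΛ : 1 ≤ Λ)
    (h : ∀ (k : ℕ) x, Λ ^ k * ‖iteratedFDeriv ℝ k F x‖ ≤ δ * (k.factorial : ℝ) ^ σ) {k s : ℕ}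
    (hk : k ≤ s) (x : E) : ‖iteratedFDeriv ℝ k F x‖ ≤ δ * (s.factorial : ℝ) ^ σ := by
  have hδ : 0 ≤ δ := by
    have := h 0 x
    simp only [pow_zero, one_mul, Nat.factorial_zero, Nat.cast_one, Real.one_rpow, mul_one] at this
    exact (norm_nonneg _).trans this
  calc ‖iteratedFDeriv ℝ k F x‖ ≤ Λ ^ k * ‖iteratedFDeriv ℝ k F x‖ :=
        le_mul_of_one_le_left (norm_nonneg _) (one_le_pow₀ hΛ)
    _ ≤ δ * (k.factorial : ℝ) ^ σ := h k x
    _ ≤ _ := by gcongr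

variable {d : ℕ} {hd : 4 ≤ d}

/-- The `i`-th action, as a linear form on the cover. -/
noncomputable def actL (i : Fin d) : Cover d →L[ℝ] ℝ :=
  (EuclideanSpace.proj i : Act d →L[ℝ] ℝ).comp (ContinuousLinearMap.snd ℝ (Act d) (Act d))

theorem abs_actL_le (i : Fin d) (x : Cover d) : |actL i x| ≤ ‖x.2‖ := PiLp.norm_apply_le x.2 i

theorem norm_iteratedFDeriv_actL_le (i : Fin d) (k : ℕ) (x : Cover d) :
    ‖iteratedFDeriv ℝ k (fun x => actL i x) x‖ ≤ 1 + ‖x.2‖ := by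
  have h1 : ‖actL i‖ ≤ 1 := ContinuousLinearMap.opNorm_le_bound _ zero_le_one fun x => by
    rw [one_mul]; exact (abs_actL_le i x).trans (norm_snd_le x)
  have h2 := norm_nonneg x.2
  rcases k with _ | _ | k
  · rw [norm_iteratedFDeriv_zero]
    exact (abs_actL_le i x).trans (by linarith)
  · rw [← norm_iteratedFDeriv_fderiv, norm_iteratedFDeriv_zero, (actL i).fderiv]
    linarith
  · have h3 : fderiv ℝ (fun x => actL i x) = fun _ => actL i := funext fun x => (actL i).fderiv
    rw [← norm_iteratedFDeriv_fderiv, h3, iteratedFDeriv_const_of_ne (Nat.succ_ne_zero k),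
      Pi.zero_apply, norm_zero]
    linarith

theorem twistPart_eq (f : Fin 3 → ℝ → ℝ) :
    twistPart hd f = fun x => ∑ i, f i (r4L hd x) * actL (e3 hd i) x := rfl

theorem contDiff_twistPart {f : Fin 3 → ℝ → ℝ} (hf : ∀ i, ContDiff ℝ ∞ (f i)) :
    ContDiff ℝ ∞ (twistPart hd f) := by
  rw [twistPart_eq]
  exact ContDiff.sum fun i _ => ((hf i).comp (r4L hd).contDiff).mul (actL (e3 hd i)).contDiff

theorem flatAlong_twistPart {f : Fin 3 → ℝ → ℝ} (hf : ∀ i, ContDiff ℝ ∞ (f i))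
    (h0 : ∀ i, FlatAt (f i) 0) : FlatAlong hd (twistPart hd f) := by
  rw [flatAlong_iff, twistPart_eq]
  intro x hx
  have c1 : ∀ i, ContDiff ℝ ∞ fun x => f i (r4L hd x) := fun i => (hf i).comp (r4L hd).contDiff
  have c2 : ∀ i, ContDiff ℝ ∞ fun x => actL (e3 hd i) x := fun i => (actL (e3 hd i)).contDiff
  refine FlatAt.sum _ (fun i _ => ?_) fun i _ => (c1 i).mul (c2 i)
  have h1 : FlatAt (fun x => f i (r4L hd x)) x :=
    FlatAt.comp (by rw [← r4_eq, hx]; exact h0 i) (hf i) (r4L hd).contDiff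
  exact h1.smul_left (c1 i) (c2 i)

theorem norm_iteratedFDeriv_twistPart_le {f : Fin 3 → ℝ → ℝ} (hf : ∀ i, ContDiff ℝ ∞ (f i)) {β : ℝ}
    {s : ℕ} (hβ : ∀ i, ∀ k ≤ s, ∀ x, ‖iteratedFDeriv ℝ k (f i) x‖ ≤ β) {k : ℕ} (hk : k ≤ s)
    (x : Cover d) : ‖iteratedFDeriv ℝ k (twistPart hd f) x‖ ≤ 3 * (2 ^ s * β * (1 + ‖x.2‖)) := by
  have hβ0 : 0 ≤ β := (norm_nonneg _).trans (hβ 0 0 (Nat.zero_le _) 0)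
  have c1 : ∀ i, ContDiff ℝ ∞ fun x => f i (r4L hd x) := fun i => (hf i).comp (r4L hd).contDiff
  have c2 : ∀ i, ContDiff ℝ ∞ fun x => actL (e3 hd i) x := fun i => (actL (e3 hd i)).contDiff
  rw [twistPart_eq, iteratedFDeriv_sum fun i _ => ((c1 i).mul (c2 i)).of_le (mod_cast le_top),
    Finset.sum_apply]
  refine (norm_sum_le _ _).trans ?_
  have h1 : ∀ i ∈ (Finset.univ : Finset (Fin 3)),
      ‖iteratedFDeriv ℝ k (fun x => f i (r4L hd x) * actL (e3 hd i) x) x‖ ≤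
        2 ^ s * β * (1 + ‖x.2‖) := fun i _ => by
    refine (norm_iteratedFDeriv_mul_le (c1 i) (c2 i) x (mod_cast le_top)).trans ?_
    calc _ ≤ ∑ j ∈ Finset.range (k + 1), (k.choose j : ℝ) * β * (1 + ‖x.2‖) := by
          refine Finset.sum_le_sum fun j hj => ?_
          have hjk : j ≤ k := Nat.lt_succ_iff.1 (Finset.mem_range.1 hj)
          gcongr
          · refine (norm_iteratedFDeriv_comp_clm_le (hf i) (r4L hd) j x).trans ?_
            exact (mul_le_of_le_one_right (norm_nonneg _) (pow_le_one₀ (norm_nonneg _) norm_r4L_le)).trans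
              (hβ i j (hjk.trans hk) _)
          · exact norm_iteratedFDeriv_actL_le _ _ x
      _ = 2 ^ k * β * (1 + ‖x.2‖) := by
          rw [← Finset.sum_mul, ← Finset.sum_mul]
          congr 2
          exact_mod_cast Nat.sum_range_choose k
      _ ≤ _ := by gcongr; exact one_le_two
  refine (Finset.sum_le_sum h1).trans (le_of_eq ?_)
  simp

/-- Gevrey-small perturbations of the linear Hamiltonian whose orbits off `{r_4 = 0}` are all
unbounded. -/
theorem exists_small_unstable (hd : 4 ≤ d) (ω₀ : Act d) {σ L ε : ℝ} (s : ℕ) (hσ : 1 < σ) (hL : 0 < L)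
    (hε : 0 < ε) : ∃ (f : Fin 3 → ℝ → ℝ) (g h H : SmoothHam d),
      IsLiouvilleTwist (freq3 hd ω₀) f ∧
      (∀ i, CsNormLT s ε (f i) ∧ GevreyNormLT σ L ε (f i)) ∧
      CsNormLT s ε g.1 ∧ GevreyNormLT σ L ε g.1 ∧
      (∀ x, h.1 x = twistPart hd f x + g.1 x) ∧
      (∀ k ≤ s, ∀ x, ‖iteratedFDeriv ℝ k h.1 x‖ ≤ ε * (1 + ‖x.2‖)) ∧
      FlatAlong hd h.1 ∧
      (∀ x, H.1 x = inner ℝ ω₀ x.2 + h.1 x) ∧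
      H ∈ closure (conjClass hd ω₀ f) ∧
      ∃ Φ : ℝ → Cover d → Cover d, IsHamFlow H.1 Φ ∧
        (∀ p, r4 hd p ≠ 0 → Escapes Φ p) ∧
        volume {z : Phase d | ∃ T, IsInvariantTorus Φ T ∧ z ∈ T} = 0 := by
  have hσ0 : 0 ≤ σ := by linarith
  -- a Gevrey bound at the scale `Λ ≥ 1` controls the `C^s` norms, up to the factor `S = s!^σ`
  set Λ := max L 1 with hΛ
  have hΛ1 : 1 ≤ Λ := le_max_right _ _
  have hΛ0 : 0 < Λ := by linarith
  have hLΛ : L ≤ Λ := le_max_left _ _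
  set S : ℝ := (s.factorial : ℝ) ^ σ with hS
  have hS1 : 1 ≤ S := one_le_rpow_factorial hσ0 s
  have h2s : (1 : ℝ) ≤ 2 ^ s := one_le_pow₀ one_le_two
  set η := min 1 (ε / (4 * 2 ^ s * S)) with hη
  have hη0 : 0 < η := lt_min one_pos (by positivity)
  have hηε : 4 * (2 ^ s * (η * S)) ≤ ε := by
    have h1 : η ≤ ε / (4 * 2 ^ s * S) := min_le_right _ _
    rw [le_div_iff₀ (by positivity)] at h1
    linarith
  have hηS : η ≤ η * S := le_mul_of_one_le_right hη0.le hS1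
  have hηS' : η * S ≤ 2 ^ s * (η * S) := le_mul_of_one_le_left (by positivity) h2s
  have hηε' : η ≤ ε := by linarith
  obtain ⟨f, a, b, hab, hW, hf, hf0, hfη⟩ :=
    exists_gevrey_twist hσ (freq3 hd ω₀) hΛ0 hη0 (min_le_left _ _)
  obtain ⟨χ, m, δ, hlac, hsmall⟩ := exists_gevrey_isLacunary (hd := hd) hσ hab hW hΛ0
    (by positivity : 0 < η / 4)
  have cf := hf.1
  set G : Cover d → ℝ := fun x => ∑' j, baseTerm hd (χ j) (m j) (δ j) x with hG
  have cG : ContDiff ℝ ∞ G := hlac.contDiff_tsum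
  have pG : AnglePeriodic G := IsLacunary.anglePeriodic_tsum χ m δ
  obtain ⟨-, -, hGη⟩ := summable_gevrey (fun j => contDiff_baseTerm (hlac.contDiff j) (m j) (δ j))
    (summable_geometric_two.mul_left (η / 4)) hΛ0 hsmall
  rw [tsum_mul_left, tsum_geometric_two] at hGη
  have ctw := contDiff_twistPart (hd := hd) cf
  have cin : ContDiff ℝ ∞ fun x : Cover d => inner ℝ ω₀ x.2 := contDiff_const.inner ℝ contDiff_snd
  have ptw : AnglePeriodic (twistPart hd f) := fun k x => rfl
  have hfs : ∀ i, ∀ k ≤ s, ∀ x, ‖iteratedFDeriv ℝ k (f i) x‖ ≤ η * S := fun i k hk x => by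
    obtain ⟨δ', hδ', hb⟩ := hfη i
    refine (norm_iteratedFDeriv_le_of_gevrey hσ0 hΛ1 hb hk x).trans ?_
    gcongr
  have hGs : ∀ k ≤ s, ∀ x, ‖iteratedFDeriv ℝ k G x‖ ≤ η / 4 * 2 * S := fun k hk x =>
    norm_iteratedFDeriv_le_of_gevrey hσ0 hΛ1 hGη hk x
  have hηS0 : 0 < η * S := by positivity
  let g : SmoothHam d := ⟨G, cG, pG⟩
  let h : SmoothHam d := ⟨fun x => twistPart hd f x + G x, ctw.add cG, fun k x => by
    dsimp only
    rw [ptw k x, pG k x]⟩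
  let H : SmoothHam d := ⟨fun x => inner ℝ ω₀ x.2 + (twistPart hd f x + G x), cin.add (ctw.add cG),
    fun k x => by
      dsimp only
      rw [ptw k x, pG k x]⟩
  have hH : ∀ x, H.1 x = H0 hd ω₀ f x + 1 * ∑' j, baseTerm hd (χ j) (m j) (δ j) x := fun x => by
    rw [one_mul, H0, add_assoc]
  obtain ⟨Φ, hΦ, hp⟩ := hlac.exists_flow cf one_pos
  have hesc : ∀ p, r4 hd p ≠ 0 → Escapes Φ p := fun p hp0 => by
    refine escapes_iff.2 fun b N => ?_
    obtain ⟨t, ht, hkey⟩ := (hp p).2.2 hp0 b (3 * N + 3) 0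
    obtain ⟨hy, -⟩ := hkey t (by simp)
    have hN : (0 : ℝ) ≤ N := Nat.cast_nonneg N
    have h1 : |yL hd (Φ t p)| ≤ 3 * ‖(Φ t p).2‖ := by
      rw [yL_apply]
      refine (Finset.abs_sum_le_sum_abs _ _).trans ?_
      refine (Finset.sum_le_sum fun i _ => PiLp.norm_apply_le (Φ t p).2 (e3 hd i)).trans (le_of_eq ?_)
      simp
    exact ⟨t, by linarith, by linarith⟩
  refine ⟨f, g, h, H, hf, fun i => ⟨⟨η * S, by linarith, hfs i⟩, ?_⟩,
    ⟨η / 4 * 2 * S, by linarith, hGs⟩,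
    gevreyNormLT_of_le hL hLΛ (by linarith) hGη, fun x => rfl, fun k hk x => ?_, ?_, fun x => rfl,
    hlac.mem_closure cf hH, Φ, (funext hH) ▸ hΦ, hesc, volume_invariantTori hesc⟩
  · obtain ⟨δ', hδ', hb⟩ := hfη i
    exact gevreyNormLT_of_le hL hLΛ (hδ'.trans_le hηε') hb
  · have e : iteratedFDeriv ℝ k h.1 x = iteratedFDeriv ℝ k (twistPart hd f) x + iteratedFDeriv ℝ k G x :=
      iteratedFDeriv_add_apply (ctw.of_le (mod_cast le_top)).contDiffAt
        (cG.of_le (mod_cast le_top)).contDiffAt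
    rw [e]
    have h1 := norm_iteratedFDeriv_twistPart_le (hd := hd) cf hfs hk x
    have h2 := hGs k hk x
    have h3 := norm_nonneg x.2
    calc _ ≤ 3 * (2 ^ s * (η * S) * (1 + ‖x.2‖)) + η / 4 * 2 * S :=
          (norm_add_le _ _).trans (add_le_add h1 h2)
      _ ≤ 4 * (2 ^ s * (η * S)) * (1 + ‖x.2‖) := by nlinarith
      _ ≤ _ := by gcongr
  · rw [flatAlong_iff]
    exact fun x hx => ((flatAlong_iff.1 (flatAlong_twistPart cf hf0)) x hx).add
      ((flatAlong_iff.1 hlac.flatAlong_tsum) x hx) ctw cG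

end Norms

theorem theoremE (d : ℕ) (hd : 4 ≤ d) (ω₀ : Act d) :
    -- arbitrarily small Gevrey perturbations all of whose orbits off `r_4 = 0` are unbounded
    (∀ (σ L ε : ℝ) (s : ℕ), 1 < σ → 0 < L → 0 < ε →
      ∃ (f : Fin 3 → ℝ → ℝ) (g h H : SmoothHam d),
        IsLiouvilleTwist (freq3 hd ω₀) f ∧
        (∀ i, CsNormLT s ε (f i) ∧ GevreyNormLT σ L ε (f i)) ∧
        CsNormLT s ε g.1 ∧ GevreyNormLT σ L ε g.1 ∧
        (∀ x, h.1 x = twistPart hd f x + g.1 x) ∧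
        (∀ k ≤ s, ∀ x, ‖iteratedFDeriv ℝ k h.1 x‖ ≤ ε * (1 + ‖x.2‖)) ∧
        FlatAlong hd h.1 ∧
        (∀ x, H.1 x = inner ℝ ω₀ x.2 + h.1 x) ∧
        H ∈ closure (conjClass hd ω₀ f) ∧
        ∃ Φ : ℝ → Cover d → Cover d, IsHamFlow H.1 Φ ∧
          (∀ p, r4 hd p ≠ 0 → Escapes Φ p) ∧
          volume {z : Phase d | ∃ T, IsInvariantTorus Φ T ∧ z ∈ T} = 0) ∧
    -- genericity in the closure of the conjugacy class
    (∀ f : Fin 3 → ℝ → ℝ, IsLiouvilleTwist (freq3 hd ω₀) f →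
      (IsGδ (escapingSet hd ω₀ f) ∧ Dense (escapingSet hd ω₀ f)) ∧
      (IsGδ (oscillatingSet hd ω₀ f) ∧ Dense (oscillatingSet hd ω₀ f))) := by
  refine ⟨fun σ L ε s hσ hL hε => exists_small_unstable hd ω₀ s hσ hL hε, fun f hf => ?_⟩
  have h := dense_oscillatingSet (hd := hd) hf
  exact ⟨⟨isGδ_escapingSet ω₀ f, h.mono (oscillatingSet_subset_escapingSet ω₀ f)⟩,
    isGδ_oscillatingSet ω₀ f, h⟩
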